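/- **Setting.** Let $\Bbbk$ be an algebraically closed field of characteristic $0$, let $N,n\ge 1$ be integers, and let $\mu,\lambda\in\{1,-1\}$. The Suzuki algebra $A=A_{N\,2n+1}^{\mu\lambda}$ is the Hopf algebra generated by $x_{11},x_{12},x_{21},x_{22}$ with relations $$x_{11}^2=x_{22}^2,\quad x_{12}^2=x_{21}^2,\quad \chi_{21}^{2n+1}=\lambda\chi_{12}^{2n+1},\quad \chi_{11}^{2n+1}=\chi_{22}^{2n+1},\quad x_{11}^{2N}+\mu x_{12}^{2N}=1,$$ and $x_{ij}x_{kl}=0$ whenever $i+j+k+l$ is odd. Here $\chi_{ij}^m$ is the alternating product $x_{ij}x_{3-i\,3-j}x_{ij}\cdots$ with $m$ factors ($\chi_{ij}^0=1$). The Hopf structure is $\Delta(x_{ij})=x_{i1}\otimes x_{1j}+x_{i2}\otimes x_{2j}$, $\varepsilon(x_{ij})=\delta_{ij}$, $S(x_{ij})=x_{ji}^{4N-1}$. Let $\omega$ be a primitive $4(2n+1)N$-th root of unity. Put $\tilde\mu=\bar\mu=1$ if $\mu=1$, and $\tilde\mu=\omega^{2n+1}$, $\bar\mu=\omega^{2(2n+1)}$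 if $\mu=-1$. Fix square roots $\sqrt\lambda,\sqrt{\bar\mu},\sqrt{\lambda\bar\mu}$. Consider the following left $A$-modules, where $j$ is even and matrices act on the row vector of basis elements, that is, $x\cdot(v_1,v_2)=(v_1,v_2)X$. * $V_k=\Bbbk v$: $x_{11},x_{22}\mapsto\omega^{2k(2n+1)}$ and $x_{12},x_{21}\mapsto 0$. * $V_k'=\Bbbk v$: $x_{11},x_{22}\mapsto0$, $x_{12}\mapsto\omega^{2k(2n+1)}\tilde\mu$, $x_{21}\mapsto\omega^{2k(2n+1)}\tilde\mu\lambda$. * $V_{jk}=\Bbbk v_1\oplus\Bbbk v_2$: $x_{11}\mapsto\begin{pmatrix}0&\omega^{4k(2n+1)-2jN}\\ \omega^{2jN}&0\end{pmatrix}$, $x_{22}\mapsto\begin{pmatrix}0&\omega^{4k(2n+1)}\\1&0\end{pmatrix}$, $x_{12},x_{21}\mapsto0$. * $V_{jk}'=\Bbbk v_1'\oplus\Bbbk v_2'$: $x_{12}\mapsto\begin{pmatrix}0&\bar\mu\omega^{4k(2n+1)}\\1&0\end{pmatrix}$, $x_{21}\mapsto\begin{pmatrix}0&\lambda\bar\mu\omega^{4k(2n+1)-2jN}\\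 \lambda\omega^{2jN}&0\end{pmatrix}$, $x_{11},x_{22}\mapsto0$. For a left $A$-module $V$ let $V\boxtimes A$ be the space $V\otimes A$ with $h\cdot(\ell\boxtimes g)=(h_{(2)}\cdot\ell)\boxtimes h_{(1)}gS(h_{(3)})$ and $\rho(\ell\boxtimes h)=h_{(1)}\otimes(\ell\boxtimes h_{(2)})$. Write $X^{s,t}=x_{11}^s\chi_{22}^t$, $Y^{s,t}=x_{12}^s\chi_{21}^t$, $\beta=\omega^{jN-2k(2n+1)}$ and $\epsilon=(-1)^p$. Each of the following is the span, inside the indicated $V\boxtimes A$, of the listed vectors. * $\mathscr A_{k,p}^s\subset V_k\boxtimes A$: $\;v\boxtimes(X^{2s,0}+\epsilon Y^{2s,0})$. * $\mathscr B_{k,p}^s\subset V_k'\boxtimes A$: $\;v\boxtimes(X^{2s+1,2n}+\epsilon\sqrt\lambda\,Y^{2s+1,2n})$. * $\mathscr C_{jk,p}^{st}\subset V_{jk}\boxtimes A$: $\;v_1\boxtimes X^{2s,2t+2}+\epsilon\beta\, v_2\boxtimes Y^{2s,2t+2}$ and $v_2\boxtimes X^{2s+1,2t+1}+\epsilon\beta^{-1}v_1\boxtimes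 Y^{2s+1,2t+1}$. * $\mathscr D_{jk,p}^{st}\subset V_{jk}\boxtimes A$: $\;v_1\boxtimes X^{2s+1,2t+1}+\epsilon\beta\, v_2\boxtimes Y^{2s+1,2t+1}$ and $v_2\boxtimes X^{2s,2t+2}+\epsilon\beta^{-1}v_1\boxtimes Y^{2s,2t+2}$. * $\mathscr E_{jk,p}^{s}\subset V_{jk}\boxtimes A$: $\;v_1\boxtimes X^{2s,0}+\epsilon\beta\, v_2\boxtimes Y^{2s,0}$ and $v_2\boxtimes X^{2s,0}+\epsilon\beta^{-1}v_1\boxtimes Y^{2s,0}$. * $\mathscr F_{k,p}^{st}\subset V_k\boxtimes A$: $\;v\boxtimes(X^{2s+1,2t+1}+\epsilon Y^{2s+1,2t+1})$ and $v\boxtimes(X^{2s,2t+2}+\epsilon Y^{2s,2t+2})$. * $\mathscr G_{k,p}^{st}\subset V_k'\boxtimes A$: $\;v\boxtimes(X^{2s,2t+1}+\epsilon\sqrt\lambda\,Y^{2s,2t+1})$ and $v\boxtimes(X^{2s+1,2t}+\tfrac{\epsilon}{\sqrt\lambda}Y^{2s+1,2t})$. * $\mathscr H_{jk,p}^{st}\subset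 V_{jk}'\boxtimes A$: $\;v_1'\boxtimes X^{2s,2t+1}+\tfrac{\epsilon\beta}{\sqrt{\lambda\bar\mu}}v_2'\boxtimes Y^{2s,2t+1}$ and $v_2'\boxtimes X^{2s+1,2t}+\epsilon\sqrt{\lambda\bar\mu}\,\beta^{-1}v_1'\boxtimes Y^{2s+1,2t}$. * $\mathscr I_{jk,p}^{st}\subset V_{jk}'\boxtimes A$: $\;v_1'\boxtimes X^{2s+1,2t}+\tfrac{\epsilon\beta}{\sqrt{\lambda\bar\mu}}v_2'\boxtimes Y^{2s+1,2t}$ and $v_2'\boxtimes X^{2s,2t+1}+\epsilon\sqrt{\lambda\bar\mu}\,\beta^{-1}v_1'\boxtimes Y^{2s,2t+1}$. * $\mathscr L_{k,pq}^{s}\subset V_{jk}\boxtimes A$: vectors $m_1,\dots,m_{2n+1}$. With $u=v_1+\epsilon\,\omega^{2jN-2k(2n+1)}v_2$, $$m_1=u\boxtimes x_{11}^{2s-1}+(-1)^q\sqrt\lambda\,\omega^{-4kn(2n+1)}\chi_{22}^{2n}\cdot(u\boxtimes x_{21}^{2s-1}),$$ and for $i>1$, $m_i=x_{22}\cdot m_{i-1}$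 if $i$ is even and $m_i=x_{11}\cdot m_{i-1}$ if $i$ is odd. * $\mathscr N_{k,pq}^{s}\subset V_{jk}'\boxtimes A$: vectors $w_1,\dots,w_{2n+1}$. With $u=v_1'+\tfrac{\epsilon}{\sqrt{\bar\mu}}\omega^{-2k(2n+1)}v_2'$, $$w_1=u\boxtimes X^{2s,2n}+(-1)^q(\bar\mu\omega^{4k(2n+1)})^{-n}\chi_{21}^{2n}\cdot(u\boxtimes Y^{2s+1,2n-1}),$$ and for $i>1$, $w_i=x_{21}\cdot w_{i-1}$ if $i$ is even and $w_i=x_{12}\cdot w_{i-1}$ if $i$ is odd. **Theorem 3.1.** All the spans below are Yetter–Drinfeld modules, are simple, and have the stated dimension. Throughout $1\le s\le N$ and $p,q\in\mathbb Z_2$. 1. Dimension $1$: $\mathscr A_{k,p}^s$ and $\mathscr B_{k,p}^s$ with $0\le k\le 2N-1$. These are $8N^2$ modules. 2. Dimension $2$, $8N^2n(n+1)$ modules in total: * $\mathscr C_{jk,p}^{st},\mathscr D_{jk,p}^{st},\mathscr H_{jk,p}^{st}$ with $0\le t\le n-1$, $\tfrac j2\in\{1,\dots,n\}$, $0\le k\le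 N-1$; * $\mathscr E_{jk,p}^{s}$ with $\tfrac j2\in\{1,\dots,n\}$, $0\le k\le N-1$; * $\mathscr I_{jk,p}^{st}$ with $0\le t\le n$, $\tfrac j2\in\{1,\dots,n\}$, $0\le k\le N-1$; * $\mathscr F_{k,p}^{st},\mathscr G_{k,p}^{st}$ with $0\le t\le n-1$, $0\le k\le N-1$. For these ranges $\mathscr F_{k+N,p+1}^{st}\cong\mathscr F_{k,p}^{st}$ and $\mathscr G_{k+N,p+1}^{st}\cong\mathscr G_{k,p}^{st}$, so $N\le k\le 2N-1$ gives nothing new. 3. Dimension $2n+1$: $\mathscr L_{k,pq}^s$ and $\mathscr N_{k,pq}^s$ with $0\le k\le N-1$. These are $8N^2$ modules; up to isomorphism they do not depend on the auxiliary choice of $j$ with $\tfrac j2\in\{1,\dots,n\}$. The modules in this list are pairwise non-isomorphic, and every simple left Yetter–Drinfeld module over $A$ is isomorphic to exactly one of them. -/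

import Mathlib

open scoped TensorProduct

/-! ## The Suzuki algebras -/

section Tuples

/-- The alternating word `X i j * X (i+1) (j+1) * X i j * ⋯` with `m` factors.  The indices `1, 2`
of the generators are written `0, 1 : Fin 2`, so `i + 1` is the other index. -/
def altProd {R : Type*} [Monoid R] (X : Fin 2 → Fin 2 → R) : Fin 2 → Fin 2 → ℕ → R
  | _, _, 0 => 1
  | i, j, m + 1 => X i j * altProd X (i + 1) (j + 1) m

/-- The defining relations of the Suzuki algebra `A_{N m}^{μ λ}`, for four elements of a ring. -/
structure IsSuzukiTuple {R : Type*} [Ring R] (N m : ℕ) (μ lam : ℤˣ) (X : Fin 2 → Fin 2 → R) :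
    Prop where
  sq_diag : X 0 0 ^ 2 = X 1 1 ^ 2
  sq_off : X 0 1 ^ 2 = X 1 0 ^ 2
  chi_off : altProd X 1 0 m = (lam : ℤ) • altProd X 0 1 m
  chi_diag : altProd X 0 0 m = altProd X 1 1 m
  unit : X 0 0 ^ (2 * N) + (μ : ℤ) • X 0 1 ^ (2 * N) = 1
  zero : ∀ i j k l : Fin 2, i + j + k + l = 1 → X i j * X k l = 0

end Tuples

section Algebra

variable (K : Type*) [Field K] (N m : ℕ) (μ lam : ℤˣ)

/-- The generators of the free algebra. -/
def freeGen (i j : Fin 2) : FreeAlgebra K (Fin 2 × Fin 2) := FreeAlgebra.ι K (i, j)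

/-- The relations presenting the Suzuki algebra. -/
inductive SuzukiRel : FreeAlgebra K (Fin 2 × Fin 2) → FreeAlgebra K (Fin 2 × Fin 2) → Prop
  | sq_diag : SuzukiRel (freeGen K 0 0 ^ 2) (freeGen K 1 1 ^ 2)
  | sq_off : SuzukiRel (freeGen K 0 1 ^ 2) (freeGen K 1 0 ^ 2)
  | chi_off : SuzukiRel (altProd (freeGen K) 1 0 m) ((lam : ℤ) • altProd (freeGen K) 0 1 m)
  | chi_diag : SuzukiRel (altProd (freeGen K) 0 0 m) (altProd (freeGen K) 1 1 m)
  | unit : SuzukiRel (freeGen K 0 0 ^ (2 * N) + (μ : ℤ) • freeGen K 0 1 ^ (2 * N)) 1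
  | zero (i j k l : Fin 2) (h : i + j + k + l = 1) : SuzukiRel (freeGen K i j * freeGen K k l) 0

/-- The Suzuki algebra `A_{N m}^{μ λ}`. -/
def SuzukiAlgebra : Type _ := RingQuot (SuzukiRel K N m μ lam)

namespace SuzukiAlgebra

instance : Ring (SuzukiAlgebra K N m μ lam) :=
  inferInstanceAs (Ring (RingQuot (SuzukiRel K N m μ lam)))

instance : Algebra K (SuzukiAlgebra K N m μ lam) :=
  inferInstanceAs (Algebra K (RingQuot (SuzukiRel K N m μ lam)))

/-- The quotient map from the free algebra. -/
def quot : FreeAlgebra K (Fin 2 × Fin 2) →ₐ[K] SuzukiAlgebra K N m μ lam :=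
  RingQuot.mkAlgHom K (SuzukiRel K N m μ lam)

/-- The generators `x_{ij}` of the Suzuki algebra. -/
def gen (i j : Fin 2) : SuzukiAlgebra K N m μ lam := quot K N m μ lam (freeGen K i j)

/-- The elements `χ_{ij}^r` of the Suzuki algebra. -/
def chi (i j : Fin 2) (r : ℕ) : SuzukiAlgebra K N m μ lam := altProd (gen K N m μ lam) i j r

end SuzukiAlgebra

end Algebra

section TupleLemmas

theorem map_altProd {R S F : Type*} [Monoid R] [Monoid S] [FunLike F R S] [MonoidHomClass F R S]
    (f : F) (X : Fin 2 → Fin 2 → R) (i j : Fin 2) (m : ℕ) :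
    f (altProd X i j m) = altProd (fun a b => f (X a b)) i j m := by
  induction m generalizing i j with
  | zero => simp [altProd]
  | succ m ih => simp [altProd, ih]

end TupleLemmas

namespace SuzukiAlgebra

section Lift

variable {K : Type*} [Field K] {N m : ℕ} {μ lam : ℤˣ}

theorem quot_rel {a b : FreeAlgebra K (Fin 2 × Fin 2)} (h : SuzukiRel K N m μ lam a b) :
    quot K N m μ lam a = quot K N m μ lam b :=
  RingQuot.mkAlgHom_rel K h

theorem isSuzukiTuple_gen : IsSuzukiTuple N m μ lam (gen K N m μ lam) where
  sq_diag := by simpa [gen] using quot_rel (K := K) (SuzukiRel.sq_diag (N := N) (m := m) (μ := μ) (lam := lam))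
  sq_off := by simpa [gen] using quot_rel (K := K) (SuzukiRel.sq_off (N := N) (m := m) (μ := μ) (lam := lam))
  chi_off := by
    have h := quot_rel (K := K) (SuzukiRel.chi_off (N := N) (m := m) (μ := μ) (lam := lam))
    rw [map_zsmul, map_altProd, map_altProd] at h
    exact h
  chi_diag := by
    have h := quot_rel (K := K) (SuzukiRel.chi_diag (N := N) (m := m) (μ := μ) (lam := lam))
    rw [map_altProd, map_altProd] at h
    exact h
  unit := by
    have h := quot_rel (K := K) (SuzukiRel.unit (N := N) (m := m) (μ := μ) (lam := lam))
    rw [map_add, map_zsmul, map_pow, map_pow, map_one] at h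
    exact h
  zero i j k l hp := by
    have h := quot_rel (K := K) (SuzukiRel.zero (N := N) (m := m) (μ := μ) (lam := lam) i j k l hp)
    rw [map_mul, map_zero] at h
    exact h

theorem quot_surjective : Function.Surjective (quot K N m μ lam) :=
  RingQuot.mkAlgHom_surjective K (SuzukiRel K N m μ lam)

/-- The algebra map out of the Suzuki algebra given by four elements satisfying the relations. -/
def lift {B : Type*} [Ring B] [Algebra K B] (X : Fin 2 → Fin 2 → B)
    (hX : IsSuzukiTuple N m μ lam X) : SuzukiAlgebra K N m μ lam →ₐ[K] B :=
  RingQuot.liftAlgHom K (s := SuzukiRel K N m μ lam)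
    ⟨FreeAlgebra.lift K (fun q : Fin 2 × Fin 2 => X q.1 q.2), by
      have hg : ∀ i j, FreeAlgebra.lift K (fun q : Fin 2 × Fin 2 => X q.1 q.2) (freeGen K i j)
          = X i j := fun i j => by simp [freeGen]
      intro a b h
      induction h with
      | sq_diag => simpa [hg] using hX.sq_diag
      | sq_off => simpa [hg] using hX.sq_off
      | chi_off => simpa only [map_zsmul, map_altProd, hg] using hX.chi_off
      | chi_diag => simpa only [map_altProd, hg] using hX.chi_diag
      | unit => simpa only [map_add, map_zsmul, map_pow, map_one, hg] using hX.unit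
      | zero i j k l hp => simpa only [map_mul, map_zero, hg] using hX.zero i j k l hp⟩

@[simp] theorem lift_gen {B : Type*} [Ring B] [Algebra K B] (X : Fin 2 → Fin 2 → B)
    (hX : IsSuzukiTuple N m μ lam X) (i j : Fin 2) :
    lift (K := K) X hX (gen K N m μ lam i j) = X i j := by
  simp only [lift, gen, quot]
  erw [RingQuot.liftAlgHom_mkAlgHom_apply]
  simp [freeGen]

theorem algHom_ext {B : Type*} [Semiring B] [Algebra K B]
    {f g : SuzukiAlgebra K N m μ lam →ₐ[K] B}
    (h : ∀ i j, f (gen K N m μ lam i j) = g (gen K N m μ lam i j)) : f = g := by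
  have h1 : f.comp (quot K N m μ lam) = g.comp (quot K N m μ lam) := by
    apply FreeAlgebra.hom_ext
    funext q
    exact h q.1 q.2
  ext a
  obtain ⟨b, rfl⟩ := quot_surjective a
  exact congrArg (fun φ => φ b) h1

theorem gen_induction {P : SuzukiAlgebra K N m μ lam → Prop}
    (hgen : ∀ i j, P (gen K N m μ lam i j)) (halg : ∀ c : K, P (algebraMap K _ c))
    (hadd : ∀ a b, P a → P b → P (a + b)) (hmul : ∀ a b, P a → P b → P (a * b))
    (a : SuzukiAlgebra K N m μ lam) : P a := by
  obtain ⟨b, rfl⟩ := quot_surjective a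
  induction b using FreeAlgebra.induction with
  | grade0 r => simpa using halg r
  | grade1 q => exact hgen q.1 q.2
  | mul a b ha hb => rw [map_mul]; exact hmul _ _ ha hb
  | add a b ha hb => rw [map_add]; exact hadd _ _ ha hb

end Lift

end SuzukiAlgebra

/-! ## The Hopf algebra structure -/

section TupleConstructions

theorem altProd_succ {R : Type*} [Monoid R] (X : Fin 2 → Fin 2 → R) (i j : Fin 2) (r : ℕ) :
    altProd X i j (r + 1) = X i j * altProd X (i + 1) (j + 1) r := rfl

theorem add_pow_of_mul_zero {R : Type*} [Ring R] {a b : R} (hab : a * b = 0) (hba : b * a = 0)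
    (r : ℕ) : (a + b) ^ (r + 1) = a ^ (r + 1) + b ^ (r + 1) := by
  induction r with
  | zero => simp
  | succ r ih =>
    rw [pow_succ (a + b), ih, add_mul, mul_add, mul_add, pow_succ a r, pow_succ b r, mul_assoc _ a b,
      mul_assoc _ b a, hab, hba, mul_zero, mul_zero, add_zero, zero_add, ← pow_succ a r,
      ← pow_succ b r, ← pow_succ, ← pow_succ]

namespace IsSuzukiTuple

variable {K : Type*} [Field K] {N m : ℕ} {μ lam : ℤˣ}
  {R S : Type*} [Ring R] [Algebra K R] [Ring S] [Algebra K S]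
  {X : Fin 2 → Fin 2 → R} {Y : Fin 2 → Fin 2 → S}

/-- The matrix coproduct of two tuples. -/
def tensorTuple (K : Type*) [Field K] {R S : Type*} [Ring R] [Algebra K R] [Ring S] [Algebra K S]
    (X : Fin 2 → Fin 2 → R) (Y : Fin 2 → Fin 2 → S) (i j : Fin 2) : R ⊗[K] S :=
  X i 0 ⊗ₜ Y 0 j + X i 1 ⊗ₜ Y 1 j

theorem fin2_cross (i : Fin 2) : i + 0 + i + 1 = 1 ∧ i + 1 + i + 0 = 1 ∧
    i + 0 + (i + 1) + 0 = 1 ∧ i + 1 + (i + 1) + 1 = 1 := by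
  revert i; decide

theorem tensorTuple_pow (hX : IsSuzukiTuple N m μ lam X) (i j : Fin 2) (r : ℕ) :
    tensorTuple K X Y i j ^ (r + 1) =
      (X i 0 ^ (r + 1)) ⊗ₜ[K] (Y 0 j ^ (r + 1)) + (X i 1 ^ (r + 1)) ⊗ₜ[K] (Y 1 j ^ (r + 1)) := by
  obtain ⟨h1, h2, -, -⟩ := fin2_cross i
  unfold tensorTuple
  rw [add_pow_of_mul_zero]
  · simp [Algebra.TensorProduct.tmul_pow]
  · simp [Algebra.TensorProduct.tmul_mul_tmul, hX.zero _ _ _ _ h1]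
  · simp [Algebra.TensorProduct.tmul_mul_tmul, hX.zero _ _ _ _ h2]

theorem altProd_tensorTuple (hX : IsSuzukiTuple N m μ lam X) (i j : Fin 2) (r : ℕ) :
    altProd (tensorTuple K X Y) i j (r + 1) =
      altProd X i 0 (r + 1) ⊗ₜ[K] altProd Y 0 j (r + 1) +
        altProd X i 1 (r + 1) ⊗ₜ[K] altProd Y 1 j (r + 1) := by
  induction r generalizing i j with
  | zero => simp [altProd, tensorTuple]
  | succ r ih =>
    obtain ⟨-, -, h3, h4⟩ := fin2_cross i
    have e3 : X i 0 * altProd X (i + 1) 0 (r + 1) = 0 := by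
      rw [altProd, ← mul_assoc, hX.zero _ _ _ _ h3, zero_mul]
    have e4 : X i 1 * altProd X (i + 1) 1 (r + 1) = 0 := by
      rw [altProd, ← mul_assoc, hX.zero _ _ _ _ h4, zero_mul]
    have z1 : (1 : Fin 2) + 1 = 0 := rfl
    rw [altProd_succ, ih, altProd_succ X i 0 (r + 1), altProd_succ X i 1 (r + 1),
      altProd_succ Y 0 j (r + 1), altProd_succ Y 1 j (r + 1)]
    simp only [tensorTuple, add_mul, mul_add, Algebra.TensorProduct.tmul_mul_tmul, e3, e4,
      TensorProduct.zero_tmul, zero_add, add_zero, z1]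
    rw [add_comm]

theorem e_mul_f [NeZero N] (hX : IsSuzukiTuple N m μ lam X) :
    X 0 0 ^ (2 * N) * X 0 1 ^ (2 * N) = 0 := by
  obtain ⟨r, hr⟩ : ∃ r, 2 * N = r + 1 :=
    ⟨2 * N - 1, by have := NeZero.pos N; omega⟩
  rw [hr, pow_succ (X 0 0), pow_succ' (X 0 1), mul_assoc, ← mul_assoc (X 0 0),
    hX.zero 0 0 0 1 rfl, zero_mul, mul_zero]

theorem e_mul_e [NeZero N] (hX : IsSuzukiTuple N m μ lam X) :
    X 0 0 ^ (2 * N) * X 0 0 ^ (2 * N) = X 0 0 ^ (2 * N) := by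
  have h := congrArg (fun y => X 0 0 ^ (2 * N) * y) hX.unit
  simpa only [mul_add, mul_smul_comm, hX.e_mul_f, smul_zero, add_zero, mul_one] using h

theorem units_cast_mul_self (u : ℤˣ) : (u : ℤ) * (u : ℤ) = 1 := by
  rcases Int.units_eq_one_or u with rfl | rfl <;> simp

theorem f_mul_e [NeZero N] (hX : IsSuzukiTuple N m μ lam X) :
    X 0 1 ^ (2 * N) * X 0 0 ^ (2 * N) = 0 := by
  obtain ⟨r, hr⟩ : ∃ r, 2 * N = r + 1 :=
    ⟨2 * N - 1, by have := NeZero.pos N; omega⟩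
  rw [hr, pow_succ (X 0 1), pow_succ' (X 0 0), mul_assoc, ← mul_assoc (X 0 1),
    hX.zero 0 1 0 0 rfl, zero_mul, mul_zero]

theorem f_mul_f [NeZero N] (hX : IsSuzukiTuple N m μ lam X) :
    X 0 1 ^ (2 * N) * X 0 1 ^ (2 * N) = (μ : ℤ) • X 0 1 ^ (2 * N) := by
  have h := congrArg (fun y => (μ : ℤ) • (X 0 1 ^ (2 * N) * y)) hX.unit
  simpa only [mul_add, mul_smul_comm, hX.f_mul_e, smul_zero, zero_add, mul_one, smul_smul,
    units_cast_mul_self, one_smul] using h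

theorem pow_diag (hX : IsSuzukiTuple N m μ lam X) (r : ℕ) :
    X 1 1 ^ (2 * r) = X 0 0 ^ (2 * r) := by
  rw [pow_mul, pow_mul, hX.sq_diag]

theorem pow_off (hX : IsSuzukiTuple N m μ lam X) (r : ℕ) :
    X 1 0 ^ (2 * r) = X 0 1 ^ (2 * r) := by
  rw [pow_mul, pow_mul, hX.sq_off]

theorem tensor [NeZero N] [NeZero m] (hX : IsSuzukiTuple N m μ lam X)
    (hY : IsSuzukiTuple N m μ lam Y) : IsSuzukiTuple N m μ lam (tensorTuple K X Y) where
  sq_diag := by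
    rw [hX.tensorTuple_pow 0 0 1, hX.tensorTuple_pow 1 1 1]
    simp only [Nat.reduceAdd, ← hX.sq_diag, ← hX.sq_off, ← hY.sq_diag, ← hY.sq_off]
    rw [add_comm]
  sq_off := by
    rw [hX.tensorTuple_pow 0 1 1, hX.tensorTuple_pow 1 0 1]
    simp only [Nat.reduceAdd, ← hX.sq_diag, ← hX.sq_off, ← hY.sq_diag, ← hY.sq_off]
    rw [add_comm]
  chi_off := by
    obtain ⟨r, rfl⟩ := Nat.exists_eq_succ_of_ne_zero (NeZero.ne m)
    rw [hX.altProd_tensorTuple, hX.altProd_tensorTuple, hX.chi_off, hY.chi_off, ← hX.chi_diag,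
      ← hY.chi_diag, smul_add, TensorProduct.smul_tmul', TensorProduct.smul_tmul',
      TensorProduct.tmul_smul, TensorProduct.smul_tmul', add_comm]
  chi_diag := by
    obtain ⟨r, rfl⟩ := Nat.exists_eq_succ_of_ne_zero (NeZero.ne m)
    rw [hX.altProd_tensorTuple, hX.altProd_tensorTuple, hX.chi_off, hY.chi_off, ← hX.chi_diag,
      ← hY.chi_diag, TensorProduct.tmul_smul, ← TensorProduct.smul_tmul', add_comm]
  unit := by
    obtain ⟨r, hr⟩ : ∃ r, 2 * N = r + 1 :=
      ⟨2 * N - 1, by have := NeZero.pos N; omega⟩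
    have h1 := hX.unit
    have h2 := hY.unit
    have h3 := hX.pow_diag N
    have h4 := hX.pow_off N
    have h5 := hY.pow_diag N
    have h6 := hY.pow_off N
    have e1 : Y 0 0 ^ (2 * N) = 1 - (μ : ℤ) • Y 0 1 ^ (2 * N) := eq_sub_of_add_eq h2
    have e2 : X 0 0 ^ (2 * N) = 1 - (μ : ℤ) • X 0 1 ^ (2 * N) := eq_sub_of_add_eq h1
    rw [hr] at h3 h4 h5 h6 e1 e2 ⊢
    rw [hX.tensorTuple_pow, hX.tensorTuple_pow, h5, h6, e1, e2, Algebra.TensorProduct.one_def]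
    rcases Int.units_eq_one_or μ with rfl | rfl <;>
    · simp only [Units.val_one, Units.val_neg, one_smul, neg_smul, TensorProduct.sub_tmul,
        TensorProduct.tmul_sub, TensorProduct.tmul_neg, TensorProduct.neg_tmul]
      abel
  zero i j k l h := by
    have hk : ∀ a b : Fin 2, i + a + k + b = 1 ∨ a + j + b + l = 1 := by
      revert i j k l; decide
    have key : ∀ a b : Fin 2, (X i a ⊗ₜ[K] Y a j) * (X k b ⊗ₜ[K] Y b l) = 0 := by
      intro a b
      rw [Algebra.TensorProduct.tmul_mul_tmul]
      rcases hk a b with h | h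
      · rw [hX.zero _ _ _ _ h, TensorProduct.zero_tmul]
      · rw [hY.zero _ _ _ _ h, TensorProduct.tmul_zero]
    simp only [tensorTuple, add_mul, mul_add, key, add_zero]


end IsSuzukiTuple

end TupleConstructions

section AntipodeTuple

open MulOpposite

namespace IsSuzukiTuple

variable {N m : ℕ} {μ lam : ℤˣ} {R : Type*} [Ring R] {X : Fin 2 → Fin 2 → R}

/-- The tuple of the values of the antipode, in the opposite ring. -/
def antipodeTuple (N : ℕ) {R : Type*} [Ring R] (X : Fin 2 → Fin 2 → R) (i j : Fin 2) : Rᵐᵒᵖ :=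
  op (X j i ^ (4 * N - 1))

theorem sq_eq (hX : IsSuzukiTuple N m μ lam X) (i j : Fin 2) :
    X (i + 1) (j + 1) ^ 2 = X i j ^ 2 := by
  fin_cases i <;> fin_cases j
  · exact hX.sq_diag.symm
  · exact hX.sq_off.symm
  · exact hX.sq_off
  · exact hX.sq_diag

/-- The square of a generator commutes with the alternating words of its block. -/
theorem sq_comm (hX : IsSuzukiTuple N m μ lam X) (i j : Fin 2) (r : ℕ) :
    Commute (X i j ^ 2) (altProd X i j r) := by
  induction r generalizing i j with
  | zero => exact Commute.one_right _
  | succ r ih =>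
    rw [altProd_succ]
    refine Commute.mul_right ((Commute.refl _).pow_left 2) ?_
    rw [← hX.sq_eq]
    exact ih _ _

theorem fin2_add (i : Fin 2) : i + 1 + 1 = i := by revert i; decide

/-- Appending a letter on the right of an alternating word. -/
theorem altProd_succ_right (X : Fin 2 → Fin 2 → R) (i j : Fin 2) (r : ℕ) :
    altProd X i j (r + 1) =
      altProd X i j r * (if Even r then X i j else X (i + 1) (j + 1)) := by
  induction r generalizing i j with
  | zero => simp [altProd]
  | succ r ih =>
    rw [altProd_succ, ih, altProd_succ, mul_assoc, fin2_add, fin2_add]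
    by_cases h : Even r <;> simp [h, Nat.even_add_one]

theorem altProd_antipodeTuple [NeZero N] (hX : IsSuzukiTuple N m μ lam X) (i j : Fin 2) (r : ℕ) :
    altProd (antipodeTuple N X) i j r =
      op ((X j i ^ 2) ^ ((2 * N - 1) * r) *
        (if Even r then altProd X (j + 1) (i + 1) r else altProd X j i r)) := by
  have hN := NeZero.pos N
  induction r generalizing i j with
  | zero => simp [altProd]
  | succ r ih =>
    have hp : X j i ^ (4 * N - 1) = (X j i ^ 2) ^ (2 * N - 1) * X j i := by
      rw [← pow_mul, ← pow_succ]; congr 1; omega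
    rw [altProd_succ, ih, antipodeTuple, ← op_mul, fin2_add, fin2_add, hX.sq_eq, hp, mul_add,
      pow_add, mul_one]
    congr 1
    by_cases h : Even r
    · have h' : ¬ Even (r + 1) := by simpa [Nat.even_add_one] using h
      rw [if_pos h, if_neg h', altProd_succ_right, if_pos h]
      have hc := ((hX.sq_comm j i r).pow_left (2 * N - 1)).eq
      rw [mul_assoc, ← mul_assoc (altProd X j i r), ← hc]
      simp only [mul_assoc]
    · have h' : Even (r + 1) := by simpa [Nat.even_add_one] using h
      rw [if_neg h, if_pos h', altProd_succ_right, if_neg h, fin2_add, fin2_add]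
      have hc := ((hX.sq_comm (j + 1) (i + 1) r).pow_left (2 * N - 1)).eq
      rw [hX.sq_eq] at hc
      rw [mul_assoc, ← mul_assoc (altProd X (j + 1) (i + 1) r), ← hc]
      simp only [mul_assoc]

theorem e_pow [NeZero N] (hX : IsSuzukiTuple N m μ lam X) (r : ℕ) :
    (X 0 0 ^ (2 * N)) ^ (r + 1) = X 0 0 ^ (2 * N) := by
  induction r with
  | zero => simp
  | succ r ih => rw [pow_succ, ih, hX.e_mul_e]

theorem f_pow [NeZero N] (hX : IsSuzukiTuple N m μ lam X) (r : ℕ) :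
    (X 0 1 ^ (2 * N)) ^ (2 * r + 1) = X 0 1 ^ (2 * N) := by
  induction r with
  | zero => simp
  | succ r ih =>
    rw [show 2 * (r + 1) + 1 = 2 * r + 1 + 1 + 1 by ring, pow_succ, pow_succ, ih, hX.f_mul_f,
      smul_mul_assoc, hX.f_mul_f, smul_smul, units_cast_mul_self, one_smul]

theorem antipode [NeZero N] (hX : IsSuzukiTuple N m μ lam X) :
    IsSuzukiTuple N m μ lam (antipodeTuple N X) where
  sq_diag := by
    simp only [antipodeTuple, ← op_pow]
    rw [pow_right_comm, hX.sq_diag, pow_right_comm]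
  sq_off := by
    simp only [antipodeTuple, ← op_pow]
    rw [pow_right_comm, ← hX.sq_off, pow_right_comm]
  chi_off := by
    rw [hX.altProd_antipodeTuple, hX.altProd_antipodeTuple, hX.sq_off]
    have z1 : (1 : Fin 2) + 1 = 0 := rfl
    rw [← op_smul]
    congr 1
    simp only [zero_add, z1]
    by_cases h : Even m
    · rw [if_pos h, if_pos h, hX.chi_off, mul_smul_comm]
    · rw [if_neg h, if_neg h, hX.chi_off, mul_smul_comm, smul_smul, units_cast_mul_self, one_smul]
  chi_diag := by
    rw [hX.altProd_antipodeTuple, hX.altProd_antipodeTuple, hX.sq_diag]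
    have z1 : (1 : Fin 2) + 1 = 0 := rfl
    simp only [zero_add, z1, hX.chi_diag]
  unit := by
    have hN := NeZero.pos N
    simp only [antipodeTuple, ← op_pow]
    rw [← op_smul, ← op_add, ← op_one]
    congr 1
    rw [pow_right_comm, pow_right_comm (X 1 0), hX.pow_off,
      show 4 * N - 1 = 2 * (2 * N - 1) + 1 by omega, hX.e_pow, hX.f_pow, hX.unit]
  zero i j k l h := by
    have hN := NeZero.pos N
    have h' : l + k + j + i = 1 := by rw [← h]; abel
    simp only [antipodeTuple, ← op_mul]
    obtain ⟨r, hr⟩ : ∃ r, 4 * N - 1 = r + 1 := ⟨4 * N - 2, by omega⟩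
    rw [hr, pow_succ (X l k), pow_succ' (X j i), mul_assoc, ← mul_assoc (X l k),
      hX.zero _ _ _ _ h', zero_mul, mul_zero, op_zero]

theorem counit {K : Type*} [Field K] [NeZero N] [NeZero m] :
    IsSuzukiTuple N m μ lam (fun i j => if i = j then (1 : K) else 0) where
  sq_diag := by simp
  sq_off := by simp
  chi_off := by
    obtain ⟨r, rfl⟩ := Nat.exists_eq_succ_of_ne_zero (NeZero.ne m)
    simp [altProd]
  chi_diag := by
    have h : ∀ i : Fin 2, altProd (fun i j : Fin 2 => if i = j then (1 : K) else 0) i i m = 1 := by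
      induction m with
      | zero => intro i; rfl
      | succ m ih =>
        intro i
        rcases Nat.eq_zero_or_pos m with rfl | hm
        · simp [altProd]
        · have : NeZero m := ⟨hm.ne'⟩
          rw [altProd_succ, ih]; simp
    rw [h, h]
  unit := by
    have hN := NeZero.pos N
    simp [hN.ne']
  zero i j k l h := by
    revert i j k l
    intro i j k l
    fin_cases i <;> fin_cases j <;> fin_cases k <;> fin_cases l <;> simp

end IsSuzukiTuple

end AntipodeTuple

namespace SuzukiAlgebra

section Hopf

set_option linter.unusedSectionVars false

variable (K : Type*) [Field K] (N m : ℕ) (μ lam : ℤˣ) [NeZero N]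

/-- The comultiplication, `x_{ij} ↦ x_{i1} ⊗ x_{1j} + x_{i2} ⊗ x_{2j}`. -/
def comulHom [NeZero m] : SuzukiAlgebra K N m μ lam →ₐ[K]
    SuzukiAlgebra K N m μ lam ⊗[K] SuzukiAlgebra K N m μ lam :=
  lift _ (isSuzukiTuple_gen.tensor (K := K) isSuzukiTuple_gen)

/-- The counit, `x_{ij} ↦ δ_{ij}`. -/
def counitHom [NeZero m] : SuzukiAlgebra K N m μ lam →ₐ[K] K :=
  lift _ IsSuzukiTuple.counit

/-- The antipode, as an algebra map to the opposite algebra: `x_{ij} ↦ x_{ji}^{4N-1}`. -/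
def antipodeHom : SuzukiAlgebra K N m μ lam →ₐ[K] (SuzukiAlgebra K N m μ lam)ᵐᵒᵖ :=
  lift _ (isSuzukiTuple_gen (K := K)).antipode

variable [NeZero m]

theorem comulHom_gen (i j : Fin 2) : comulHom K N m μ lam (gen K N m μ lam i j) =
    gen K N m μ lam i 0 ⊗ₜ gen K N m μ lam 0 j + gen K N m μ lam i 1 ⊗ₜ gen K N m μ lam 1 j := by
  simp [comulHom, IsSuzukiTuple.tensorTuple]

theorem counitHom_gen (i j : Fin 2) :
    counitHom K N m μ lam (gen K N m μ lam i j) = if i = j then 1 else 0 := by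
  simp [counitHom]

theorem antipodeHom_gen (i j : Fin 2) : antipodeHom K N m μ lam (gen K N m μ lam i j) =
    MulOpposite.op (gen K N m μ lam j i ^ (4 * N - 1)) := by
  simp [antipodeHom, IsSuzukiTuple.antipodeTuple]

instance : Bialgebra K (SuzukiAlgebra K N m μ lam) :=
  Bialgebra.ofAlgHom (comulHom K N m μ lam) (counitHom K N m μ lam)
    (by
      apply algHom_ext
      intro i j
      simp [comulHom_gen, TensorProduct.add_tmul, TensorProduct.tmul_add]
      abel)
    (by
      apply algHom_ext
      intro i j
      fin_cases i <;> simp [comulHom_gen, counitHom_gen])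
    (by
      apply algHom_ext
      intro i j
      fin_cases j <;> simp [comulHom_gen, counitHom_gen])

theorem comul_eq (a : SuzukiAlgebra K N m μ lam) :
    Coalgebra.comul (R := K) a = comulHom K N m μ lam a := rfl

theorem counit_eq (a : SuzukiAlgebra K N m μ lam) :
    Coalgebra.counit (R := K) a = counitHom K N m μ lam a := rfl

/-- The antipode as a linear map. -/
def antipodeLin : SuzukiAlgebra K N m μ lam →ₗ[K] SuzukiAlgebra K N m μ lam :=
  (MulOpposite.opLinearEquiv K).symm.toLinearMap ∘ₗ (antipodeHom K N m μ lam).toLinearMap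

theorem antipodeLin_gen (i j : Fin 2) : antipodeLin K N m μ lam (gen K N m μ lam i j) =
    gen K N m μ lam j i ^ (4 * N - 1) := by
  simp [antipodeLin, antipodeHom_gen]

theorem antipodeLin_mul (a b : SuzukiAlgebra K N m μ lam) : antipodeLin K N m μ lam (a * b) =
    antipodeLin K N m μ lam b * antipodeLin K N m μ lam a := by
  simp [antipodeLin]

theorem antipodeLin_algebraMap (c : K) : antipodeLin K N m μ lam (algebraMap K _ c) =
    algebraMap K _ c := by
  simp [antipodeLin, MulOpposite.algebraMap_apply]

theorem e_add_f : gen K N m μ lam 0 0 ^ (4 * N) + gen K N m μ lam 0 1 ^ (4 * N) = 1 := by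
  have h := isSuzukiTuple_gen (K := K) (N := N) (m := m) (μ := μ) (lam := lam)
  rw [show 4 * N = 2 * N + 2 * N by ring, pow_add, pow_add, h.e_mul_e, h.f_mul_f, h.unit]

theorem gen_pow_diag : gen K N m μ lam 1 1 ^ (4 * N) = gen K N m μ lam 0 0 ^ (4 * N) := by
  have h := isSuzukiTuple_gen (K := K) (N := N) (m := m) (μ := μ) (lam := lam)
  rw [show 4 * N = 2 * (2 * N) by ring, h.pow_diag]

theorem gen_pow_off : gen K N m μ lam 1 0 ^ (4 * N) = gen K N m μ lam 0 1 ^ (4 * N) := by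
  have h := isSuzukiTuple_gen (K := K) (N := N) (m := m) (μ := μ) (lam := lam)
  rw [show 4 * N = 2 * (2 * N) by ring, h.pow_off]

theorem gen_mul_zero (i j k l : Fin 2) (h : i + j + k + l = 1) (r s : ℕ) (hr : 0 < r)
    (hs : 0 < s) : gen K N m μ lam i j ^ r * gen K N m μ lam k l ^ s = 0 := by
  obtain ⟨r, rfl⟩ := Nat.exists_eq_succ_of_ne_zero hr.ne'
  obtain ⟨s, rfl⟩ := Nat.exists_eq_succ_of_ne_zero hs.ne'
  rw [pow_succ, pow_succ', mul_assoc, ← mul_assoc (gen K N m μ lam i j),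
    isSuzukiTuple_gen.zero _ _ _ _ h, zero_mul, mul_zero]

theorem antipode_left (a : SuzukiAlgebra K N m μ lam) :
    LinearMap.mul' K _ ((antipodeLin K N m μ lam).rTensor _ (comulHom K N m μ lam a)) =
      algebraMap K _ (counitHom K N m μ lam a) := by
  have hN := NeZero.pos N
  induction a using gen_induction with
  | hgen i j =>
    rw [comulHom_gen, counitHom_gen]
    simp only [map_add, LinearMap.rTensor_tmul, LinearMap.mul'_apply, antipodeLin_gen]
    have e : 4 * N - 1 + 1 = 4 * N := by omega
    fin_cases i <;> fin_cases j <;> simp only [Fin.zero_eta, Fin.mk_one, Fin.isValue]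
    · rw [← pow_succ, ← pow_succ, e, gen_pow_off, e_add_f]; simp
    · have h1 := gen_mul_zero K N m μ lam 0 0 0 1 rfl (4 * N - 1) 1 (by omega) one_pos
      have h2 := gen_mul_zero K N m μ lam 1 0 1 1 rfl (4 * N - 1) 1 (by omega) one_pos
      rw [pow_one] at h1 h2
      rw [h1, h2]; simp
    · have h1 := gen_mul_zero K N m μ lam 0 1 0 0 rfl (4 * N - 1) 1 (by omega) one_pos
      have h2 := gen_mul_zero K N m μ lam 1 1 1 0 rfl (4 * N - 1) 1 (by omega) one_pos
      rw [pow_one] at h1 h2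
      rw [h1, h2]; simp
    · rw [← pow_succ, ← pow_succ, e, gen_pow_diag, add_comm, e_add_f]; simp
  | halg c =>
    rw [AlgHom.commutes, AlgHom.commutes, Algebra.TensorProduct.algebraMap_apply,
      LinearMap.rTensor_tmul, antipodeLin_algebraMap]
    simp
  | hadd a b ha hb => simp only [map_add, ha, hb]
  | hmul a b ha hb =>
    have key : ∀ t t' : SuzukiAlgebra K N m μ lam ⊗[K] SuzukiAlgebra K N m μ lam, ∀ c : K,
        LinearMap.mul' K _ ((antipodeLin K N m μ lam).rTensor _ t) = algebraMap K _ c →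
        LinearMap.mul' K _ ((antipodeLin K N m μ lam).rTensor _ (t * t')) =
          c • LinearMap.mul' K _ ((antipodeLin K N m μ lam).rTensor _ t') := by
      intro t t' c ht
      induction t' with
      | zero => simp
      | add x y hx hy => simp only [mul_add, map_add, hx, hy, smul_add]
      | tmul x y =>
        have h2 : ∀ s : SuzukiAlgebra K N m μ lam ⊗[K] SuzukiAlgebra K N m μ lam,
            LinearMap.mul' K _ ((antipodeLin K N m μ lam).rTensor _ (s * x ⊗ₜ y)) =
            antipodeLin K N m μ lam x *
              LinearMap.mul' K _ ((antipodeLin K N m μ lam).rTensor _ s) * y := by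
          intro s
          induction s with
          | zero => simp
          | add u v hu hv => simp only [add_mul, mul_add, map_add, hu, hv]
          | tmul u v => simp [antipodeLin_mul, mul_assoc]
        rw [h2, ht, ← Algebra.commutes, mul_assoc, ← Algebra.smul_def]
        simp
    rw [map_mul, key _ _ _ ha, hb, map_mul, map_mul, Algebra.smul_def]

theorem antipode_right (a : SuzukiAlgebra K N m μ lam) :
    LinearMap.mul' K _ ((antipodeLin K N m μ lam).lTensor _ (comulHom K N m μ lam a)) =
      algebraMap K _ (counitHom K N m μ lam a) := by
  have hN := NeZero.pos N
  induction a using gen_induction with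
  | hgen i j =>
    rw [comulHom_gen, counitHom_gen]
    simp only [map_add, LinearMap.lTensor_tmul, LinearMap.mul'_apply, antipodeLin_gen]
    have e : 4 * N - 1 + 1 = 4 * N := by omega
    fin_cases i <;> fin_cases j <;> simp only [Fin.zero_eta, Fin.mk_one, Fin.isValue]
    · rw [← pow_succ', ← pow_succ', e, e_add_f]; simp
    · have h1 := gen_mul_zero K N m μ lam 0 0 1 0 rfl 1 (4 * N - 1) one_pos (by omega)
      have h2 := gen_mul_zero K N m μ lam 0 1 1 1 rfl 1 (4 * N - 1) one_pos (by omega)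
      rw [pow_one] at h1 h2
      rw [h1, h2]; simp
    · have h1 := gen_mul_zero K N m μ lam 1 0 0 0 rfl 1 (4 * N - 1) one_pos (by omega)
      have h2 := gen_mul_zero K N m μ lam 1 1 0 1 rfl 1 (4 * N - 1) one_pos (by omega)
      rw [pow_one] at h1 h2
      rw [h1, h2]; simp
    · rw [← pow_succ', ← pow_succ', e, gen_pow_diag, gen_pow_off, add_comm, e_add_f]; simp
  | halg c =>
    rw [AlgHom.commutes, AlgHom.commutes, Algebra.TensorProduct.algebraMap_apply,
      LinearMap.lTensor_tmul, ← map_one (algebraMap K _), antipodeLin_algebraMap]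
    simp
  | hadd a b ha hb => simp only [map_add, ha, hb]
  | hmul a b ha hb =>
    have key : ∀ t t' : SuzukiAlgebra K N m μ lam ⊗[K] SuzukiAlgebra K N m μ lam, ∀ c : K,
        LinearMap.mul' K _ ((antipodeLin K N m μ lam).lTensor _ t') = algebraMap K _ c →
        LinearMap.mul' K _ ((antipodeLin K N m μ lam).lTensor _ (t * t')) =
          c • LinearMap.mul' K _ ((antipodeLin K N m μ lam).lTensor _ t) := by
      intro t t' c ht
      induction t with
      | zero => simp
      | add x y hx hy => simp only [add_mul, map_add, hx, hy, smul_add]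
      | tmul x y =>
        have h2 : ∀ s : SuzukiAlgebra K N m μ lam ⊗[K] SuzukiAlgebra K N m μ lam,
            LinearMap.mul' K _ ((antipodeLin K N m μ lam).lTensor _ (x ⊗ₜ y * s)) =
            x * LinearMap.mul' K _ ((antipodeLin K N m μ lam).lTensor _ s) *
              antipodeLin K N m μ lam y := by
          intro s
          induction s with
          | zero => simp
          | add u v hu hv => simp only [add_mul, mul_add, map_add, hu, hv]
          | tmul u v => simp [antipodeLin_mul, mul_assoc]
        rw [h2, ht, ← Algebra.commutes, mul_assoc, ← Algebra.smul_def]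
        simp
    rw [map_mul, key _ _ _ hb, ha, map_mul, map_mul, Algebra.smul_def, Algebra.commutes]

instance : HopfAlgebra K (SuzukiAlgebra K N m μ lam) where
  antipode := antipodeLin K N m μ lam
  mul_antipode_rTensor_comul := LinearMap.ext fun a => antipode_left K N m μ lam a
  mul_antipode_lTensor_comul := LinearMap.ext fun a => antipode_right K N m μ lam a

end Hopf

end SuzukiAlgebra

/-! ## Yetter-Drinfeld modules over a Hopf algebra -/

section YetterDrinfeld

universe u w v v'

section Compat

variable {K : Type u} [Field K] {H : Type w} [Ring H] [HopfAlgebra K H]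
  {M : Type v} [AddCommGroup M] [Module K M]

/-- The bilinear operation `(a, b) ↦ (m ↦ a m₍₋₁₎ ⊗ b · m₍₀₎)`, extended to `H ⊗ H`. -/
noncomputable def ydLeft (act : H →ₐ[K] Module.End K M) (coact : M →ₗ[K] H ⊗[K] M) :
    H ⊗[K] H →ₗ[K] M →ₗ[K] H ⊗[K] M :=
  TensorProduct.lift (LinearMap.mk₂ K
    (fun a b => TensorProduct.map (LinearMap.mul K H a) (act b) ∘ₗ coact)
    (fun a a' b => by ext m; simp [TensorProduct.map_add_left])
    (fun c a b => by ext m; simp [TensorProduct.map_smul_left])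
    (fun a b b' => by ext m; simp [TensorProduct.map_add_right])
    (fun c a b => by ext m; simp [TensorProduct.map_smul_right]))

/-- The bilinear operation `(a, b) ↦ (m ↦ (a · m)₍₋₁₎ b ⊗ (a · m)₍₀₎)`, extended to `H ⊗ H`. -/
noncomputable def ydRight (act : H →ₐ[K] Module.End K M) (coact : M →ₗ[K] H ⊗[K] M) :
    H ⊗[K] H →ₗ[K] M →ₗ[K] H ⊗[K] M :=
  TensorProduct.lift (LinearMap.mk₂ K
    (fun a b => TensorProduct.map ((LinearMap.mul K H).flip b) LinearMap.id ∘ₗ coact ∘ₗ act a)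
    (fun a a' b => by ext m; simp)
    (fun c a b => by ext m; simp)
    (fun a b b' => by ext m; simp [TensorProduct.map_add_left])
    (fun c a b => by ext m; simp [TensorProduct.map_smul_left]))

theorem ydLeft_tmul (act : H →ₐ[K] Module.End K M) (coact : M →ₗ[K] H ⊗[K] M) (a b : H) (m : M) :
    ydLeft act coact (a ⊗ₜ b) m =
      TensorProduct.map (LinearMap.mul K H a) (act b) (coact m) := by
  simp [ydLeft]

theorem ydRight_tmul (act : H →ₐ[K] Module.End K M) (coact : M →ₗ[K] H ⊗[K] M) (a b : H)
    (m : M) : ydRight act coact (a ⊗ₜ b) m =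
      TensorProduct.map ((LinearMap.mul K H).flip b) LinearMap.id (coact (act a m)) := by
  simp [ydRight]

end Compat

/-- Left-left Yetter-Drinfeld modules over a Hopf algebra `H`: a left module and left comodule
with `h₍₁₎ m₍₋₁₎ ⊗ h₍₂₎ · m₍₀₎ = (h₍₁₎ · m)₍₋₁₎ h₍₂₎ ⊗ (h₍₁₎ · m)₍₀₎`, which is the same as
`ρ(h · m) = h₍₁₎ m₍₋₁₎ S(h₍₃₎) ⊗ h₍₂₎ · m₍₀₎`. -/
structure YDModule (K : Type u) [Field K] (H : Type w) [Ring H] [HopfAlgebra K H] where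
  carrier : Type v
  [addCommGroup : AddCommGroup carrier]
  [module : Module K carrier]
  act : H →ₐ[K] Module.End K carrier
  coact : carrier →ₗ[K] H ⊗[K] carrier
  counit_coact : ∀ m, TensorProduct.lid K carrier
    ((Coalgebra.counit (R := K) (A := H)).rTensor carrier (coact m)) = m
  coassoc : ∀ m, TensorProduct.assoc K H H carrier
    ((Coalgebra.comul (R := K) (A := H)).rTensor carrier (coact m)) = coact.lTensor H (coact m)
  compat : ∀ (h : H) (m : carrier), ydLeft act coact (Coalgebra.comul (R := K) h) m =
    ydRight act coact (Coalgebra.comul (R := K) h) m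

attribute [instance] YDModule.addCommGroup YDModule.module

namespace YDModule

variable {K : Type u} [Field K] {H : Type w} [Ring H] [HopfAlgebra K H]

/-- Isomorphism of Yetter-Drinfeld modules. -/
def Isomorphic (M : YDModule.{u, w, v} K H) (M' : YDModule.{u, w, v'} K H) : Prop :=
  ∃ f : M.carrier ≃ₗ[K] M'.carrier,
    (∀ h m, f (M.act h m) = M'.act h (f m)) ∧
    ∀ m, M'.coact (f m) = f.toLinearMap.lTensor H (M.coact m)

/-- A Yetter-Drinfeld submodule: a subspace stable under the action and under the coaction. -/
def IsSubYD (M : YDModule.{u, w, v} K H) (W : Submodule K M.carrier) : Prop :=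
  (∀ h, ∀ m ∈ W, M.act h m ∈ W) ∧ ∀ m ∈ W, M.coact m ∈ LinearMap.range (W.subtype.lTensor H)

/-- Simple Yetter-Drinfeld modules. -/
def IsSimpleYD (M : YDModule.{u, w, v} K H) : Prop :=
  Nontrivial M.carrier ∧ ∀ W : Submodule K M.carrier, M.IsSubYD W → W = ⊥ ∨ W = ⊤

end YDModule

section Box

variable {K : Type u} [Field K] {H : Type w} [Ring H] [HopfAlgebra K H]
  {V : Type v} [AddCommGroup V] [Module K V]

/-- Left multiplication on the factor `H` of `V ⊗ H`. -/
noncomputable def boxMulLeft (K : Type u) [Field K] (H : Type w) [Ring H] [HopfAlgebra K H]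
    (V : Type v) [AddCommGroup V] [Module K V] : H →ₐ[K] Module.End K (V ⊗[K] H) :=
  AlgHom.ofLinearMap ((LinearMap.lTensorHom V).comp (LinearMap.mul K H))
    (by ext; simp) (fun a a' => by ext; simp [mul_assoc])

/-- The action of `H` on the factor `V` of `V ⊗ H`. -/
noncomputable def boxRep (ρ : H →ₐ[K] Module.End K V) : H →ₐ[K] Module.End K (V ⊗[K] H) :=
  AlgHom.ofLinearMap ((LinearMap.rTensorHom H).comp ρ.toLinearMap)
    (by ext; simp) (fun b b' => by ext; simp)

/-- Right multiplication by the antipode on the factor `H` of `V ⊗ H`. -/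
noncomputable def boxMulAntipode (K : Type u) [Field K] (H : Type w) [Ring H] [HopfAlgebra K H]
    (V : Type v) [AddCommGroup V] [Module K V] : H →ₐ[K] Module.End K (V ⊗[K] H) :=
  AlgHom.ofLinearMap ((LinearMap.lTensorHom V).comp
      ((LinearMap.mul K H).flip.comp (HopfAlgebra.antipode K)))
    (by ext; simp)
    (fun c c' => by ext; simp [HopfAlgebra.antipode_mul_antidistrib, mul_assoc])

theorem boxMulLeft_tmul (a g : H) (l : V) : boxMulLeft K H V a (l ⊗ₜ g) = l ⊗ₜ (a * g) := by
  simp [boxMulLeft]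

theorem boxRep_tmul (ρ : H →ₐ[K] Module.End K V) (b g : H) (l : V) :
    boxRep ρ b (l ⊗ₜ g) = ρ b l ⊗ₜ g := by
  simp [boxRep]

theorem boxMulAntipode_tmul (c g : H) (l : V) :
    boxMulAntipode K H V c (l ⊗ₜ g) = l ⊗ₜ (g * HopfAlgebra.antipode K c) := by
  simp [boxMulAntipode]

theorem boxRep_comm (ρ : H →ₐ[K] Module.End K V) (b c : H) :
    Commute (boxRep ρ b) (boxMulAntipode K H V c) := by
  refine TensorProduct.ext' fun l g => ?_
  simp only [Module.End.mul_apply, boxMulAntipode_tmul, boxRep_tmul]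

/-- The algebra map `b ⊗ c ↦ (ℓ ⊠ g ↦ b · ℓ ⊠ g S(c))`. -/
noncomputable def boxPair (ρ : H →ₐ[K] Module.End K V) :
    H ⊗[K] H →ₐ[K] Module.End K (V ⊗[K] H) :=
  Algebra.TensorProduct.lift (boxRep ρ) (boxMulAntipode K H V) (boxRep_comm ρ)

theorem boxPair_tmul (ρ : H →ₐ[K] Module.End K V) (b c g : H) (l : V) :
    boxPair ρ (b ⊗ₜ c) (l ⊗ₜ g) = ρ b l ⊗ₜ (g * HopfAlgebra.antipode K c) := by
  rw [boxPair, Algebra.TensorProduct.lift_tmul, Module.End.mul_apply, boxMulAntipode_tmul,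
    boxRep_tmul]

theorem boxMulLeft_comm (ρ : H →ₐ[K] Module.End K V) (a : H) (t : H ⊗[K] H) :
    Commute (boxMulLeft K H V a) (boxPair ρ t) := by
  induction t with
  | zero => rw [map_zero]; exact Commute.zero_right _
  | add x y hx hy => rw [map_add]; exact hx.add_right hy
  | tmul b c =>
    refine TensorProduct.ext' fun l g => ?_
    simp only [Module.End.mul_apply, boxPair_tmul, boxMulLeft_tmul, mul_assoc]

/-- The algebra map `a ⊗ (b ⊗ c) ↦ (ℓ ⊠ g ↦ b · ℓ ⊠ a g S(c))`. -/
noncomputable def boxTriple (ρ : H →ₐ[K] Module.End K V) :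
    H ⊗[K] (H ⊗[K] H) →ₐ[K] Module.End K (V ⊗[K] H) :=
  Algebra.TensorProduct.lift (boxMulLeft K H V) (boxPair ρ) (boxMulLeft_comm ρ)

theorem boxTriple_tmul (ρ : H →ₐ[K] Module.End K V) (a b c g : H) (l : V) :
    boxTriple ρ (a ⊗ₜ (b ⊗ₜ c)) (l ⊗ₜ g) = ρ b l ⊗ₜ (a * g * HopfAlgebra.antipode K c) := by
  rw [boxTriple, Algebra.TensorProduct.lift_tmul, Module.End.mul_apply, boxPair_tmul,
    boxMulLeft_tmul, mul_assoc]

/-- The action `h · (ℓ ⊠ g) = h₍₂₎ · ℓ ⊠ h₍₁₎ g S(h₍₃₎)` of `H` on `V ⊠ H`. -/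
noncomputable def boxAct (ρ : H →ₐ[K] Module.End K V) : H →ₐ[K] Module.End K (V ⊗[K] H) :=
  (boxTriple ρ).comp ((Algebra.TensorProduct.map (AlgHom.id K H) (Bialgebra.comulAlgHom K H)).comp
    (Bialgebra.comulAlgHom K H))

/-- The coaction `ρ(ℓ ⊠ h) = h₍₁₎ ⊗ (ℓ ⊠ h₍₂₎)` of `H` on `V ⊠ H`. -/
noncomputable def boxCoact (K : Type u) [Field K] (H : Type w) [Ring H] [HopfAlgebra K H]
    (V : Type v) [AddCommGroup V] [Module K V] : V ⊗[K] H →ₗ[K] H ⊗[K] (V ⊗[K] H) :=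
  (TensorProduct.leftComm K V H H).toLinearMap ∘ₗ (Coalgebra.comul (R := K) (A := H)).lTensor V

/-- `M` is isomorphic to the Yetter-Drinfeld submodule `W` of `V ⊠ H`: there is an injective
map `M → V ⊠ H` with image `W`, compatible with the actions and the coactions. -/
def YDModule.IsomorphicToSub (M : YDModule.{u, w, v'} K H) (ρ : H →ₐ[K] Module.End K V)
    (W : Submodule K (V ⊗[K] H)) : Prop :=
  ∃ f : M.carrier →ₗ[K] V ⊗[K] H, Function.Injective f ∧ LinearMap.range f = W ∧
    (∀ h m, f (M.act h m) = boxAct ρ h (f m)) ∧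
    ∀ m, boxCoact K H V (f m) = f.lTensor H (M.coact m)

end Box

end YetterDrinfeld

/-! ## The simple modules of the Suzuki algebra `A_{N, 2n+1}^{μ λ}` -/

section Representations

/-- A primitive `4(2n+1)N`-th root of unity together with choices of `√λ`, `√μ̄`, `√(λ μ̄)`, where
`μ̄ = 1` if `μ = 1` and `μ̄ = ω^{2(2n+1)}` if `μ = -1`. -/
structure RootChoice (K : Type*) [Field K] (N n : ℕ) (μ lam : ℤˣ) where
  ω : K
  prim : IsPrimitiveRoot ω (4 * (2 * n + 1) * N)
  sqrtLam : K
  sqrtLam_sq : sqrtLam ^ 2 = ((lam : ℤ) : K)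
  sqrtMuBar : K
  sqrtMuBar_sq : sqrtMuBar ^ 2 = if μ = 1 then 1 else ω ^ (2 * (2 * n + 1))
  sqrtLamMuBar : K
  sqrtLamMuBar_sq : sqrtLamMuBar ^ 2 =
    ((lam : ℤ) : K) * if μ = 1 then 1 else ω ^ (2 * (2 * n + 1))

/-- The four values of a tuple supported on `x₁₁, x₂₂`. -/
def diagTuple {B : Type*} [Ring B] (P Q : B) : Fin 2 → Fin 2 → B := ![![P, 0], ![0, Q]]

/-- The four values of a tuple supported on `x₁₂, x₂₁`. -/
def offTuple {B : Type*} [Ring B] (P Q : B) : Fin 2 → Fin 2 → B := ![![0, P], ![Q, 0]]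

theorem altProd_odd {B : Type*} [Ring B] (X : Fin 2 → Fin 2 → B) (i j : Fin 2) (r : ℕ) :
    altProd X i j (2 * r + 1) = (X i j * X (i + 1) (j + 1)) ^ r * X i j := by
  induction r with
  | zero => simp [altProd]
  | succ r ih =>
    rw [show 2 * (r + 1) + 1 = 2 * r + 1 + 1 + 1 by ring, altProd_succ, altProd_succ,
      IsSuzukiTuple.fin2_add, IsSuzukiTuple.fin2_add, ih, pow_succ']
    simp only [mul_assoc]

theorem isSuzukiTuple_diag {B : Type*} [Ring B] {N n : ℕ} [NeZero N] {μ lam : ℤˣ} {P Q : B}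
    (h1 : P ^ 2 = Q ^ 2) (h2 : (P * Q) ^ n * P = (Q * P) ^ n * Q) (h3 : P ^ (2 * N) = 1) :
    IsSuzukiTuple N (2 * n + 1) μ lam (diagTuple P Q) where
  sq_diag := by simpa [diagTuple] using h1
  sq_off := by simp [diagTuple]
  chi_off := by simp [altProd_odd, diagTuple]
  chi_diag := by simpa [altProd_odd, diagTuple] using h2
  unit := by
    have hN := NeZero.ne N
    simpa [diagTuple, hN] using h3
  zero i j k l h := by
    fin_cases i <;> fin_cases j <;> fin_cases k <;> fin_cases l <;>
      first | exact absurd h (by decide) | simp [diagTuple]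

theorem isSuzukiTuple_off {B : Type*} [Ring B] {N n : ℕ} [NeZero N] {μ lam : ℤˣ} {P Q : B}
    (h1 : P ^ 2 = Q ^ 2) (h2 : (Q * P) ^ n * Q = (lam : ℤ) • ((P * Q) ^ n * P))
    (h3 : (μ : ℤ) • P ^ (2 * N) = 1) :
    IsSuzukiTuple N (2 * n + 1) μ lam (offTuple P Q) where
  sq_diag := by simp [offTuple]
  sq_off := by simpa [offTuple] using h1
  chi_off := by
    rw [altProd_odd, altProd_odd]
    exact h2
  chi_diag := by simp [altProd_odd, offTuple]
  unit := by
    have hN := NeZero.ne N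
    rw [show offTuple P Q 0 0 = 0 from rfl, show offTuple P Q 0 1 = P from rfl, h3]
    simp [hN]
  zero i j k l h := by
    fin_cases i <;> fin_cases j <;> fin_cases k <;> fin_cases l <;>
      first | exact absurd h (by decide) | simp [offTuple]

namespace RootChoice

variable {K : Type*} [Field K] {N n : ℕ} {μ lam : ℤˣ}

/-- `μ̃`, which is `1` if `μ = 1` and `ω^{2n+1}` if `μ = -1`. -/
def muTilde (R : RootChoice K N n μ lam) : K := if μ = 1 then 1 else R.ω ^ (2 * n + 1)

/-- `μ̄`, which is `1` if `μ = 1` and `ω^{2(2n+1)}` if `μ = -1`. -/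
def muBar (R : RootChoice K N n μ lam) : K := if μ = 1 then 1 else R.ω ^ (2 * (2 * n + 1))

variable [NeZero N] (R : RootChoice K N n μ lam)

theorem ω_ne_zero : R.ω ≠ 0 :=
  R.prim.ne_zero (by have := NeZero.pos N; positivity)

theorem zpow_eq_one {e : ℤ} (d : ℤ) (h : e = 4 * (2 * n + 1) * N * d) : R.ω ^ e = 1 := by
  rw [h, zpow_mul, show (4 * (2 * (n : ℤ) + 1) * N) = ((4 * (2 * n + 1) * N : ℕ) : ℤ) by
    push_cast; ring, zpow_natCast, R.prim.pow_eq_one, one_zpow]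

theorem half_turn : R.ω ^ (2 * (2 * n + 1) * N) = -1 := by
  have hN := NeZero.pos N
  have h1 : (R.ω ^ (2 * (2 * n + 1) * N)) ^ 2 = 1 := by
    rw [← pow_mul, show 2 * (2 * n + 1) * N * 2 = 4 * (2 * n + 1) * N by ring,
      R.prim.pow_eq_one]
  rcases mul_self_eq_one_iff.mp ((pow_two _).symm.trans h1) with h | h
  · exfalso
    have := R.prim.pow_ne_one_of_pos_of_lt (l := 2 * (2 * n + 1) * N) (by positivity)
      (by nlinarith [Nat.mul_pos (Nat.succ_pos (2 * n)) hN])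
    exact this h
  · exact h

theorem muTilde_pow : ((μ : ℤ) : K) * R.muTilde ^ (2 * N) = 1 := by
  rcases Int.units_eq_one_or μ with rfl | rfl
  · simp [muTilde]
  · have h : ¬ ((-1 : ℤˣ) = 1) := by decide
    rw [muTilde, if_neg h, ← pow_mul, show (2 * n + 1) * (2 * N) = 2 * (2 * n + 1) * N by ring,
      R.half_turn]
    simp

theorem muBar_pow : ((μ : ℤ) : K) * R.muBar ^ N = 1 := by
  rcases Int.units_eq_one_or μ with rfl | rfl
  · simp [muBar]
  · have h : ¬ ((-1 : ℤˣ) = 1) := by decide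
    rw [muBar, if_neg h, ← pow_mul, R.half_turn]
    simp

theorem zpow_pow_eq_one (e : ℤ) (r : ℕ) (d : ℤ) (h : e * r = 4 * (2 * n + 1) * N * d) :
    (R.ω ^ e) ^ r = 1 := by
  rw [← zpow_natCast, ← zpow_mul]
  exact R.zpow_eq_one d h

/-- The module `V_k`, with `x₁₁, x₂₂ ↦ ω^{2k(2n+1)}` and `x₁₂, x₂₁ ↦ 0`. -/
noncomputable def repV (k : ℕ) :
    SuzukiAlgebra K N (2 * n + 1) μ lam →ₐ[K] Module.End K (Fin 1 → K) :=
  SuzukiAlgebra.lift (diagTuple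
    (algebraMap K _ (R.ω ^ (2 * k * (2 * n + 1) : ℤ)))
    (algebraMap K _ (R.ω ^ (2 * k * (2 * n + 1) : ℤ)))) <|
  isSuzukiTuple_diag rfl rfl <| by
    rw [← map_pow, R.zpow_pow_eq_one _ _ k (by push_cast; ring), map_one]

/-- The module `V'_k`, with `x₁₁, x₂₂ ↦ 0`, `x₁₂ ↦ ω^{2k(2n+1)} μ̃`, `x₂₁ ↦ ω^{2k(2n+1)} μ̃ λ`. -/
noncomputable def repV' (k : ℕ) :
    SuzukiAlgebra K N (2 * n + 1) μ lam →ₐ[K] Module.End K (Fin 1 → K) :=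
  SuzukiAlgebra.lift (offTuple
    (algebraMap K _ (R.ω ^ (2 * k * (2 * n + 1) : ℤ) * R.muTilde))
    (algebraMap K _ (R.ω ^ (2 * k * (2 * n + 1) : ℤ) * R.muTilde * ((lam : ℤ) : K)))) <|
  isSuzukiTuple_off
    (by
      rw [← map_pow, ← map_pow]
      rcases Int.units_eq_one_or lam with rfl | rfl <;> simp)
    (by
      simp only [← map_pow, ← map_mul, ← map_zsmul]
      congr 1
      rcases Int.units_eq_one_or lam with rfl | rfl <;> simp)
    (by
      rw [← map_pow, ← map_zsmul, mul_pow, R.zpow_pow_eq_one _ _ k (by push_cast; ring), one_mul,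
        zsmul_eq_mul, R.muTilde_pow, map_one])

theorem diag_pow (x y : K) (r : ℕ) : (!![x, 0; 0, y] : Matrix (Fin 2) (Fin 2) K) ^ r =
    !![x ^ r, 0; 0, y ^ r] := by
  induction r with
  | zero => simp [Matrix.one_fin_two]
  | succ r ih => rw [pow_succ, ih]; simp [pow_succ]

theorem anti_sq (x y c : K) (h : x * y = c) :
    (!![0, x; y, 0] : Matrix (Fin 2) (Fin 2) K) ^ 2 = !![c, 0; 0, c] := by
  rw [pow_two]; simp [h, mul_comm y x]

theorem anti_braid (x y b c : K) (hx : x * b = c) (hy : y = b) (hb : b ^ (2 * n + 1) = 1) :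
    ((!![0, x; y, 0] : Matrix (Fin 2) (Fin 2) K) * !![0, c; 1, 0]) ^ n * !![0, x; y, 0] =
      (!![0, c; 1, 0] * !![0, x; y, 0]) ^ n * !![0, c; 1, 0] := by
  subst hx hy
  have e1 : (!![0, x; y, 0] : Matrix (Fin 2) (Fin 2) K) * !![0, x * y; 1, 0] =
      !![x, 0; 0, y * (x * y)] := by simp
  have e2 : (!![0, x * y; 1, 0] : Matrix (Fin 2) (Fin 2) K) * !![0, x; y, 0] =
      !![x * y * y, 0; 0, x] := by simp
  rw [e1, e2, diag_pow, diag_pow]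
  have h1 : x ^ n * x = (x * y * y) ^ n * (x * y) := by
    calc x ^ n * x = x ^ n * x * y ^ (2 * n + 1) := by rw [hb, mul_one]
      _ = _ := by ring
  have h2 : (y * (x * y)) ^ n * y = x ^ n := by
    calc (y * (x * y)) ^ n * y = x ^ n * y ^ (2 * n + 1) := by ring
      _ = _ := by rw [hb, mul_one]
  simp [h1, h2]

/-- The module `V_{jk}` for `j = 2i`, with basis `v₁, v₂`. -/
noncomputable def repVV (i k : ℕ) :
    SuzukiAlgebra K N (2 * n + 1) μ lam →ₐ[K] Module.End K (Fin 2 → K) :=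
  (Matrix.toLinAlgEquiv' (R := K) (n := Fin 2)).toAlgHom.comp <| SuzukiAlgebra.lift
    (diagTuple
      !![0, R.ω ^ (4 * k * (2 * n + 1) - 2 * (2 * i) * N : ℤ); R.ω ^ (2 * (2 * i) * N : ℤ), 0]
      !![0, R.ω ^ (4 * k * (2 * n + 1) : ℤ); 1, 0]) <| by
    have h := R.ω_ne_zero
    have hx : R.ω ^ (4 * k * (2 * n + 1) - 2 * (2 * i) * N : ℤ) * R.ω ^ (2 * (2 * i) * N : ℤ) =
        R.ω ^ (4 * k * (2 * n + 1) : ℤ) := by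
      rw [← zpow_add₀ h]; congr 1; ring
    refine isSuzukiTuple_diag ?_ ?_ ?_
    · rw [anti_sq _ _ _ hx, anti_sq _ _ _ (mul_one _)]
    · exact anti_braid _ _ _ _ hx rfl (R.zpow_pow_eq_one _ _ i (by push_cast; ring))
    · rw [pow_mul, anti_sq _ _ _ hx, diag_pow, R.zpow_pow_eq_one _ _ k (by push_cast; ring),
        Matrix.one_fin_two]

/-- The module `V'_{jk}` for `j = 2i`, with basis `v'₁, v'₂`. -/
noncomputable def repVV' (i k : ℕ) :
    SuzukiAlgebra K N (2 * n + 1) μ lam →ₐ[K] Module.End K (Fin 2 → K) :=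
  (Matrix.toLinAlgEquiv' (R := K) (n := Fin 2)).toAlgHom.comp <| SuzukiAlgebra.lift
    (offTuple
      !![0, R.muBar * R.ω ^ (4 * k * (2 * n + 1) : ℤ); 1, 0]
      !![0, ((lam : ℤ) : K) * R.muBar * R.ω ^ (4 * k * (2 * n + 1) - 2 * (2 * i) * N : ℤ);
        ((lam : ℤ) : K) * R.ω ^ (2 * (2 * i) * N : ℤ), 0]) <| by
    have h := R.ω_ne_zero
    have hx : R.muBar * R.ω ^ (4 * k * (2 * n + 1) - 2 * (2 * i) * N : ℤ) *
        R.ω ^ (2 * (2 * i) * N : ℤ) = R.muBar * R.ω ^ (4 * k * (2 * n + 1) : ℤ) := by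
      rw [mul_assoc, ← zpow_add₀ h]; congr 2; ring
    have hb := anti_braid _ _ _ _ hx rfl (R.zpow_pow_eq_one (2 * (2 * i) * N) (2 * n + 1) i
      (by push_cast; ring))
    have hl : (((lam : ℤ) : K)) * ((lam : ℤ) : K) = 1 := by
      rw [← Int.cast_mul, IsSuzukiTuple.units_cast_mul_self, Int.cast_one]
    have hQ : (!![0, ((lam : ℤ) : K) * R.muBar *
          R.ω ^ (4 * k * (2 * n + 1) - 2 * (2 * i) * N : ℤ);
        ((lam : ℤ) : K) * R.ω ^ (2 * (2 * i) * N : ℤ), 0] : Matrix (Fin 2) (Fin 2) K) =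
        (lam : ℤ) • !![0, R.muBar * R.ω ^ (4 * k * (2 * n + 1) - 2 * (2 * i) * N : ℤ);
          R.ω ^ (2 * (2 * i) * N : ℤ), 0] := by
      rcases Int.units_eq_one_or lam with rfl | rfl <;> simp
    refine isSuzukiTuple_off ?_ ?_ ?_
    · rw [anti_sq _ _ _ (mul_one _), anti_sq _ _ (R.muBar * R.ω ^ (4 * k * (2 * n + 1) : ℤ))]
      rw [← hx]
      linear_combination (R.muBar * R.ω ^ (4 * k * (2 * n + 1) - 2 * (2 * i) * N : ℤ) *
        R.ω ^ (2 * (2 * i) * N : ℤ)) * hl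
    · rw [hQ]
      simp only [smul_mul_assoc, mul_smul_comm, smul_pow]
      rw [hb, smul_comm]
    · rw [pow_mul, anti_sq _ _ _ (mul_one _), diag_pow, mul_pow,
        R.zpow_pow_eq_one _ _ k (by push_cast; ring), mul_one, Matrix.one_fin_two]
      have := R.muBar_pow
      rw [← zsmul_eq_mul] at this
      simp [this]

end RootChoice

end Representations

/-! ## The families of Yetter-Drinfeld modules -/

namespace SuzukiAlgebra

variable {K : Type*} [Field K] {N m : ℕ} {μ lam : ℤˣ}

/-- The element `x₁₁^s χ₂₂^t`. -/
def mono₁ (s t : ℕ) : SuzukiAlgebra K N m μ lam :=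
  gen K N m μ lam 0 0 ^ s * chi K N m μ lam 1 1 t

/-- The element `x₁₂^s χ₂₁^t`. -/
def mono₂ (s t : ℕ) : SuzukiAlgebra K N m μ lam :=
  gen K N m μ lam 0 1 ^ s * chi K N m μ lam 1 0 t

end SuzukiAlgebra

namespace RootChoice

open SuzukiAlgebra

variable {K : Type*} [Field K] {N n : ℕ} {μ lam : ℤˣ} [NeZero N] (R : RootChoice K N n μ lam)

/-- The space `V ⊠ A` for `V` of dimension `d` with its standard basis. -/
abbrev BoxSpace (_ : RootChoice K N n μ lam) (d : ℕ) : Type _ :=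
  (Fin d → K) ⊗[K] SuzukiAlgebra K N (2 * n + 1) μ lam

/-- The scalar `ω^{jN - 2k(2n+1)}` for `j = 2i`. -/
def β (i k : ℕ) : K := R.ω ^ ((2 * i) * N - 2 * k * (2 * n + 1) : ℤ)

/-- The vector spanning `𝒜_{k,p}^s` in `V_k ⊠ A`. -/
def vecA (s p : ℕ) : Fin 1 → R.BoxSpace 1 :=
  ![![1] ⊗ₜ (mono₁ (2 * s) 0 + (-1 : K) ^ p • mono₂ (2 * s) 0)]

/-- The vector spanning `ℬ_{k,p}^s` in `V'_k ⊠ A`. -/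
def vecB (s p : ℕ) : Fin 1 → R.BoxSpace 1 :=
  ![![1] ⊗ₜ (mono₁ (2 * s + 1) (2 * n) +
    ((-1 : K) ^ p * R.sqrtLam) • mono₂ (2 * s + 1) (2 * n))]

/-- The vectors spanning `𝒞_{jk,p}^{st}` in `V_{jk} ⊠ A`, for `j = 2i`. -/
def vecC (s t i k p : ℕ) : Fin 2 → R.BoxSpace 2 :=
  ![![1, 0] ⊗ₜ mono₁ (2 * s) (2 * t + 2) +
      ((-1) ^ p * R.β i k) • (![0, 1] ⊗ₜ mono₂ (2 * s) (2 * t + 2)),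
    ![0, 1] ⊗ₜ mono₁ (2 * s + 1) (2 * t + 1) +
      ((-1) ^ p * (R.β i k)⁻¹) • (![1, 0] ⊗ₜ mono₂ (2 * s + 1) (2 * t + 1))]

/-- The vectors spanning `𝒟_{jk,p}^{st}` in `V_{jk} ⊠ A`, for `j = 2i`. -/
def vecD (s t i k p : ℕ) : Fin 2 → R.BoxSpace 2 :=
  ![![1, 0] ⊗ₜ mono₁ (2 * s + 1) (2 * t + 1) +
      ((-1) ^ p * R.β i k) • (![0, 1] ⊗ₜ mono₂ (2 * s + 1) (2 * t + 1)),
    ![0, 1] ⊗ₜ mono₁ (2 * s) (2 * t + 2) +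
      ((-1) ^ p * (R.β i k)⁻¹) • (![1, 0] ⊗ₜ mono₂ (2 * s) (2 * t + 2))]

/-- The vectors spanning `ℰ_{jk,p}^s` in `V_{jk} ⊠ A`, for `j = 2i`. -/
def vecE (s i k p : ℕ) : Fin 2 → R.BoxSpace 2 :=
  ![![1, 0] ⊗ₜ mono₁ (2 * s) 0 + ((-1) ^ p * R.β i k) • (![0, 1] ⊗ₜ mono₂ (2 * s) 0),
    ![0, 1] ⊗ₜ mono₁ (2 * s) 0 + ((-1) ^ p * (R.β i k)⁻¹) • (![1, 0] ⊗ₜ mono₂ (2 * s) 0)]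

/-- The vectors spanning `ℱ_{k,p}^{st}` in `V_k ⊠ A`. -/
def vecF (s t p : ℕ) : Fin 2 → R.BoxSpace 1 :=
  ![![1] ⊗ₜ (mono₁ (2 * s + 1) (2 * t + 1) + (-1 : K) ^ p • mono₂ (2 * s + 1) (2 * t + 1)),
    ![1] ⊗ₜ (mono₁ (2 * s) (2 * t + 2) + (-1 : K) ^ p • mono₂ (2 * s) (2 * t + 2))]

/-- The vectors spanning `𝒢_{k,p}^{st}` in `V'_k ⊠ A`. -/
def vecG (s t p : ℕ) : Fin 2 → R.BoxSpace 1 :=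
  ![![1] ⊗ₜ (mono₁ (2 * s) (2 * t + 1) +
      ((-1 : K) ^ p * R.sqrtLam) • mono₂ (2 * s) (2 * t + 1)),
    ![1] ⊗ₜ (mono₁ (2 * s + 1) (2 * t) +
      ((-1 : K) ^ p / R.sqrtLam) • mono₂ (2 * s + 1) (2 * t))]

/-- The vectors spanning `ℋ_{jk,p}^{st}` in `V'_{jk} ⊠ A`, for `j = 2i`. -/
def vecH (s t i k p : ℕ) : Fin 2 → R.BoxSpace 2 :=
  ![![1, 0] ⊗ₜ mono₁ (2 * s) (2 * t + 1) +
      ((-1) ^ p / R.sqrtLamMuBar * R.β i k) • (![0, 1] ⊗ₜ mono₂ (2 * s) (2 * t + 1)),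
    ![0, 1] ⊗ₜ mono₁ (2 * s + 1) (2 * t) +
      ((-1) ^ p * R.sqrtLamMuBar * (R.β i k)⁻¹) • (![1, 0] ⊗ₜ mono₂ (2 * s + 1) (2 * t))]

/-- The vectors spanning `ℐ_{jk,p}^{st}` in `V'_{jk} ⊠ A`, for `j = 2i`. -/
def vecI (s t i k p : ℕ) : Fin 2 → R.BoxSpace 2 :=
  ![![1, 0] ⊗ₜ mono₁ (2 * s + 1) (2 * t) +
      ((-1) ^ p / R.sqrtLamMuBar * R.β i k) • (![0, 1] ⊗ₜ mono₂ (2 * s + 1) (2 * t)),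
    ![0, 1] ⊗ₜ mono₁ (2 * s) (2 * t + 1) +
      ((-1) ^ p * R.sqrtLamMuBar * (R.β i k)⁻¹) • (![1, 0] ⊗ₜ mono₂ (2 * s) (2 * t + 1))]

/-- The vector `v₁ + a v₂` of `V_{jk}`, `j = 2i`, with `a = (-1)^p ω^{2jN - 2k(2n+1)}`. -/
def baseL (i k p : ℕ) : Fin 2 → K :=
  ![1, (-1) ^ p * R.ω ^ (2 * (2 * i) * N - 2 * k * (2 * n + 1) : ℤ)]

/-- The vectors `m₁, m₂, …` (numbered from `0`) whose first `2n+1` span `ℒ_{k,pq}^s` in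
`V_{jk} ⊠ A`, for `j = 2i`: `m₁ = (v₁ + a v₂) ⊠ x₁₁^{2s-1} + b χ₂₂^{2n} · [(v₁ + a v₂) ⊠ x₂₁^{2s-1}]`
with `b = (-1)^q √λ ω^{-4kn(2n+1)}`, and then `m_{r} = x₂₂ · m_{r-1}` for even `r` and
`m_{r} = x₁₁ · m_{r-1}` for odd `r`. -/
noncomputable def vecL (s i k p q : ℕ) : ℕ → R.BoxSpace 2
  | 0 => R.baseL i k p ⊗ₜ (gen K N (2 * n + 1) μ lam 0 0 ^ (2 * s - 1)) +
      ((-1) ^ q * R.sqrtLam * R.ω ^ (-4 * k * n * (2 * n + 1) : ℤ)) •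
        boxAct (R.repVV i k) (chi K N (2 * n + 1) μ lam 1 1 (2 * n))
          (R.baseL i k p ⊗ₜ (gen K N (2 * n + 1) μ lam 1 0 ^ (2 * s - 1)))
  | r + 1 => boxAct (R.repVV i k)
      (if Even r then gen K N (2 * n + 1) μ lam 1 1 else gen K N (2 * n + 1) μ lam 0 0)
      (vecL s i k p q r)

/-- The vector `v'₁ + a v'₂` of `V'_{jk}` with `a = (-1)^p / √μ̄ · ω^{-2k(2n+1)}`. -/
def baseN (k p : ℕ) : Fin 2 → K :=
  ![1, (-1) ^ p / R.sqrtMuBar * R.ω ^ (-2 * k * (2 * n + 1) : ℤ)]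

/-- The vectors `w₁, w₂, …` (numbered from `0`) whose first `2n+1` span `𝒩_{k,pq}^s` in
`V'_{jk} ⊠ A`, for `j = 2i`:
`w₁ = (v'₁ + a v'₂) ⊠ x₁₁^{2s} χ₂₂^{2n} + b χ₂₁^{2n} · [(v'₁ + a v'₂) ⊠ x₁₂^{2s+1} χ₂₁^{2n-1}]`
with `b = (-1)^q (μ̄ ω^{4k(2n+1)})^{-n}`, and then `w_{r} = x₂₁ · w_{r-1}` for even `r` and
`w_{r} = x₁₂ · w_{r-1}` for odd `r`. -/
noncomputable def vecN (s i k p q : ℕ) : ℕ → R.BoxSpace 2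
  | 0 => R.baseN k p ⊗ₜ mono₁ (2 * s) (2 * n) +
      ((-1) ^ q * ((R.muBar * R.ω ^ (4 * k * (2 * n + 1) : ℤ)) ^ n)⁻¹) •
        boxAct (R.repVV' i k) (chi K N (2 * n + 1) μ lam 1 0 (2 * n))
          (R.baseN k p ⊗ₜ mono₂ (2 * s + 1) (2 * n - 1))
  | r + 1 => boxAct (R.repVV' i k)
      (if Even r then gen K N (2 * n + 1) μ lam 1 0 else gen K N (2 * n + 1) μ lam 0 1)
      (vecN s i k p q r)

end RootChoice

/-- The parameters of the simple Yetter-Drinfeld modules.  A parameter `s : Fin N` stands for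
`s + 1 ∈ {1, …, N}`, and `i : Fin n` stands for `j / 2 = i + 1 ∈ {1, …, n}`. -/
inductive YDIndex (N n : ℕ) : Type
  | scrA (s : Fin N) (k : Fin (2 * N)) (p : Fin 2)
  | scrB (s : Fin N) (k : Fin (2 * N)) (p : Fin 2)
  | scrC (s : Fin N) (t : Fin n) (i : Fin n) (k : Fin N) (p : Fin 2)
  | scrD (s : Fin N) (t : Fin n) (i : Fin n) (k : Fin N) (p : Fin 2)
  | scrE (s : Fin N) (i : Fin n) (k : Fin N) (p : Fin 2)
  | scrF (s : Fin N) (t : Fin n) (k : Fin N) (p : Fin 2)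
  | scrG (s : Fin N) (t : Fin n) (k : Fin N) (p : Fin 2)
  | scrH (s : Fin N) (t : Fin n) (i : Fin n) (k : Fin N) (p : Fin 2)
  | scrI (s : Fin N) (t : Fin (n + 1)) (i : Fin n) (k : Fin N) (p : Fin 2)
  | scrL (s : Fin N) (k : Fin N) (p q : Fin 2)
  | scrN (s : Fin N) (k : Fin N) (p q : Fin 2)

/-- The dimension of the simple module with the given parameters. -/
def YDIndex.dim {N n : ℕ} : YDIndex N n → ℕ
  | scrA .. | scrB .. => 1
  | scrC .. | scrD .. | scrE .. | scrF .. | scrG .. | scrH .. | scrI .. => 2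
  | scrL .. | scrN .. => 2 * n + 1

section Families

open Submodule Set

/-- `M` is isomorphic to the listed module with parameters `x`.  For `ℱ` and `𝒢` the modules with
parameters `(k, p)` and `(k + N, p + 1)` are both meant, and for `ℒ` and `𝒩` the modules built
from `V_{jk}`, `V'_{jk}` for every `j`. -/
def RootChoice.IsListed {K : Type*} [Field K] {N n : ℕ} {μ lam : ℤˣ} [NeZero N]
    (R : RootChoice K N n μ lam) (M : YDModule K (SuzukiAlgebra K N (2 * n + 1) μ lam)) :
    YDIndex N n → Prop
  | .scrA s k p => M.IsomorphicToSub (R.repV k) (span K (range (R.vecA (s + 1) p)))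
  | .scrB s k p => M.IsomorphicToSub (R.repV' k) (span K (range (R.vecB (s + 1) p)))
  | .scrC s t i k p =>
      M.IsomorphicToSub (R.repVV (i + 1) k) (span K (range (R.vecC (s + 1) t (i + 1) k p)))
  | .scrD s t i k p =>
      M.IsomorphicToSub (R.repVV (i + 1) k) (span K (range (R.vecD (s + 1) t (i + 1) k p)))
  | .scrE s i k p =>
      M.IsomorphicToSub (R.repVV (i + 1) k) (span K (range (R.vecE (s + 1) (i + 1) k p)))
  | .scrF s t k p =>
      M.IsomorphicToSub (R.repV k) (span K (range (R.vecF (s + 1) t p))) ∧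
      M.IsomorphicToSub (R.repV (k + N)) (span K (range (R.vecF (s + 1) t (p + 1))))
  | .scrG s t k p =>
      M.IsomorphicToSub (R.repV' k) (span K (range (R.vecG (s + 1) t p))) ∧
      M.IsomorphicToSub (R.repV' (k + N)) (span K (range (R.vecG (s + 1) t (p + 1))))
  | .scrH s t i k p =>
      M.IsomorphicToSub (R.repVV' (i + 1) k) (span K (range (R.vecH (s + 1) t (i + 1) k p)))
  | .scrI s t i k p =>
      M.IsomorphicToSub (R.repVV' (i + 1) k) (span K (range (R.vecI (s + 1) t (i + 1) k p)))
  | .scrL s k p q => ∀ i : Fin n, M.IsomorphicToSub (R.repVV (i + 1) k)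
      (span K (range fun r : Fin (2 * n + 1) => R.vecL (s + 1) (i + 1) k p q r))
  | .scrN s k p q => ∀ i : Fin n, M.IsomorphicToSub (R.repVV' (i + 1) k)
      (span K (range fun r : Fin (2 * n + 1) => R.vecN (s + 1) (i + 1) k p q r))

end Families

universe u v

/-!
The proof has two halves: the listed modules are simple, pairwise non-isomorphic and of the stated
dimensions, and the sum of the squares of these dimensions leaves no room for another simple module.

*Upper bound.* Let `A` be the Suzuki algebra. A Yetter-Drinfeld module is the same as a vector space
with the operators of the elements of `A` and the operators `m ↦ φ(m₍₋₁₎) m₍₀₎` of the functionals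
`φ` on `A` (`coeffOp`). The compatibility condition allows one to move the operators of `A` past
those of `A^*`, so the algebra they generate is spanned by products `φ · a`, uniformly in the module
(`exists_opSpan_eq`). By Schur's lemma and the Jacobson density theorem, for pairwise non-isomorphic
simple modules `M_x` the space `A^* ⊗ A` maps onto `∏ End(M_x)`, whence
`∑ (dim M_x)² ≤ (dim A)²` (`sum_finrank_sq_le`). The words `W_{ij} = x_{ij}^{2s} χ_{ij}^t`
(indices `0, 1`) with `1 ≤ s ≤ N` and `0 ≤ t ≤ 2n+1` span `A`, and counting them gives `dim A ≤ 4N(2n+1)`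
(`finrank_suzukiAlgebra_le`). The listed dimensions satisfy
`8N² + 8N²n(n+1)·4 + 8N²(2n+1)² = (4N(2n+1))²` (`YDIndex.sum_dim_sq`), so equality holds and the list
is complete.

*The listed modules.* For fixed `s` and `t` the words form a matrix coalgebra, `Δ W_{ij} = ∑ W_{ia} ⊗
W_{aj}`, and `x_{ia} W_{kl} S(x_{a+c,i+c}) = W_{k+1,l+1}` for the parity `c` of `t`
(`gen_mul_word_mul_antipode`). Hence in `V ⊠ A` the two vectors `∑ₐ y_a ⊠ W_{ia}`, for `y_0`, `y_1`
exchanged up to scalars by the generators `x_{i,i+c}`, span a submodule whose structure constants are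
explicit. All listed one- and two-dimensional modules are of this form: in the extreme lengths
`t = 0` and `t = 2n+1` the words `W_{ij}` and `W_{i+1,j+1}` agree up to sign, and the two vectors may
be proportional. The modules `ℒ` and `𝒩` are spanned by a path: starting from an eigenvector of
`x_{0c}` the letters of the block `c` are applied alternately, and the relation between the two
alternating words of length `2n+1` closes the path after `2n+1` steps (`IsPath`, `boxPath`).

*Telling modules apart.* Both blocks of `A` map to the group algebra of a product of a dihedral and a
cyclic group (`diagHom`, `offHom`), in which words stay distinct; this yields functionals on `A` that
separate words (`exists_coordinate`). Their operators are projections onto basis vectors, which gives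
simplicity. Traces of products of such operators with generators are isomorphism invariants, and they
recover the parameters (`line_invariants`, `pair_invariants`, `path_invariants`). For pairs of words of
extreme length the basis vectors are separated by the eigenvalues of a product of two generators, and
the exchange of the two vectors is excluded by the sign of the twist (`pair_parameters`).
-/

/-! ### Operators of linear functionals, isomorphisms and submodules -/

section CoefficientOperators

universe w v'

variable {K : Type u} [Field K] {H : Type w} [Ring H] [HopfAlgebra K H]

theorem lid_rTensor_mem_iff {V : Type v} [AddCommGroup V] [Module K V] (W : Submodule K V)
    (x : H ⊗[K] V) : x ∈ LinearMap.range (W.subtype.lTensor H) ↔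
      ∀ φ : Module.Dual K H, TensorProduct.lid K V (φ.rTensor V x) ∈ W := by
  constructor
  · rintro ⟨y, rfl⟩ φ
    induction y with
    | zero => simp
    | add a b ha hb => simp only [map_add]; exact W.add_mem ha hb
    | tmul a b => simpa using W.smul_mem _ b.2
  · intro h
    classical
    let b := Module.Basis.ofVectorSpace K H
    obtain ⟨c, hc⟩ : ∃ c : Module.Basis.ofVectorSpaceIndex K H →₀ V,
        x = c.sum fun i m => b i ⊗ₜ m := by
      refine ⟨TensorProduct.equivFinsuppOfBasisLeft b x, ?_⟩
      exact ((TensorProduct.equivFinsuppOfBasisLeft b).symm_apply_apply x).symm.trans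
        (TensorProduct.equivFinsuppOfBasisLeft_symm_apply b _)
    have key : ∀ i, c i ∈ W := fun i => by
      have := h (b.coord i)
      rw [hc, Finsupp.sum, map_sum, map_sum] at this
      simp only [LinearMap.rTensor_tmul, TensorProduct.lid_tmul, Module.Basis.coord_apply,
        Module.Basis.repr_self] at this
      rw [Finset.sum_eq_single i] at this
      · simpa using this
      · intro j _ hj; rw [Finsupp.single_eq_of_ne hj.symm, zero_smul]
      · intro hi; rw [Finsupp.notMem_support_iff.mp hi, smul_zero]
    rw [hc]
    exact Submodule.sum_mem _ fun i _ => ⟨b i ⊗ₜ ⟨c i, key i⟩, by simp⟩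

namespace YDModule

/-- The operator `m ↦ φ(m₍₋₁₎) m₍₀₎` attached to a linear functional `φ` on `H`. -/
noncomputable def coeffOp (M : YDModule.{u, w, v} K H) (φ : Module.Dual K H) :
    Module.End K M.carrier :=
  (TensorProduct.lid K M.carrier).toLinearMap ∘ₗ φ.rTensor M.carrier ∘ₗ M.coact

theorem coeffOp_apply (M : YDModule.{u, w, v} K H) (φ : Module.Dual K H) (m : M.carrier) :
    M.coeffOp φ m = TensorProduct.lid K M.carrier (φ.rTensor M.carrier (M.coact m)) := rfl

theorem coeffOp_add (M : YDModule.{u, w, v} K H) (φ ψ : Module.Dual K H) :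
    M.coeffOp (φ + ψ) = M.coeffOp φ + M.coeffOp ψ := by
  ext m; simp [coeffOp_apply, LinearMap.rTensor_add]

theorem coeffOp_smul (M : YDModule.{u, w, v} K H) (c : K) (φ : Module.Dual K H) :
    M.coeffOp (c • φ) = c • M.coeffOp φ := by
  ext m; simp [coeffOp_apply, LinearMap.rTensor_smul]

theorem coeffOp_counit (M : YDModule.{u, w, v} K H) : M.coeffOp Coalgebra.counit = 1 := by
  ext m; exact M.counit_coact m

theorem coeffOp_mul (M : YDModule.{u, w, v} K H) (φ ψ : Module.Dual K H) :
    M.coeffOp ψ * M.coeffOp φ =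
      M.coeffOp (LinearMap.mul' K K ∘ₗ TensorProduct.map φ ψ ∘ₗ Coalgebra.comul) := by
  ext m
  let G : H ⊗[K] (H ⊗[K] M.carrier) →ₗ[K] M.carrier :=
    (TensorProduct.lid K _).toLinearMap ∘ₗ φ.rTensor _ ∘ₗ
      ((TensorProduct.lid K _).toLinearMap ∘ₗ ψ.rTensor _).lTensor H
  have h1 : ∀ x : H ⊗[K] M.carrier, M.coeffOp ψ (TensorProduct.lid K _ (φ.rTensor _ x)) =
      G (M.coact.lTensor H x) := by
    intro x
    induction x with
    | zero => simp
    | add a b ha hb => simp only [map_add, ha, hb]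
    | tmul a b => simp [G, coeffOp_apply]
  have h2 : ∀ x : H ⊗[K] M.carrier, G (TensorProduct.assoc K H H _
      ((Coalgebra.comul (R := K) (A := H)).rTensor _ x)) =
      TensorProduct.lid K _ ((LinearMap.mul' K K ∘ₗ TensorProduct.map φ ψ ∘ₗ
        Coalgebra.comul).rTensor _ x) := by
    intro x
    induction x with
    | zero => simp
    | add a b ha hb => simp only [map_add, ha, hb]
    | tmul a b =>
      simp only [LinearMap.rTensor_tmul, LinearMap.comp_apply, TensorProduct.lid_tmul]
      induction Coalgebra.comul (R := K) a with
      | zero => simp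
      | add c d hc hd => simp only [TensorProduct.add_tmul, map_add, hc, hd, add_smul]
      | tmul c d => simp [G, mul_smul, smul_comm (ψ d)]
  rw [Module.End.mul_apply, coeffOp_apply M φ, h1, ← M.coassoc, h2, coeffOp_apply]

theorem isSubYD_iff (M : YDModule.{u, w, v} K H) (W : Submodule K M.carrier) :
    M.IsSubYD W ↔ (∀ h, ∀ m ∈ W, M.act h m ∈ W) ∧ ∀ φ, ∀ m ∈ W, M.coeffOp φ m ∈ W := by
  unfold IsSubYD
  refine and_congr_right fun _ => ?_
  simp only [lid_rTensor_mem_iff, coeffOp_apply]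
  exact ⟨fun h φ m hm => h m hm φ, fun h m hm φ => h φ m hm⟩

theorem tensor_ext {V : Type v} [AddCommGroup V] [Module K V] {x y : H ⊗[K] V}
    (h : ∀ φ : Module.Dual K H, TensorProduct.lid K V (φ.rTensor V x) =
      TensorProduct.lid K V (φ.rTensor V y)) : x = y := by
  have : x - y ∈ LinearMap.range ((⊥ : Submodule K V).subtype.lTensor H) := by
    rw [lid_rTensor_mem_iff]
    intro φ
    rw [map_sub, map_sub, h φ, sub_self]
    exact Submodule.zero_mem _
  obtain ⟨z, hz⟩ := this
  have h0 : (⊥ : Submodule K V).subtype = 0 := by ext ⟨a, ha⟩; simpa using ha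
  rw [h0, LinearMap.lTensor_zero, LinearMap.zero_apply] at hz
  exact (sub_eq_zero.mp hz.symm)

theorem isomorphic_of_coeffOp {M : YDModule.{u, w, v} K H} {M' : YDModule.{u, w, v'} K H}
    (f : M.carrier ≃ₗ[K] M'.carrier) (h1 : ∀ h m, f (M.act h m) = M'.act h (f m))
    (h2 : ∀ φ m, f (M.coeffOp φ m) = M'.coeffOp φ (f m)) : M.Isomorphic M' := by
  refine ⟨f, h1, fun m => tensor_ext fun φ => ?_⟩
  rw [← coeffOp_apply, ← h2, coeffOp_apply]
  induction M.coact m with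
  | zero => simp
  | add a b ha hb => simp only [map_add, ha, hb]
  | tmul a b => simp

theorem Isomorphic.exists_coeffOp {M : YDModule.{u, w, v} K H} {M' : YDModule.{u, w, v'} K H}
    (h : M.Isomorphic M') : ∃ f : M.carrier ≃ₗ[K] M'.carrier,
      (∀ h m, f (M.act h m) = M'.act h (f m)) ∧
      ∀ φ m, f (M.coeffOp φ m) = M'.coeffOp φ (f m) := by
  obtain ⟨f, h1, h2⟩ := h
  refine ⟨f, h1, fun φ m => ?_⟩
  rw [coeffOp_apply, coeffOp_apply, h2]
  induction M.coact m with
  | zero => simp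
  | add a b ha hb => simp only [map_add, ha, hb]
  | tmul a b => simp

theorem Isomorphic.symm {M : YDModule.{u, w, v} K H} {M' : YDModule.{u, w, v'} K H}
    (h : M.Isomorphic M') : M'.Isomorphic M := by
  obtain ⟨f, h1, h2⟩ := h.exists_coeffOp
  refine isomorphic_of_coeffOp f.symm (fun h m => ?_) fun φ m => ?_
  · rw [LinearEquiv.symm_apply_eq, h1, f.apply_symm_apply]
  · rw [LinearEquiv.symm_apply_eq, h2, f.apply_symm_apply]

universe v''

theorem Isomorphic.trans {M : YDModule.{u, w, v} K H} {M' : YDModule.{u, w, v'} K H}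
    {M'' : YDModule.{u, w, v''} K H} (h : M.Isomorphic M') (h' : M'.Isomorphic M'') :
    M.Isomorphic M'' := by
  obtain ⟨f, h1, h2⟩ := h.exists_coeffOp
  obtain ⟨g, h3, h4⟩ := h'.exists_coeffOp
  exact isomorphic_of_coeffOp (f.trans g) (fun h m => by simp [h1, h3])
    fun φ m => by simp [h2, h4]

/-- The trace of `a` followed by the operator of `φ` is an isomorphism invariant. -/
theorem Isomorphic.trace_eq {M : YDModule.{u, w, v} K H} {M' : YDModule.{u, w, v'} K H}
    (h : M.Isomorphic M') (φ : Module.Dual K H) (a : H) :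
    LinearMap.trace K _ (M.coeffOp φ * M.act a) = LinearMap.trace K _ (M'.coeffOp φ * M'.act a) := by
  obtain ⟨f, h1, h2⟩ := h.exists_coeffOp
  have : M'.coeffOp φ * M'.act a = f.conj (M.coeffOp φ * M.act a) := by
    ext m
    simp [LinearEquiv.conj_apply, h1, h2]
  rw [this, LinearMap.trace_conj']

theorem Isomorphic.isSimpleYD {M : YDModule.{u, w, v} K H} {M' : YDModule.{u, w, v'} K H}
    (h : M.Isomorphic M') (hM : M.IsSimpleYD) : M'.IsSimpleYD := by
  obtain ⟨f, h1, h2⟩ := h.exists_coeffOp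
  obtain ⟨hn, hs⟩ := hM
  refine ⟨f.symm.toEquiv.nontrivial, fun W hW => ?_⟩
  rw [isSubYD_iff] at hW
  have := hs (W.comap f.toLinearMap) ((isSubYD_iff _ _).2
    ⟨fun h m hm => by
      simpa [h1] using hW.1 h _ hm, fun φ m hm => by simpa [h2] using hW.2 φ _ hm⟩)
  rcases this with h | h
  · left
    rw [eq_bot_iff]
    intro w hw
    have : f.symm w ∈ W.comap f.toLinearMap := by simpa using hw
    rw [h, Submodule.mem_bot] at this
    simpa using this
  · right
    rw [eq_top_iff]
    intro w _
    have : f.symm w ∈ W.comap f.toLinearMap := by rw [h]; trivial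
    simpa using this

/-- A Yetter-Drinfeld structure pulled back along an injective linear map that intertwines given
operations of `H` on its source. -/
noncomputable def pullback (M : YDModule.{u, w, v} K H) {V : Type v'} [AddCommGroup V]
    [Module K V] (e : V →ₗ[K] M.carrier) (he : Function.Injective e)
    (ac : H →ₐ[K] Module.End K V) (co : V →ₗ[K] H ⊗[K] V)
    (hac : ∀ h m, e (ac h m) = M.act h (e m))
    (hco : ∀ m, e.lTensor H (co m) = M.coact (e m)) : YDModule.{u, w, v'} K H where
  carrier := V
  act := ac
  coact := co
  counit_coact m := by
    apply he
    have : ∀ x : H ⊗[K] V, e (TensorProduct.lid K V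
        ((Coalgebra.counit (R := K) (A := H)).rTensor V x)) =
        TensorProduct.lid K _ ((Coalgebra.counit (R := K) (A := H)).rTensor _
          (e.lTensor H x)) := by
      intro x
      induction x with
      | zero => simp
      | add a b ha hb => simp only [map_add, ha, hb]
      | tmul a b => simp
    rw [this, hco, M.counit_coact]
  coassoc m := by
    have hinj : Function.Injective ((e.lTensor H).lTensor H) :=
      Module.Flat.lTensor_preserves_injective_linearMap _
        (Module.Flat.lTensor_preserves_injective_linearMap _ he)
    apply hinj
    have h1 : ∀ x : H ⊗[K] V, (e.lTensor H).lTensor H (TensorProduct.assoc K H H V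
        ((Coalgebra.comul (R := K) (A := H)).rTensor V x)) =
        TensorProduct.assoc K H H _
          ((Coalgebra.comul (R := K) (A := H)).rTensor _ (e.lTensor H x)) := by
      intro x
      induction x with
      | zero => simp
      | add a b ha hb => simp only [map_add, ha, hb]
      | tmul a b =>
        simp only [LinearMap.rTensor_tmul, LinearMap.lTensor_tmul]
        induction Coalgebra.comul (R := K) a with
        | zero => simp
        | add c d hc hd => simp only [TensorProduct.add_tmul, map_add, hc, hd]
        | tmul c d => simp
    rw [h1, hco, M.coassoc, ← hco]
    induction co m with
    | zero => simp
    | add a b ha hb => simp only [map_add, ha, hb]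
    | tmul a b => simp [hco]
  compat h m := by
    have hinj : Function.Injective (e.lTensor H) :=
      Module.Flat.lTensor_preserves_injective_linearMap _ he
    apply hinj
    have hl : ∀ t : H ⊗[K] H, e.lTensor H (ydLeft ac co t m) =
        ydLeft M.act M.coact t (e m) := by
      intro t
      induction t with
      | zero => simp
      | add a b ha hb => simp only [map_add, LinearMap.add_apply, ha, hb]
      | tmul a b =>
        rw [ydLeft_tmul, ydLeft_tmul, ← hco]
        induction co m with
        | zero => simp
        | add a b ha hb => simp only [map_add, ha, hb]
        | tmul a b => simp [hac]
    have hr : ∀ t : H ⊗[K] H, e.lTensor H (ydRight ac co t m) =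
        ydRight M.act M.coact t (e m) := by
      intro t
      induction t with
      | zero => simp
      | add a b ha hb => simp only [map_add, LinearMap.add_apply, ha, hb]
      | tmul a b =>
        rw [ydRight_tmul, ydRight_tmul, ← hac, ← hco]
        induction co (ac a m) with
        | zero => simp
        | add a b ha hb => simp only [map_add, ha, hb]
        | tmul a b => simp
    rw [hl, hr, M.compat]

/-- Every Yetter-Drinfeld structure can be carried along a linear equivalence. -/
theorem exists_isomorphic (M : YDModule.{u, w, v} K H) {V : Type v'} [AddCommGroup V]
    [Module K V] (e : M.carrier ≃ₗ[K] V) :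
    ∃ M' : YDModule.{u, w, v'} K H, M.Isomorphic M' := by
  refine ⟨M.pullback e.symm.toLinearMap e.symm.injective
    (AlgHom.ofLinearMap (e.conj.toLinearMap ∘ₗ M.act.toLinearMap)
      (by ext; simp [LinearEquiv.conj_apply]) (fun a b => by ext; simp [LinearEquiv.conj_apply]))
    (e.toLinearMap.lTensor H ∘ₗ M.coact ∘ₗ e.symm.toLinearMap)
    (fun h m => by simp [LinearEquiv.conj_apply]) (fun m => ?_), e, fun h m => ?_, fun m => ?_⟩
  · simp only [LinearMap.comp_apply, ← LinearMap.lTensor_comp_apply]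
    simp
  · change e (M.act h m) = e.conj (M.act h) (e m)
    simp [LinearEquiv.conj_apply]
  · exact congrArg (fun y => e.toLinearMap.lTensor H (M.coact y)) (e.symm_apply_apply m)

theorem lTensor_subtype_injective {V : Type v} [AddCommGroup V] [Module K V]
    (W : Submodule K V) : Function.Injective (W.subtype.lTensor H) :=
  Module.Flat.lTensor_preserves_injective_linearMap _ W.injective_subtype

/-- A stable subspace as a Yetter-Drinfeld module. -/
noncomputable def sub (M : YDModule.{u, w, v} K H) (W : Submodule K M.carrier)
    (hW : M.IsSubYD W) : YDModule.{u, w, v} K H :=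
  M.pullback W.subtype W.injective_subtype
    (AlgHom.ofLinearMap
      { toFun := fun h => (M.act h).restrict (hW.1 h)
        map_add' := fun a b => by ext; simp
        map_smul' := fun a b => by ext; simp }
      (by ext; simp) (fun a b => by ext; simp))
    ((LinearEquiv.ofInjective _ (lTensor_subtype_injective W)).symm.toLinearMap ∘ₗ
      (M.coact ∘ₗ W.subtype).codRestrict _ (fun m => hW.2 m m.2))
    (fun h m => rfl)
    (fun m => congrArg Subtype.val
      ((LinearEquiv.ofInjective _ (lTensor_subtype_injective W)).apply_symm_apply
        ((M.coact ∘ₗ W.subtype).codRestrict _ (fun m => hW.2 m m.2) m)))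

theorem subtype_act (M : YDModule.{u, w, v} K H) (W : Submodule K M.carrier)
    (hW : M.IsSubYD W) (h : H) (m : W) : W.subtype ((M.sub W hW).act h m) = M.act h m := rfl

theorem subtype_coact (M : YDModule.{u, w, v} K H) (W : Submodule K M.carrier)
    (hW : M.IsSubYD W) (m : W) :
    W.subtype.lTensor H ((M.sub W hW).coact m) = M.coact m :=
  congrArg Subtype.val
    ((LinearEquiv.ofInjective _ (lTensor_subtype_injective W)).apply_symm_apply
      ((M.coact ∘ₗ W.subtype).codRestrict _ (fun m => hW.2 m m.2) m))

end YDModule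
end CoefficientOperators

/-! ### Density and the bound for the sum of squares of dimensions -/

section DensityBound

namespace YDModule

open SuzukiAlgebra

theorem map_act_of_gen {K : Type*} [Field K] {N m : ℕ} {μ lam : ℤˣ} {V V' : Type*} [AddCommGroup V] [Module K V] [AddCommGroup V'] [Module K V']
    (ρ : SuzukiAlgebra K N m μ lam →ₐ[K] Module.End K V) (ρ' : SuzukiAlgebra K N m μ lam →ₐ[K] Module.End K V') (f : V →ₗ[K] V')
    (h : ∀ i j x, f (ρ (gen K N m μ lam i j) x) = ρ' (gen K N m μ lam i j) (f x)) (a : SuzukiAlgebra K N m μ lam) :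
    ∀ x, f (ρ a x) = ρ' a (f x) := by
  induction a using gen_induction with
  | hgen i j => exact h i j
  | halg c => intro x; simp
  | hadd a b ha hb => intro x; simp [ha, hb]
  | hmul a b ha hb => intro x; simp [ha, hb]

variable {K : Type u} [Field K] {N m : ℕ} [NeZero N] [NeZero m] {μ lam : ℤˣ}

local notation "𝔸" => SuzukiAlgebra K N m μ lam
local notation "𝔻" => FreeAlgebra K ((Fin 2 × Fin 2) ⊕ Module.Dual K (SuzukiAlgebra K N m μ lam))

/-- The Yetter-Drinfeld compatibility for a generator. -/
theorem compat_gen (M : YDModule.{u, u, v} K 𝔸) (i j : Fin 2) (x : M.carrier) :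
    ∑ a, TensorProduct.map (LinearMap.mul K 𝔸 (gen K N m μ lam i a))
        (M.act (gen K N m μ lam a j)) (M.coact x) =
      ∑ a, TensorProduct.map ((LinearMap.mul K 𝔸).flip (gen K N m μ lam a j)) LinearMap.id
        (M.coact (M.act (gen K N m μ lam i a) x)) := by
  have h := M.compat (gen K N m μ lam i j) x
  rw [comul_eq, comulHom_gen, map_add, map_add, LinearMap.add_apply, LinearMap.add_apply,
    ydLeft_tmul, ydLeft_tmul, ydRight_tmul, ydRight_tmul] at h
  simpa [Fin.sum_univ_two] using h

theorem sum_antipode_mul_gen (k a : Fin 2) :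
    ∑ i, gen K N m μ lam i k ^ (4 * N - 1) * gen K N m μ lam i a = if k = a then 1 else 0 := by
  have h := antipode_left K N m μ lam (gen K N m μ lam k a)
  rw [comulHom_gen, counitHom_gen] at h
  simp only [map_add, LinearMap.rTensor_tmul, LinearMap.mul'_apply, antipodeLin_gen] at h
  rw [Fin.sum_univ_two, h]
  split_ifs <;> simp

theorem sum_gen_mul_antipode (k a : Fin 2) :
    ∑ i, gen K N m μ lam k i * gen K N m μ lam a i ^ (4 * N - 1) = if k = a then 1 else 0 := by
  have h := antipode_right K N m μ lam (gen K N m μ lam k a)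
  rw [comulHom_gen, counitHom_gen] at h
  simp only [map_add, LinearMap.lTensor_tmul, LinearMap.mul'_apply, antipodeLin_gen] at h
  rw [Fin.sum_univ_two, h]
  split_ifs <;> simp

/-- Moving a generator past an operator of the dual, by solving the compatibility condition with
the antipode. -/
theorem act_gen_mul_coeffOp (M : YDModule.{u, u, v} K 𝔸) (k j : Fin 2) (ψ : Module.Dual K 𝔸) :
    M.act (gen K N m μ lam k j) * M.coeffOp ψ =
      ∑ i, ∑ a, M.coeffOp (ψ ∘ₗ LinearMap.mulLeft K (gen K N m μ lam i k ^ (4 * N - 1)) ∘ₗ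
        LinearMap.mulRight K (gen K N m μ lam a j)) * M.act (gen K N m μ lam i a) := by
  ext x
  have hL : ∀ i, ∀ y : 𝔸 ⊗[K] M.carrier,
      TensorProduct.lid K _ ((ψ ∘ₗ LinearMap.mulLeft K (gen K N m μ lam i k ^ (4 * N - 1))).rTensor _
        (∑ a, TensorProduct.map (LinearMap.mul K 𝔸 (gen K N m μ lam i a))
        (M.act (gen K N m μ lam a j)) y)) =
      ∑ a, TensorProduct.lid K _ (ψ.rTensor _ (TensorProduct.map (LinearMap.mulLeft K
        (gen K N m μ lam i k ^ (4 * N - 1) * gen K N m μ lam i a))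
        (M.act (gen K N m μ lam a j)) y)) := by
    intro i y
    rw [map_sum, map_sum]
    refine Finset.sum_congr rfl fun a _ => ?_
    induction y with
    | zero => simp
    | add a b ha hb => simp only [map_add, ha, hb]
    | tmul a b => simp
  have hR : ∀ i a, ∀ y : 𝔸 ⊗[K] M.carrier,
      TensorProduct.lid K _ ((ψ ∘ₗ LinearMap.mulLeft K (gen K N m μ lam i k ^ (4 * N - 1))).rTensor _
        (TensorProduct.map ((LinearMap.mul K 𝔸).flip (gen K N m μ lam a j)) LinearMap.id y)) =
      TensorProduct.lid K _ ((ψ ∘ₗ LinearMap.mulLeft K (gen K N m μ lam i k ^ (4 * N - 1)) ∘ₗ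
        LinearMap.mulRight K (gen K N m μ lam a j)).rTensor _ y) := by
    intro i a y
    induction y with
    | zero => simp
    | add a b ha hb => simp only [map_add, ha, hb]
    | tmul a b => simp
  have h1 : ∑ i, TensorProduct.lid K _
      ((ψ ∘ₗ LinearMap.mulLeft K (gen K N m μ lam i k ^ (4 * N - 1))).rTensor _
        (∑ a, TensorProduct.map (LinearMap.mul K 𝔸 (gen K N m μ lam i a))
        (M.act (gen K N m μ lam a j)) (M.coact x))) =
      M.act (gen K N m μ lam k j) (M.coeffOp ψ x) := by
    simp only [hL]
    rw [Finset.sum_comm]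
    have h2 : ∀ a, ∑ i, TensorProduct.lid K _ (ψ.rTensor _ (TensorProduct.map (LinearMap.mulLeft K
        (gen K N m μ lam i k ^ (4 * N - 1) * gen K N m μ lam i a))
        (M.act (gen K N m μ lam a j)) (M.coact x))) = if k = a then
          M.act (gen K N m μ lam a j) (M.coeffOp ψ x) else 0 := by
      intro a
      rw [coeffOp_apply]
      have h3 : ∀ y : 𝔸 ⊗[K] M.carrier, ∑ i, TensorProduct.lid K _ (ψ.rTensor _
          (TensorProduct.map (LinearMap.mulLeft K
          (gen K N m μ lam i k ^ (4 * N - 1) * gen K N m μ lam i a))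
          (M.act (gen K N m μ lam a j)) y)) = TensorProduct.lid K _ (ψ.rTensor _
          (TensorProduct.map (LinearMap.mulLeft K (if k = a then 1 else 0))
          (M.act (gen K N m μ lam a j)) y)) := by
        intro y
        rw [← sum_antipode_mul_gen]
        induction y with
        | zero => simp
        | add a b ha hb => simp only [map_add, Finset.sum_add_distrib, ha, hb]
        | tmul a b =>
          simp [add_mul, add_smul, mul_assoc]
      rw [h3]
      split_ifs
      · induction M.coact x with
        | zero => simp
        | add a b ha hb => simp only [map_add, ha, hb]
        | tmul a b => simp
      · induction M.coact x with
        | zero => simp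
        | add a b ha hb => simp only [map_add, ha, hb, add_zero]
        | tmul a b => simp
    simp only [h2]
    rw [Finset.sum_ite_eq, if_pos (Finset.mem_univ k)]
  rw [Module.End.mul_apply, ← h1]
  simp only [compat_gen, LinearMap.sum_apply, Module.End.mul_apply]
  refine Finset.sum_congr rfl fun i _ => ?_
  rw [map_sum, map_sum]
  exact Finset.sum_congr rfl fun a _ => hR i a _

/-- The operators of the generators and of the dual, as a representation of a free algebra. -/
noncomputable def opAlg (M : YDModule.{u, u, v} K 𝔸) : 𝔻 →ₐ[K] Module.End K M.carrier :=
  FreeAlgebra.lift K (Sum.elim (fun p => M.act (gen K N m μ lam p.1 p.2)) M.coeffOp)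

theorem opAlg_inl (M : YDModule.{u, u, v} K 𝔸) (p : Fin 2 × Fin 2) :
    M.opAlg (FreeAlgebra.ι K (Sum.inl p)) = M.act (gen K N m μ lam p.1 p.2) := by
  simp [opAlg]

theorem opAlg_inr (M : YDModule.{u, u, v} K 𝔸) (φ : Module.Dual K 𝔸) :
    M.opAlg (FreeAlgebra.ι K (Sum.inr φ)) = M.coeffOp φ := by
  simp [opAlg]

theorem act_mem_of_gen (M : YDModule.{u, u, v} K 𝔸) {W : Submodule K M.carrier}
    (h : ∀ i j, ∀ x ∈ W, M.act (gen K N m μ lam i j) x ∈ W) (a : 𝔸) :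
    ∀ x ∈ W, M.act a x ∈ W := by
  induction a using gen_induction with
  | hgen i j => exact h i j
  | halg c => intro x hx; simpa using W.smul_mem c hx
  | hadd a b ha hb => intro x hx; simpa using W.add_mem (ha x hx) (hb x hx)
  | hmul a b ha hb => intro x hx; simpa using ha _ (hb x hx)

theorem isSubYD_of_opAlg (M : YDModule.{u, u, v} K 𝔸) {W : Submodule K M.carrier}
    (h : ∀ d, ∀ x ∈ W, M.opAlg d x ∈ W) : M.IsSubYD W := by
  rw [isSubYD_iff]
  refine ⟨M.act_mem_of_gen fun i j x hx => ?_, fun φ x hx => ?_⟩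
  · have := h (FreeAlgebra.ι K (Sum.inl (i, j))) x hx
    rwa [opAlg_inl] at this
  · have := h (FreeAlgebra.ι K (Sum.inr φ)) x hx
    rwa [opAlg_inr] at this

theorem isomorphic_of_opAlg {M M' : YDModule.{u, u, v} K 𝔸} (f : M.carrier ≃ₗ[K] M'.carrier)
    (h : ∀ d x, f (M.opAlg d x) = M'.opAlg d (f x)) : M.Isomorphic M' := by
  refine isomorphic_of_coeffOp f (map_act_of_gen M.act M'.act f.toLinearMap fun i j x => ?_)
    fun φ x => ?_
  · have := h (FreeAlgebra.ι K (Sum.inl (i, j))) x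
    rwa [opAlg_inl, opAlg_inl] at this
  · have := h (FreeAlgebra.ι K (Sum.inr φ)) x
    rwa [opAlg_inr, opAlg_inr] at this

/-- The carrier of `M` as a module over the free algebra of operators. -/
def OpMod (M : YDModule.{u, u, v} K 𝔸) : Type v := M.carrier

instance (M : YDModule.{u, u, v} K 𝔸) : AddCommGroup M.OpMod := M.addCommGroup
noncomputable instance (M : YDModule.{u, u, v} K 𝔸) : Module K M.OpMod := M.module
noncomputable instance (M : YDModule.{u, u, v} K 𝔸) : Module 𝔻 M.OpMod :=
  Module.compHom M.carrier M.opAlg.toRingHom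

theorem smul_opMod (M : YDModule.{u, u, v} K 𝔸) (d : 𝔻) (x : M.OpMod) : d • x = M.opAlg d x := rfl

instance (M : YDModule.{u, u, v} K 𝔸) : IsScalarTower K 𝔻 M.OpMod :=
  ⟨fun c d x => by
    rw [smul_opMod, smul_opMod, map_smul]; rfl⟩

theorem isSimpleModule_opMod {M : YDModule.{u, u, v} K 𝔸} (hM : M.IsSimpleYD) :
    IsSimpleModule 𝔻 M.OpMod := by
  have : Nontrivial M.OpMod := hM.1
  refine (isSimpleModule_iff _ _).2 ⟨fun W => ?_⟩
  rcases hM.2 (W.restrictScalars K) (M.isSubYD_of_opAlg fun d x hx => W.smul_mem d hx) with h | h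
  · left; ext x; exact SetLike.ext_iff.mp h x
  · right; ext x; exact SetLike.ext_iff.mp h x

theorem isomorphic_of_opMod {M M' : YDModule.{u, u, v} K 𝔸} (f : M.OpMod ≃ₗ[𝔻] M'.OpMod) :
    M.Isomorphic M' :=
  isomorphic_of_opAlg (f.restrictScalars K) fun d x => f.map_smul d x

/-- The operators `φ ⊗ a ↦ (m ↦ φ((a m)₍₋₁₎) (a m)₍₀₎)`. -/
noncomputable def opSpan (M : YDModule.{u, u, v} K 𝔸) :
    Module.Dual K 𝔸 ⊗[K] 𝔸 →ₗ[K] Module.End K M.carrier :=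
  TensorProduct.lift (LinearMap.mk₂ K (fun φ a => M.coeffOp φ * M.act a)
    (fun φ ψ a => by rw [coeffOp_add, add_mul])
    (fun c φ a => by rw [coeffOp_smul, smul_mul_assoc])
    (fun φ a b => by rw [map_add, mul_add])
    (fun c φ a => by rw [map_smul, mul_smul_comm]))

theorem opSpan_tmul (M : YDModule.{u, u, v} K 𝔸) (φ : Module.Dual K 𝔸) (a : 𝔸) :
    M.opSpan (φ ⊗ₜ a) = M.coeffOp φ * M.act a := by simp [opSpan]

/-- The algebra generated by the operators is spanned by the products of an operator of the dual
and an operator of the algebra, in a way that does not depend on the module. -/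
theorem exists_opSpan_eq (d : 𝔻) : ∃ t : Module.Dual K 𝔸 ⊗[K] 𝔸,
    ∀ M : YDModule.{u, u, v} K 𝔸, M.opAlg d = M.opSpan t := by
  suffices h : ∀ t : Module.Dual K 𝔸 ⊗[K] 𝔸, ∃ t' : Module.Dual K 𝔸 ⊗[K] 𝔸,
      ∀ M : YDModule.{u, u, v} K 𝔸, M.opAlg d * M.opSpan t = M.opSpan t' by
    obtain ⟨t', ht'⟩ := h (Coalgebra.counit ⊗ₜ 1)
    refine ⟨t', fun M => ?_⟩
    rw [← ht', opSpan_tmul, coeffOp_counit, map_one, mul_one, mul_one]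
  induction d using FreeAlgebra.induction with
  | grade0 c => exact fun t => ⟨c • t, fun M => by
      rw [map_smul, AlgHom.commutes, Algebra.smul_def]⟩
  | grade1 p =>
    intro t
    induction t with
    | zero => exact ⟨0, fun M => by simp⟩
    | add a b ha hb =>
      obtain ⟨a', ha⟩ := ha
      obtain ⟨b', hb⟩ := hb
      exact ⟨a' + b', fun M => by rw [map_add, mul_add, ha, hb, map_add]⟩
    | tmul φ a =>
      rcases p with ⟨k, j⟩ | ψ
      · refine ⟨∑ i, ∑ b, (φ ∘ₗ LinearMap.mulLeft K (gen K N m μ lam i k ^ (4 * N - 1)) ∘ₗ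
          LinearMap.mulRight K (gen K N m μ lam b j)) ⊗ₜ (gen K N m μ lam i b * a), fun M => ?_⟩
        rw [opAlg_inl, opSpan_tmul, ← mul_assoc, act_gen_mul_coeffOp]
        simp only [map_sum, opSpan_tmul, map_mul, Finset.sum_mul, mul_assoc]
      · refine ⟨(LinearMap.mul' K K ∘ₗ TensorProduct.map φ ψ ∘ₗ Coalgebra.comul) ⊗ₜ a,
          fun M => ?_⟩
        rw [opAlg_inr, opSpan_tmul, opSpan_tmul, ← mul_assoc, coeffOp_mul]
  | mul a b ha hb =>
    intro t
    obtain ⟨t', h1⟩ := hb t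
    obtain ⟨t'', h2⟩ := ha t'
    exact ⟨t'', fun M => by rw [map_mul, mul_assoc, h1, h2]⟩
  | add a b ha hb =>
    intro t
    obtain ⟨t', h1⟩ := ha t
    obtain ⟨t'', h2⟩ := hb t
    exact ⟨t' + t'', fun M => by rw [map_add, add_mul, h1, h2, map_add]⟩

/-- A simple module `M` is finite-dimensional: for `x ≠ 0`, the image of `A^* ⊗ A` under
`t ↦ opSpan t x` is a nonzero submodule. -/
theorem finite_of_isSimpleYD [Module.Finite K 𝔸] {M : YDModule.{u, u, v} K 𝔸}
    (hM : M.IsSimpleYD) : Module.Finite K M.carrier := by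
  obtain ⟨hn, hs⟩ := hM
  obtain ⟨x, hx⟩ := exists_ne (0 : M.carrier)
  let F : Module.Dual K 𝔸 ⊗[K] 𝔸 →ₗ[K] M.carrier := (LinearMap.applyₗ x) ∘ₗ M.opSpan
  have h1 : M.IsSubYD (LinearMap.range F) := by
    apply isSubYD_of_opAlg
    rintro d _ ⟨t, rfl⟩
    have key : ∀ t : Module.Dual K 𝔸 ⊗[K] 𝔸, ∃ e : 𝔻, M.opAlg e = M.opSpan t := by
      intro t
      induction t with
      | zero => exact ⟨0, by simp⟩
      | add a b ha hb =>
        obtain ⟨a', ha⟩ := ha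
        obtain ⟨b', hb⟩ := hb
        exact ⟨a' + b', by rw [map_add, map_add, ha, hb]⟩
      | tmul φ a =>
        have : ∃ e : 𝔻, M.opAlg e = M.act a := by
          induction a using gen_induction with
          | hgen i j => exact ⟨_, M.opAlg_inl (i, j)⟩
          | halg c => exact ⟨algebraMap K _ c, by simp⟩
          | hadd a b ha hb =>
            obtain ⟨a', ha⟩ := ha
            obtain ⟨b', hb⟩ := hb
            exact ⟨a' + b', by rw [map_add, map_add, ha, hb]⟩
          | hmul a b ha hb =>
            obtain ⟨a', ha⟩ := ha
            obtain ⟨b', hb⟩ := hb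
            exact ⟨a' * b', by rw [map_mul, map_mul, ha, hb]⟩
        obtain ⟨e, he⟩ := this
        exact ⟨FreeAlgebra.ι K (Sum.inr φ) * e, by rw [map_mul, opAlg_inr, he, opSpan_tmul]⟩
    obtain ⟨e, he⟩ := key t
    obtain ⟨t', ht'⟩ := exists_opSpan_eq.{u, v} (d * e)
    refine ⟨t', ?_⟩
    change M.opSpan t' x = M.opAlg d (M.opSpan t x)
    rw [← ht', map_mul, he, Module.End.mul_apply]
  have h2 : x ∈ LinearMap.range F :=
    ⟨Coalgebra.counit ⊗ₜ 1, by
      change M.opSpan (Coalgebra.counit ⊗ₜ 1) x = x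
      rw [opSpan_tmul, coeffOp_counit, map_one, mul_one, Module.End.one_apply]⟩
  rcases hs _ h1 with h | h
  · rw [h] at h2; exact absurd h2 hx
  · exact Module.Finite.of_surjective F (LinearMap.range_eq_top.mp h)

/-- Pairwise non-isomorphic simple modules: every family of endomorphisms comes from a single
element of the free algebra of operators (Schur's lemma and the density theorem). -/
theorem exists_opAlg_eq [IsAlgClosed K] {ι : Type} [Fintype ι]
    (M : ι → YDModule.{u, u, v} K 𝔸) (hs : ∀ x, (M x).IsSimpleYD)
    (hf : ∀ x, Module.Finite K (M x).carrier) (hi : ∀ x y, (M x).Isomorphic (M y) → x = y)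
    (F : ∀ x, Module.End K (M x).carrier) : ∃ d : 𝔻, ∀ x, (M x).opAlg d = F x := by
  classical
  have hsimp := fun x => isSimpleModule_opMod (hs x)
  have hfin : ∀ x, Module.Finite K (M x).OpMod := hf
  -- Schur's lemma: an endomorphism of the sum has scalar diagonal components and no others
  have hsc : ∀ (g : Module.End 𝔻 (∀ x, (M x).OpMod)) (x y : ι), ∃ c : K, ∀ v : (M y).OpMod,
      g (Pi.single y v) x = if h : y = x then c • (h ▸ v) else 0 := by
    intro g x y
    let gxy : (M y).OpMod →ₗ[𝔻] (M x).OpMod :=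
      LinearMap.proj x ∘ₗ g ∘ₗ LinearMap.single 𝔻 (fun x => (M x).OpMod) y
    have hg : ∀ v, gxy v = g (Pi.single y v) x := fun v => rfl
    by_cases h : y = x
    · subst h
      have := IsSimpleModule.nontrivial 𝔻 (M y).OpMod
      obtain ⟨c, hc⟩ := Module.End.exists_eigenvalue (gxy.restrictScalars K)
      refine ⟨c, fun v => ?_⟩
      obtain ⟨w, hw⟩ := hc.exists_hasEigenvector
      have hw1 : gxy w = c • w := hw.apply_eq_smul
      let cc : (M y).OpMod →ₗ[𝔻] (M y).OpMod :=
        { toFun := fun v => c • v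
          map_add' := smul_add c
          map_smul' := fun d v => (((M y).opAlg d).map_smul c v).symm }
      have h0 : gxy - cc = 0 := by
        rcases LinearMap.bijective_or_eq_zero (gxy - cc) with h | h
        · exact absurd (h.1 ((show (gxy - cc) w = gxy w - c • w from rfl).trans
            (by rw [hw1, sub_self, map_zero]) : (gxy - cc) w = (gxy - cc) 0)) hw.2
        · exact h
      rw [dif_pos rfl, ← hg]
      exact congrArg (fun q => q v) (sub_eq_zero.mp h0)
    · refine ⟨0, fun v => ?_⟩
      rw [dif_neg h, ← hg]
      rcases LinearMap.bijective_or_eq_zero gxy with h' | h'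
      · exact absurd (hi _ _ (isomorphic_of_opMod (LinearEquiv.ofBijective gxy h'))) h
      · rw [h']; rfl
  let F' : ∀ x, (M x).OpMod →ₗ[K] (M x).OpMod := F
  -- hence the family `F` commutes with the endomorphisms of the sum, as the density theorem needs
  let f : Module.End (Module.End 𝔻 (∀ x, (M x).OpMod)) (∀ x, (M x).OpMod) :=
    { toFun := fun v x => F' x (v x)
      map_add' := fun v w => funext fun x => map_add (F' x) _ _
      map_smul' := fun g v => by
        funext x
        have hv : ∀ v : ∀ x, (M x).OpMod, g v = ∑ y, g (Pi.single y (v y)) := fun v => by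
          conv_lhs => rw [← Finset.univ_sum_single v]
          rw [map_sum]
        change F' x ((g v) x) = (g fun x => F' x (v x)) x
        rw [hv, hv (fun x => F' x (v x)), Finset.sum_apply, Finset.sum_apply]
        refine (map_sum (F' x) _ _).trans ?_
        refine Finset.sum_congr rfl fun y _ => ?_
        obtain ⟨c, hc⟩ := hsc g x y
        rw [hc, hc]
        split_ifs with h
        · subst h; exact map_smul (F' y) c (v y)
        · exact map_zero (F' x) }
  let B := Module.finBasis K (∀ x, (M x).OpMod)
  obtain ⟨d, hd⟩ := jacobson_density f (Finset.univ.image B)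
  have hd' : ∀ v : ∀ x, (M x).OpMod, f v = d • v := by
    let L : (∀ x, (M x).OpMod) →ₗ[K] (∀ x, (M x).OpMod) :=
      LinearMap.pi fun x => F' x ∘ₗ LinearMap.proj x
    let L' : (∀ x, (M x).OpMod) →ₗ[K] (∀ x, (M x).OpMod) :=
      LinearMap.pi fun x => ((M x).opAlg d : (M x).OpMod →ₗ[K] (M x).OpMod) ∘ₗ LinearMap.proj x
    have : L = L' := B.ext fun i => hd (B i) (Finset.mem_image_of_mem _ (Finset.mem_univ i))
    exact fun v => congrArg (fun q => q v) this
  have key : ∀ x, ∀ v : (M x).OpMod, F' x v = (M x).opAlg d v := fun x v => by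
    have e := Pi.single_eq_same (M := fun x => (M x).OpMod) x v
    have h1 : F' x ((Pi.single x v : ∀ x, (M x).OpMod) x) =
      d • ((Pi.single x v : ∀ x, (M x).OpMod) x) := congrFun (hd' (Pi.single x v)) x
    rw [e] at h1
    exact h1
  exact ⟨d, fun x => LinearMap.ext fun v => (key x v).symm⟩

/-- The squares of the dimensions of pairwise non-isomorphic simple Yetter-Drinfeld modules add up
to at most the square of the dimension of the algebra, because `A^* ⊗ A` maps onto the product of
the endomorphism algebras of the modules. -/
theorem sum_finrank_sq_le [IsAlgClosed K] [Module.Finite K 𝔸] {ι : Type} [Fintype ι]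
    (M : ι → YDModule.{u, u, v} K 𝔸) (hs : ∀ x, (M x).IsSimpleYD)
    (hi : ∀ x y, (M x).Isomorphic (M y) → x = y) :
    ∑ x, Module.finrank K (M x).carrier ^ 2 ≤ Module.finrank K 𝔸 ^ 2 := by
  have hf := fun x => finite_of_isSimpleYD (hs x)
  let G : Module.Dual K 𝔸 ⊗[K] 𝔸 →ₗ[K] ∀ x, Module.End K (M x).carrier :=
    LinearMap.pi fun x => (M x).opSpan
  have hG : Function.Surjective G := fun F => by
    obtain ⟨d, hd⟩ := exists_opAlg_eq M hs hf hi F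
    obtain ⟨t, ht⟩ := exists_opSpan_eq.{u, v} d
    exact ⟨t, funext fun x => (ht (M x)).symm.trans (hd x)⟩
  have h1 := LinearMap.finrank_le_finrank_of_surjective hG
  rw [Module.finrank_pi_fintype, Module.finrank_tensorProduct, Subspace.dual_finrank_eq] at h1
  simpa [Module.finrank_linearMap, pow_two] using h1

end YDModule
end DensityBound

/-! ### The Yetter-Drinfeld module `V ⊠ A` -/

section CompatMul

universe w
variable {K : Type u} [Field K] {H : Type w} [Ring H] [HopfAlgebra K H]
  {M : Type v} [AddCommGroup M] [Module K M]

/-- The action of `H ⊗ H` on `H ⊗ M`, by left multiplication and by the given action. -/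
noncomputable def tensorAct (act : H →ₐ[K] Module.End K M) :
    H ⊗[K] H →ₗ[K] Module.End K (H ⊗[K] M) :=
  TensorProduct.homTensorHomMap (RingHom.id K) H M H M ∘ₗ
    TensorProduct.map (LinearMap.mul K H) act.toLinearMap

theorem tensorAct_tmul (act : H →ₐ[K] Module.End K M) (a b : H) :
    tensorAct act (a ⊗ₜ b) = TensorProduct.map (LinearMap.mul K H a) (act b) := by
  simp [tensorAct]

theorem ydLeft_eq_tensorAct (act : H →ₐ[K] Module.End K M) (coact : M →ₗ[K] H ⊗[K] M)
    (t : H ⊗[K] H) (m : M) : ydLeft act coact t m = tensorAct act t (coact m) := by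
  induction t with
  | zero => simp
  | add a b ha hb => simp only [map_add, LinearMap.add_apply, ha, hb]
  | tmul a b => rw [ydLeft_tmul, tensorAct_tmul]

theorem tensorAct_mul (act : H →ₐ[K] Module.End K M) (t t' : H ⊗[K] H) :
    tensorAct act (t * t') = tensorAct act t * tensorAct act t' := by
  induction t with
  | zero => simp
  | add a b ha hb => simp only [map_add, add_mul, ha, hb]
  | tmul a b =>
    induction t' with
    | zero => simp
    | add c d hc hd => simp only [map_add, mul_add, hc, hd]
    | tmul c d =>
      rw [Algebra.TensorProduct.tmul_mul_tmul, tensorAct_tmul, tensorAct_tmul, tensorAct_tmul]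
      refine TensorProduct.ext' fun x y => ?_
      simp [mul_assoc]

theorem tensorAct_comm_mulRight (act : H →ₐ[K] Module.End K M) (t : H ⊗[K] H) (b : H)
    (x : H ⊗[K] M) :
    tensorAct act t (TensorProduct.map ((LinearMap.mul K H).flip b) LinearMap.id x) =
      TensorProduct.map ((LinearMap.mul K H).flip b) LinearMap.id (tensorAct act t x) := by
  induction t with
  | zero => simp
  | add c d hc hd => simp only [map_add, LinearMap.add_apply, hc, hd]
  | tmul c d =>
    rw [tensorAct_tmul]
    induction x with
    | zero => simp
    | add y z hy hz => simp only [map_add, hy, hz]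
    | tmul y z => simp [mul_assoc]

/-- The Yetter-Drinfeld compatibility is multiplicative, so that it may be checked on algebra
generators. -/
theorem ydCompat_mul (act : H →ₐ[K] Module.End K M) (coact : M →ₗ[K] H ⊗[K] M) (h h' : H)
    (H1 : ∀ m, ydLeft act coact (Coalgebra.comul (R := K) h) m =
      ydRight act coact (Coalgebra.comul (R := K) h) m)
    (H2 : ∀ m, ydLeft act coact (Coalgebra.comul (R := K) h') m =
      ydRight act coact (Coalgebra.comul (R := K) h') m) (m : M) :
    ydLeft act coact (Coalgebra.comul (R := K) (h * h')) m =
      ydRight act coact (Coalgebra.comul (R := K) (h * h')) m := by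
  rw [Bialgebra.comul_mul, ydLeft_eq_tensorAct, tensorAct_mul, Module.End.mul_apply,
    ← ydLeft_eq_tensorAct, H2]
  induction Coalgebra.comul (R := K) h' with
  | zero => simp
  | add a b ha hb => simp only [map_add, mul_add, LinearMap.add_apply, ha, hb]
  | tmul a b =>
    rw [ydRight_tmul, tensorAct_comm_mulRight, ← ydLeft_eq_tensorAct, H1]
    induction Coalgebra.comul (R := K) h with
    | zero => simp
    | add c d hc hd => simp only [map_add, add_mul, LinearMap.add_apply, hc, hd]
    | tmul c d =>
      rw [Algebra.TensorProduct.tmul_mul_tmul, ydRight_tmul, ydRight_tmul, map_mul act,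
        Module.End.mul_apply]
      induction coact (act c (act a m)) with
      | zero => simp
      | add y z hy hz => simp only [map_add, hy, hz]
      | tmul y z => simp [mul_assoc]

end CompatMul

section BoxModule

open SuzukiAlgebra

variable {K : Type u} [Field K] {N m : ℕ} [NeZero N] [NeZero m] {μ lam : ℤˣ}
  {V : Type v} [AddCommGroup V] [Module K V]

local notation "𝔸" => SuzukiAlgebra K N m μ lam
local notation "𝕩" => gen K N m μ lam

theorem antipode_gen (i j : Fin 2) :
    HopfAlgebra.antipode K (𝕩 i j) = 𝕩 j i ^ (4 * N - 1) :=
  antipodeLin_gen K N m μ lam i j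

theorem boxAct_gen (ρ : 𝔸 →ₐ[K] Module.End K V) (i j : Fin 2) (l : V) (g : 𝔸) :
    boxAct ρ (𝕩 i j) (l ⊗ₜ g) =
      ∑ b, ∑ c, ρ (𝕩 b c) l ⊗ₜ[K] (𝕩 i b * g * 𝕩 j c ^ (4 * N - 1)) := by
  have h : ∀ i j, Bialgebra.comulAlgHom K 𝔸 (𝕩 i j) =
      𝕩 i 0 ⊗ₜ 𝕩 0 j + 𝕩 i 1 ⊗ₜ 𝕩 1 j := fun i j => comulHom_gen K N m μ lam i j
  simp only [boxAct, AlgHom.comp_apply, h, map_add, Algebra.TensorProduct.map_tmul,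
    AlgHom.coe_id, id_eq, TensorProduct.tmul_add, LinearMap.add_apply, boxTriple_tmul,
    antipode_gen, Fin.sum_univ_two]

/-- The map `a ⊗ b ↦ a ⊗ (l ⊠ b)`. -/
noncomputable def boxInsert (l : V) : 𝔸 ⊗[K] 𝔸 →ₗ[K] 𝔸 ⊗[K] (V ⊗[K] 𝔸) :=
  (TensorProduct.mk K V 𝔸 l).lTensor 𝔸

theorem boxInsert_tmul (l : V) (a b : 𝔸) : boxInsert l (a ⊗ₜ b) = a ⊗ₜ[K] (l ⊗ₜ[K] b) := by
  simp [boxInsert]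

theorem boxCoact_tmul (l : V) (g : 𝔸) :
    boxCoact K 𝔸 V (l ⊗ₜ g) = boxInsert l (Coalgebra.comul (R := K) g) := by
  simp only [boxCoact, LinearMap.comp_apply, LinearMap.lTensor_tmul, LinearEquiv.coe_coe]
  induction Coalgebra.comul (R := K) g with
  | zero => simp
  | add a b ha hb => simp only [map_add, TensorProduct.tmul_add, ha, hb]
  | tmul a b => simp [boxInsert_tmul]

theorem comul_gen (i j : Fin 2) : Coalgebra.comul (R := K) (𝕩 i j) =
    𝕩 i 0 ⊗ₜ 𝕩 0 j + 𝕩 i 1 ⊗ₜ 𝕩 1 j := comulHom_gen K N m μ lam i j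

theorem comul_gen_pow_antipode (i j : Fin 2) :
    Coalgebra.comul (R := K) (𝕩 i j ^ (4 * N - 1)) =
      ∑ e, (𝕩 i e ^ (4 * N - 1)) ⊗ₜ[K] (𝕩 e j ^ (4 * N - 1)) := by
  have hN := NeZero.pos N
  rw [comul_eq, map_pow, comulHom_gen, show 4 * N - 1 = (4 * N - 2) + 1 by omega,
    Fin.sum_univ_two]
  exact isSuzukiTuple_gen.tensorTuple_pow i j (4 * N - 2)

/-- The compatibility condition of `V ⊠ A` for a generator, in terms of `Δ(g) = t`. -/
theorem box_compat_aux (ρ : 𝔸 →ₐ[K] Module.End K V) (i j : Fin 2) (l : V) (t : 𝔸 ⊗[K] 𝔸) :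
    ∑ a, TensorProduct.map (LinearMap.mul K 𝔸 (𝕩 i a)) (boxAct ρ (𝕩 a j)) (boxInsert l t) =
      ∑ a, TensorProduct.map ((LinearMap.mul K 𝔸).flip (𝕩 a j)) LinearMap.id
        (∑ b, ∑ c, boxInsert (ρ (𝕩 b c) l) ((∑ d, 𝕩 i d ⊗ₜ[K] 𝕩 d b) * t *
          ∑ e, (𝕩 a e ^ (4 * N - 1)) ⊗ₜ[K] (𝕩 e c ^ (4 * N - 1)))) := by
  induction t with
  | zero => simp
  | add s t hs ht => simp only [map_add, mul_add, add_mul, Finset.sum_add_distrib, hs, ht]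
  | tmul p q =>
    have hR : ∀ a, TensorProduct.map ((LinearMap.mul K 𝔸).flip (𝕩 a j)) LinearMap.id
        (∑ b, ∑ c, boxInsert (ρ (𝕩 b c) l) ((∑ d, 𝕩 i d ⊗ₜ[K] 𝕩 d b) * p ⊗ₜ q *
          ∑ e, (𝕩 a e ^ (4 * N - 1)) ⊗ₜ[K] (𝕩 e c ^ (4 * N - 1)))) =
        ∑ b, ∑ c, ∑ d, ∑ e, (𝕩 i d * p * (𝕩 a e ^ (4 * N - 1) * 𝕩 a j)) ⊗ₜ[K]
          (ρ (𝕩 b c) l ⊗ₜ[K] (𝕩 d b * q * 𝕩 e c ^ (4 * N - 1))) := by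
      intro a
      simp only [Finset.sum_mul, Finset.mul_sum, Algebra.TensorProduct.tmul_mul_tmul, map_sum,
        boxInsert_tmul, TensorProduct.map_tmul, LinearMap.flip_apply, LinearMap.mul_apply',
        LinearMap.id_apply, mul_assoc]
      exact Finset.sum_congr rfl fun b _ => Finset.sum_congr rfl fun c _ => Finset.sum_comm
    simp only [hR]
    have hL : ∀ b c d e, ∑ a, (𝕩 i d * p * (𝕩 a e ^ (4 * N - 1) * 𝕩 a j)) ⊗ₜ[K]
          (ρ (𝕩 b c) l ⊗ₜ[K] (𝕩 d b * q * 𝕩 e c ^ (4 * N - 1))) =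
        if e = j then (𝕩 i d * p) ⊗ₜ[K]
          (ρ (𝕩 b c) l ⊗ₜ[K] (𝕩 d b * q * 𝕩 e c ^ (4 * N - 1))) else 0 := by
      intro b c d e
      rw [← TensorProduct.sum_tmul, ← Finset.mul_sum, YDModule.sum_antipode_mul_gen]
      split_ifs <;> simp
    rw [Finset.sum_comm]
    simp only [fun b => Finset.sum_comm (s := Finset.univ) (t := Finset.univ)
      (f := fun a c => ∑ d, ∑ e, (𝕩 i d * p * (𝕩 a e ^ (4 * N - 1) * 𝕩 a j)) ⊗ₜ[K]
          (ρ (𝕩 b c) l ⊗ₜ[K] (𝕩 d b * q * 𝕩 e c ^ (4 * N - 1))))]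
    simp only [fun b c => Finset.sum_comm (s := Finset.univ) (t := Finset.univ)
      (f := fun a d => ∑ e, (𝕩 i d * p * (𝕩 a e ^ (4 * N - 1) * 𝕩 a j)) ⊗ₜ[K]
          (ρ (𝕩 b c) l ⊗ₜ[K] (𝕩 d b * q * 𝕩 e c ^ (4 * N - 1))))]
    simp only [fun b c d => Finset.sum_comm (s := Finset.univ) (t := Finset.univ)
      (f := fun a e => (𝕩 i d * p * (𝕩 a e ^ (4 * N - 1) * 𝕩 a j)) ⊗ₜ[K]
          (ρ (𝕩 b c) l ⊗ₜ[K] (𝕩 d b * q * 𝕩 e c ^ (4 * N - 1))))]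
    simp only [hL, Finset.sum_ite_eq', Finset.mem_univ, if_true, boxInsert_tmul,
      TensorProduct.map_tmul, LinearMap.mul_apply', boxAct_gen, TensorProduct.tmul_sum]
    rw [Finset.sum_comm]
    exact Finset.sum_congr rfl fun b _ => Finset.sum_comm

theorem box_compat (ρ : 𝔸 →ₐ[K] Module.End K V) (h : 𝔸) (x : V ⊗[K] 𝔸) :
    ydLeft (boxAct ρ) (boxCoact K 𝔸 V) (Coalgebra.comul (R := K) h) x =
      ydRight (boxAct ρ) (boxCoact K 𝔸 V) (Coalgebra.comul (R := K) h) x := by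
  induction h using gen_induction generalizing x with
  | hgen i j =>
    rw [comul_gen]
    induction x with
    | zero => simp
    | add a b ha hb =>
      refine (LinearMap.map_add _ a b).trans ?_
      rw [ha, hb]
      exact (LinearMap.map_add _ a b).symm
    | tmul l g =>
      have hg := box_compat_aux ρ i j l (Coalgebra.comul (R := K) g)
      simp only [Fin.sum_univ_two] at hg
      rw [map_add, map_add, LinearMap.add_apply, LinearMap.add_apply, ydLeft_tmul, ydLeft_tmul,
        ydRight_tmul, ydRight_tmul, boxCoact_tmul, hg, boxAct_gen, boxAct_gen]
      simp only [map_add, boxCoact_tmul, Bialgebra.comul_mul, comul_gen_pow_antipode,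
        Fin.sum_univ_two, comul_gen]
  | halg c =>
    rw [comul_eq, AlgHom.commutes, Algebra.algebraMap_eq_smul_one, Algebra.TensorProduct.one_def,
      map_smul, map_smul, LinearMap.smul_apply, LinearMap.smul_apply, ydLeft_tmul, ydRight_tmul,
      map_one (boxAct ρ), Module.End.one_apply]
    congr 1
    induction boxCoact K 𝔸 V x with
    | zero => simp
    | add a b ha hb => rw [map_add, map_add, ha, hb]
    | tmul a b => simp
  | hadd a b ha hb => simp only [map_add, LinearMap.add_apply, ha, hb]
  | hmul a b ha hb => exact ydCompat_mul _ _ a b ha hb x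

/-- The Yetter-Drinfeld module `V ⊠ A`. -/
noncomputable def boxModule (ρ : 𝔸 →ₐ[K] Module.End K V) : YDModule K 𝔸 where
  carrier := V ⊗[K] 𝔸
  act := boxAct ρ
  coact := boxCoact K 𝔸 V
  counit_coact x := by
    induction x with
    | zero => simp
    | add a b ha hb => simp only [map_add, ha, hb]
    | tmul l g =>
      rw [boxCoact_tmul]
      have h : ∀ t : 𝔸 ⊗[K] 𝔸, TensorProduct.lid K (V ⊗[K] 𝔸)
          ((Coalgebra.counit (R := K) (A := 𝔸)).rTensor _ (boxInsert l t)) =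
          l ⊗ₜ TensorProduct.lid K 𝔸 ((Coalgebra.counit (R := K) (A := 𝔸)).rTensor _ t) := by
        intro t
        induction t with
        | zero => simp
        | add a b ha hb => simp only [map_add, TensorProduct.tmul_add, ha, hb]
        | tmul a b => simp [boxInsert_tmul]
      rw [h, Coalgebra.rTensor_counit_comul]
      simp
  coassoc x := by
    induction x with
    | zero => simp
    | add a b ha hb => simp only [map_add, ha, hb]
    | tmul l g =>
      rw [boxCoact_tmul]
      have h1 : ∀ t : 𝔸 ⊗[K] 𝔸, TensorProduct.assoc K 𝔸 𝔸 (V ⊗[K] 𝔸)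
          ((Coalgebra.comul (R := K) (A := 𝔸)).rTensor _ (boxInsert l t)) =
          (boxInsert l).lTensor 𝔸 (TensorProduct.assoc K 𝔸 𝔸 𝔸
            ((Coalgebra.comul (R := K) (A := 𝔸)).rTensor _ t)) := by
        intro t
        induction t with
        | zero => simp
        | add a b ha hb => simp only [map_add, ha, hb]
        | tmul a b =>
          rw [boxInsert_tmul, LinearMap.rTensor_tmul, LinearMap.rTensor_tmul]
          induction Coalgebra.comul (R := K) a with
          | zero => simp
          | add c d hc hd => simp only [TensorProduct.add_tmul, map_add, hc, hd]
          | tmul c d => simp [boxInsert_tmul]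
      have h2 : ∀ t : 𝔸 ⊗[K] 𝔸, (boxCoact K 𝔸 V).lTensor 𝔸 (boxInsert l t) =
          (boxInsert l).lTensor 𝔸 ((Coalgebra.comul (R := K) (A := 𝔸)).lTensor _ t) := by
        intro t
        induction t with
        | zero => simp
        | add a b ha hb => simp only [map_add, ha, hb]
        | tmul a b => simp [boxInsert_tmul, boxCoact_tmul]
      rw [h1, h2, Coalgebra.coassoc_apply]
  compat h x := box_compat ρ h x

end BoxModule

/-! ### Words, and a spanning set of the algebra -/

section Words

/-- The element `X_{ij}^{2s} χ_{ij}^t`. -/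
def word {R : Type*} [Monoid R] (X : Fin 2 → Fin 2 → R) (s t : ℕ) (i j : Fin 2) : R :=
  X i j ^ (2 * s) * altProd X i j t

/-- The parity of a natural number, as an index. -/
def par (t : ℕ) : Fin 2 := if Even t then 0 else 1

theorem par_even (h : ℕ) : par (2 * h) = 0 := by simp [par]

theorem par_odd (h : ℕ) : par (2 * h + 1) = 1 := by simp [par]

theorem par_add_two (t : ℕ) : par (t + 2) = par t := by
  simp [par, Nat.even_add_one]

namespace IsSuzukiTuple

variable {N m : ℕ} {μ lam : ℤˣ} {R : Type*} [Ring R] {X : Fin 2 → Fin 2 → R}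

theorem mul_eq_zero_of_ne (hX : IsSuzukiTuple N m μ lam X) {i j k l : Fin 2}
    (h : i + j ≠ k + l) : X i j * X k l = 0 := by
  apply hX.zero
  revert i j k l; decide

theorem even_pow_eq (hX : IsSuzukiTuple N m μ lam X) (i j : Fin 2) (s : ℕ) :
    X (i + 1) (j + 1) ^ (2 * s) = X i j ^ (2 * s) := by
  rw [pow_mul, pow_mul, hX.sq_eq]

theorem pow_mul_eq_zero (hX : IsSuzukiTuple N m μ lam X) {i j k l : Fin 2}
    (h : i + j ≠ k + l) {r : ℕ} (hr : r ≠ 0) : X i j ^ r * X k l = 0 := by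
  obtain ⟨r, rfl⟩ := Nat.exists_eq_succ_of_ne_zero hr
  rw [pow_succ, mul_assoc, hX.mul_eq_zero_of_ne h, mul_zero]

theorem mul_pow_eq_zero (hX : IsSuzukiTuple N m μ lam X) {i j k l : Fin 2}
    (h : i + j ≠ k + l) {r : ℕ} (hr : r ≠ 0) : X i j * X k l ^ r = 0 := by
  obtain ⟨r, rfl⟩ := Nat.exists_eq_succ_of_ne_zero hr
  rw [pow_succ', ← mul_assoc, hX.mul_eq_zero_of_ne h, zero_mul]

theorem gen_mul_word_eq_zero (hX : IsSuzukiTuple N m μ lam X) {i j k l : Fin 2}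
    (h : i + j ≠ k + l) {s : ℕ} (hs : s ≠ 0) (t : ℕ) : X i j * word X s t k l = 0 := by
  rw [word, ← mul_assoc, hX.mul_pow_eq_zero h (by omega), zero_mul]

/-- The even powers of a generator commute with the alternating words of its block. -/
theorem even_pow_comm (hX : IsSuzukiTuple N m μ lam X) (i j : Fin 2) (s t : ℕ) :
    X i j ^ (2 * s) * altProd X i j t = altProd X i j t * X i j ^ (2 * s) := by
  rw [pow_mul]; exact ((hX.sq_comm i j t).pow_left s).eq

theorem even_pow_comm_gen (hX : IsSuzukiTuple N m μ lam X) (i j : Fin 2) (s : ℕ) :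
    X (i + 1) (j + 1) * X i j ^ (2 * s) = X i j ^ (2 * s) * X (i + 1) (j + 1) := by
  rw [← hX.even_pow_eq, ← pow_succ, ← pow_succ']

/-- Prefixing the other letter makes a word longer. -/
theorem gen_succ_mul_word (hX : IsSuzukiTuple N m μ lam X) (i j : Fin 2) (s t : ℕ) :
    X (i + 1) (j + 1) * word X s t i j = word X s (t + 1) (i + 1) (j + 1) := by
  rw [word, word, altProd_succ, fin2_add, fin2_add, ← mul_assoc, ← mul_assoc,
    even_pow_comm_gen hX, hX.even_pow_eq]

/-- Prefixing the initial letter makes a word shorter. -/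
theorem gen_mul_word_succ (hX : IsSuzukiTuple N m μ lam X) (i j : Fin 2) (s t : ℕ) :
    X i j * word X s (t + 1) i j = word X (s + 1) t (i + 1) (j + 1) := by
  rw [word, word, altProd_succ, hX.even_pow_eq, ← mul_assoc, ← mul_assoc, ← pow_succ', ← pow_succ]
  rfl

theorem gen_mul_word_zero (X : Fin 2 → Fin 2 → R) (i j : Fin 2) (s : ℕ) :
    X i j * word X s 0 i j = word X s 1 i j := by
  simp only [word, altProd, mul_one]
  rw [← pow_succ, ← pow_succ']

theorem word_zero_succ (hX : IsSuzukiTuple N m μ lam X) (i j : Fin 2) (s : ℕ) :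
    word X s 0 (i + 1) (j + 1) = word X s 0 i j := by
  simp only [word, altProd, mul_one, hX.even_pow_eq]

/-- The sign `λ` on the off-diagonal block and `1` on the diagonal block. -/
def _root_.blockSign (lam : ℤˣ) (b : Fin 2) : ℤˣ := if b = 0 then 1 else lam

theorem altProd_top (hX : IsSuzukiTuple N m μ lam X) (i j : Fin 2) :
    altProd X (i + 1) (j + 1) m = (blockSign lam (i + j) : ℤ) • altProd X i j m := by
  have hl : (lam : ℤ) • altProd X 1 0 m = altProd X 0 1 m := by
    rw [hX.chi_off, smul_smul, units_cast_mul_self, one_smul]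
  fin_cases i <;> fin_cases j
  · simpa [blockSign] using hX.chi_diag.symm
  · simpa [blockSign] using hX.chi_off
  · simpa [blockSign] using hl.symm
  · simpa [blockSign] using hX.chi_diag

theorem word_top_succ (hX : IsSuzukiTuple N m μ lam X) (i j : Fin 2) (s : ℕ) :
    word X s m (i + 1) (j + 1) = (blockSign lam (i + j) : ℤ) • word X s m i j := by
  rw [word, word, hX.altProd_top, hX.even_pow_eq, mul_smul_comm]

/-- A letter moves through a word of its block, changing the initial letter of the word. -/
theorem gen_mul_word (hX : IsSuzukiTuple N m μ lam X) {i a k l : Fin 2} (h : i + a = k + l)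
    (s t : ℕ) : X i a * word X s t k l =
      word X s t (k + 1) (l + 1) * X (i + par t) (a + par t) := by
  have hcase : (i = k ∧ a = l) ∨ (i = k + 1 ∧ a = l + 1) := by
    revert i a k l; decide
  rcases hcase with ⟨rfl, rfl⟩ | ⟨rfl, rfl⟩
  · rcases t with _ | t
    · rw [hX.word_zero_succ, gen_mul_word_zero]
      simp [word, altProd, par]
    · have hsq : (if Even t then X (i + 1) (a + 1) else X (i + 1 + 1) (a + 1 + 1)) *
          X (i + par (t + 1)) (a + par (t + 1)) = X (i + 1) (a + 1) ^ 2 := by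
        by_cases h : Even t
        · simp [h, par, Nat.even_add_one, pow_two]
        · simp only [h, par, Nat.even_add_one, if_false, if_true, not_false_eq_true, fin2_add,
            add_zero, hX.sq_eq, pow_two]
      rw [hX.gen_mul_word_succ, word, word, altProd_succ_right, mul_assoc, mul_assoc, hsq,
        ← (hX.sq_comm _ _ t).eq, ← mul_assoc, ← pow_add]
      rfl
  · rw [hX.gen_succ_mul_word, word, word, altProd_succ_right, mul_assoc]
    by_cases h : Even t
    · simp [h, par]
    · simp [h, par]

/-- The idempotents of the two blocks add up to `1`. -/
theorem idempotent_add [NeZero N] (hX : IsSuzukiTuple N m μ lam X) (i : Fin 2) :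
    X i 0 ^ (4 * N) + X i 1 ^ (4 * N) = 1 := by
  have h0 : X 0 0 ^ (4 * N) + X 0 1 ^ (4 * N) = 1 := by
    rw [show 4 * N = 2 * N + 2 * N by ring, pow_add, pow_add, hX.e_mul_e, hX.f_mul_f, hX.unit]
  fin_cases i
  · exact h0
  · have h1 := hX.even_pow_eq 0 0 (2 * N)
    have h2 := hX.even_pow_eq 0 1 (2 * N)
    rw [show 2 * (2 * N) = 4 * N by ring] at h1 h2
    simp only [Fin.mk_one, Fin.isValue, zero_add] at h1 h2 ⊢
    rw [show (1 : Fin 2) + 1 = 0 from rfl] at h2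
    rw [h1, h2, add_comm, h0]

theorem word_mul_idempotent [NeZero N] (hX : IsSuzukiTuple N m μ lam X) {i j k l : Fin 2}
    (h : i + j = k + l) {s : ℕ} (hs : s ≠ 0) (t : ℕ) :
    word X s t k l * X i j ^ (4 * N) = word X s t k l := by
  have hN := NeZero.pos N
  have h0 : word X s t k l * X i (j + 1) ^ (4 * N) = 0 := by
    have hne : k + l ≠ i + (j + 1) := by revert i j k l; decide
    rw [word, hX.even_pow_comm, mul_assoc, show 4 * N = (4 * N - 1) + 1 by omega, pow_succ' (X _ _),
      ← mul_assoc (X k l ^ _), hX.pow_mul_eq_zero hne (by omega), zero_mul, mul_zero]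
  have h1 : X i j ^ (4 * N) + X i (j + 1) ^ (4 * N) = 1 := by
    rw [← hX.idempotent_add i]
    fin_cases j
    · rfl
    · rw [add_comm]; rfl
  conv_rhs => rw [← mul_one (word X s t k l), ← h1, mul_add, h0, add_zero]

/-- The conjugation rule: `x_{ia} W_{kl} S(x_{a+c,i+c})`, `c` the parity of the length, is
`W_{k+1,l+1}`. -/
theorem gen_mul_word_mul_antipode [NeZero N] (hX : IsSuzukiTuple N m μ lam X) {i a k l : Fin 2}
    (h : i + a = k + l) {s : ℕ} (hs : s ≠ 0) (t : ℕ) :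
    X i a * word X s t k l * X (i + par t) (a + par t) ^ (4 * N - 1) =
      word X s t (k + 1) (l + 1) := by
  have hN := NeZero.pos N
  rw [hX.gen_mul_word h, mul_assoc, ← pow_succ', show 4 * N - 1 + 1 = 4 * N by omega,
    hX.word_mul_idempotent _ hs]
  generalize par t = c
  revert i a k l c; decide

/-- Raising the exponent `s` by `N` changes a word by the sign `1` or `μ` of its block. -/
theorem word_add_half_period [NeZero N] (hX : IsSuzukiTuple N m μ lam X) (i j : Fin 2) {s : ℕ}
    (hs : s ≠ 0) (t : ℕ) :
    word X (s + N) t i j = (blockSign μ (i + j) : ℤ) • word X s t i j := by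
  have hN := NeZero.pos N
  have h1 : X i j ^ (2 * (s + N)) = (blockSign μ (i + j) : ℤ) • X i j ^ (2 * s) := by
    have h0 : ∀ b : Fin 2, X 0 b ^ (2 * (s + N)) = (blockSign μ b : ℤ) • X 0 b ^ (2 * s) := by
      intro b
      have hu := congrArg (fun y => X 0 b ^ (2 * s) * y) hX.unit
      simp only [mul_add, mul_smul_comm, mul_one] at hu
      have hne : X 0 b ^ (2 * s) * X 0 (b + 1) ^ (2 * N) = 0 := by
        rw [show 2 * N = (2 * N - 1) + 1 by omega, pow_succ' (X _ _), ← mul_assoc,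
          hX.pow_mul_eq_zero (by clear hu; revert b; decide) (by omega), zero_mul]
      rw [mul_add, pow_add]
      fin_cases b
      · simp only [Fin.zero_eta, Fin.isValue, zero_add] at hne ⊢
        simp only [Fin.zero_eta, Fin.isValue] at hu
        rw [hne, smul_zero, add_zero] at hu
        simp [hu, blockSign]
      · simp only [Fin.mk_one, Fin.isValue] at hne hu ⊢
        rw [show (1 : Fin 2) + 1 = 0 from rfl] at hne
        rw [hne, zero_add] at hu
        conv_rhs => rw [← hu]
        rw [smul_smul]
        simp [blockSign, -zsmul_eq_mul]
    have hcase : i = 0 ∨ i = 1 := by revert i; decide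
    rcases hcase with rfl | rfl
    · simpa using h0 j
    · have := h0 (j + 1)
      rw [← hX.even_pow_eq 0 (j + 1) s, ← hX.even_pow_eq 0 (j + 1) (s + N), fin2_add,
        zero_add] at this
      rw [add_comm (1 : Fin 2) j]
      exact this
  rw [word, word, h1, smul_mul_assoc]

end IsSuzukiTuple
end Words

section Spanning

open SuzukiAlgebra Submodule

variable (K : Type*) [Field K] (N m : ℕ) [NeZero N] [NeZero m] (μ lam : ℤˣ)

local notation "𝔸" => SuzukiAlgebra K N m μ lam
local notation "𝕨" => word (gen K N m μ lam)

/-- The words with given `s` and `t` form a matrix coalgebra. -/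
theorem comul_word {s : ℕ} (hs : s ≠ 0) (t : ℕ) (i j : Fin 2) :
    Coalgebra.comul (R := K) (𝕨 s t i j) = ∑ a, 𝕨 s t i a ⊗ₜ[K] 𝕨 s t a j := by
  have hX := isSuzukiTuple_gen (K := K) (N := N) (m := m) (μ := μ) (lam := lam)
  obtain ⟨r, hr⟩ : ∃ r, 2 * s = r + 1 := ⟨2 * s - 1, by omega⟩
  have hz : ∀ a b : Fin 2, a ≠ b → gen K N m μ lam i a ^ (2 * s) * altProd (gen K N m μ lam) i b t
      = 0 ∨ t = 0 := by
    intro a b hab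
    rcases t with _ | t
    · exact Or.inr rfl
    · left
      rw [altProd_succ, ← mul_assoc, hX.pow_mul_eq_zero (by simpa using hab) (by omega), zero_mul]
  have hc : Coalgebra.comul (R := K) (gen K N m μ lam i j ^ (2 * s)) =
      ∑ a, (gen K N m μ lam i a ^ (2 * s)) ⊗ₜ[K] (gen K N m μ lam a j ^ (2 * s)) := by
    rw [comul_eq, map_pow, comulHom_gen, hr, Fin.sum_univ_two]
    exact hX.tensorTuple_pow i j r
  rcases t with _ | t
  · simpa [word, altProd] using hc
  · have ha : Coalgebra.comul (R := K) (altProd (gen K N m μ lam) i j (t + 1)) =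
        ∑ a, altProd (gen K N m μ lam) i a (t + 1) ⊗ₜ[K]
          altProd (gen K N m μ lam) a j (t + 1) := by
      rw [comul_eq, map_altProd, Fin.sum_univ_two, ← hX.altProd_tensorTuple (K := K)]
      congr 1
      funext a b
      exact comulHom_gen K N m μ lam a b
    have h01 := (hz 0 1 (by decide)).resolve_right (by omega)
    have h10 := (hz 1 0 (by decide)).resolve_right (by omega)
    rw [word, Bialgebra.comul_mul, hc, ha]
    simp only [Fin.sum_univ_two, add_mul, mul_add, Algebra.TensorProduct.tmul_mul_tmul, h01, h10,
      TensorProduct.zero_tmul, add_zero, zero_add]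
    rfl

/-- The words that span the algebra: for every `s` in a full period, words of length `0, …, m` with
the first letter of a block and of length `1, …, m - 1` with the other letter. -/
def spanningWord : Fin N × Fin 2 × (Fin (m + 1) ⊕ Fin (m - 1)) → 𝔸
  | (s, c, Sum.inl t) => 𝕨 (s + 1) t 0 c
  | (s, c, Sum.inr t) => 𝕨 (s + 1) (t + 1) 1 (1 + c)

theorem word_mem_span_spanningWord {s t : ℕ} (hs : s ≠ 0) (ht : t ≤ m) (i j : Fin 2) :
    𝕨 s t i j ∈ span K (Set.range (spanningWord K N m μ lam)) := by
  have hX := isSuzukiTuple_gen (K := K) (N := N) (m := m) (μ := μ) (lam := lam)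
  have hN := NeZero.pos N
  have hm := NeZero.pos m
  have hsign : ∀ (u : ℤˣ) (x : 𝔸), x ∈ span K (Set.range (spanningWord K N m μ lam)) →
      (u : ℤ) • x ∈ span K (Set.range (spanningWord K N m μ lam)) := by
    intro u x hx
    rcases Int.units_eq_one_or u with rfl | rfl
    · simpa using hx
    · simpa using hx
  have h0 : ∀ s : Fin N, ∀ i j, 𝕨 (s + 1) t i j ∈ span K (Set.range (spanningWord K N m μ lam)) := by
    intro s i j
    have hb : ∀ j, 𝕨 (s + 1) t 0 j ∈ span K (Set.range (spanningWord K N m μ lam)) := fun j =>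
      subset_span ⟨(s, j, Sum.inl ⟨t, by omega⟩), rfl⟩
    have hi : i = 0 ∨ i = 1 := by revert i; decide
    rcases hi with rfl | rfl
    · exact hb j
    · obtain ⟨j, rfl⟩ : ∃ j', j = j' + 1 := ⟨j + 1, (IsSuzukiTuple.fin2_add j).symm⟩
      rcases Nat.eq_zero_or_pos t with rfl | h1
      · exact (hX.word_zero_succ 0 j (s + 1)).symm ▸ hb j
      · rcases ht.lt_or_eq with h2 | rfl
        · have := subset_span (R := K) (s := Set.range (spanningWord K N m μ lam))
            ⟨(s, j, Sum.inr ⟨t - 1, by omega⟩), rfl⟩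
          simp only [spanningWord] at this
          rwa [show t - 1 + 1 = t by omega, add_comm 1 j] at this
        · exact (hX.word_top_succ 0 j (s + 1)).symm ▸ hsign _ _ (hb j)
  induction s using Nat.strong_induction_on with
  | _ s ih =>
    by_cases h : s ≤ N
    · have := h0 ⟨s - 1, by omega⟩ i j
      simpa [show s - 1 + 1 = s by omega] using this
    · have := hX.word_add_half_period i j (s := s - N) (by omega) t
      rw [show s - N + N = s by omega] at this
      rw [this]
      exact hsign _ _ (ih (s - N) (by omega) (by omega))

theorem span_spanningWord : span K (Set.range (spanningWord K N m μ lam)) = ⊤ := by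
  have hX := isSuzukiTuple_gen (K := K) (N := N) (m := m) (μ := μ) (lam := lam)
  have hN := NeZero.pos N
  have hm := NeZero.pos m
  have hw := @word_mem_span_spanningWord K _ N m _ _ μ lam
  set U := span K (Set.range (spanningWord K N m μ lam)) with hU
  have hsign : ∀ (u : ℤˣ) (x : 𝔸), x ∈ U → (u : ℤ) • x ∈ U := by
    intro u x hx
    rcases Int.units_eq_one_or u with rfl | rfl
    · simpa using hx
    · simpa using hx
  have hgen : ∀ k l : Fin 2, ∀ s t : ℕ, s ≠ 0 → t ≤ m → ∀ i j, gen K N m μ lam k l * 𝕨 s t i j ∈ U := by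
    intro k l s t hs ht i j
    by_cases hb : k + l = i + j
    · have hother : ∀ k l i j : Fin 2, k = i + 1 → l = j + 1 → t < m →
          gen K N m μ lam k l * 𝕨 s t i j ∈ U := by
        rintro k l i j rfl rfl h
        rw [hX.gen_succ_mul_word]
        exact hw hs h _ _
      have hsame : ∀ i j : Fin 2, gen K N m μ lam i j * 𝕨 s t i j ∈ U := by
        intro i j
        rcases t with _ | t
        · rw [IsSuzukiTuple.gen_mul_word_zero]
          exact hw hs hm _ _
        · rw [hX.gen_mul_word_succ]
          exact hw (by omega) (by omega) _ _
      have hcase : (k = i ∧ l = j) ∨ (k = i + 1 ∧ l = j + 1) := by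
        clear hsame hother; revert k l i j; decide
      rcases hcase with ⟨rfl, rfl⟩ | ⟨h1, h2⟩
      · exact hsame _ _
      · rcases ht.lt_or_eq with h3 | rfl
        · exact hother _ _ _ _ h1 h2 h3
        · have hi : i = k + 1 := by rw [h1, IsSuzukiTuple.fin2_add]
          have hj : j = l + 1 := by rw [h2, IsSuzukiTuple.fin2_add]
          rw [hi, hj, hX.word_top_succ, mul_smul_comm]
          exact hsign _ _ (hsame _ _)
    · rw [hX.gen_mul_word_eq_zero hb hs]
      exact U.zero_mem
  have hspan : ∀ k l : Fin 2, ∀ x ∈ U, gen K N m μ lam k l * x ∈ U := by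
    intro k l x hx
    induction hx using span_induction with
    | mem x hx =>
      obtain ⟨⟨s, c, t | t⟩, rfl⟩ := hx
      · exact hgen k l _ _ (by omega) (by omega) _ _
      · exact hgen k l _ _ (by omega) (by omega) _ _
    | zero => rw [mul_zero]; exact U.zero_mem
    | add x y _ _ hx hy => rw [mul_add]; exact U.add_mem hx hy
    | smul c x _ hx => rw [mul_smul_comm]; exact U.smul_mem _ hx
  have hall : ∀ a : 𝔸, ∀ x ∈ U, a * x ∈ U := by
    intro a
    induction a using gen_induction with
    | hgen i j => exact hspan i j
    | halg c => intro x hx; rw [← Algebra.smul_def]; exact U.smul_mem _ hx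
    | hadd a b ha hb => intro x hx; rw [add_mul]; exact U.add_mem (ha x hx) (hb x hx)
    | hmul a b ha hb => intro x hx; rw [mul_assoc]; exact ha _ (hb x hx)
  -- the unit is the sum of the idempotents `x_{00}^{4N}` and `x_{01}^{4N}`, which are words
  have hone : (1 : 𝔸) ∈ U := by
    have := hX.idempotent_add 0
    rw [← this, show 4 * N = 2 * (2 * N) by ring]
    have h1 := fun j => hw (s := 2 * N) (t := 0) (by omega) (by omega) 0 j
    simp only [word, altProd, mul_one] at h1
    exact U.add_mem (h1 0) (h1 1)
  rw [eq_top_iff]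
  intro a _
  simpa using hall a 1 hone

instance finite_suzukiAlgebra : Module.Finite K 𝔸 :=
  Module.Finite.of_fg_top (by
    rw [← span_spanningWord K N m μ lam]
    exact fg_span (Set.finite_range _))

theorem finrank_suzukiAlgebra_le : Module.finrank K 𝔸 ≤ 4 * N * m := by
  have hm := NeZero.pos m
  have h := finrank_range_le_card (R := K) (spanningWord K N m μ lam)
  rw [Set.finrank, span_spanningWord, finrank_top] at h
  refine h.trans (le_of_eq ?_)
  simp only [Fintype.card_prod, Fintype.card_sum, Fintype.card_fin]
  rw [show m + 1 + (m - 1) = 2 * m by omega]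
  ring

end Spanning

/-! ### A group of words, and coordinate functionals -/

section WordGroup

variable (N n : ℕ)

/-- A group in which the words in the two letters of a block stay distinct. -/
abbrev WordGroup : Type := DihedralGroup (2 * n + 1) × Multiplicative (ZMod (2 * N))

/-- The two letters, two reflections of degree `1`. -/
def letter (i : Fin 2) : WordGroup N n :=
  (DihedralGroup.sr (i.val : ZMod (2 * n + 1)), Multiplicative.ofAdd 1)

theorem letter_sq (i : Fin 2) : letter N n i ^ 2 = (1, Multiplicative.ofAdd 2) := by
  rw [pow_two, letter, Prod.mk_mul_mk, DihedralGroup.sr_mul_self, ← ofAdd_add]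
  norm_num

theorem letter_pow_even (i : Fin 2) (s : ℕ) :
    letter N n i ^ (2 * s) = (1, Multiplicative.ofAdd (2 * s : ZMod (2 * N))) := by
  rw [pow_mul, letter_sq, Prod.pow_mk, one_pow, ← ofAdd_nsmul, nsmul_eq_mul,
    mul_comm (s : ZMod (2 * N)) 2]

/-- The signed length of a rotation word. -/
def rotExp (i : Fin 2) (h : ℤ) : ℤ := if i = 0 then h else -h

/-- The position of a reflection word. -/
def reflExp (i : Fin 2) (h : ℤ) : ℤ := if i = 0 then -h else h + 1

theorem altProd_letter (i j : Fin 2) (h : ℕ) :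
    altProd (fun a _ => letter N n a) i j (2 * h) =
      (DihedralGroup.r (rotExp i h : ZMod (2 * n + 1)),
        Multiplicative.ofAdd (2 * h : ZMod (2 * N))) ∧
    altProd (fun a _ => letter N n a) i j (2 * h + 1) =
      (DihedralGroup.sr (reflExp i h : ZMod (2 * n + 1)),
        Multiplicative.ofAdd (2 * h + 1 : ZMod (2 * N))) := by
  induction h generalizing i j with
  | zero =>
    refine ⟨by simp [altProd, rotExp]; rfl, ?_⟩
    simp only [mul_zero, zero_add, altProd, mul_one, letter]
    congr 2
    · fin_cases i <;> simp [reflExp]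
    · simp
  | succ h ih =>
    have heven : ∀ i j, altProd (fun a _ => letter N n a) i j (2 * (h + 1)) =
        (DihedralGroup.r (rotExp i (h + 1 : ℕ) : ZMod (2 * n + 1)),
          Multiplicative.ofAdd (2 * (h + 1 : ℕ) : ZMod (2 * N))) := by
      intro i j
      rw [show 2 * (h + 1) = 2 * h + 1 + 1 by ring, altProd_succ, (ih _ _).2, letter,
        Prod.mk_mul_mk, DihedralGroup.sr_mul_sr, ← ofAdd_add]
      congr 2
      · fin_cases i
        · simp [reflExp, rotExp]
        · simp [reflExp, rotExp]; ring
      · push_cast; ring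
    refine ⟨heven i j, ?_⟩
    rw [altProd_succ, heven, letter, Prod.mk_mul_mk, DihedralGroup.sr_mul_r, ← ofAdd_add]
    congr 2
    · fin_cases i
      · simp [reflExp, rotExp]; try ring
      · simp [reflExp, rotExp]; try ring
    · push_cast; ring

/-- The word of the group with the shape of `word`. -/
def groupWord (s t : ℕ) (i : Fin 2) : WordGroup N n := word (fun a _ => letter N n a) s t i 0

theorem groupWord_even (s h : ℕ) (i : Fin 2) : groupWord N n s (2 * h) i =
    (DihedralGroup.r (rotExp i h : ZMod (2 * n + 1)),
      Multiplicative.ofAdd ((2 * s + 2 * h : ℕ) : ZMod (2 * N))) := by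
  rw [groupWord, word, letter_pow_even, (altProd_letter N n i 0 h).1, Prod.mk_mul_mk, one_mul,
    ← ofAdd_add]
  push_cast; rfl

theorem groupWord_odd (s h : ℕ) (i : Fin 2) : groupWord N n s (2 * h + 1) i =
    (DihedralGroup.sr (reflExp i h : ZMod (2 * n + 1)),
      Multiplicative.ofAdd ((2 * s + (2 * h + 1) : ℕ) : ZMod (2 * N))) := by
  rw [groupWord, word, letter_pow_even, (altProd_letter N n i 0 h).2, Prod.mk_mul_mk, one_mul,
    ← ofAdd_add]
  push_cast; rfl

variable {N n}

theorem eq_of_modEq_of_mem {s s' : ℕ} (hs : s ∈ Set.Icc 1 N) (hs' : s' ∈ Set.Icc 1 N) {t : ℕ}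
    (h : ((2 * s + t : ℕ) : ZMod (2 * N)) = ((2 * s' + t : ℕ) : ZMod (2 * N))) : s = s' := by
  obtain ⟨h1, h2⟩ := hs
  obtain ⟨h3, h4⟩ := hs'
  rw [ZMod.natCast_eq_natCast_iff] at h
  have h5 := Nat.ModEq.add_right_cancel' t h
  have h6 : s ≡ s' [MOD N] := Nat.ModEq.mul_left_cancel' (by norm_num) h5
  rw [Nat.modEq_iff_dvd] at h6
  obtain ⟨d, hd⟩ := h6
  rcases lt_trichotomy d 0 with hd0 | rfl | hd0
  · nlinarith
  · omega
  · nlinarith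

theorem int_eq_of_cast_eq {M : ℕ} {a b : ℤ} (h : (a : ZMod M) = (b : ZMod M))
    (hab : |b - a| < M) : a = b := by
  rw [ZMod.intCast_eq_intCast_iff_dvd_sub] at h
  have := Int.eq_zero_of_abs_lt_dvd h hab
  omega

/-- Two words of length at most `2n+1` in a full period agree only if they have the same length
and the same initial letter, up to the two extreme lengths. -/
theorem groupWord_inj {s s' t t' : ℕ} {i i' : Fin 2} (hs : s ∈ Set.Icc 1 N)
    (hs' : s' ∈ Set.Icc 1 N) (ht : t ≤ 2 * n + 1) (ht' : t' ≤ 2 * n + 1)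
    (h : groupWord N n s t i = groupWord N n s' t' i') :
    s = s' ∧ t = t' ∧ (i = i' ∨ t = 0 ∨ t = 2 * n + 1) := by
  have key : t = t' ∧ (i = i' ∨ t = 0 ∨ t = 2 * n + 1) := by
    rcases Nat.even_or_odd' t with ⟨a, rfl | rfl⟩ <;>
    rcases Nat.even_or_odd' t' with ⟨b, rfl | rfl⟩
    -- words of even length are rotations by `±a` with `a ≤ n`, distinct modulo `2n+1`
    · rw [groupWord_even, groupWord_even, Prod.mk.injEq, DihedralGroup.r.injEq] at h
      have h1 := int_eq_of_cast_eq h.1 (by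
        rw [abs_lt]; unfold rotExp; split_ifs <;> constructor <;> push_cast <;> omega)
      unfold rotExp at h1
      split_ifs at h1 with h2 h3 h3
      · exact ⟨by omega, Or.inl (by rw [h2, h3])⟩
      · exact ⟨by omega, by omega⟩
      · exact ⟨by omega, by omega⟩
      · exact ⟨by omega, Or.inl (by rw [Fin.eq_one_of_ne_zero _ h2, Fin.eq_one_of_ne_zero _ h3])⟩
    · rw [groupWord_even, groupWord_odd, Prod.mk.injEq] at h
      exact absurd h.1 (by simp)
    · rw [groupWord_even, groupWord_odd, Prod.mk.injEq] at h
      exact absurd h.1 (by simp)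
    -- words of odd length are reflections in the positions `-a` and `b + 1`; these agree modulo
    -- `2n+1` only for `a = b = n`
    · rw [groupWord_odd, groupWord_odd, Prod.mk.injEq, DihedralGroup.sr.injEq] at h
      have hd := h.1
      unfold reflExp at hd
      split_ifs at hd with h2 h3 h3
      · have h1 := int_eq_of_cast_eq hd (by rw [abs_lt]; constructor <;> push_cast <;> omega)
        exact ⟨by omega, Or.inl (by rw [h2, h3])⟩
      · have h1 : ((-(a : ℤ) + (2 * n + 1 : ℕ) : ℤ) : ZMod (2 * n + 1)) =
            (((b : ℤ) + 1 : ℤ) : ZMod (2 * n + 1)) := by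
          rw [← hd, Int.cast_add, Int.cast_natCast, ZMod.natCast_self, add_zero]
        have h1 := int_eq_of_cast_eq h1 (by rw [abs_lt]; constructor <;> push_cast <;> omega)
        push_cast at h1
        exact ⟨by omega, by omega⟩
      · have h1 : (((a : ℤ) + 1 : ℤ) : ZMod (2 * n + 1)) =
            ((-(b : ℤ) + (2 * n + 1 : ℕ) : ℤ) : ZMod (2 * n + 1)) := by
          rw [hd, Int.cast_add, Int.cast_natCast, ZMod.natCast_self, add_zero]
        have h1 := int_eq_of_cast_eq h1 (by rw [abs_lt]; constructor <;> push_cast <;> omega)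
        push_cast at h1
        exact ⟨by omega, by omega⟩
      · have h1 := int_eq_of_cast_eq hd (by rw [abs_lt]; constructor <;> push_cast <;> omega)
        exact ⟨by omega, Or.inl (by rw [Fin.eq_one_of_ne_zero _ h2, Fin.eq_one_of_ne_zero _ h3])⟩
  refine ⟨?_, key⟩
  obtain ⟨rfl, -⟩ := key
  have h2 : ((2 * s + t : ℕ) : ZMod (2 * N)) = ((2 * s' + t : ℕ) : ZMod (2 * N)) := by
    rcases Nat.even_or_odd' t with ⟨a, rfl | rfl⟩
    · rw [groupWord_even, groupWord_even, Prod.mk.injEq] at h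
      exact h.2
    · rw [groupWord_odd, groupWord_odd, Prod.mk.injEq] at h
      exact h.2
  exact eq_of_modEq_of_mem hs hs' h2

end WordGroup

section CoordinateFunctionals

open SuzukiAlgebra

variable {K : Type*} [Field K] {N n : ℕ} [NeZero N] {μ lam : ℤˣ}

local notation "𝔸" => SuzukiAlgebra K N (2 * n + 1) μ lam
local notation "𝕨" => word (gen K N (2 * n + 1) μ lam)

theorem of_letter_sq : (MonoidAlgebra.of K (WordGroup N n) (letter N n 0)) ^ 2 =
    (MonoidAlgebra.of K (WordGroup N n) (letter N n 1)) ^ 2 := by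
  rw [← map_pow, ← map_pow, letter_sq, letter_sq]

theorem of_letter_braid :
    (MonoidAlgebra.of K (WordGroup N n) (letter N n 0) *
      MonoidAlgebra.of K (WordGroup N n) (letter N n 1)) ^ n *
        MonoidAlgebra.of K (WordGroup N n) (letter N n 0) =
    (MonoidAlgebra.of K (WordGroup N n) (letter N n 1) *
      MonoidAlgebra.of K (WordGroup N n) (letter N n 0)) ^ n *
        MonoidAlgebra.of K (WordGroup N n) (letter N n 1) := by
  simp only [← map_mul, ← map_pow]
  congr 1
  simp only [letter, Prod.mk_mul_mk, DihedralGroup.sr_mul_sr, Prod.pow_mk, DihedralGroup.r_pow,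
    DihedralGroup.r_mul_sr, Prod.mk.injEq, DihedralGroup.sr.injEq, and_true]
  have := ZMod.natCast_self (2 * n + 1)
  push_cast at this
  simp
  linear_combination (-1) * this

theorem of_letter_pow : (MonoidAlgebra.of K (WordGroup N n) (letter N n 0)) ^ (2 * N) = 1 := by
  rw [← map_pow, letter_pow_even]
  have : (2 * (N : ZMod (2 * N))) = 0 := by exact_mod_cast ZMod.natCast_self (2 * N)
  rw [this]
  exact map_one _

variable (K N n μ lam) in
/-- The projection to the diagonal block, with values in a group algebra. -/
noncomputable def diagHom : 𝔸 →ₐ[K] MonoidAlgebra K (WordGroup N n) :=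
  lift (diagTuple (MonoidAlgebra.of K (WordGroup N n) (letter N n 0))
    (MonoidAlgebra.of K (WordGroup N n) (letter N n 1)))
    (isSuzukiTuple_diag of_letter_sq of_letter_braid of_letter_pow)

variable (n lam) in
/-- The projection to the off-diagonal block, with values in a group algebra. -/
noncomputable def offHom (ν : K) (hν : ((μ : ℤ) : K) * ν ^ (2 * N) = 1) :
    𝔸 →ₐ[K] MonoidAlgebra K (WordGroup N n) :=
  lift (offTuple (ν • MonoidAlgebra.of K (WordGroup N n) (letter N n 0))
    ((lam : ℤ) • ν • MonoidAlgebra.of K (WordGroup N n) (letter N n 1)))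
    (isSuzukiTuple_off
      (by
        rw [smul_pow, smul_pow, smul_pow, of_letter_sq, pow_two (lam : ℤ),
          IsSuzukiTuple.units_cast_mul_self, one_smul])
      (by
        simp only [smul_mul_assoc, mul_smul_comm, smul_pow]
        rw [of_letter_braid, smul_comm (ν ^ n) ((lam : ℤ) ^ n)])
      (by
        rw [smul_pow, of_letter_pow, ← Int.cast_smul_eq_zsmul K, smul_smul, hν, one_smul]))

theorem exists_map_word {B : Type*} [Ring B] [Algebra K B] (Y : Fin 2 → Fin 2 → B)
    (p : WordGroup N n →* B) {i j : Fin 2}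
    (hY : ∀ k l, k + l = i + j → ∃ κ : K, κ ≠ 0 ∧ Y k l = κ • p (letter N n k)) (s t : ℕ) :
    ∃ κ : K, κ ≠ 0 ∧ word Y s t i j = κ • p (groupWord N n s t i) := by
  have ha : ∀ t k l b, k + l = i + j → ∃ κ : K, κ ≠ 0 ∧ altProd Y k l t =
      κ • p (altProd (fun a _ => letter N n a) k b t) := by
    intro t
    induction t with
    | zero => exact fun k l b _ => ⟨1, one_ne_zero, by simp [altProd]⟩
    | succ t ih =>
      intro k l b hk
      obtain ⟨κ, h1, h2⟩ := hY k l hk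
      obtain ⟨κ', h3, h4⟩ := ih (k + 1) (l + 1) (b + 1) (by
        rw [← hk]; clear hk h1 h2; revert k l; decide)
      exact ⟨κ * κ', mul_ne_zero h1 h3, by
        rw [altProd_succ, altProd_succ, h2, h4, smul_mul_smul_comm, map_mul]⟩
  obtain ⟨κ, h1, h2⟩ := hY i j rfl
  obtain ⟨κ', h3, h4⟩ := ha t i j 0 rfl
  exact ⟨κ ^ (2 * s) * κ', mul_ne_zero (pow_ne_zero _ h1) h3, by
    rw [word, groupWord, word, h2, h4, smul_pow, smul_mul_smul_comm, map_mul, map_pow]⟩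

theorem diagHom_gen (k l : Fin 2) : diagHom K N n μ lam (gen K N (2 * n + 1) μ lam k l) =
    if k = l then MonoidAlgebra.of K (WordGroup N n) (letter N n k) else 0 := by
  rw [diagHom, lift_gen]
  fin_cases k <;> fin_cases l <;> rfl

theorem diagHom_word_self (s t : ℕ) (i : Fin 2) :
    diagHom K N n μ lam (𝕨 s t i i) = MonoidAlgebra.of K _ (groupWord N n s t i) := by
  have hg := diagHom_gen (K := K) (N := N) (n := n) (μ := μ) (lam := lam)
  have ha : ∀ t (k b : Fin 2), diagHom K N n μ lam (altProd (gen K N (2 * n + 1) μ lam) k k t) =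
      MonoidAlgebra.of K _ (altProd (fun a _ => letter N n a) k b t) := by
    intro t
    induction t with
    | zero => intro k b; simp only [altProd, map_one]
    | succ t ih =>
      intro k b
      rw [altProd_succ, altProd_succ, map_mul, ih (k + 1) (b + 1), hg, if_pos rfl, map_mul]
  rw [word, groupWord, word, map_mul, map_pow, hg, if_pos rfl, ha t i 0, map_mul, map_pow]

theorem diagHom_word_of_ne {s : ℕ} (hs : s ≠ 0) (t : ℕ) {i j : Fin 2} (h : i ≠ j) :
    diagHom K N n μ lam (𝕨 s t i j) = 0 := by
  rw [word, map_mul, map_pow, diagHom_gen, if_neg h, zero_pow (by omega), zero_mul]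

theorem offHom_gen (ν : K) (hν : ((μ : ℤ) : K) * ν ^ (2 * N) = 1) (k l : Fin 2) :
    offHom n lam ν hν (gen K N (2 * n + 1) μ lam k l) =
      if k = l then 0 else (if k = 0 then ν else ((lam : ℤ) : K) * ν) •
        MonoidAlgebra.of K (WordGroup N n) (letter N n k) := by
  rw [offHom, lift_gen]
  fin_cases k <;> fin_cases l
  · rfl
  · rfl
  · change (lam : ℤ) • ν • MonoidAlgebra.of K (WordGroup N n) (letter N n 1) =
      (((lam : ℤ) : K) * ν) • MonoidAlgebra.of K (WordGroup N n) (letter N n 1)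
    rw [mul_smul, Int.cast_smul_eq_zsmul]
  · rfl

theorem offHom_word_self (ν : K) (hν : ((μ : ℤ) : K) * ν ^ (2 * N) = 1) {s : ℕ} (hs : s ≠ 0)
    (t : ℕ) (i : Fin 2) : offHom n lam ν hν (𝕨 s t i i) = 0 := by
  rw [word, map_mul, map_pow, offHom_gen, if_pos rfl, zero_pow (by omega), zero_mul]

theorem ne_zero_of_mul_pow_eq_one {ν : K} (hν : ((μ : ℤ) : K) * ν ^ (2 * N) = 1) : ν ≠ 0 := by
  rintro rfl
  have := NeZero.pos N
  rw [zero_pow (by omega), mul_zero] at hν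
  exact zero_ne_one hν

theorem units_cast_ne_zero (u : ℤˣ) : ((u : ℤ) : K) ≠ 0 := by
  rcases Int.units_eq_one_or u with rfl | rfl <;> simp

theorem exists_offHom_word (ν : K) (hν : ((μ : ℤ) : K) * ν ^ (2 * N) = 1) (s t : ℕ) {i j : Fin 2}
    (h : i ≠ j) : ∃ κ : K, κ ≠ 0 ∧ offHom n lam ν hν (𝕨 s t i j) =
      κ • MonoidAlgebra.of K _ (groupWord N n s t i) := by
  have hw : offHom n lam ν hν (𝕨 s t i j) =
      word (fun k l => offHom n lam ν hν (gen K N (2 * n + 1) μ lam k l)) s t i j := by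
    rw [word, word, map_mul, map_pow, map_altProd]
  rw [hw]
  refine exists_map_word _ (MonoidAlgebra.of K (WordGroup N n)) (fun k l hk => ?_) s t
  have hkl : k ≠ l := by clear hw; revert i j k l; decide
  refine ⟨if k = 0 then ν else ((lam : ℤ) : K) * ν, ?_, by rw [offHom_gen, if_neg hkl]⟩
  have h0 := ne_zero_of_mul_pow_eq_one hν
  split_ifs
  · exact h0
  · exact mul_ne_zero (units_cast_ne_zero lam) h0

/-- The coefficient of a group element in an element of the group algebra. -/
noncomputable def groupCoeff (K : Type*) [Field K] {G : Type*} [Group G] (g : G) :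
    Module.Dual K (MonoidAlgebra K G) :=
  Finsupp.lapply g ∘ₗ (MonoidAlgebra.coeffLinearEquiv K).toLinearMap

theorem groupCoeff_of {G : Type*} [Group G] [DecidableEq G] (g g' : G) :
    groupCoeff K g (MonoidAlgebra.of K G g') = if g' = g then 1 else 0 := by
  simp only [groupCoeff, LinearMap.comp_apply, LinearEquiv.coe_coe, Finsupp.lapply_apply]
  exact Finsupp.single_apply

/-- Coordinate functionals: the words in a full period of length at most `2n+1` are linearly
independent up to the coincidences in the two extreme lengths. -/
theorem exists_coordinate {ν : K} (hν : ((μ : ℤ) : K) * ν ^ (2 * N) = 1) {s t : ℕ}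
    (hs : s ∈ Set.Icc 1 N) (ht : t ≤ 2 * n + 1) (i j : Fin 2) :
    ∃ φ : Module.Dual K 𝔸, φ (𝕨 s t i j) = 1 ∧
      ∀ s' ∈ Set.Icc 1 N, ∀ t' ≤ 2 * n + 1, ∀ i' j' : Fin 2,
        (s' ≠ s ∨ t' ≠ t ∨ i' + j' ≠ i + j ∨ (i' ≠ i ∧ t ≠ 0 ∧ t ≠ 2 * n + 1)) →
        φ (𝕨 s' t' i' j') = 0 := by
  classical
  have hne : ∀ s' ∈ Set.Icc 1 N, ∀ t' ≤ 2 * n + 1, ∀ i' : Fin 2,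
      (s' ≠ s ∨ t' ≠ t ∨ (i' ≠ i ∧ t ≠ 0 ∧ t ≠ 2 * n + 1)) →
      groupWord N n s' t' i' ≠ groupWord N n s t i := by
    intro s' hs' t' ht' i' h he
    obtain ⟨h1, h2, h3⟩ := groupWord_inj hs' hs ht' ht he
    subst h1 h2
    rcases h with h | h | ⟨h, h4, h5⟩
    · exact h rfl
    · exact h rfl
    · rcases h3 with h3 | h3 | h3
      · exact h h3
      · exact h4 h3
      · exact h5 h3
  by_cases hij : i = j
  · subst hij
    refine ⟨groupCoeff K (groupWord N n s t i) ∘ₗ (diagHom K N n μ lam).toLinearMap, ?_, ?_⟩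
    · rw [LinearMap.comp_apply, AlgHom.toLinearMap_apply, diagHom_word_self, groupCoeff_of,
        if_pos rfl]
    · intro s' hs' t' ht' i' j' h
      rw [LinearMap.comp_apply, AlgHom.toLinearMap_apply]
      by_cases hij' : i' = j'
      · subst hij'
        rw [diagHom_word_self, groupCoeff_of, if_neg]
        refine hne s' hs' t' ht' i' ?_
        rcases h with h | h | h | h
        · exact Or.inl h
        · exact Or.inr (Or.inl h)
        · exact absurd (show i' + i' = i + i by generalize i = a; generalize i' = b; revert a b; decide) h
        · exact Or.inr (Or.inr h)
      · rw [diagHom_word_of_ne (by have := hs'.1; omega) _ hij', map_zero]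
  · obtain ⟨κ, hκ, hw⟩ := exists_offHom_word (n := n) (lam := lam) ν hν s t hij
    refine ⟨κ⁻¹ • (groupCoeff K (groupWord N n s t i) ∘ₗ (offHom n lam ν hν).toLinearMap),
      ?_, ?_⟩
    · rw [LinearMap.smul_apply, LinearMap.comp_apply, AlgHom.toLinearMap_apply, hw, map_smul,
        groupCoeff_of, if_pos rfl, smul_eq_mul, smul_eq_mul, mul_one, inv_mul_cancel₀ hκ]
    · intro s' hs' t' ht' i' j' h
      rw [LinearMap.smul_apply, LinearMap.comp_apply, AlgHom.toLinearMap_apply]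
      by_cases hij' : i' = j'
      · subst hij'
        rw [offHom_word_self _ _ (by have := hs'.1; omega), map_zero, smul_zero]
      · obtain ⟨κ', -, hw'⟩ := exists_offHom_word (n := n) (lam := lam) ν hν s' t' hij'
        rw [hw', map_smul, groupCoeff_of, if_neg, smul_zero, smul_zero]
        refine hne s' hs' t' ht' i' ?_
        rcases h with h | h | h | h
        · exact Or.inl h
        · exact Or.inr (Or.inl h)
        · exact absurd (show i' + j' = i + j by clear h hw hw' hne; revert i i' j j'; decide) h
        · exact Or.inr (Or.inr h)

end CoordinateFunctionals

/-! ### Yetter-Drinfeld modules given by structure constants -/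

section MatrixModels

universe v'

open SuzukiAlgebra Submodule

variable {K : Type u} [Field K] {N m : ℕ} [NeZero N] [NeZero m] {μ lam : ℤˣ}

local notation "𝔸" => SuzukiAlgebra K N m μ lam
local notation "𝕩" => gen K N m μ lam

namespace YDModule

variable {ι : Type*} [Fintype ι] {M : YDModule.{u, u, v} K (SuzukiAlgebra K N m μ lam)}
  {Y : YDModule.{u, u, v'} K (SuzukiAlgebra K N m μ lam)}
  {X : Fin 2 → Fin 2 → Matrix ι ι K} {C : Matrix ι ι (SuzukiAlgebra K N m μ lam)}

/-- The vectors `q` of a Yetter-Drinfeld module are permuted by the generators through the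
matrices `X i j`, and by the coaction through the coefficient matrix `C`. -/
structure IsModel (M : YDModule.{u, u, v} K (SuzukiAlgebra K N m μ lam)) (q : ι → M.carrier)
    (X : Fin 2 → Fin 2 → Matrix ι ι K) (C : Matrix ι ι 𝔸) : Prop where
  act_gen : ∀ i j r, M.act (𝕩 i j) (q r) = ∑ a, X i j a r • q a
  coact_eq : ∀ r, M.coact (q r) = ∑ a, (C a r ⊗ₜ[K] q a : 𝔸 ⊗[K] M.carrier)

theorem IsModel.coeffOp_eq {q : ι → M.carrier} (h : M.IsModel q X C) (φ : Module.Dual K 𝔸)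
    (r : ι) : M.coeffOp φ (q r) = ∑ a, φ (C a r) • q a := by
  rw [coeffOp_apply, h.coact_eq]
  simp

theorem IsModel.isSubYD {q : ι → M.carrier} (h : M.IsModel q X C) :
    M.IsSubYD (span K (Set.range q)) := by
  rw [isSubYD_iff]
  constructor
  · intro a
    induction a using gen_induction with
    | hgen i j =>
      intro x hx
      induction hx using span_induction with
      | mem x hx =>
        obtain ⟨r, rfl⟩ := hx
        rw [h.act_gen]
        exact sum_mem fun a _ => smul_mem _ _ (subset_span ⟨a, rfl⟩)
      | zero => simp
      | add x y _ _ hx hy => rw [map_add]; exact add_mem hx hy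
      | smul c x _ hx => rw [map_smul]; exact smul_mem _ _ hx
    | halg c =>
      intro x hx
      rw [AlgHom.commutes, Module.algebraMap_end_apply]
      exact smul_mem _ _ hx
    | hadd a b ha hb =>
      intro x hx
      rw [map_add]
      exact add_mem (ha x hx) (hb x hx)
    | hmul a b ha hb =>
      intro x hx
      rw [map_mul]
      exact ha _ (hb x hx)
  · intro φ x hx
    induction hx using span_induction with
    | mem x hx =>
      obtain ⟨r, rfl⟩ := hx
      rw [h.coeffOp_eq]
      exact sum_mem fun a _ => smul_mem _ _ (subset_span ⟨a, rfl⟩)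
    | zero => simp
    | add x y _ _ hx hy => rw [map_add]; exact add_mem hx hy
    | smul c x _ hx => rw [map_smul]; exact smul_mem _ _ hx

/-- The module has a basis with the structure constants `X` and `C`. -/
def HasModel (M : YDModule.{u, u, v} K 𝔸) (X : Fin 2 → Fin 2 → Matrix ι ι K)
    (C : Matrix ι ι 𝔸) : Prop :=
  ∃ b : Module.Basis ι K M.carrier, M.IsModel b X C

/-- Vectors with the structure constants of `M` define a map of Yetter-Drinfeld modules. -/
theorem IsModel.constr_act {b : Module.Basis ι K M.carrier} (hb : M.IsModel b X C)
    {q : ι → Y.carrier} (hq : Y.IsModel q X C) (a : 𝔸) (x : M.carrier) :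
    b.constr K q (M.act a x) = Y.act a (b.constr K q x) := by
  induction a using gen_induction generalizing x with
  | hgen i j =>
    have : b.constr K q ∘ₗ M.act (𝕩 i j) = Y.act (𝕩 i j) ∘ₗ b.constr K q := by
      refine b.ext fun r => ?_
      simp only [LinearMap.comp_apply, b.constr_basis, hb.act_gen, hq.act_gen, map_sum, map_smul]
    exact congrArg (fun g => g x) this
  | halg c => simp only [AlgHom.commutes, Module.algebraMap_end_apply, map_smul]
  | hadd a a' h h' => simp only [map_add, LinearMap.add_apply, h, h']
  | hmul a a' h h' => simp only [map_mul, Module.End.mul_apply, h, h']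

theorem IsModel.constr_coact {b : Module.Basis ι K M.carrier} (hb : M.IsModel b X C)
    {q : ι → Y.carrier} (hq : Y.IsModel q X C) (x : M.carrier) :
    Y.coact (b.constr K q x) = (b.constr K q).lTensor 𝔸 (M.coact x) := by
  have : Y.coact ∘ₗ b.constr K q = (b.constr K q).lTensor 𝔸 ∘ₗ M.coact := by
    refine b.ext fun r => ?_
    simp only [LinearMap.comp_apply, b.constr_basis, hb.coact_eq, hq.coact_eq, map_sum,
      LinearMap.lTensor_tmul]
  exact congrArg (fun g => g x) this

theorem HasModel.isomorphicToSub (hM : M.HasModel X C) {V : Type v'} [AddCommGroup V] [Module K V]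
    {ρ : 𝔸 →ₐ[K] Module.End K V} {q : ι → V ⊗[K] 𝔸} (hq : (boxModule ρ).IsModel q X C)
    (hli : LinearIndependent K q) : M.IsomorphicToSub ρ (span K (Set.range q)) := by
  obtain ⟨b, hb⟩ := hM
  refine ⟨b.constr K q, ?_, b.constr_range K, fun a x => hb.constr_act hq a x,
    fun x => hb.constr_coact hq x⟩
  rw [injective_iff_map_eq_zero]
  intro x hx
  rw [Module.Basis.constr_apply_fintype] at hx
  have h0 := Fintype.linearIndependent_iff.mp hli _ hx
  exact b.equivFun.map_eq_zero_iff.mp (funext h0)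

/-- Linearly independent vectors with structure constants `X` and `C` span a module. -/
theorem IsModel.exists_hasModel {q : ι → M.carrier} (h : M.IsModel q X C)
    (hli : LinearIndependent K q) : ∃ M' : YDModule.{u, u, v} K 𝔸, M'.HasModel X C := by
  have hc : ∀ a, (span K (Set.range q)).subtype (Module.Basis.span hli a) = q a := fun a => by
    rw [Submodule.subtype_apply, Module.Basis.span_apply]
  refine ⟨M.sub _ h.isSubYD, Module.Basis.span hli, ⟨fun i j r => ?_, fun r => ?_⟩⟩
  · refine (span K (Set.range q)).injective_subtype ?_
    refine (subtype_act M _ h.isSubYD (𝕩 i j) (Module.Basis.span hli r)).trans ?_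
    refine (congrArg (M.act (𝕩 i j)) (hc r)).trans ((h.act_gen i j r).trans ?_)
    refine Eq.trans ?_ (map_sum (span K (Set.range q)).subtype _ _).symm
    exact Finset.sum_congr rfl fun a _ => congrArg (X i j a r • ·) (hc a).symm
  · refine lTensor_subtype_injective (span K (Set.range q)) ?_
    refine (subtype_coact M _ h.isSubYD (Module.Basis.span hli r)).trans ?_
    refine (congrArg M.coact (hc r)).trans ((h.coact_eq r).trans ?_)
    refine Eq.trans ?_ (map_sum ((span K (Set.range q)).subtype.lTensor 𝔸) _ _).symm
    exact Finset.sum_congr rfl fun a _ => congrArg (C a r ⊗ₜ[K] ·) (hc a).symm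

theorem HasModel.finrank_eq (hM : M.HasModel X C) :
    Module.finrank K M.carrier = Fintype.card ι := by
  obtain ⟨b, -⟩ := hM
  exact Module.finrank_eq_card_basis b

/-- A module is simple if the coordinate projections of a basis preserve all submodules and
every basis vector generates all the others. -/
theorem isSimpleYD_of_basis [Nonempty ι] [DecidableEq ι] (b : Module.Basis ι K M.carrier)
    (hproj : ∀ r, ∃ T : Module.End K M.carrier, (∀ W, M.IsSubYD W → ∀ w ∈ W, T w ∈ W) ∧
      ∀ s, T (b s) = if s = r then b r else 0)
    (htrans : ∀ W, M.IsSubYD W → ∀ r r', b r ∈ W → b r' ∈ W) : M.IsSimpleYD := by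
  refine ⟨b.repr.toEquiv.nontrivial, fun W hW => ?_⟩
  rw [or_iff_not_imp_left]
  intro hne
  obtain ⟨w, hw, hw0⟩ := W.ne_bot_iff.mp hne
  obtain ⟨r, hr⟩ : ∃ r, b.repr w r ≠ 0 := by
    by_contra hcon
    push Not at hcon
    exact hw0 (b.repr.map_eq_zero_iff.mp (Finsupp.ext hcon))
  obtain ⟨T, hT, hTb⟩ := hproj r
  have hTw : T w = b.repr w r • b r := by
    conv_lhs => rw [← b.sum_repr w, map_sum]
    rw [Finset.sum_eq_single r]
    · rw [map_smul, hTb, if_pos rfl]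
    · intro s _ hs
      rw [map_smul, hTb, if_neg hs, smul_zero]
    · intro h
      exact absurd (Finset.mem_univ r) h
  have hbr : b r ∈ W := (W.smul_mem_iff hr).mp (hTw ▸ hT W hW w hw)
  rw [eq_top_iff, ← b.span_eq, span_le]
  rintro _ ⟨r', rfl⟩
  exact htrans W hW r r' hbr

/-- Vectors separated by coordinate maps are linearly independent. -/
theorem _root_.linearIndependent_of_separating {V V' : Type*} [AddCommGroup V] [Module K V]
    [AddCommGroup V'] [Module K V'] [DecidableEq ι] {q : ι → V} (z : ι → V') (hz : ∀ r, z r ≠ 0)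
    (h : ∀ r, ∃ F : V →ₗ[K] V', ∀ s, F (q s) = if s = r then z r else 0) :
    LinearIndependent K q := by
  rw [Fintype.linearIndependent_iff]
  intro g hg r
  obtain ⟨F, hF⟩ := h r
  have := congrArg F hg
  rw [map_sum, map_zero, Finset.sum_eq_single r, map_smul, hF, if_pos rfl] at this
  · exact (smul_eq_zero.mp this).resolve_right (hz r)
  · intro s _ hs
    rw [map_smul, hF, if_neg hs, smul_zero]
  · intro h
    exact absurd (Finset.mem_univ r) h

section Traces

variable [DecidableEq ι] {ι' : Type*} [Fintype ι'] [DecidableEq ι']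
  {X' : Fin 2 → Fin 2 → Matrix ι' ι' K} 
  {C' : Matrix ι' ι' (SuzukiAlgebra K N m μ lam)}

theorem IsModel.toMatrix_act {b : Module.Basis ι K M.carrier} (hb : M.IsModel b X C)
    (i j : Fin 2) : LinearMap.toMatrix b b (M.act (𝕩 i j)) = X i j := by
  ext a r
  rw [LinearMap.toMatrix_apply, hb.act_gen]
  simp [Finsupp.single_apply]

theorem IsModel.toMatrix_coeffOp {b : Module.Basis ι K M.carrier} (hb : M.IsModel b X C)
    (φ : Module.Dual K 𝔸) : LinearMap.toMatrix b b (M.coeffOp φ) = C.map φ := by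
  ext a r
  rw [LinearMap.toMatrix_apply, hb.coeffOp_eq]
  simp [Finsupp.single_apply]

theorem HasModel.trace_coeff (hM : M.HasModel X C) (hY : Y.HasModel X' C') (h : M.Isomorphic Y)
    (φ : Module.Dual K 𝔸) : (C.map φ).trace = (C'.map φ).trace := by
  obtain ⟨b, hb⟩ := hM
  obtain ⟨b', hb'⟩ := hY
  have := h.trace_eq φ 1
  rw [map_one, map_one, mul_one, mul_one, LinearMap.trace_eq_matrix_trace K b,
    LinearMap.trace_eq_matrix_trace K b', hb.toMatrix_coeffOp, hb'.toMatrix_coeffOp] at this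
  exact this

theorem HasModel.trace_coeff_mul (hM : M.HasModel X C) (hY : Y.HasModel X' C')
    (h : M.Isomorphic Y) (φ : Module.Dual K 𝔸) (i j : Fin 2) :
    (C.map φ * X i j).trace = (C'.map φ * X' i j).trace := by
  obtain ⟨b, hb⟩ := hM
  obtain ⟨b', hb'⟩ := hY
  have := h.trace_eq φ (𝕩 i j)
  rw [LinearMap.trace_eq_matrix_trace K b, LinearMap.trace_eq_matrix_trace K b',
    LinearMap.toMatrix_mul, LinearMap.toMatrix_mul, hb.toMatrix_coeffOp, hb'.toMatrix_coeffOp,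
    hb.toMatrix_act, hb'.toMatrix_act] at this
  exact this

theorem HasModel.trace_mul (hM : M.HasModel X C) (hY : Y.HasModel X' C')
    (h : M.Isomorphic Y) (i j k l : Fin 2) :
    (X i j * X k l).trace = (X' i j * X' k l).trace := by
  obtain ⟨b, hb⟩ := hM
  obtain ⟨b', hb'⟩ := hY
  have := h.trace_eq Coalgebra.counit (𝕩 i j * 𝕩 k l)
  rw [coeffOp_counit, coeffOp_counit, one_mul, one_mul, map_mul M.act, map_mul Y.act,
    LinearMap.trace_eq_matrix_trace K b, LinearMap.trace_eq_matrix_trace K b',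
    LinearMap.toMatrix_mul, LinearMap.toMatrix_mul,
    hb.toMatrix_act, hb'.toMatrix_act, hb.toMatrix_act, hb'.toMatrix_act] at this
  exact this

theorem HasModel.trace_gen (hM : M.HasModel X C) (hY : Y.HasModel X' C')
    (h : M.Isomorphic Y) (i j : Fin 2) : (X i j).trace = (X' i j).trace := by
  obtain ⟨b, hb⟩ := hM
  obtain ⟨b', hb'⟩ := hY
  have := h.trace_eq Coalgebra.counit (𝕩 i j)
  rw [coeffOp_counit, coeffOp_counit, one_mul, one_mul,
    LinearMap.trace_eq_matrix_trace K b, LinearMap.trace_eq_matrix_trace K b',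
    hb.toMatrix_act, hb'.toMatrix_act] at this
  exact this

end Traces

end YDModule

end MatrixModels

/-! ### Modules spanned by one or two vectors -/

section PairModels

universe v'

open SuzukiAlgebra Submodule

variable {K : Type u} [Field K]

section Action

variable {N m : ℕ} [NeZero N] [NeZero m] {μ lam : ℤˣ} {V : Type v} [AddCommGroup V] [Module K V]

local notation "𝔸" => SuzukiAlgebra K N m μ lam
local notation "𝕩" => gen K N m μ lam
local notation "𝕨" => word (gen K N m μ lam)

/-- The action on `y ⊠ W_{kl}` when `V` is supported on the block given by the parity of the length
of the word. -/
theorem boxAct_word {ρ : 𝔸 →ₐ[K] Module.End K V} {t : ℕ}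
    (hρ : ∀ i j, i + j ≠ par t → ρ (𝕩 i j) = 0) {s : ℕ} (hs : s ≠ 0) (i j k l : Fin 2) (y : V) :
    boxAct ρ (𝕩 i j) (y ⊗ₜ 𝕨 s t k l) = if j = i + par t then
      ρ (𝕩 (i + (k + l)) (i + (k + l) + par t)) y ⊗ₜ[K] 𝕨 s t (k + 1) (l + 1) else 0 := by
  have hX := isSuzukiTuple_gen (K := K) (N := N) (m := m) (μ := μ) (lam := lam)
  have hN := NeZero.pos N
  have hF : ∀ i j b c e : Fin 2, b + c = e → ¬ j = i + e → i + e + (b + e) ≠ j + c := by decide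
  have hF' : ∀ i b : Fin 2, b = i + (i + b) := by decide
  have hF'' : ∀ b e : Fin 2, b + (b + e) = e := by decide
  have key : ∀ b c, ρ (𝕩 b c) y ⊗ₜ[K] (𝕩 i b * 𝕨 s t k l * 𝕩 j c ^ (4 * N - 1)) =
      if b = i + (k + l) ∧ c = i + (k + l) + par t then (if j = i + par t then
      ρ (𝕩 (i + (k + l)) (i + (k + l) + par t)) y ⊗ₜ[K] 𝕨 s t (k + 1) (l + 1) else 0) else 0 := by
    intro b c
    by_cases hbc : b + c = par t
    · by_cases hb : b = i + (k + l)
      · have hc : c = i + (k + l) + par t := by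
          rw [← hbc, ← hb]; clear hbc hb; revert b c; decide
        have hib : i + b = k + l := by rw [hb]; clear hb hc; revert i k l; decide
        rw [if_pos ⟨hb, hc⟩]
        by_cases hj : j = i + par t
        · rw [if_pos hj, ← hb, show 𝕩 j c = 𝕩 (i + par t) (b + par t) by rw [hj, hc, hb],
            hX.gen_mul_word_mul_antipode hib hs, ← hbc]
          congr 4
          clear hc hb hib hbc; revert b c; decide
        · rw [if_neg hj, hX.gen_mul_word hib, mul_assoc, hX.mul_pow_eq_zero ?_ (by omega),
            mul_zero, TensorProduct.tmul_zero]
          exact hF i j b c _ hbc hj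
      · have hib : i + b ≠ k + l := by
          rintro h; apply hb; rw [← h]; exact hF' i b
        rw [if_neg (fun h => hb h.1), hX.gen_mul_word_eq_zero hib hs, zero_mul,
          TensorProduct.tmul_zero]
    · rw [hρ _ _ hbc, LinearMap.zero_apply, TensorProduct.zero_tmul, if_neg]
      rintro ⟨h1, h2⟩
      apply hbc
      rw [h2, ← h1, hF'']
  rw [boxAct_gen]
  simp only [key]
  rw [Finset.sum_eq_single (i + (k + l)), Finset.sum_eq_single (i + (k + l) + par t)]
  · rw [if_pos ⟨rfl, rfl⟩]
  · intro c _ hc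
    rw [if_neg (fun h => hc h.2)]
  · intro h; exact absurd (Finset.mem_univ _) h
  · intro b _ hb
    exact Finset.sum_eq_zero fun c _ => if_neg fun h => hb h.1
  · intro h; exact absurd (Finset.mem_univ _) h

variable (N m μ lam) in
/-- The vectors `∑ₐ y_a ⊠ W_{ia}`. -/
noncomputable def pairVec (s t : ℕ) (y : Fin 2 → V) (i : Fin 2) : V ⊗[K] 𝔸 :=
  ∑ a, y a ⊗ₜ 𝕨 s t i a

/-- The matrices of the generators on `∑ₐ y_a ⊠ W_{ia}`: in the block `c`, they exchange the two
vectors, up to scalars. -/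
def pairX (c : Fin 2) (B : Fin 2 → K) (i j : Fin 2) : Matrix (Fin 2) (Fin 2) K :=
  Matrix.of fun a r => if j = i + c ∧ a = r + 1 then B (i + r) else 0

variable (K N m μ lam) in
/-- The coefficient matrix of the vectors `∑ₐ y_a ⊠ W_{ia}`. -/
def pairC (s t : ℕ) : Matrix (Fin 2) (Fin 2) 𝔸 := Matrix.of fun a r => 𝕨 s t r a

theorem pairX_apply (c : Fin 2) (B : Fin 2 → K) (i j a r : Fin 2) :
    pairX c B i j a r = if j = i + c ∧ a = r + 1 then B (i + r) else 0 := rfl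

theorem pairC_apply (s t : ℕ) (a r : Fin 2) : pairC K N m μ lam s t a r = 𝕨 s t r a := rfl

theorem boxCoact_word {s : ℕ} (hs : s ≠ 0) (t : ℕ) (i j : Fin 2) (y : V) :
    boxCoact K 𝔸 V (y ⊗ₜ 𝕨 s t i j) = ∑ a, 𝕨 s t i a ⊗ₜ[K] (y ⊗ₜ[K] 𝕨 s t a j) := by
  rw [boxCoact_tmul, comul_word K N m μ lam hs, map_sum]
  simp only [boxInsert_tmul]

theorem pairVec_isModel {ρ : 𝔸 →ₐ[K] Module.End K V} {s t : ℕ} (hs : s ≠ 0)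
    (hρ : ∀ i j, i + j ≠ par t → ρ (𝕩 i j) = 0) {y : Fin 2 → V} {B : Fin 2 → K}
    (hB : ∀ j l, ρ (𝕩 (j + l) (j + l + par t)) (y l) = B j • y (l + 1)) :
    (boxModule ρ).IsModel (pairVec N m μ lam s t y) (pairX (par t) B) (pairC K N m μ lam s t) := by
  constructor
  · intro i j r
    change boxAct ρ (𝕩 i j) (pairVec N m μ lam s t y r) =
      ∑ a, pairX (par t) B i j a r • pairVec N m μ lam s t y a
    have h1 : ∀ l, boxAct ρ (𝕩 i j) (y l ⊗ₜ 𝕨 s t r l) = if j = i + par t then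
        B (i + r) • (y (l + 1) ⊗ₜ[K] 𝕨 s t (r + 1) (l + 1)) else 0 := by
      intro l
      rw [boxAct_word hρ hs, ← add_assoc, hB, TensorProduct.smul_tmul']
    rw [pairVec, map_sum]
    simp only [h1]
    by_cases hj : j = i + par t
    · refine Eq.trans ?_ (Finset.sum_eq_single (r + 1) (fun a _ ha => by
        rw [pairX_apply, if_neg (fun h => ha h.2), zero_smul])
        (fun h => absurd (Finset.mem_univ _) h)).symm
      rw [pairX_apply, if_pos ⟨hj, rfl⟩, pairVec, Finset.smul_sum]
      simp only [if_pos hj]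
      exact Equiv.sum_comp (Equiv.addRight (1 : Fin 2))
        (fun l => B (i + r) • (y l ⊗ₜ[K] 𝕨 s t (r + 1) l))
    · simp only [if_neg hj, pairX_apply, hj, false_and, if_false, zero_smul,
        Finset.sum_const_zero]
  · intro r
    change boxCoact K 𝔸 V (pairVec N m μ lam s t y r) = _
    rw [pairVec, map_sum]
    simp only [boxCoact_word hs, pairC_apply]
    rw [Finset.sum_comm]
    refine Finset.sum_congr rfl fun a _ => ?_
    rw [← TensorProduct.tmul_sum]
    rfl

/-- The matrices of the generators on a vector that spans a module over the block `c`. -/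
def lineX (c : Fin 2) (a : Fin 2 → K) (i j : Fin 2) : Matrix (Fin 1) (Fin 1) K :=
  Matrix.of fun _ _ => if j = i + c then a i else 0

variable (N m μ lam) in
/-- The coefficient of the vector `v ⊠ (W_{00} + κ W_{01})`. -/
def lineC (s t : ℕ) (κ : K) : Matrix (Fin 1) (Fin 1) 𝔸 :=
  Matrix.of fun _ _ => 𝕨 s t 0 0 + κ • 𝕨 s t 0 1

theorem line_isModel {M : YDModule.{u, u, v} K 𝔸} {q : Fin 2 → M.carrier} {s t : ℕ}
    {c : Fin 2} {B : Fin 2 → K} (h : M.IsModel q (pairX c B) (pairC K N m μ lam s t)) {κ : K}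
    (hq : q 1 = κ • q 0) : M.IsModel (fun _ : Fin 1 => q 0) (lineX c fun i => B i * κ)
      (lineC N m μ lam s t κ) := by
  constructor
  · intro i j r
    rw [h.act_gen]
    simp only [pairX_apply, lineX, Matrix.of_apply, Fin.sum_univ_two, Finset.univ_unique,
      Finset.sum_const, Finset.card_singleton, one_smul, hq]
    by_cases hj : j = i + c <;> simp [hj, mul_smul]
  · intro r
    rw [h.coact_eq]
    simp only [pairC_apply, lineC, Matrix.of_apply, Fin.sum_univ_two, Finset.univ_unique,
      Finset.sum_const, Finset.card_singleton, one_smul, hq, TensorProduct.add_tmul,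
      TensorProduct.tmul_smul, TensorProduct.smul_tmul']

end Action

section Invariants

variable {N n : ℕ} [NeZero N] {μ lam : ℤˣ}

local notation "𝔸" => SuzukiAlgebra K N (2 * n + 1) μ lam
local notation "𝕩" => gen K N (2 * n + 1) μ lam
local notation "𝕨" => word (gen K N (2 * n + 1) μ lam)

/-- In the extreme lengths `0` and `2n+1` the words `W_{ij}` and `W_{i+1,j+1}` agree up to sign. -/
theorem word_extreme {s t : ℕ} (ht : t = 0 ∨ t = 2 * n + 1) (i j : Fin 2) :
    𝕨 s t (i + 1) (j + 1) =
      ((if i = j then 1 else (blockSign lam (par t) : ℤ) : ℤ) : K) • 𝕨 s t i j := by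
  have hX := isSuzukiTuple_gen (K := K) (N := N) (m := 2 * n + 1) (μ := μ) (lam := lam)
  rcases ht with rfl | rfl
  · rw [hX.word_zero_succ]
    simp [blockSign, par]
  · rw [hX.word_top_succ, par_odd, Int.cast_smul_eq_zsmul]
    congr 1
    have : ∀ i j : Fin 2, i + j = if i = j then 0 else 1 := by decide
    rw [this]
    split_ifs <;> simp [blockSign]

theorem pairVec_linearIndependent {V : Type v} [AddCommGroup V] [Module K V] {ν : K}
    (hν : ((μ : ℤ) : K) * ν ^ (2 * N) = 1) {s t : ℕ} (hs : s ∈ Set.Icc 1 N)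
    (ht : t ≤ 2 * n + 1) {y : Fin 2 → V} (hy : ∀ l, y l ≠ 0)
    (hli : t = 0 ∨ t = 2 * n + 1 → LinearIndependent K y) :
    LinearIndependent K (pairVec (K := K) N (2 * n + 1) μ lam s t y) := by
  have hF : ∀ r j s : Fin 2, s ≠ r → s + j ≠ r + r ∨ s ≠ r := by decide
  by_cases h : t = 0 ∨ t = 2 * n + 1
  · obtain ⟨φ, h1, h2⟩ := exists_coordinate (n := n) (lam := lam) hν hs ht 0 0
    let F : V ⊗[K] 𝔸 →ₗ[K] V := (TensorProduct.rid K V).toLinearMap ∘ₗ φ.lTensor V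
    refine LinearIndependent.of_comp F ?_
    convert hli h using 1
    have h11 : φ (𝕨 s t 1 1) = 1 := by
      have := word_extreme (K := K) (N := N) (μ := μ) (lam := lam) (s := s) h 0 0
      rw [zero_add, if_pos rfl, Int.cast_one, one_smul] at this
      rw [this, h1]
    have h01 := h2 s hs t ht 0 1 (Or.inr (Or.inr (Or.inl (by decide))))
    have h10 := h2 s hs t ht 1 0 (Or.inr (Or.inr (Or.inl (by decide))))
    funext i
    fin_cases i
    · simp [F, pairVec, h1, h01]
    · simp [F, pairVec, h10, h11]
  · refine linearIndependent_of_separating y hy fun r => ?_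
    obtain ⟨φ, h1, h2⟩ := exists_coordinate (n := n) (lam := lam) hν hs ht r r
    refine ⟨(TensorProduct.rid K V).toLinearMap ∘ₗ φ.lTensor V, fun i => ?_⟩
    have h3 : ∀ l, φ (𝕨 s t i l) = if i = r ∧ l = r then 1 else 0 := by
      intro l
      split_ifs with hil
      · rw [hil.1, hil.2, h1]
      · refine h2 s hs t ht i l ?_
        by_cases hi : i = r
        · refine Or.inr (Or.inr (Or.inl ?_))
          have : l ≠ r := fun hl => hil ⟨hi, hl⟩
          rw [hi]; simpa using this
        · exact Or.inr (Or.inr (Or.inr ⟨hi, fun h0 => h (Or.inl h0), fun h0 => h (Or.inr h0)⟩))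
    simp only [pairVec, LinearMap.comp_apply, map_sum, LinearMap.lTensor_tmul,
      LinearEquiv.coe_coe, TensorProduct.rid_tmul, h3]
    by_cases hi : i = r
    · simp [hi]
    · simp [hi]

namespace YDModule

variable {M : YDModule.{u, u, v} K (SuzukiAlgebra K N (2 * n + 1) μ lam)}
  {Y : YDModule.{u, u, v'} K (SuzukiAlgebra K N (2 * n + 1) μ lam)}

/-- For words of intermediate length the coefficient functionals separate the two basis vectors.
For words of extreme length this is done by the eigenvalues of a product of two generators. -/
theorem isSimpleYD_of_pair {ν : K}
    (hν : ((μ : ℤ) : K) * ν ^ (2 * N) = 1) {s t : ℕ} (hs : s ∈ Set.Icc 1 N)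
    (ht : t ≤ 2 * n + 1) {c : Fin 2} {B : Fin 2 → K} (hB : ∀ j, B j ≠ 0)
    (hB' : t = 0 ∨ t = 2 * n + 1 → B 0 ^ 2 ≠ B 1 ^ 2)
    (hM : M.HasModel (pairX c B) (pairC K N (2 * n + 1) μ lam s t)) : M.IsSimpleYD := by
  obtain ⟨b, hb⟩ := hM
  have hact : ∀ i r, M.act (𝕩 i (i + c)) (b r) = B (i + r) • b (r + 1) := by
    intro i r
    rw [hb.act_gen]
    simp [pairX_apply]
  refine isSimpleYD_of_basis b (fun r => ?_) fun W hW r r' hr => ?_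
  · by_cases h : t = 0 ∨ t = 2 * n + 1
    · have hP : ∀ i, M.act (𝕩 0 (0 + c) * 𝕩 1 (1 + c)) (b i) = B (i + 1) ^ 2 • b i := by
        intro i
        have hF : ∀ i : Fin 2, 0 + (i + 1) = i + 1 ∧ 1 + i = i + 1 ∧ i + 1 + 1 = i := by decide
        obtain ⟨e1, e2, e3⟩ := hF i
        rw [map_mul, Module.End.mul_apply, hact, map_smul, hact, smul_smul, e1, e2, e3, pow_two]
      have hd : B (r + 1) ^ 2 - B r ^ 2 ≠ 0 := by
        have := hB' h
        rw [sub_ne_zero]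
        fin_cases r
        · exact this.symm
        · exact this
      refine ⟨(B (r + 1) ^ 2 - B r ^ 2)⁻¹ •
        (M.act (𝕩 0 (0 + c) * 𝕩 1 (1 + c)) - algebraMap K _ (B r ^ 2)), fun W hW w hw => ?_,
        fun i => ?_⟩
      · rw [LinearMap.smul_apply, LinearMap.sub_apply, Module.algebraMap_end_apply]
        exact W.smul_mem _ (W.sub_mem (hW.1 _ w hw) (W.smul_mem _ hw))
      · rw [LinearMap.smul_apply, LinearMap.sub_apply, Module.algebraMap_end_apply, hP, ← sub_smul,
          smul_smul]
        split_ifs with hi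
        · rw [hi, inv_mul_cancel₀ hd, one_smul]
        · have : ∀ i r : Fin 2, ¬ i = r → i + 1 = r := by decide
          rw [this i r hi, sub_self, mul_zero, zero_smul]
    · obtain ⟨φ, h1, h2⟩ := exists_coordinate (n := n) (lam := lam) hν hs ht r r
      refine ⟨M.coeffOp φ, fun W hW => ((isSubYD_iff M W).mp hW).2 φ, fun i => ?_⟩
      have h3 : ∀ l, φ (𝕨 s t i l) = if i = r ∧ l = r then 1 else 0 := by
        intro l
        split_ifs with hil
        · rw [hil.1, hil.2, h1]
        · refine h2 s hs t ht i l ?_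
          by_cases hi : i = r
          · refine Or.inr (Or.inr (Or.inl ?_))
            have : l ≠ r := fun hl => hil ⟨hi, hl⟩
            rw [hi]; simpa using this
          · exact Or.inr (Or.inr (Or.inr ⟨hi, fun h0 => h (Or.inl h0), fun h0 => h (Or.inr h0)⟩))
      rw [hb.coeffOp_eq]
      simp only [pairC_apply, h3]
      by_cases hi : i = r
      · simp [hi]
      · simp [hi]
  · have h1 : b (r + 1) ∈ W := by
      have := hW.1 (𝕩 0 (0 + c)) _ hr
      rw [hact] at this
      exact (W.smul_mem_iff (hB _)).mp this
    have hF : ∀ r r' : Fin 2, r' = r ∨ r' = r + 1 := by decide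
    rcases hF r r' with rfl | rfl
    · exact hr
    · exact h1

/-- The isomorphism class of a pair module determines `s`, `t` and the scalars `B 0`, `B 1`, up to an
exchange of the two basis vectors when the words have extreme length. -/
theorem pair_invariants [CharZero K] {ν : K}
    (hν : ((μ : ℤ) : K) * ν ^ (2 * N) = 1) {s t s' t' : ℕ} (hs : s ∈ Set.Icc 1 N)
    (ht : t ≤ 2 * n + 1) (hs' : s' ∈ Set.Icc 1 N) (ht' : t' ≤ 2 * n + 1) {B B' : Fin 2 → K}
    (hM : M.HasModel (pairX (par t) B) (pairC K N (2 * n + 1) μ lam s t))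
    (hY : Y.HasModel (pairX (par t') B') (pairC K N (2 * n + 1) μ lam s' t'))
    (h : M.Isomorphic Y) : s = s' ∧ t = t' ∧ ((B 0 = B' 0 ∧ B 1 = B' 1) ∨
      ((t = 0 ∨ t = 2 * n + 1) ∧ B 0 = ((blockSign lam (par t) : ℤ) : K) * B' 1 ∧
        B 1 = ((blockSign lam (par t) : ℤ) : K) * B' 0)) := by
  -- `s` and `t` are read off from the trace of a coefficient operator, to which only the diagonal
  -- entries `W_{00}` and `W_{11}` contribute
  have hst : s = s' ∧ t = t' := by
    obtain ⟨φ, h1, h2⟩ := exists_coordinate (n := n) (lam := lam) hν hs ht 0 0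
    have h3 := hM.trace_coeff hY h φ
    simp only [Matrix.trace, Matrix.diag_apply, Matrix.map_apply, pairC_apply,
      Fin.sum_univ_two, h1] at h3
    by_contra hcon
    have h4 : s' ≠ s ∨ t' ≠ t := by
      by_contra h5
      push Not at h5
      exact hcon ⟨h5.1.symm, h5.2.symm⟩
    rw [h2 s' hs' t' ht' 0 0 (by tauto), h2 s' hs' t' ht' 1 1 (by tauto), add_zero] at h3
    by_cases h0 : t = 0 ∨ t = 2 * n + 1
    · have := word_extreme (K := K) (N := N) (μ := μ) (lam := lam) (s := s) h0 0 0
      rw [zero_add, if_pos rfl, Int.cast_one, one_smul] at this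
      rw [this, h1] at h3
      norm_num at h3
    · rw [h2 s hs t ht 1 1 (Or.inr (Or.inr (Or.inr ⟨by decide, by tauto⟩)))] at h3
      norm_num at h3
  obtain ⟨rfl, rfl⟩ := hst
  refine ⟨rfl, rfl, ?_⟩
  have htr : ∀ φ : Module.Dual K 𝔸, φ (𝕨 s t 0 1) * B 1 + φ (𝕨 s t 1 0) * B 0 =
      φ (𝕨 s t 0 1) * B' 1 + φ (𝕨 s t 1 0) * B' 0 := by
    intro φ
    have h3 := hM.trace_coeff_mul hY h φ 0 (par t)
    simp only [Matrix.trace, Matrix.diag_apply, Matrix.mul_apply, Matrix.map_apply, pairC_apply,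
      Fin.sum_univ_two, pairX_apply] at h3
    simp at h3
    linear_combination h3
  by_cases h0 : t = 0 ∨ t = 2 * n + 1
  · obtain ⟨φ, h1, h2⟩ := exists_coordinate (n := n) (lam := lam) hν hs ht 0 1
    have h3 := htr φ
    have h4 := word_extreme (K := K) (N := N) (μ := μ) (lam := lam) (s := s) h0 0 1
    rw [zero_add, if_neg (by decide), show (1 : Fin 2) + 1 = 0 from rfl] at h4
    rw [h4, map_smul, h1] at h3
    have h5 := hM.trace_mul hY h 0 (par t) 0 (par t)
    simp only [Matrix.trace, Matrix.diag_apply, Matrix.mul_apply, Fin.sum_univ_two,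
      pairX_apply] at h5
    simp at h5
    have hσ : ((blockSign lam (par t) : ℤ) : K) * ((blockSign lam (par t) : ℤ) : K) = 1 := by
      rw [← Int.cast_mul, IsSuzukiTuple.units_cast_mul_self, Int.cast_one]
    generalize ((blockSign lam (par t) : ℤ) : K) = σ at *
    simp only [smul_eq_mul, mul_one, one_mul] at h3
    -- the product of the two scalars and the combination `σ B 0 + B 1` are invariants, so that the
    -- two pairs of scalars are roots of the same quadratic equation
    have h6 : B 0 * B 1 = B' 0 * B' 1 := by linear_combination h5 / 2
    have h7 : (B 1 - B' 1) * (B 1 - σ * B' 0) = 0 := by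
      linear_combination B 1 * h3 - σ * h6
    rcases mul_eq_zero.mp h7 with h7 | h7
    · left
      have h8 := sub_eq_zero.mp h7
      refine ⟨?_, h8⟩
      linear_combination σ * (h3 - h8) - (B 0 - B' 0) * hσ
    · right
      have h8 := sub_eq_zero.mp h7
      refine ⟨h0, ?_, h8⟩
      linear_combination σ * (h3 - h8) - B 0 * hσ
  · left
    obtain ⟨φ, h1, h2⟩ := exists_coordinate (n := n) (lam := lam) hν hs ht 0 1
    obtain ⟨ψ, h3, h4⟩ := exists_coordinate (n := n) (lam := lam) hν hs ht 1 0
    have h5 := htr φ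
    have h6 := htr ψ
    rw [h1, h2 s hs t ht 1 0 (Or.inr (Or.inr (Or.inr ⟨by decide, by tauto⟩)))] at h5
    rw [h3, h4 s hs t ht 0 1 (Or.inr (Or.inr (Or.inr ⟨by decide, by tauto⟩)))] at h6
    constructor
    · linear_combination h6
    · linear_combination h5

theorem line_invariants {ν : K}
    (hν : ((μ : ℤ) : K) * ν ^ (2 * N) = 1) {s t s' t' : ℕ} (hs : s ∈ Set.Icc 1 N)
    (ht : t ≤ 2 * n + 1) (hs' : s' ∈ Set.Icc 1 N) (ht' : t' ≤ 2 * n + 1) {a a' : Fin 2 → K}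
    {κ κ' : K} (hM : M.HasModel (lineX (par t) a) (lineC N (2 * n + 1) μ lam s t κ))
    (hY : Y.HasModel (lineX (par t') a') (lineC N (2 * n + 1) μ lam s' t' κ'))
    (h : M.Isomorphic Y) : s = s' ∧ t = t' ∧ κ = κ' ∧ a 0 = a' 0 := by
  have hst : s = s' ∧ t = t' := by
    obtain ⟨φ, h1, h2⟩ := exists_coordinate (n := n) (lam := lam) hν hs ht 0 0
    have h3 := hM.trace_coeff hY h φ
    simp only [Matrix.trace, Matrix.diag_apply, Matrix.map_apply, lineC, Matrix.of_apply,
      Finset.univ_unique, Finset.sum_const, Finset.card_singleton, one_smul, map_add, map_smul, h1,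
      h2 s hs t ht 0 1 (Or.inr (Or.inr (Or.inl (by decide)))), smul_zero, add_zero] at h3
    by_contra hcon
    have h4 : s' ≠ s ∨ t' ≠ t := by
      by_contra h5
      push Not at h5
      exact hcon ⟨h5.1.symm, h5.2.symm⟩
    rw [h2 s' hs' t' ht' 0 0 (by tauto), h2 s' hs' t' ht' 0 1 (by tauto), smul_zero,
      add_zero] at h3
    exact one_ne_zero h3
  obtain ⟨rfl, rfl⟩ := hst
  refine ⟨rfl, rfl, ?_, ?_⟩
  · obtain ⟨φ, h1, h2⟩ := exists_coordinate (n := n) (lam := lam) hν hs ht 0 1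
    have h3 := hM.trace_coeff hY h φ
    simpa [Matrix.trace, lineC, h1, h2 s hs t ht 0 0 (Or.inr (Or.inr (Or.inl (by decide))))] using h3
  · have h3 := hM.trace_gen hY h 0 (par t)
    simpa [Matrix.trace, lineX] using h3

theorem isSimpleYD_of_finrank_eq_one {M : YDModule.{u, u, v} K (SuzukiAlgebra K N (2 * n + 1) μ lam)}
    (h : Module.finrank K M.carrier = 1) : M.IsSimpleYD :=
  ⟨Module.nontrivial_of_finrank_pos (R := K) (by omega), fun W _ => by
    have := (isSimpleModule_iff_finrank_eq_one (R := K) (M := M.carrier)).mpr h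
    exact eq_bot_or_eq_top W⟩

end YDModule

end Invariants

end PairModels

/-! ### Paths of vectors -/

section PathModels

universe v'

open SuzukiAlgebra Submodule

variable {K : Type u} [Field K]

section Coaction

variable {N m : ℕ} [NeZero N] [NeZero m] {μ lam : ℤˣ}

local notation "𝔸" => SuzukiAlgebra K N m μ lam
local notation "𝕩" => gen K N m μ lam

/-- The coaction on `x_{ik} · y` when the other generator of the row kills `y`. -/
theorem YDModule.coact_act_gen (M : YDModule.{u, u, v} K (SuzukiAlgebra K N m μ lam))
    (y : M.carrier) {i k : Fin 2} (hy : ∀ a, a ≠ k → M.act (𝕩 i a) y = 0) :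
    M.coact (M.act (𝕩 i k) y) = ∑ j, ∑ a, TensorProduct.map
      ((LinearMap.mul K 𝔸).flip (𝕩 k j ^ (4 * N - 1)) ∘ₗ LinearMap.mul K 𝔸 (𝕩 i a))
        (M.act (𝕩 a j)) (M.coact y) := by
  have h1 : ∀ j, ∑ a, TensorProduct.map
      ((LinearMap.mul K 𝔸).flip (𝕩 k j ^ (4 * N - 1)) ∘ₗ LinearMap.mul K 𝔸 (𝕩 i a))
        (M.act (𝕩 a j)) (M.coact y) =
      TensorProduct.map ((LinearMap.mul K 𝔸).flip (𝕩 k j * 𝕩 k j ^ (4 * N - 1))) LinearMap.id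
        (M.coact (M.act (𝕩 i k) y)) := by
    intro j
    have h2 := M.compat_gen i j y
    have h3 : ∑ a, TensorProduct.map ((LinearMap.mul K 𝔸).flip (𝕩 a j)) LinearMap.id
        (M.coact (M.act (𝕩 i a) y)) = TensorProduct.map ((LinearMap.mul K 𝔸).flip (𝕩 k j))
          LinearMap.id (M.coact (M.act (𝕩 i k) y)) :=
      Finset.sum_eq_single k (fun a _ ha => by rw [hy a ha, map_zero, map_zero])
        (fun h => absurd (Finset.mem_univ _) h)
    rw [h3] at h2
    have h4 := congrArg (TensorProduct.map ((LinearMap.mul K 𝔸).flip (𝕩 k j ^ (4 * N - 1)))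
      (LinearMap.id (M := M.carrier))) h2
    rw [map_sum] at h4
    refine Eq.trans (Finset.sum_congr rfl fun a _ => ?_) (h4.trans ?_)
    · induction M.coact y with
      | zero => simp
      | add a b ha hb => simp only [map_add, ha, hb]
      | tmul a b => rfl
    · induction M.coact (M.act (𝕩 i k) y) with
      | zero => simp
      | add a b ha hb => simp only [map_add, ha, hb]
      | tmul a b => simp [mul_assoc]
  rw [Finset.sum_congr rfl fun j _ => h1 j]
  have h5 := sum_gen_mul_antipode (K := K) (N := N) (m := m) (μ := μ) (lam := lam) k k
  rw [if_pos rfl] at h5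
  have h6 : ∀ t : 𝔸 ⊗[K] M.carrier, ∑ j, TensorProduct.map
      ((LinearMap.mul K 𝔸).flip (𝕩 k j * 𝕩 k j ^ (4 * N - 1))) LinearMap.id t = t := by
    intro t
    induction t with
    | zero => simp
    | add a b ha hb => simp only [map_add, Finset.sum_add_distrib, ha, hb]
    | tmul a b =>
      simp only [TensorProduct.map_tmul, LinearMap.flip_apply, LinearMap.mul_apply',
        LinearMap.id_apply]
      rw [← TensorProduct.sum_tmul, ← Finset.mul_sum, h5, mul_one]
  exact (h6 _).symm

variable (N m μ lam) in
/-- The coefficient elements of the diagonal block along a path. -/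
noncomputable def pathG (c : Fin 2) (g : 𝔸) : ℕ → 𝔸
  | 0 => g
  | r + 1 => 𝕩 (par (r + 1)) (par (r + 1)) * pathG c g r *
      𝕩 (par (r + 1) + c) (par (r + 1) + c) ^ (4 * N - 1)

variable (N m μ lam) in
/-- The coefficient elements of the off-diagonal block along a path, where `Z` is the square of
the letters. -/
noncomputable def pathH (c : Fin 2) (Z : K) (h : 𝔸) : ℕ → 𝔸
  | 0 => h
  | r + 1 => Z • (𝕩 (par (r + 1)) (par (r + 1) + 1) * pathH c Z h r *
      𝕩 (par (r + 1) + c) (par (r + 1) + c + 1) ^ (4 * N - 1))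

end Coaction

section Path

variable {N n : ℕ} [NeZero N] {μ lam : ℤˣ}

local notation "𝔸" => SuzukiAlgebra K N (2 * n + 1) μ lam
local notation "𝕩" => gen K N (2 * n + 1) μ lam

theorem par_succ (r : ℕ) : par (r + 1) = par r + 1 := by
  unfold par
  by_cases h : Even r <;> simp [h, Nat.even_add_one]

/-- The even vectors obtained by applying the letters of a block alternately. -/
theorem YDModule.act_alternating (M : YDModule.{u, u, v} K (SuzukiAlgebra K N (2 * n + 1) μ lam))
    {f : ℕ → M.carrier} {c : Fin 2}
    (hf : ∀ r, f (r + 1) = M.act (𝕩 (par (r + 1)) (par (r + 1) + c)) (f r)) (r : ℕ) :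
    f (2 * r) = M.act ((𝕩 0 c * 𝕩 1 (1 + c)) ^ r) (f 0) := by
  induction r with
  | zero => simp
  | succ r ih =>
    rw [show 2 * (r + 1) = 2 * r + 1 + 1 by ring, hf, hf, ih, pow_succ', mul_assoc,
      map_mul, map_mul, Module.End.mul_apply, Module.End.mul_apply, par_odd,
      show 2 * r + 1 + 1 = 2 * (r + 1) by ring, par_even, zero_add]

/-- The vectors `f 0, f 1, …` obtained from an eigenvector `f 0` of the letter `x_{0c}` by
applying the letters of the block `c` alternately, with a coaction on `f 0` that involves the
last vector `f (2n)`. -/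
structure YDModule.IsPath (M : YDModule.{u, u, v} K (SuzukiAlgebra K N (2 * n + 1) μ lam))
    (f : ℕ → M.carrier) (c : Fin 2) (A : K) (g h : SuzukiAlgebra K N (2 * n + 1) μ lam) :
    Prop where
  step : ∀ r, f (r + 1) = M.act (𝕩 (par (r + 1)) (par (r + 1) + c)) (f r)
  base : M.act (𝕩 0 c) (f 0) = A • f 0
  ne_zero : A ≠ 0
  coact_base : M.coact (f 0) = g ⊗ₜ[K] f 0 + h ⊗ₜ[K] f (2 * n)
  left_diag : ∀ k l, k + l ≠ 0 → 𝕩 k l * g = 0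
  left_off : ∀ k l, k + l ≠ 1 → 𝕩 k l * h = 0

namespace YDModule.IsPath

variable {M : YDModule.{u, u, v} K (SuzukiAlgebra K N (2 * n + 1) μ lam)}
  {f : ℕ → M.carrier} {c : Fin 2} {A : K} {g h : SuzukiAlgebra K N (2 * n + 1) μ lam}

theorem act_eq_zero (hf : M.IsPath f c A g h) {i j : Fin 2} (hj : j ≠ i + c) (r : ℕ) :
    M.act (𝕩 i j) (f r) = 0 := by
  have hX := isSuzukiTuple_gen (K := K) (N := N) (m := 2 * n + 1) (μ := μ) (lam := lam)
  have key : ∀ k x, M.act (𝕩 i j) (M.act (𝕩 k (k + c)) x) = 0 := by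
    intro k x
    have hF : ∀ i j k c : Fin 2, j ≠ i + c → i + j ≠ k + (k + c) := by decide
    rw [← Module.End.mul_apply, ← map_mul, hX.mul_eq_zero_of_ne (hF i j k c hj), map_zero,
      LinearMap.zero_apply]
  cases r with
  | zero =>
    have h1 := key 0 (f 0)
    rw [zero_add, hf.base, map_smul] at h1
    exact (smul_eq_zero.mp h1).resolve_left hf.ne_zero
  | succ r => rw [hf.step, key]

/-- The letters of the block square to the same scalar on the whole path. -/
theorem act_sq (hf : M.IsPath f c A g h) (i : Fin 2) (r : ℕ) :
    M.act (𝕩 i (i + c)) (M.act (𝕩 i (i + c)) (f r)) = A ^ 2 • f r := by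
  have hX := isSuzukiTuple_gen (K := K) (N := N) (m := 2 * n + 1) (μ := μ) (lam := lam)
  have hsq : ∀ i : Fin 2, 𝕩 i (i + c) ^ 2 = 𝕩 0 c ^ 2 := by
    intro i
    have := hX.sq_eq 0 c
    have hF : ∀ i : Fin 2, i = 0 ∨ i = 1 := by decide
    rcases hF i with rfl | rfl
    · rw [zero_add]
    · rw [← this, zero_add, add_comm (1 : Fin 2) c]
  have hsq' : ∀ i x, M.act (𝕩 i (i + c)) (M.act (𝕩 i (i + c)) x) = M.act (𝕩 0 c ^ 2) x := by
    intro i x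
    rw [← hsq i, pow_two, map_mul, Module.End.mul_apply]
  rw [hsq']
  induction r with
  | zero =>
    have := hsq' 0 (f 0)
    rw [zero_add, hf.base, map_smul, hf.base, smul_smul] at this
    rw [← this, pow_two]
  | succ r ih =>
    rw [hf.step, ← hsq (par (r + 1)), ← Module.End.mul_apply, ← map_mul, ← pow_succ, pow_succ',
      map_mul, Module.End.mul_apply, hsq, ih, map_smul]

theorem act_back (hf : M.IsPath f c A g h) (r : ℕ) :
    M.act (𝕩 (par (r + 1)) (par (r + 1) + c)) (f (r + 1)) = A ^ 2 • f r := by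
  rw [hf.step, hf.act_sq]

theorem act_altProd (hf : M.IsPath f c A g h) (r : ℕ) :
    f (2 * r) = M.act ((𝕩 0 c * 𝕩 1 (1 + c)) ^ r) (f 0) :=
  M.act_alternating hf.step r

/-- The end of the path, by the relation between the two alternating words of length `2n+1`. -/
theorem act_last (hf : M.IsPath f c A g h) :
    M.act (𝕩 1 (1 + c)) (f (2 * n)) = (((blockSign lam c : ℤ) : K) * A) • f (2 * n) := by
  have hX := isSuzukiTuple_gen (K := K) (N := N) (m := 2 * n + 1) (μ := μ) (lam := lam)
  have h1 := hX.altProd_top 0 c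
  rw [altProd_succ, zero_add, zero_add, altProd_odd,
    show altProd 𝕩 ((1 : Fin 2) + 1) (c + 1 + 1) (2 * n) = (𝕩 0 c * 𝕩 1 (1 + c)) ^ n from ?_,
    zero_add, add_comm c 1] at h1
  · rw [hf.act_altProd, ← Module.End.mul_apply, ← map_mul, h1, ← Int.cast_smul_eq_zsmul K, map_smul,
      LinearMap.smul_apply, map_mul, Module.End.mul_apply, hf.base, map_smul, smul_smul]
  · have h2 : ∀ r, altProd 𝕩 0 c (2 * r) = (𝕩 0 c * 𝕩 1 (1 + c)) ^ r := by
      intro r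
      induction r with
      | zero => simp [altProd]
      | succ r ih =>
        rw [show 2 * (r + 1) = 2 * r + 1 + 1 by ring, altProd_succ, altProd_succ,
          IsSuzukiTuple.fin2_add, IsSuzukiTuple.fin2_add, ih, pow_succ', zero_add, add_comm c 1,
          mul_assoc]
    rw [IsSuzukiTuple.fin2_add]
    exact h2 n

theorem left_pathG (hf : M.IsPath f c A g h) (r : ℕ) {k l : Fin 2} (hk : k + l ≠ 0) :
    𝕩 k l * pathG N (2 * n + 1) μ lam c g r = 0 := by
  have hX := isSuzukiTuple_gen (K := K) (N := N) (m := 2 * n + 1) (μ := μ) (lam := lam)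
  cases r with
  | zero => exact hf.left_diag k l hk
  | succ r =>
    have hF : ∀ a : Fin 2, a + a = 0 := by decide
    rw [pathG, ← mul_assoc, ← mul_assoc, hX.mul_eq_zero_of_ne (by rwa [hF]), zero_mul, zero_mul]

theorem left_pathH (hf : M.IsPath f c A g h) (r : ℕ) {k l : Fin 2} (hk : k + l ≠ 1) :
    𝕩 k l * pathH N (2 * n + 1) μ lam c (A ^ 2) h r = 0 := by
  have hX := isSuzukiTuple_gen (K := K) (N := N) (m := 2 * n + 1) (μ := μ) (lam := lam)
  cases r with
  | zero => exact hf.left_off k l hk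
  | succ r =>
    have hF : ∀ a : Fin 2, a + (a + 1) = 1 := by decide
    rw [pathH, mul_smul_comm, ← mul_assoc, ← mul_assoc, hX.mul_eq_zero_of_ne (by rwa [hF]),
      zero_mul, zero_mul, smul_zero]

/-- The coaction along a path: each step conjugates the two coefficient elements, and the second term
travels from the last vector backwards. -/
theorem coact_eq (hf : M.IsPath f c A g h) (r : ℕ) (hr : r ≤ 2 * n) :
    M.coact (f r) = pathG N (2 * n + 1) μ lam c g r ⊗ₜ[K] f r +
      pathH N (2 * n + 1) μ lam c (A ^ 2) h r ⊗ₜ[K] f (2 * n - r) := by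
  induction r with
  | zero => exact hf.coact_base
  | succ r ih =>
    have hterm : ∀ (i j a : Fin 2) (G : 𝔸) (e : Fin 2) (k : ℕ)
        (_ : ∀ k l, k + l ≠ e → 𝕩 k l * G = 0),
        (𝕩 i a * G * 𝕩 (i + c) j ^ (4 * N - 1)) ⊗ₜ[K] M.act (𝕩 a j) (f k) =
        if a = i + e ∧ j = i + e + c then
          (𝕩 i (i + e) * G * 𝕩 (i + c) (i + e + c) ^ (4 * N - 1)) ⊗ₜ[K]
            M.act (𝕩 (i + e) (i + e + c)) (f k) else 0 := by
      intro i j a G e k hG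
      split_ifs with haj
      · rw [haj.1, haj.2]
      · by_cases ha : a = i + e
        · rw [hf.act_eq_zero (fun h => haj ⟨ha, by rw [h, ha]⟩), TensorProduct.tmul_zero]
        · have hF : ∀ a i e : Fin 2, a ≠ i + e → i + a ≠ e := by decide
          rw [hG _ _ (hF a i e ha), zero_mul, TensorProduct.zero_tmul]
    have hsum : ∀ (i : Fin 2) (G : 𝔸) (e : Fin 2) (k : ℕ)
        (_ : ∀ k l, k + l ≠ e → 𝕩 k l * G = 0),
        ∑ j, ∑ a, (𝕩 i a * G * 𝕩 (i + c) j ^ (4 * N - 1)) ⊗ₜ[K] M.act (𝕩 a j) (f k) =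
          (𝕩 i (i + e) * G * 𝕩 (i + c) (i + e + c) ^ (4 * N - 1)) ⊗ₜ[K]
            M.act (𝕩 (i + e) (i + e + c)) (f k) := by
      intro i G e k hG
      rw [Finset.sum_eq_single (i + e + c), Finset.sum_eq_single (i + e)]
      · intro a _ ha
        rw [hterm _ _ _ _ e _ hG, if_neg (fun h => ha h.1)]
      · intro h; exact absurd (Finset.mem_univ _) h
      · intro j _ hj
        exact Finset.sum_eq_zero fun a _ => by
          rw [hterm _ _ _ _ e _ hG, if_neg (fun h => hj h.2)]
      · intro h; exact absurd (Finset.mem_univ _) h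
    obtain ⟨k, hk⟩ : ∃ k, 2 * n - r = k + 1 := ⟨2 * n - r - 1, by omega⟩
    have hpar : par (r + 1) + 1 = par (k + 1) := by
      have h1 : k + 1 + r = 2 * n := by omega
      have h2 : par (k + 1) = par r := by
        unfold par
        have : Even (k + 1 + r) := ⟨n, by omega⟩
        rw [Nat.even_add] at this
        simp only [this]
      rw [h2, par_succ, IsSuzukiTuple.fin2_add]
    have hk' : 2 * n - (r + 1) = k := by omega
    conv_lhs => rw [hf.step, M.coact_act_gen _ (fun a ha => hf.act_eq_zero ha r)]
    rw [ih (by omega), hk, hk']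
    simp only [map_add, Finset.sum_add_distrib, TensorProduct.map_tmul, LinearMap.comp_apply,
      LinearMap.flip_apply, LinearMap.mul_apply']
    rw [hsum _ _ 0 _ (fun k l hkl => hf.left_pathG r hkl),
      hsum _ _ 1 _ (fun k l hkl => hf.left_pathH r hkl), hpar, hf.act_back k, add_zero,
      ← hf.step, ← hpar]
    congr 1
    rw [pathH, TensorProduct.tmul_smul, TensorProduct.smul_tmul', add_right_comm]

end YDModule.IsPath

end Path

end PathModels

/-! ### Simplicity of path modules -/

section PathSimplicity

universe v'

open SuzukiAlgebra Submodule

variable {K : Type u} [Field K] {N n : ℕ} [NeZero N] {μ lam : ℤˣ}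

local notation "𝔸" => SuzukiAlgebra K N (2 * n + 1) μ lam
local notation "𝕩" => gen K N (2 * n + 1) μ lam
local notation "𝕨" => word (gen K N (2 * n + 1) μ lam)

section Group

variable (N n)

/-- The conjugation recursion of `pathG` in the group of words. -/
def groupPath (c : Fin 2) (γ : WordGroup N n) : ℕ → WordGroup N n
  | 0 => γ
  | r + 1 => letter N n (par (r + 1)) * groupPath c γ r * (letter N n (par (r + 1) + c))⁻¹

/-- The length of the words at the start of a path. -/
def pathLen (c : Fin 2) : ℕ := if c = 0 then 1 else 2 * n

theorem letter_inv (i : Fin 2) : (letter N n i)⁻¹ =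
    (DihedralGroup.sr (i.val : ZMod (2 * n + 1)), Multiplicative.ofAdd (-1)) := by
  rw [letter, Prod.inv_mk, DihedralGroup.inv_sr]; rfl

theorem groupPath_zero (d : ZMod (2 * N)) (k : ℕ) :
    groupPath N n 0 (DihedralGroup.sr 0, Multiplicative.ofAdd d) (2 * k) =
      (DihedralGroup.sr ((2 * (-k : ℤ) : ℤ) : ZMod (2 * n + 1)), Multiplicative.ofAdd d) ∧
    groupPath N n 0 (DihedralGroup.sr 0, Multiplicative.ofAdd d) (2 * k + 1) =
      (DihedralGroup.sr ((2 * (k + 1 : ℤ) : ℤ) : ZMod (2 * n + 1)), Multiplicative.ofAdd d) := by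
  have hstep : ∀ k : ℕ, groupPath N n 0 (DihedralGroup.sr 0, Multiplicative.ofAdd d) (2 * k) =
      (DihedralGroup.sr ((2 * (-k : ℤ) : ℤ) : ZMod (2 * n + 1)), Multiplicative.ofAdd d) →
      groupPath N n 0 (DihedralGroup.sr 0, Multiplicative.ofAdd d) (2 * k + 1) =
      (DihedralGroup.sr ((2 * (k + 1 : ℤ) : ℤ) : ZMod (2 * n + 1)), Multiplicative.ofAdd d) := by
    intro k hk
    rw [groupPath, hk, letter_inv, letter, par_odd, add_zero, Prod.mk_mul_mk, Prod.mk_mul_mk,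
      DihedralGroup.sr_mul_sr, DihedralGroup.r_mul_sr, ← ofAdd_add, ← ofAdd_add]
    congr 2
    · push_cast; simp; ring
    · ring
  have heven : groupPath N n 0 (DihedralGroup.sr 0, Multiplicative.ofAdd d) (2 * k) =
      (DihedralGroup.sr ((2 * (-k : ℤ) : ℤ) : ZMod (2 * n + 1)), Multiplicative.ofAdd d) := by
    induction k with
    | zero => simp [groupPath]
    | succ k ih =>
      rw [show 2 * (k + 1) = 2 * k + 1 + 1 by ring, groupPath, hstep k ih, letter_inv, letter,
        show 2 * k + 1 + 1 = 2 * (k + 1) by ring, par_even, add_zero, Prod.mk_mul_mk,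
        Prod.mk_mul_mk, DihedralGroup.sr_mul_sr, DihedralGroup.r_mul_sr, ← ofAdd_add, ← ofAdd_add]
      congr 2
      · push_cast; simp; ring
      · ring
  exact ⟨heven, hstep k heven⟩

theorem groupPath_one (d : ZMod (2 * N)) (k : ℕ) :
    groupPath N n 1 (DihedralGroup.r (-(n : ZMod (2 * n + 1))), Multiplicative.ofAdd d) (2 * k) =
      (DihedralGroup.r ((-n + 2 * k : ℤ) : ZMod (2 * n + 1)), Multiplicative.ofAdd d) ∧
    groupPath N n 1 (DihedralGroup.r (-(n : ZMod (2 * n + 1))), Multiplicative.ofAdd d) (2 * k + 1) =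
      (DihedralGroup.r ((n - 2 * k - 1 : ℤ) : ZMod (2 * n + 1)), Multiplicative.ofAdd d) := by
  have hstep : ∀ k : ℕ, groupPath N n 1 (DihedralGroup.r (-(n : ZMod (2 * n + 1))), Multiplicative.ofAdd d) (2 * k) =
      (DihedralGroup.r ((-n + 2 * k : ℤ) : ZMod (2 * n + 1)), Multiplicative.ofAdd d) →
      groupPath N n 1 (DihedralGroup.r (-(n : ZMod (2 * n + 1))), Multiplicative.ofAdd d) (2 * k + 1) =
      (DihedralGroup.r ((n - 2 * k - 1 : ℤ) : ZMod (2 * n + 1)), Multiplicative.ofAdd d) := by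
    intro k hk
    rw [groupPath, hk, letter_inv, letter, par_odd, show (1 : Fin 2) + 1 = 0 from rfl,
      Prod.mk_mul_mk, Prod.mk_mul_mk,
      DihedralGroup.sr_mul_r, DihedralGroup.sr_mul_sr, ← ofAdd_add, ← ofAdd_add]
    congr 2
    · push_cast; simp; ring
    · ring
  have heven : groupPath N n 1 (DihedralGroup.r (-(n : ZMod (2 * n + 1))), Multiplicative.ofAdd d) (2 * k) =
      (DihedralGroup.r ((-n + 2 * k : ℤ) : ZMod (2 * n + 1)), Multiplicative.ofAdd d) := by
    induction k with
    | zero => simp [groupPath]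
    | succ k ih =>
      rw [show 2 * (k + 1) = 2 * k + 1 + 1 by ring, groupPath, hstep k ih, letter_inv, letter,
        show 2 * k + 1 + 1 = 2 * (k + 1) by ring, par_even, zero_add, Prod.mk_mul_mk,
        Prod.mk_mul_mk, DihedralGroup.sr_mul_r, DihedralGroup.sr_mul_sr, ← ofAdd_add, ← ofAdd_add]
      congr 2
      · push_cast; simp; ring
      · ring
  exact ⟨heven, hstep k heven⟩

theorem groupWord_pathLen (s : ℕ) (c : Fin 2) : groupWord N n s (pathLen n c) c =
    (if c = 0 then DihedralGroup.sr 0 else DihedralGroup.r (-(n : ZMod (2 * n + 1))),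
      Multiplicative.ofAdd ((2 * s + pathLen n c : ℕ) : ZMod (2 * N))) := by
  fin_cases c
  · have := groupWord_odd N n s 0 0
    simpa [pathLen, reflExp] using this
  · have := groupWord_even N n s n 1
    simpa [pathLen, rotExp] using this

theorem two_mul_cancel {x y : ℤ}
    (h : ((2 * x : ℤ) : ZMod (2 * n + 1)) = ((2 * y : ℤ) : ZMod (2 * n + 1))) :
    (x : ZMod (2 * n + 1)) = y := by
  have h1 := ZMod.natCast_self (2 * n + 1)
  push_cast at h h1
  linear_combination ((n : ZMod (2 * n + 1)) + 1) * h - ((x : ZMod (2 * n + 1)) - y) * h1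

variable {N n} in
/-- The diagonal coefficient elements along a path are distinct group elements, of a degree that
determines the start. -/
theorem groupPath_inj {s s' : ℕ} {c : Fin 2} {r r' : ℕ} (hr : r ≤ 2 * n) (hr' : r' ≤ 2 * n)
    (h : groupPath N n c (groupWord N n s (pathLen n c) c) r =
      groupPath N n c (groupWord N n s' (pathLen n c) c) r') :
    r = r' ∧ ((2 * s + pathLen n c : ℕ) : ZMod (2 * N)) = (2 * s' + pathLen n c : ℕ) := by
  rw [groupWord_pathLen, groupWord_pathLen] at h
  generalize ((2 * s + pathLen n c : ℕ) : ZMod (2 * N)) = d at *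
  generalize ((2 * s' + pathLen n c : ℕ) : ZMod (2 * N)) = d' at *
  have hF : ∀ c : Fin 2, c = 0 ∨ c = 1 := by decide
  rcases hF c with rfl | rfl
  · simp only [if_true] at h
    rcases Nat.even_or_odd' r with ⟨a, rfl | rfl⟩ <;>
    rcases Nat.even_or_odd' r' with ⟨b, rfl | rfl⟩ <;>
    simp only [(groupPath_zero N n d a).1, (groupPath_zero N n d a).2,
      (groupPath_zero N n d' b).1, (groupPath_zero N n d' b).2, Prod.mk.injEq,
      DihedralGroup.sr.injEq] at h <;>
    · obtain ⟨h1, h2⟩ := h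
      have h3 := int_eq_of_cast_eq (two_mul_cancel n h1)
        (by rw [abs_lt]; constructor <;> push_cast <;> omega)
      exact ⟨by omega, h2⟩
  · simp only [if_neg (show ¬ (1 : Fin 2) = 0 by decide)] at h
    rcases Nat.even_or_odd' r with ⟨a, rfl | rfl⟩ <;>
    rcases Nat.even_or_odd' r' with ⟨b, rfl | rfl⟩ <;>
    simp only [(groupPath_one N n d a).1, (groupPath_one N n d a).2,
      (groupPath_one N n d' b).1, (groupPath_one N n d' b).2, Prod.mk.injEq,
      DihedralGroup.r.injEq] at h <;>
    · obtain ⟨h1, h2⟩ := h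
      have h3 := int_eq_of_cast_eq h1
        (by rw [abs_lt]; constructor <;> push_cast <;> omega)
      exact ⟨by omega, h2⟩

end Group

theorem letter_pow_inv (i : Fin 2) : letter N n i ^ (4 * N - 1) = (letter N n i)⁻¹ := by
  have hN := NeZero.pos N
  have h1 : letter N n i ^ (4 * N) = 1 := by
    rw [show 4 * N = 2 * (2 * N) by ring, letter_pow_even]
    have : (2 * ((2 * N : ℕ) : ZMod (2 * N))) = 0 := by rw [ZMod.natCast_self, mul_zero]
    rw [this]; rfl
  rw [eq_inv_iff_mul_eq_one, ← pow_succ, show 4 * N - 1 + 1 = 4 * N by omega, h1]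

theorem diagHom_pathG (c : Fin 2) {g : 𝔸} {γ : WordGroup N n}
    (hg : diagHom K N n μ lam g = MonoidAlgebra.of K _ γ) (r : ℕ) :
    diagHom K N n μ lam (pathG N (2 * n + 1) μ lam c g r) =
      MonoidAlgebra.of K _ (groupPath N n c γ r) := by
  induction r with
  | zero => exact hg
  | succ r ih =>
    rw [pathG, map_mul, map_mul, map_pow, ih, diagHom_gen, if_pos rfl, diagHom_gen, if_pos rfl,
      ← map_pow, letter_pow_inv, ← map_mul, ← map_mul]
    rfl

theorem diagHom_pathH (c : Fin 2) (Z : K) {h : 𝔸} (hh : diagHom K N n μ lam h = 0) (r : ℕ) :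
    diagHom K N n μ lam (pathH N (2 * n + 1) μ lam c Z h r) = 0 := by
  induction r with
  | zero => exact hh
  | succ r ih => rw [pathH, map_smul, map_mul, map_mul, ih, mul_zero, zero_mul, smul_zero]

theorem offHom_pathG (ν : K) (hν : ((μ : ℤ) : K) * ν ^ (2 * N) = 1) (c : Fin 2) {g : 𝔸}
    (hg : offHom n lam ν hν g = 0) (r : ℕ) :
    offHom n lam ν hν (pathG N (2 * n + 1) μ lam c g r) = 0 := by
  induction r with
  | zero => exact hg
  | succ r ih => rw [pathG, map_mul, map_mul, ih, mul_zero, zero_mul]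

theorem exists_offHom_pathH (ν : K) (hν : ((μ : ℤ) : K) * ν ^ (2 * N) = 1) (c : Fin 2) {Z : K}
    (hZ : Z ≠ 0) {h : 𝔸} (hh : ∃ κ : K, ∃ γ, κ ≠ 0 ∧ offHom n lam ν hν h =
      κ • MonoidAlgebra.of K (WordGroup N n) γ) (r : ℕ) :
    ∃ κ : K, ∃ γ, κ ≠ 0 ∧ offHom n lam ν hν (pathH N (2 * n + 1) μ lam c Z h r) =
      κ • MonoidAlgebra.of K (WordGroup N n) γ := by
  have hgen : ∀ k l : Fin 2, k ≠ l → ∃ κ : K, κ ≠ 0 ∧ offHom n lam ν hν (𝕩 k l) =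
      κ • MonoidAlgebra.of K (WordGroup N n) (letter N n k) := by
    intro k l hkl
    have h0 := ne_zero_of_mul_pow_eq_one hν
    refine ⟨_, ?_, by rw [offHom_gen, if_neg hkl]⟩
    split_ifs
    · exact h0
    · exact mul_ne_zero (units_cast_ne_zero lam) h0
  induction r with
  | zero => exact hh
  | succ r ih =>
    obtain ⟨κ, γ, h1, h2⟩ := ih
    have hF : ∀ k : Fin 2, k ≠ k + 1 := by decide
    obtain ⟨κ₁, h3, h4⟩ := hgen (par (r + 1)) (par (r + 1) + 1) (hF _)
    obtain ⟨κ₂, h5, h6⟩ := hgen (par (r + 1) + c) (par (r + 1) + c + 1) (hF _)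
    refine ⟨Z * (κ₁ * κ * κ₂ ^ (4 * N - 1)), letter N n (par (r + 1)) * γ *
      letter N n (par (r + 1) + c) ^ (4 * N - 1),
      mul_ne_zero hZ (mul_ne_zero (mul_ne_zero h3 h1) (pow_ne_zero _ h5)), ?_⟩
    rw [pathH, map_smul, map_mul, map_mul, map_pow, h2, h4, h6, smul_pow, smul_mul_smul_comm,
      smul_mul_smul_comm, smul_smul, map_mul, map_mul, map_pow]

theorem pathH_smul (c : Fin 2) (Z δ : K) (h : 𝔸) (r : ℕ) :
    pathH N (2 * n + 1) μ lam c Z (δ • h) r = δ • pathH N (2 * n + 1) μ lam c Z h r := by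
  induction r with
  | zero => rfl
  | succ r ih => rw [pathH, pathH, ih, mul_smul_comm, smul_mul_assoc, smul_comm]

/-- The position reached from position `r` of a path by the letter with row index `i`. -/
def pathTarget (n : ℕ) (i : Fin 2) (r : ℕ) : ℕ :=
  if i = par (r + 1) then (if r = 2 * n then r else r + 1) else r - 1

/-- The scalar by which the letter with row index `i` acts at position `r` of a path. -/
def pathScalar (n : ℕ) (A σ : K) (i : Fin 2) (r : ℕ) : K :=
  if i = par (r + 1) then (if r = 2 * n then σ * A else 1) else (if r = 0 then A else A ^ 2)

/-- The matrices of the generators on a path. -/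
def pathX (n : ℕ) (c : Fin 2) (A σ : K) (i j : Fin 2) :
    Matrix (Fin (2 * n + 1)) (Fin (2 * n + 1)) K :=
  Matrix.of fun a r => if j = i + c ∧ a.val = pathTarget n i r then pathScalar n A σ i r else 0

variable (N n μ lam) in
/-- The coefficient matrix of a path. -/
noncomputable def pathC (c : Fin 2) (Z : K) (g h : 𝔸) :
    Matrix (Fin (2 * n + 1)) (Fin (2 * n + 1)) 𝔸 :=
  Matrix.of fun a r => (if a = r then pathG N (2 * n + 1) μ lam c g r else 0) +
    if a = Fin.rev r then pathH N (2 * n + 1) μ lam c Z h r else 0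

namespace YDModule

variable {M : YDModule.{u, u, v} K (SuzukiAlgebra K N (2 * n + 1) μ lam)}
  {Y : YDModule.{u, u, v'} K (SuzukiAlgebra K N (2 * n + 1) μ lam)}

section

variable {f : ℕ → M.carrier} {c : Fin 2} {A : K} {g h : SuzukiAlgebra K N (2 * n + 1) μ lam}

theorem IsPath.act_letter (hf : M.IsPath f c A g h) (i : Fin 2) (r : ℕ) :
    M.act (𝕩 i (i + c)) (f r) =
      pathScalar n A ((blockSign lam c : ℤ) : K) i r • f (pathTarget n i r) := by
  unfold pathScalar pathTarget
  by_cases hi : i = par (r + 1)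
  · rw [if_pos hi, if_pos hi]
    by_cases hr : r = 2 * n
    · have h1 : i = 1 := by rw [hi, hr, par_odd]
      rw [if_pos hr, if_pos hr, h1, hr]
      exact hf.act_last
    · rw [if_neg hr, if_neg hr, one_smul, hf.step, hi]
  · rw [if_neg hi, if_neg hi]
    have h1 : i = par r := by
      rw [par_succ] at hi
      have hF : ∀ i p : Fin 2, ¬ i = p + 1 → i = p := by decide
      exact hF _ _ hi
    cases r with
    | zero =>
      have h0 : i = 0 := h1
      rw [if_pos rfl, h0, zero_add]
      exact hf.base
    | succ r => rw [if_neg (by omega), h1]; exact hf.act_back r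

theorem pathTarget_lt (i : Fin 2) (r : Fin (2 * n + 1)) : pathTarget n i r < 2 * n + 1 := by
  unfold pathTarget
  have := r.2
  split_ifs <;> omega

theorem IsPath.isModel (hf : M.IsPath f c A g h) :
    M.IsModel (fun r : Fin (2 * n + 1) => f r) (pathX n c A ((blockSign lam c : ℤ) : K))
      (pathC N n μ lam c (A ^ 2) g h) := by
  constructor
  · intro i j r
    by_cases hj : j = i + c
    · rw [hj, hf.act_letter]
      refine Eq.trans ?_ (Finset.sum_eq_single (⟨pathTarget n i r, pathTarget_lt i r⟩ :
        Fin (2 * n + 1)) (fun a _ ha => ?_) (fun h => absurd (Finset.mem_univ _) h)).symm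
      · simp [pathX]
      · simp only [pathX, Matrix.of_apply]
        rw [if_neg (fun h => ha (Fin.ext h.2)), zero_smul]
    · rw [hf.act_eq_zero hj]
      simp [pathX, hj]
  · intro r
    rw [hf.coact_eq r (by omega)]
    simp only [pathC, Matrix.of_apply, TensorProduct.add_tmul, Finset.sum_add_distrib]
    congr 1
    · refine Eq.trans ?_ (Finset.sum_eq_single r (fun a _ ha => ?_)
        (fun h => absurd (Finset.mem_univ _) h)).symm
      · rw [if_pos rfl]
      · rw [if_neg ha, TensorProduct.zero_tmul]
    · refine Eq.trans ?_ (Finset.sum_eq_single (Fin.rev r) (fun a _ ha => ?_)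
        (fun h => absurd (Finset.mem_univ _) h)).symm
      · rw [if_pos rfl, Fin.val_rev, show 2 * n + 1 - (r.val + 1) = 2 * n - r.val by omega]
      · rw [if_neg ha, TensorProduct.zero_tmul]

end

/-- The coefficient functionals that separate the vectors of a path. -/
theorem exists_path_functional {c : Fin 2} {Z : K} {g h : 𝔸} {s : ℕ}
    (hg : diagHom K N n μ lam g = MonoidAlgebra.of K _ (groupWord N n s (pathLen n c) c))
    (hh : diagHom K N n μ lam h = 0) (r : Fin (2 * n + 1)) :
    ∃ φ : Module.Dual K 𝔸, ∀ a b, φ (pathC N n μ lam c Z g h a b) =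
      if a = r ∧ b = r then 1 else 0 := by
  classical
  refine ⟨groupCoeff K (groupPath N n c (groupWord N n s (pathLen n c) c) r) ∘ₗ
    (diagHom K N n μ lam).toLinearMap, fun a b => ?_⟩
  rw [LinearMap.comp_apply, AlgHom.toLinearMap_apply, pathC, Matrix.of_apply, map_add, map_add]
  have h1 : diagHom K N n μ lam (if a = Fin.rev b then
      pathH N (2 * n + 1) μ lam c Z h b else 0) = 0 := by
    split_ifs
    · exact diagHom_pathH c Z hh b
    · exact map_zero _
  rw [h1, map_zero, add_zero]
  by_cases hab : a = b
  · subst hab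
    rw [if_pos rfl, diagHom_pathG c hg, groupCoeff_of]
    by_cases har : a = r
    · rw [if_pos (by rw [har]), if_pos ⟨har, har⟩]
    · rw [if_neg, if_neg (fun h => har h.1)]
      intro h2
      exact har (Fin.ext (groupPath_inj (by omega) (by omega) h2).1)
  · rw [if_neg hab, map_zero, map_zero, if_neg]
    rintro ⟨rfl, h2⟩
    exact hab h2.symm

theorem IsPath.linearIndependent {f : ℕ → M.carrier} {c : Fin 2} {A : K}
    {g h : SuzukiAlgebra K N (2 * n + 1) μ lam} (hf : M.IsPath f c A g h) {s : ℕ}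
    (hg : diagHom K N n μ lam g = MonoidAlgebra.of K _ (groupWord N n s (pathLen n c) c))
    (hh : diagHom K N n μ lam h = 0) (h0 : f 0 ≠ 0) :
    LinearIndependent K (fun r : Fin (2 * n + 1) => f r) := by
  have hne : ∀ r, f r ≠ 0 := by
    intro r
    induction r with
    | zero => exact h0
    | succ r ih =>
      intro h1
      have h2 := hf.act_back r
      rw [h1, map_zero] at h2
      exact (smul_ne_zero (pow_ne_zero 2 hf.ne_zero) ih) h2.symm
  refine linearIndependent_of_separating (fun r : Fin (2 * n + 1) => f r) (fun r => hne r)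
    fun r => ?_
  obtain ⟨φ, hφ⟩ := exists_path_functional (Z := A ^ 2) hg hh r
  refine ⟨M.coeffOp φ, fun b => ?_⟩
  rw [hf.isModel.coeffOp_eq]
  simp only [hφ]
  by_cases hb : b = r
  · simp [hb]
  · simp [hb]

theorem isSimpleYD_of_path {c : Fin 2} {A σ : K} (hA : A ≠ 0) {g h : 𝔸} {s : ℕ}
    (hg : diagHom K N n μ lam g = MonoidAlgebra.of K _ (groupWord N n s (pathLen n c) c))
    (hh : diagHom K N n μ lam h = 0)
    (hM : M.HasModel (pathX n c A σ) (pathC N n μ lam c (A ^ 2) g h)) : M.IsSimpleYD := by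
  obtain ⟨b, hb⟩ := hM
  have hact : ∀ i r, M.act (𝕩 i (i + c)) (b r) =
      pathScalar n A σ i r • b ⟨pathTarget n i r, pathTarget_lt i r⟩ := by
    intro i r
    rw [hb.act_gen, Finset.sum_eq_single (⟨pathTarget n i r, pathTarget_lt i r⟩ :
        Fin (2 * n + 1)) (fun a _ ha => ?_) (fun h => absurd (Finset.mem_univ _) h)]
    · simp [pathX]
    · simp only [pathX, Matrix.of_apply]
      rw [if_neg (fun h => ha (Fin.ext h.2)), zero_smul]
  refine isSimpleYD_of_basis b (fun r => ?_) fun W hW r r' hr => ?_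
  · obtain ⟨φ, hφ⟩ := exists_path_functional (Z := A ^ 2) hg hh r
    refine ⟨M.coeffOp φ, fun W hW => ((isSubYD_iff M W).mp hW).2 φ, fun i => ?_⟩
    rw [hb.coeffOp_eq]
    simp only [hφ]
    by_cases hi : i = r
    · simp [hi]
    · simp [hi]
  -- a submodule that contains a basis vector contains the whole path: go back to its start, then
  -- forward
  · have hdown : ∀ k (hk : k < 2 * n + 1), b ⟨k, hk⟩ ∈ W → b ⟨0, by omega⟩ ∈ W := by
      intro k
      induction k with
      | zero => exact fun _ h => h
      | succ k ih =>
        intro hk h1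
        refine ih (by omega) ?_
        have h2 := hW.1 (𝕩 (par (k + 1)) (par (k + 1) + c)) _ h1
        have hF : ∀ p : Fin 2, ¬ p = p + 1 := by decide
        rw [hact] at h2
        simp only [pathScalar, pathTarget, par_succ (k + 1), if_neg (hF _),
          if_neg (Nat.succ_ne_zero k), Nat.add_sub_cancel] at h2
        exact (W.smul_mem_iff (pow_ne_zero 2 hA)).mp h2
    have hup : b ⟨0, by omega⟩ ∈ W → ∀ k (hk : k < 2 * n + 1), b ⟨k, hk⟩ ∈ W := by
      intro h0 k
      induction k with
      | zero => exact fun _ => h0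
      | succ k ih =>
        intro hk
        have h2 := hW.1 (𝕩 (par (k + 1)) (par (k + 1) + c)) _ (ih (by omega))
        rw [hact] at h2
        simpa [pathScalar, pathTarget, show k ≠ 2 * n by omega] using h2
    exact hup (hdown r r.2 hr) r' r'.2

end YDModule

end PathSimplicity

/-! ### Conjugation by alternating words -/

section PathConstruction

open SuzukiAlgebra Submodule

section TwoLetters

variable {R : Type*} [Ring R] {a b z : R}

theorem alternating_telescope (ha : a * a = z) (hb : b * b = z) (r : ℕ) :
    (a * b) ^ r * (b * a) ^ r = z ^ (2 * r) := by
  have hza : Commute z a := by rw [← ha]; exact (Commute.refl a).mul_left (Commute.refl a)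
  have hzb : Commute z b := by rw [← hb]; exact (Commute.refl b).mul_left (Commute.refl b)
  induction r with
  | zero => simp
  | succ r ih =>
    have h1 : a * b * (b * a) = z * z := by
      rw [mul_assoc, ← mul_assoc b, hb, hza.eq, ← mul_assoc, ha]
    have h2 : Commute (z * z) ((a * b) ^ r) :=
      ((hza.mul_right hzb).mul_left (hza.mul_right hzb)).pow_right r
    calc (a * b) ^ (r + 1) * (b * a) ^ (r + 1)
        = (a * b) ^ r * (a * b * (b * a)) * (b * a) ^ r := by
          rw [pow_succ, pow_succ' (b * a)]; simp only [mul_assoc]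
      _ = z ^ (2 * (r + 1)) := by
          rw [h1, ← h2.eq, mul_assoc, ih, ← pow_two, ← pow_add]
          congr 1; ring

theorem mul_alternating (r : ℕ) : (a * b) ^ r * a = a * (b * a) ^ r := by
  induction r with
  | zero => simp
  | succ r ih => rw [pow_succ', mul_assoc, ih, pow_succ']; simp only [mul_assoc]

theorem inverse_letter {N : ℕ} [NeZero N] (ha : a * a = z) :
    a ^ (4 * N - 1) = z ^ (2 * N - 1) * a := by
  have hN := NeZero.pos N
  rw [← ha, ← pow_two, ← pow_mul, ← pow_succ]
  congr 1
  omega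

theorem inverse_pair_pow {N : ℕ} [NeZero N] (ha : a * a = z) (hb : b * b = z) (r : ℕ) :
    (a ^ (4 * N - 1) * b ^ (4 * N - 1)) ^ r = z ^ ((4 * N - 2) * r) * (a * b) ^ r := by
  have hN := NeZero.pos N
  have hza : Commute z a := by rw [← ha]; exact (Commute.refl a).mul_left (Commute.refl a)
  have hzb : Commute z b := by rw [← hb]; exact (Commute.refl b).mul_left (Commute.refl b)
  have h1 : a ^ (4 * N - 1) * b ^ (4 * N - 1) = z ^ (4 * N - 2) * (a * b) := by
    rw [inverse_letter ha, inverse_letter hb, mul_assoc, ← mul_assoc a, ← (hza.pow_left _).eq,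
      mul_assoc, ← mul_assoc, ← pow_add]
    congr 2; omega
  rw [h1, ((hza.mul_right hzb).pow_left _).mul_pow, ← pow_mul]

theorem pow_mul_period {N s : ℕ} (hz : z ^ s * z ^ (2 * N) = z ^ s) (r : ℕ) :
    z ^ (s + 2 * N * r) = z ^ s := by
  induction r with
  | zero => simp
  | succ r ih => rw [mul_add, ← add_assoc, pow_add, ih, mul_one, hz]

variable {N n s : ℕ} [NeZero N]

/-- Conjugation by the alternating word `(ab)^n` of a power of a letter. -/
theorem conj_letter (ha : a * a = z) (hb : b * b = z) (hz : z ^ s * z ^ (2 * N) = z ^ s) {σ : ℤ}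
    (hbraid : (a * b) ^ n * a = σ • ((b * a) ^ n * b)) :
    (a * b) ^ n * (z ^ s * a) * (b ^ (4 * N - 1) * a ^ (4 * N - 1)) ^ n = σ • (z ^ s * b) := by
  have hN := NeZero.pos N
  have hza : Commute z a := by rw [← ha]; exact (Commute.refl a).mul_left (Commute.refl a)
  have hzb : Commute z b := by rw [← hb]; exact (Commute.refl b).mul_left (Commute.refl b)
  have h1 : Commute (z ^ s) ((a * b) ^ n) := (hza.mul_right hzb).pow_pow _ _
  have h2 : Commute (z ^ ((4 * N - 2) * n)) (b * (a * b) ^ n) :=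
    (hzb.mul_right ((hza.mul_right hzb).pow_right n)).pow_left _
  rw [inverse_pair_pow hb ha, ← mul_assoc ((a * b) ^ n) (z ^ s), ← h1.eq, mul_assoc (z ^ s), hbraid, mul_alternating,
    mul_smul_comm, smul_mul_assoc]
  congr 1
  calc z ^ s * (b * (a * b) ^ n) * (z ^ ((4 * N - 2) * n) * (b * a) ^ n)
      = z ^ s * z ^ ((4 * N - 2) * n) * (b * ((a * b) ^ n * (b * a) ^ n)) := by
        rw [mul_assoc, ← mul_assoc (b * _), ← h2.eq]; simp only [mul_assoc]
    _ = z ^ (s + 2 * N * (2 * n)) * b := by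
        rw [alternating_telescope ha hb, ← (hzb.pow_left _).eq, ← mul_assoc, ← pow_add, ← pow_add]
        congr 2
        obtain ⟨M, rfl⟩ : ∃ M, N = M + 1 := ⟨N - 1, by omega⟩
        rw [show 4 * (M + 1) - 2 = 4 * M + 2 by omega]; ring
    _ = z ^ s * b := by rw [pow_mul_period hz]

/-- Conjugation by the alternating word `(ab)^n`, with a shift, of another alternating word. -/
theorem conj_alternating (ha : a * a = z) (hb : b * b = z) (hz : z ^ s * z ^ (2 * N) = z ^ s) :
    (a * b) ^ n * (z ^ s * (b * a) ^ n) * (a ^ (4 * N - 1) * b ^ (4 * N - 1)) ^ n =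
      z ^ s * (a * b) ^ n := by
  have hN := NeZero.pos N
  have hza : Commute z a := by rw [← ha]; exact (Commute.refl a).mul_left (Commute.refl a)
  have hzb : Commute z b := by rw [← hb]; exact (Commute.refl b).mul_left (Commute.refl b)
  have h1 : Commute (z ^ s) ((a * b) ^ n) := (hza.mul_right hzb).pow_pow _ _
  rw [inverse_pair_pow ha hb, ← mul_assoc ((a * b) ^ n) (z ^ s), ← h1.eq, mul_assoc (z ^ s),
    alternating_telescope ha hb, ← mul_assoc, ← pow_add, ← pow_add,
    show s + 2 * n + (4 * N - 2) * n = s + 2 * N * (2 * n) from ?_, pow_mul_period hz]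
  obtain ⟨M, rfl⟩ : ∃ M, N = M + 1 := ⟨N - 1, by omega⟩
  rw [show 4 * (M + 1) - 2 = 4 * M + 2 by omega]; ring

theorem fix_letter (ha : a * a = z) (hz : z ^ s * z ^ (2 * N) = z ^ s) :
    a * (z ^ s * a) * a ^ (4 * N - 1) = z ^ s * a := by
  have hN := NeZero.pos N
  have hza : Commute z a := by rw [← ha]; exact (Commute.refl a).mul_left (Commute.refl a)
  rw [← mul_assoc a, ← (hza.pow_left s).eq, mul_assoc _ a a, ha, inverse_letter ha, ← mul_assoc,
    ← pow_succ, ← pow_add, show s + 1 + (2 * N - 1) = s + 2 * N * 1 by omega, pow_mul_period hz]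

theorem fix_alternating (ha : a * a = z) (hb : b * b = z) (hz : z ^ s * z ^ (2 * N) = z ^ s)
    {σ : ℤ} (hbraid : (a * b) ^ n * a = σ • ((b * a) ^ n * b)) :
    a * (z ^ s * (b * a) ^ n) * b ^ (4 * N - 1) = σ • (z ^ s * (b * a) ^ n) := by
  have hN := NeZero.pos N
  have hza : Commute z a := by rw [← ha]; exact (Commute.refl a).mul_left (Commute.refl a)
  have hzb : Commute z b := by rw [← hb]; exact (Commute.refl b).mul_left (Commute.refl b)
  have h2 : Commute (z ^ (2 * N - 1)) ((b * a) ^ n * b) :=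
    (((hzb.mul_right hza).pow_right n).mul_right hzb).pow_left _
  rw [← mul_assoc a, ← (hza.pow_left s).eq, mul_assoc _ a, ← mul_alternating, hbraid,
    mul_smul_comm, smul_mul_assoc, inverse_letter hb]
  congr 1
  calc z ^ s * ((b * a) ^ n * b) * (z ^ (2 * N - 1) * b)
      = z ^ s * z ^ (2 * N - 1) * ((b * a) ^ n * (b * b)) := by
        rw [mul_assoc, ← mul_assoc (_ * b), ← h2.eq]; simp only [mul_assoc]
    _ = z ^ (s + 2 * N * 1) * (b * a) ^ n := by
        rw [hb, ← ((hzb.mul_right hza).pow_right n).eq, ← mul_assoc, ← pow_add, ← pow_succ]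
        congr 2; omega
    _ = z ^ s * (b * a) ^ n := by rw [pow_mul_period hz]

end TwoLetters

variable {K : Type u} [Field K] {N n : ℕ} [NeZero N] {μ lam : ℤˣ}
  {V : Type v} [AddCommGroup V] [Module K V]

local notation "𝔸" => SuzukiAlgebra K N (2 * n + 1) μ lam
local notation "𝕩" => gen K N (2 * n + 1) μ lam
local notation "𝕨" => word (gen K N (2 * n + 1) μ lam)

section Letters

variable (β i : Fin 2)

theorem letter_mul_self : 𝕩 i (i + β) * 𝕩 i (i + β) = 𝕩 0 β ^ 2 := by
  have hX := isSuzukiTuple_gen (K := K) (N := N) (m := 2 * n + 1) (μ := μ) (lam := lam)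
  have hF : ∀ i : Fin 2, i = 0 ∨ i = 1 := by decide
  rcases hF i with rfl | rfl
  · rw [zero_add, pow_two]
  · rw [← pow_two, ← hX.sq_eq 0 β, zero_add, add_comm (1 : Fin 2) β]

theorem sq_pow_period {s : ℕ} (hs : s ≠ 0) :
    (𝕩 0 β ^ 2) ^ s * (𝕩 0 β ^ 2) ^ (2 * N) = (𝕩 0 β ^ 2) ^ s := by
  have hX := isSuzukiTuple_gen (K := K) (N := N) (m := 2 * n + 1) (μ := μ) (lam := lam)
  have := hX.word_mul_idempotent (i := 0) (j := β) rfl hs 0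
  simp only [word, altProd, mul_one] at this
  rw [← pow_mul, ← pow_mul, show 2 * (2 * N) = 4 * N by ring]
  exact this

theorem altProd_even_letters (r : ℕ) : altProd 𝕩 i (i + β) (2 * r) =
    (𝕩 i (i + β) * 𝕩 (i + 1) (i + 1 + β)) ^ r := by
  induction r with
  | zero => simp [altProd]
  | succ r ih =>
    rw [show 2 * (r + 1) = 2 * r + 1 + 1 by ring, altProd_succ, altProd_succ,
      IsSuzukiTuple.fin2_add, IsSuzukiTuple.fin2_add, ih, pow_succ', mul_assoc,
      add_right_comm i β 1]

theorem letter_braid : (𝕩 i (i + β) * 𝕩 (i + 1) (i + 1 + β)) ^ n * 𝕩 i (i + β) =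
    (blockSign lam β : ℤ) • ((𝕩 (i + 1) (i + 1 + β) * 𝕩 i (i + β)) ^ n *
      𝕩 (i + 1) (i + 1 + β)) := by
  have hX := isSuzukiTuple_gen (K := K) (N := N) (m := 2 * n + 1) (μ := μ) (lam := lam)
  have h1 := hX.altProd_top (i + 1) (i + 1 + β)
  rw [IsSuzukiTuple.fin2_add, add_right_comm i 1 β, IsSuzukiTuple.fin2_add, altProd_odd,
    altProd_odd, IsSuzukiTuple.fin2_add, IsSuzukiTuple.fin2_add, add_right_comm i β 1] at h1
  have hF : ∀ i β : Fin 2, i + 1 + (i + 1 + β) = β := by decide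
  rwa [hF] at h1

theorem word_pathLen (s : ℕ) (c : Fin 2) : 𝕨 s (pathLen n c) i (i + β) = (𝕩 0 β ^ 2) ^ s *
    if c = 0 then 𝕩 i (i + β) else (𝕩 i (i + β) * 𝕩 (i + 1) (i + 1 + β)) ^ n := by
  rw [word, pow_mul, pow_two, letter_mul_self]
  congr 1
  by_cases hc : c = 0
  · simp [pathLen, hc, altProd]
  · rw [if_neg hc, pathLen, if_neg hc, altProd_even_letters]

end Letters

variable (lam) in
/-- The sign that appears when the first words of a path in the block `c` are conjugated by an
alternating word of the block `β`. -/
def pathSign (c β : Fin 2) : ℤ := if c = 0 then blockSign lam β else 1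

theorem conj_word_pathLen {s : ℕ} (hs : s ≠ 0) (c β i : Fin 2) :
    (𝕩 i (i + β) * 𝕩 (i + 1) (i + 1 + β)) ^ n * 𝕨 s (pathLen n c) (i + c) (i + c + β) *
      (𝕩 (i + 1 + c) (i + 1 + c + β) ^ (4 * N - 1) * 𝕩 (i + c) (i + c + β) ^ (4 * N - 1)) ^ n =
    pathSign lam c β • 𝕨 s (pathLen n c) (i + c + 1) (i + c + 1 + β) := by
  have ha := letter_mul_self (K := K) (N := N) (n := n) (μ := μ) (lam := lam) β i
  have hb := letter_mul_self (K := K) (N := N) (n := n) (μ := μ) (lam := lam) β (i + 1)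
  have hz := sq_pow_period (K := K) (N := N) (n := n) (μ := μ) (lam := lam) β hs
  have hF : ∀ c : Fin 2, c = 0 ∨ c = 1 := by decide
  rw [word_pathLen, word_pathLen, pathSign]
  rcases hF c with rfl | rfl
  · simp only [add_zero, if_true]
    exact conj_letter ha hb hz (letter_braid β i)
  · simp only [IsSuzukiTuple.fin2_add, if_neg (show ¬ (1 : Fin 2) = 0 by decide), one_smul]
    exact conj_alternating ha hb hz

theorem fix_word_pathLen {s : ℕ} (hs : s ≠ 0) (c β : Fin 2) :
    𝕩 0 β * 𝕨 s (pathLen n c) c (c + β) * 𝕩 c (c + β) ^ (4 * N - 1) =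
    (if c = 0 then 1 else (blockSign lam β : ℤ)) • 𝕨 s (pathLen n c) c (c + β) := by
  have ha := letter_mul_self (K := K) (N := N) (n := n) (μ := μ) (lam := lam) β 0
  have hb := letter_mul_self (K := K) (N := N) (n := n) (μ := μ) (lam := lam) β 1
  have hz := sq_pow_period (K := K) (N := N) (n := n) (μ := μ) (lam := lam) β hs
  have hbr := letter_braid (K := K) (N := N) (n := n) (μ := μ) (lam := lam) β 0
  have hF : ∀ c : Fin 2, c = 0 ∨ c = 1 := by decide
  rw [word_pathLen]
  simp only [zero_add] at ha hbr
  rcases hF c with rfl | rfl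
  · simp only [if_true, zero_add, one_smul]
    exact fix_letter ha hz
  · simp only [if_neg (show ¬ (1 : Fin 2) = 0 by decide), show (1 : Fin 2) + 1 = 0 from rfl,
      zero_add]
    exact fix_alternating ha hb hz hbr

/-- The action of a letter of the block that supports `V` on `y ⊠ g`, with `g` in a block. -/
theorem boxAct_block {ρ : 𝔸 →ₐ[K] Module.End K V} {c β : Fin 2}
    (hρ : ∀ i j, i + j ≠ c → ρ (𝕩 i j) = 0) {g : 𝔸} (hg : ∀ k l, k + l ≠ β → 𝕩 k l * g = 0)
    (i : Fin 2) (y : V) : boxAct ρ (𝕩 i (i + c)) (y ⊗ₜ g) =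
      ρ (𝕩 (i + β) (i + β + c)) y ⊗ₜ[K]
        (𝕩 i (i + β) * g * 𝕩 (i + c) (i + c + β) ^ (4 * N - 1)) := by
  rw [boxAct_gen, Finset.sum_eq_single (i + β), Finset.sum_eq_single (i + β + c),
    add_right_comm i β c]
  · intro e _ he
    have hF : ∀ i β c e : Fin 2, e ≠ i + β + c → i + β + e ≠ c := by decide
    rw [hρ _ _ (hF i β c e he), LinearMap.zero_apply, TensorProduct.zero_tmul]
  · intro h; exact absurd (Finset.mem_univ _) h
  · intro b _ hb
    have hF : ∀ i β b : Fin 2, b ≠ i + β → i + b ≠ β := by decide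
    refine Finset.sum_eq_zero fun e _ => ?_
    rw [hg _ _ (hF i β b hb), zero_mul, TensorProduct.tmul_zero]
  · intro h; exact absurd (Finset.mem_univ _) h

theorem boxAct_block_pow {ρ : 𝔸 →ₐ[K] Module.End K V} {c β : Fin 2}
    (hρ : ∀ i j, i + j ≠ c → ρ (𝕩 i j) = 0) {g : 𝔸} (hg : ∀ k l, k + l ≠ β → 𝕩 k l * g = 0)
    (i : Fin 2) (y : V) (r : ℕ) :
    boxAct ρ ((𝕩 i (i + c) * 𝕩 (i + 1) (i + 1 + c)) ^ r) (y ⊗ₜ g) =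
      ρ ((𝕩 (i + β) (i + β + c) * 𝕩 (i + 1 + β) (i + 1 + β + c)) ^ r) y ⊗ₜ[K]
        ((𝕩 i (i + β) * 𝕩 (i + 1) (i + 1 + β)) ^ r * g *
          (𝕩 (i + 1 + c) (i + 1 + c + β) ^ (4 * N - 1) *
            𝕩 (i + c) (i + c + β) ^ (4 * N - 1)) ^ r) := by
  have hX := isSuzukiTuple_gen (K := K) (N := N) (m := 2 * n + 1) (μ := μ) (lam := lam)
  have hmul : ∀ (i : Fin 2) (g : 𝔸) (k l : Fin 2), k + l ≠ β → 𝕩 k l * (𝕩 i (i + β) * g) = 0 := by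
    intro i g k l hk
    have hF : ∀ i β : Fin 2, i + (i + β) = β := by decide
    rw [← mul_assoc, hX.mul_eq_zero_of_ne (by rwa [hF]), zero_mul]
  induction r with
  | zero => simp
  | succ r ih =>
    have h1 : ∀ k l, k + l ≠ β → 𝕩 k l * ((𝕩 i (i + β) * 𝕩 (i + 1) (i + 1 + β)) ^ r * g *
          (𝕩 (i + 1 + c) (i + 1 + c + β) ^ (4 * N - 1) *
            𝕩 (i + c) (i + c + β) ^ (4 * N - 1)) ^ r) = 0 := by
      intro k l hk
      cases r with
      | zero => simp [hg k l hk]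
      | succ r =>
        rw [pow_succ' (𝕩 i (i + β) * _), mul_assoc (𝕩 i (i + β)), mul_assoc (𝕩 i (i + β)),
          mul_assoc (𝕩 i (i + β)), hmul i _ k l hk]
    rw [pow_succ', map_mul, Module.End.mul_apply, ih, map_mul, Module.End.mul_apply,
      boxAct_block hρ h1, boxAct_block hρ (fun k l hk => by
        rw [mul_assoc (𝕩 (i + 1) _), hmul (i + 1) _ k l hk]),
      pow_succ' (𝕩 (i + β) _ * _), map_mul, map_mul, Module.End.mul_apply, Module.End.mul_apply]
    congr 1
    rw [pow_succ' (𝕩 i (i + β) * _), pow_succ (𝕩 (i + 1 + c) _ ^ _ * _)]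
    simp only [mul_assoc]

theorem boxAct_conj_word {ρ : 𝔸 →ₐ[K] Module.End K V} {c : Fin 2}
    (hρ : ∀ i j, i + j ≠ c → ρ (𝕩 i j) = 0) {s : ℕ} (hs : s ≠ 0) (β i : Fin 2) (y : V) :
    boxAct ρ ((𝕩 i (i + c) * 𝕩 (i + 1) (i + 1 + c)) ^ n)
      (y ⊗ₜ 𝕨 s (pathLen n c) (i + c) (i + c + β)) =
      (pathSign lam c β : K) • (ρ ((𝕩 (i + β) (i + β + c) * 𝕩 (i + 1 + β) (i + 1 + β + c)) ^ n) y
        ⊗ₜ[K] 𝕨 s (pathLen n c) (i + c + 1) (i + c + 1 + β)) := by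
  have hX := isSuzukiTuple_gen (K := K) (N := N) (m := 2 * n + 1) (μ := μ) (lam := lam)
  rw [boxAct_block_pow hρ (fun k l hk => hX.gen_mul_word_eq_zero (by
    have hF : ∀ i β : Fin 2, i + (i + β) = β := by decide
    rwa [hF]) hs _), conj_word_pathLen hs, ← Int.cast_smul_eq_zsmul K, TensorProduct.tmul_smul]

end PathConstruction

/-! ### Paths in `V ⊠ A` -/

section BoxPath

universe v'

open SuzukiAlgebra Submodule

variable {K : Type u} [Field K] {N n : ℕ} [NeZero N] {μ lam : ℤˣ}
  {V : Type v} [AddCommGroup V] [Module K V]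

local notation "𝔸" => SuzukiAlgebra K N (2 * n + 1) μ lam
local notation "𝕩" => gen K N (2 * n + 1) μ lam
local notation "𝕨" => word (gen K N (2 * n + 1) μ lam)

/-- The vectors of `V ⊠ A` obtained by applying the letters of the block `c` alternately to
`u ⊠ W_{cc} + b χ · (u ⊠ W_{c+1,c})`, where `χ` is the alternating word of length `2n`. -/
noncomputable def boxPath (ρ : SuzukiAlgebra K N (2 * n + 1) μ lam →ₐ[K] Module.End K V) (s : ℕ)
    (c : Fin 2) (b : K) (u : V) : ℕ → V ⊗[K] SuzukiAlgebra K N (2 * n + 1) μ lam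
  | 0 => u ⊗ₜ 𝕨 s (pathLen n c) c c +
      b • boxAct ρ (chi K N (2 * n + 1) μ lam 1 (1 + c) (2 * n))
        (u ⊗ₜ 𝕨 s (pathLen n c) (1 + c) c)
  | r + 1 => boxAct ρ (𝕩 (par (r + 1)) (par (r + 1) + c)) (boxPath ρ s c b u r)

theorem pathSign_mul_self (c β : Fin 2) :
    ((pathSign lam c β : ℤ) : K) * ((pathSign lam c β : ℤ) : K) = 1 := by
  rw [← Int.cast_mul, pathSign]
  split_ifs
  · rw [IsSuzukiTuple.units_cast_mul_self, Int.cast_one]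
  · simp

theorem pathSign_zero (c : Fin 2) : pathSign lam c 0 = 1 := by
  simp [pathSign, blockSign]

section

variable {ρ : SuzukiAlgebra K N (2 * n + 1) μ lam →ₐ[K] Module.End K V} {c : Fin 2} {s : ℕ}
  {u : V} {A : K}

theorem boxPath_zero (hρ : ∀ i j, i + j ≠ c → ρ (𝕩 i j) = 0) (hs : s ≠ 0) (b : K) :
    boxPath ρ s c b u 0 = u ⊗ₜ 𝕨 s (pathLen n c) c c + (b * pathSign lam c 1) •
      (ρ ((𝕩 0 c * 𝕩 1 (1 + c)) ^ n) u ⊗ₜ[K] 𝕨 s (pathLen n c) c (c + 1)) := by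
  have h1 := boxAct_conj_word hρ hs 1 1 u
  rw [boxPath, chi, altProd_even_letters]
  have hF : ∀ c : Fin 2, 1 + c + 1 = c ∧ (1 : Fin 2) + 1 = 0 ∧ (0 : Fin 2) + c = c := by decide
  obtain ⟨e1, e2, e3⟩ := hF c
  rw [e1, e2, e3, zero_add] at h1
  rw [e2, zero_add, h1, smul_smul]

/-- The last vector of a path. -/
theorem boxPath_last (hρ : ∀ i j, i + j ≠ c → ρ (𝕩 i j) = 0) (hs : s ≠ 0)
    (hu : ρ (𝕩 0 c) u = A • u) (b : K) :
    boxPath ρ s c b u (2 * n) =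
      ρ ((𝕩 0 c * 𝕩 1 (1 + c)) ^ n) u ⊗ₜ 𝕨 s (pathLen n c) (c + 1) (c + 1) +
        (b * A ^ (4 * n)) • (u ⊗ₜ[K] 𝕨 s (pathLen n c) (c + 1) c) := by
  have ha := letter_mul_self (K := K) (N := N) (n := n) (μ := μ) (lam := lam) c 0
  have hb := letter_mul_self (K := K) (N := N) (n := n) (μ := μ) (lam := lam) c 1
  rw [zero_add] at ha
  have h0 := (boxModule ρ).act_alternating (f := boxPath ρ s c b u) (c := c) (fun _ => rfl) n
  refine h0.trans ?_
  change boxAct ρ _ _ = _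
  have h1 := boxAct_conj_word hρ hs 0 0 u
  have h2 := boxAct_conj_word hρ hs 1 0 (ρ ((𝕩 0 c * 𝕩 1 (1 + c)) ^ n) u)
  have hF : ∀ c : Fin 2, c + 1 + 1 = c ∧ (0 : Fin 2) + 1 = 1 := by decide
  obtain ⟨e1, e2⟩ := hF c
  simp only [zero_add, add_zero, pathSign_zero, Int.cast_one, one_smul] at h1
  simp only [zero_add] at h2
  rw [e1, show (1 : Fin 2) + 1 = 0 from rfl, zero_add, ← Module.End.mul_apply, ← map_mul, alternating_telescope hb ha] at h2
  have hZ : ∀ r, ρ ((𝕩 0 c ^ 2) ^ r) u = A ^ (2 * r) • u := by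
    intro r
    induction r with
    | zero => simp
    | succ r ih =>
      rw [pow_succ', map_mul, Module.End.mul_apply, ih, map_smul, pow_two, map_mul,
        Module.End.mul_apply, hu, map_smul, hu, smul_smul, smul_smul]
      congr 1
      ring
  rw [boxPath_zero hρ hs, map_add, h1, map_smul, h2, hZ, ← TensorProduct.smul_tmul', smul_smul,
    smul_smul]
  congr 2
  rw [mul_assoc b, pathSign_mul_self, mul_one]
  congr 2
  ring

/-- The condition on `b` makes the second summand of the coaction of the first vector a multiple of
the last vector of the path. -/
theorem boxPath_isPath (hρ : ∀ i j, i + j ≠ c → ρ (𝕩 i j) = 0) (hs : s ≠ 0)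
    (hu : ρ (𝕩 0 c) u = A • u) (hA : A ≠ 0) {b : K}
    (hb : b ^ 2 * pathSign lam c 1 * A ^ (4 * n) = 1) :
    (boxModule ρ).IsPath (boxPath ρ s c b u) c A (𝕨 s (pathLen n c) c c)
      ((b * pathSign lam c 1) • 𝕨 s (pathLen n c) c (c + 1)) := by
  have hX := isSuzukiTuple_gen (K := K) (N := N) (m := 2 * n + 1) (μ := μ) (lam := lam)
  have hF : ∀ c : Fin 2, c + c = 0 ∧ c + (c + 1) = 1 := by decide
  obtain ⟨e1, e2⟩ := hF c
  refine ⟨fun _ => rfl, ?_, hA, ?_, fun k l hk => hX.gen_mul_word_eq_zero (by rwa [e1]) hs _,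
    fun k l hk => ?_⟩
  · change boxAct ρ (𝕩 0 c) (boxPath ρ s c b u 0) = A • boxPath ρ s c b u 0
    have h1 := boxAct_block hρ (β := 0) (g := 𝕨 s (pathLen n c) c c)
      (fun k l hk => hX.gen_mul_word_eq_zero (by rwa [e1]) hs _) 0 u
    have h2 := boxAct_block hρ (β := 1) (g := 𝕨 s (pathLen n c) c (c + 1))
      (fun k l hk => hX.gen_mul_word_eq_zero (by rwa [e2]) hs _) 0
      (ρ ((𝕩 0 c * 𝕩 1 (1 + c)) ^ n) u)
    have h3 := fix_word_pathLen (K := K) (N := N) (n := n) (μ := μ) (lam := lam) hs c 0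
    have h4 := fix_word_pathLen (K := K) (N := N) (n := n) (μ := μ) (lam := lam) hs c 1
    have h5 := letter_braid (K := K) (N := N) (n := n) (μ := μ) (lam := lam) c 1
    rw [show (1 : Fin 2) + 1 = 0 from rfl, zero_add, mul_alternating] at h5
    have h6 : ρ (𝕩 1 (1 + c)) (ρ ((𝕩 0 c * 𝕩 1 (1 + c)) ^ n) u) =
        (((blockSign lam c : ℤ) : K) * A) • ρ ((𝕩 0 c * 𝕩 1 (1 + c)) ^ n) u := by
      rw [← Module.End.mul_apply, ← map_mul, h5, ← Int.cast_smul_eq_zsmul K, map_smul,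
        LinearMap.smul_apply, map_mul, Module.End.mul_apply, hu, map_smul, smul_smul]
    have h7 : (if c = 0 then 1 else (blockSign lam 1 : ℤ) : ℤ) * (blockSign lam c : ℤ) = 1 := by
      have hF : ∀ c : Fin 2, c = 0 ∨ c = 1 := by decide
      rcases hF c with rfl | rfl
      · simp [blockSign]
      · rw [if_neg (by decide), IsSuzukiTuple.units_cast_mul_self]
    have h8 : (((if c = 0 then 1 else (blockSign lam 1 : ℤ) : ℤ) : K)) *
        ((blockSign lam c : ℤ) : K) = 1 := by
      rw [← Int.cast_mul, h7, Int.cast_one]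
    have h9 : (if c = 0 then 1 else (blockSign lam 0 : ℤ)) = 1 := by simp [blockSign]
    simp only [zero_add, add_zero] at h1 h2 h3
    rw [h3, h9, one_smul, hu, ← TensorProduct.smul_tmul'] at h1
    rw [h4, h6, ← Int.cast_smul_eq_zsmul K, TensorProduct.tmul_smul,
      ← TensorProduct.smul_tmul', smul_smul, ← mul_assoc, h8, one_mul] at h2
    rw [boxPath_zero hρ hs, map_add, h1, map_smul, h2, smul_add, smul_comm A]
  · have key : boxCoact K 𝔸 V (boxPath ρ s c b u 0) =
        𝕨 s (pathLen n c) c c ⊗ₜ[K] boxPath ρ s c b u 0 +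
          ((b * pathSign lam c 1) • 𝕨 s (pathLen n c) c (c + 1)) ⊗ₜ[K] boxPath ρ s c b u (2 * n) := by
      have hsum : ∀ g : Fin 2 → 𝔸 ⊗[K] (V ⊗[K] 𝔸), ∑ a, g a = g c + g (c + 1) := by
        intro g
        have hF : ∀ c : Fin 2, c = 0 ∨ c = 1 := by decide
        rcases hF c with rfl | rfl
        · simp [Fin.sum_univ_two]
        · simp [Fin.sum_univ_two, add_comm]
      -- the coefficient of the last vector in the coaction is the inverse of its `W_{c+1,c}` component
      have hδ : (b * pathSign lam c 1) * (b * A ^ (4 * n)) = 1 := by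
        linear_combination hb
      rw [boxPath_last hρ hs hu, boxPath_zero hρ hs, map_add, map_smul, boxCoact_word hs,
        boxCoact_word hs, hsum, hsum]
      simp only [TensorProduct.tmul_add, smul_add, TensorProduct.tmul_smul,
        ← TensorProduct.smul_tmul', smul_smul]
      rw [mul_comm (b * A ^ (4 * n)), hδ, one_smul]
      abel
    exact key
  · rw [mul_smul_comm, hX.gen_mul_word_eq_zero (by rwa [e2]) hs, smul_zero]

theorem boxPath_zero_ne_zero (hρ : ∀ i j, i + j ≠ c → ρ (𝕩 i j) = 0) (hs : s ≠ 0) (hu : u ≠ 0)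
    (b : K) : boxPath ρ s c b u 0 ≠ 0 := by
  classical
  intro h
  let φ : Module.Dual K 𝔸 := groupCoeff K (groupWord N n s (pathLen n c) c) ∘ₗ
    (diagHom K N n μ lam).toLinearMap
  have h1 : φ (𝕨 s (pathLen n c) c c) = 1 := by
    rw [LinearMap.comp_apply, AlgHom.toLinearMap_apply, diagHom_word_self, groupCoeff_of, if_pos rfl]
  have h2 : φ (𝕨 s (pathLen n c) c (c + 1)) = 0 := by
    have hF : ∀ c : Fin 2, c ≠ c + 1 := by decide
    rw [LinearMap.comp_apply, AlgHom.toLinearMap_apply, diagHom_word_of_ne hs _ (hF c), map_zero]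
  have h3 := congrArg ((TensorProduct.rid K V).toLinearMap ∘ₗ φ.lTensor V) h
  rw [boxPath_zero hρ hs] at h3
  simp [h1, h2] at h3
  exact hu h3

theorem boxPath_linearIndependent (hρ : ∀ i j, i + j ≠ c → ρ (𝕩 i j) = 0) (hs : s ≠ 0)
    (hu : ρ (𝕩 0 c) u = A • u) (hA : A ≠ 0) {b : K}
    (hb : b ^ 2 * pathSign lam c 1 * A ^ (4 * n) = 1) (hu0 : u ≠ 0) :
    LinearIndependent K (fun r : Fin (2 * n + 1) => boxPath ρ s c b u r) := by
  have hF : ∀ c : Fin 2, c ≠ c + 1 := by decide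
  refine (boxPath_isPath hρ hs hu hA hb).linearIndependent (diagHom_word_self s _ c) ?_
    (boxPath_zero_ne_zero hρ hs hu0 b)
  rw [map_smul, diagHom_word_of_ne hs _ (hF c), smul_zero]

end

theorem trace_pathX (c : Fin 2) (A σ : K) (j : Fin 2) :
    (pathX n c A σ 0 j).trace = if j = c then A else 0 := by
  rw [Matrix.trace]
  simp only [Matrix.diag_apply, pathX, Matrix.of_apply, zero_add]
  split_ifs with hj
  · rw [Finset.sum_eq_single (0 : Fin (2 * n + 1))]
    · simp [hj, pathTarget, pathScalar, par]
    · intro r _ hr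
      rw [if_neg]
      rintro ⟨-, h⟩
      have h0 : r.val ≠ 0 := fun h0 => hr (Fin.ext h0)
      unfold pathTarget at h
      split_ifs at h with h1 h2
      · rw [h2, par_odd] at h1
        exact absurd h1 (by decide)
      · omega
      · omega
    · intro h; exact absurd (Finset.mem_univ _) h
  · simp [hj]

namespace YDModule

variable {M : YDModule.{u, u, v} K (SuzukiAlgebra K N (2 * n + 1) μ lam)}
  {Y : YDModule.{u, u, v'} K (SuzukiAlgebra K N (2 * n + 1) μ lam)}

/-- The structure constants of a path module determine its parameters: the block and the
eigenvalue are read off from the traces of `x_{00}` and `x_{01}`, the degree of the words from a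
diagonal coefficient and the scalar `δ` from the only off-diagonal coefficient that contributes to
a trace, that of the middle vector. -/
theorem path_invariants {ν : K} (hν : ((μ : ℤ) : K) * ν ^ (2 * N) = 1) {s s' : ℕ} (hs : s ≠ 0)
    (hs' : s' ≠ 0) {c c' : Fin 2} {A A' σ σ' δ δ' : K} (hA : A ≠ 0)
    (hinj : c = c' → ((2 * s + pathLen n c : ℕ) : ZMod (2 * N)) = (2 * s' + pathLen n c : ℕ) →
      s = s')
    (hM : M.HasModel (pathX n c A σ) (pathC N n μ lam c (A ^ 2) (𝕨 s (pathLen n c) c c)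
      (δ • 𝕨 s (pathLen n c) c (c + 1))))
    (hY : Y.HasModel (pathX n c' A' σ') (pathC N n μ lam c' (A' ^ 2) (𝕨 s' (pathLen n c') c' c')
      (δ' • 𝕨 s' (pathLen n c') c' (c' + 1))))
    (h : M.Isomorphic Y) : c = c' ∧ A = A' ∧ s = s' ∧ δ = δ' := by
  classical
  have hF : ∀ c : Fin 2, c ≠ c + 1 := by decide
  have h1 := hM.trace_gen hY h 0 c
  rw [trace_pathX, trace_pathX, if_pos rfl] at h1
  have hc : c = c' := by
    by_contra hc
    rw [if_neg hc] at h1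
    exact hA h1
  subst hc
  rw [if_pos rfl] at h1
  subst h1
  have hoff : ∀ (s : ℕ) (_ : s ≠ 0) (δ : K),
      diagHom K N n μ lam (δ • 𝕨 s (pathLen n c) c (c + 1)) = 0 := fun s hs δ => by
    rw [map_smul, diagHom_word_of_ne hs _ (hF c), smul_zero]
  -- the coefficient of the group element of the first vector in the trace of the coaction
  have hss : s = s' := by
    have h2 := hM.trace_coeff hY h (groupCoeff K (groupPath N n c
      (groupWord N n s (pathLen n c) c) 0) ∘ₗ (diagHom K N n μ lam).toLinearMap)
    have h3 : ∀ (s' : ℕ) (_ : s' ≠ 0) (δ' : K),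
        ((pathC N n μ lam c (A ^ 2) (𝕨 s' (pathLen n c) c c)
          (δ' • 𝕨 s' (pathLen n c) c (c + 1))).map (groupCoeff K (groupPath N n c
      (groupWord N n s (pathLen n c) c) 0) ∘ₗ (diagHom K N n μ lam).toLinearMap)).trace =
        ∑ r : Fin (2 * n + 1), if groupPath N n c (groupWord N n s' (pathLen n c) c) r =
          groupPath N n c (groupWord N n s (pathLen n c) c) 0 then 1 else 0 := by
      intro s' hs' δ'
      refine Finset.sum_congr rfl fun r _ => ?_
      rw [Matrix.diag_apply, Matrix.map_apply, LinearMap.comp_apply, AlgHom.toLinearMap_apply,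
        pathC, Matrix.of_apply, if_pos rfl, map_add, diagHom_pathG c (diagHom_word_self s' _ c),
        map_add, groupCoeff_of]
      split_ifs <;> simp [diagHom_pathH c _ (hoff s' hs' δ')]
    rw [h3 s hs, h3 s' hs', Finset.sum_eq_single (0 : Fin (2 * n + 1))] at h2
    · rw [Fin.val_zero, if_pos rfl] at h2
      obtain ⟨r, -, hr⟩ := Finset.exists_ne_zero_of_sum_ne_zero (h2 ▸ one_ne_zero)
      have h4 : groupPath N n c (groupWord N n s' (pathLen n c) c) r =
          groupPath N n c (groupWord N n s (pathLen n c) c) 0 := by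
        by_contra h5
        exact hr (if_neg h5)
      exact hinj rfl (groupPath_inj (by omega) (by omega) h4).2.symm
    · intro r _ hr
      rw [if_neg]
      intro h5
      exact hr (Fin.ext (groupPath_inj (by omega) (by omega) h5).1)
    · intro h; exact absurd (Finset.mem_univ _) h
  subst hss
  refine ⟨rfl, rfl, rfl, ?_⟩
  -- the antidiagonal of the coefficient matrix meets the diagonal in the entry of index `n` only
  obtain ⟨κ₀, hκ₀, h0⟩ := exists_offHom_word (n := n) (lam := lam) ν hν s (pathLen n c) (hF c)
  obtain ⟨κ, γ, hκ, h2⟩ := exists_offHom_pathH (n := n) ν hν c (pow_ne_zero 2 hA)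
    ⟨κ₀, _, hκ₀, h0⟩ n
  have h3 : ∀ δ : K, ((pathC N n μ lam c (A ^ 2) (𝕨 s (pathLen n c) c c)
      (δ • 𝕨 s (pathLen n c) c (c + 1))).map (groupCoeff K γ ∘ₗ
        (offHom n lam ν hν).toLinearMap)).trace = δ * κ := by
    intro δ
    refine (Finset.sum_eq_single (⟨n, by omega⟩ : Fin (2 * n + 1)) (fun r _ hr => ?_)
      (fun h => absurd (Finset.mem_univ _) h)).trans ?_
    · have h5 : r ≠ Fin.rev r := by
        intro h6
        have h7 := congrArg Fin.val h6
        rw [Fin.val_rev] at h7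
        exact hr (Fin.ext (by simp only; omega))
      rw [Matrix.diag_apply, Matrix.map_apply, LinearMap.comp_apply, AlgHom.toLinearMap_apply,
        pathC, Matrix.of_apply, if_pos rfl, if_neg h5, add_zero,
        offHom_pathG ν hν c (offHom_word_self ν hν hs _ c), map_zero]
    · have h5 : (⟨n, by omega⟩ : Fin (2 * n + 1)) = Fin.rev ⟨n, by omega⟩ := by
        apply Fin.ext
        rw [Fin.val_rev]
        simp only
        omega
      rw [Matrix.diag_apply, Matrix.map_apply, LinearMap.comp_apply, AlgHom.toLinearMap_apply,
        pathC, Matrix.of_apply, if_pos rfl, if_pos h5, map_add,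
        offHom_pathG ν hν c (offHom_word_self ν hν hs _ c), zero_add, pathH_smul, map_smul, h2,
        map_smul, map_smul, groupCoeff_of, if_pos rfl, smul_eq_mul, smul_eq_mul, mul_one]
  have h4 := hM.trace_coeff hY h (groupCoeff K γ ∘ₗ (offHom n lam ν hν).toLinearMap)
  rw [h3, h3] at h4
  exact mul_right_cancel₀ hκ h4

end YDModule

end BoxPath

/-! ### Realization of the models inside `V ⊠ A` -/

section Realizations

open SuzukiAlgebra Submodule

variable {K : Type u} [Field K] {N n : ℕ} [NeZero N] {μ lam : ℤˣ}

local notation "𝔸" => SuzukiAlgebra K N (2 * n + 1) μ lam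
local notation "𝕩" => gen K N (2 * n + 1) μ lam
local notation "𝕨" => word (gen K N (2 * n + 1) μ lam)

theorem mono₁_even (s t : ℕ) : (mono₁ (2 * s) t : 𝔸) = 𝕨 s t 1 1 := by
  have hX := isSuzukiTuple_gen (K := K) (N := N) (m := 2 * n + 1) (μ := μ) (lam := lam)
  rw [mono₁, word, hX.pow_diag]
  rfl

theorem mono₁_odd (s t : ℕ) : (mono₁ (2 * s + 1) t : 𝔸) = 𝕨 s (t + 1) 0 0 := by
  rw [mono₁, word, pow_succ, mul_assoc]
  rfl

theorem mono₂_even (s t : ℕ) : (mono₂ (2 * s) t : 𝔸) = 𝕨 s t 1 0 := by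
  have hX := isSuzukiTuple_gen (K := K) (N := N) (m := 2 * n + 1) (μ := μ) (lam := lam)
  rw [mono₂, word, hX.pow_off]
  rfl

theorem mono₂_odd (s t : ℕ) : (mono₂ (2 * s + 1) t : 𝔸) = 𝕨 s (t + 1) 0 1 := by
  rw [mono₂, word, pow_succ, mul_assoc]
  rfl

theorem span_range_eq_of_smul {V ι : Type*} [AddCommGroup V] [Module K V] {P Q : ι → V} (e : ι ≃ ι)
    (a : ι → K) (ha : ∀ i, a i ≠ 0) (h : ∀ i, P (e i) = a i • Q i) :
    span K (Set.range P) = span K (Set.range Q) := by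
  rw [← e.surjective.range_comp P]
  apply le_antisymm
  · rw [span_le]
    rintro _ ⟨i, rfl⟩
    rw [Function.comp_apply, h]
    exact smul_mem _ _ (subset_span ⟨i, rfl⟩)
  · rw [span_le]
    rintro _ ⟨i, rfl⟩
    have : Q i = (a i)⁻¹ • (P ∘ e) i := by
      rw [Function.comp_apply, h, smul_smul, inv_mul_cancel₀ (ha i), one_smul]
    rw [this]
    exact smul_mem _ _ (subset_span ⟨i, rfl⟩)

section Pair

variable {V : Type u} [AddCommGroup V] [Module K V]
  {ρ : SuzukiAlgebra K N (2 * n + 1) μ lam →ₐ[K] Module.End K V} {s t : ℕ}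

/-- The pair modules occur in `V ⊠ A` for `V` with two vectors exchanged by the generators of the
block of the parity of `t`. -/
theorem pair_realization {ν : K} (hν : ((μ : ℤ) : K) * ν ^ (2 * N) = 1) (hs : s ∈ Set.Icc 1 N)
    (ht : t ≤ 2 * n + 1) {c : Fin 2} (hc : par t = c) (hρ : ∀ i j, i + j ≠ c → ρ (𝕩 i j) = 0)
    {y₀ y₁ : V} {γ γ' : K} (hγ : γ * γ' = 1) {B : Fin 2 → K}
    (h₁ : ρ (𝕩 0 c) y₀ = (B 0 * γ) • y₁) (h₂ : ρ (𝕩 1 (1 + c)) y₁ = (B 0 * γ') • y₀)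
    (h₃ : ρ (𝕩 1 (1 + c)) y₀ = (B 1 * γ) • y₁) (h₄ : ρ (𝕩 0 c) y₁ = (B 1 * γ') • y₀)
    (hy₀ : y₀ ≠ 0) (hy₁ : y₁ ≠ 0)
    (hli : t = 0 ∨ t = 2 * n + 1 → LinearIndependent K ![y₀, y₁]) :
    (∃ M : YDModule.{u, u, u} K 𝔸, M.HasModel (pairX c B) (pairC K N (2 * n + 1) μ lam s t)) ∧
    ∀ M : YDModule.{u, u, u} K 𝔸, M.HasModel (pairX c B) (pairC K N (2 * n + 1) μ lam s t) →
      ∀ q : Fin 2 → V ⊗[K] 𝔸,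
      (q = ![y₀ ⊗ₜ 𝕨 s t 0 0 + γ • (y₁ ⊗ₜ 𝕨 s t 0 1), y₁ ⊗ₜ 𝕨 s t 1 1 + γ' • (y₀ ⊗ₜ 𝕨 s t 1 0)] ∨
       q = ![y₁ ⊗ₜ 𝕨 s t 1 1 + γ' • (y₀ ⊗ₜ 𝕨 s t 1 0),
        y₀ ⊗ₜ 𝕨 s t 0 0 + γ • (y₁ ⊗ₜ 𝕨 s t 0 1)]) →
      M.IsomorphicToSub ρ (span K (Set.range q)) := by
  subst hc
  have hγ0 : γ ≠ 0 := left_ne_zero_of_mul_eq_one hγ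
  have hs0 : s ≠ 0 := by have := hs.1; omega
  have hB : ∀ j l, ρ (𝕩 (j + l) (j + l + par t)) (![y₀, γ • y₁] l) =
      B j • ![y₀, γ • y₁] (l + 1) := by
    have e : (1 : Fin 2) + 1 = 0 := rfl
    rw [Fin.forall_fin_two]
    constructor <;> rw [Fin.forall_fin_two] <;> constructor
    · simp [h₁, smul_smul]
    · simp only [zero_add, e, Matrix.cons_val_zero, Matrix.cons_val_one, map_smul, h₂, smul_smul]
      congr 1; linear_combination B 0 * hγ
    · simp [h₃, smul_smul]
    · simp only [zero_add, e, Matrix.cons_val_zero, Matrix.cons_val_one, map_smul, h₄, smul_smul]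
      congr 1; linear_combination B 1 * hγ
  have hmodel := pairVec_isModel hs0 hρ hB
  have hind : LinearIndependent K (pairVec (K := K) N (2 * n + 1) μ lam s t ![y₀, γ • y₁]) := by
    refine pairVec_linearIndependent hν hs ht ?_ fun h => ?_
    · rw [Fin.forall_fin_two]
      exact ⟨hy₀, smul_ne_zero hγ0 hy₁⟩
    · have := hli h
      rw [LinearIndependent.pair_iff] at this ⊢
      intro a b hab
      rw [smul_smul] at hab
      obtain ⟨h1, h2⟩ := this _ _ hab
      exact ⟨h1, (mul_eq_zero.mp h2).resolve_right hγ0⟩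
  refine ⟨hmodel.exists_hasModel hind, fun M hM q hq => ?_⟩
  have hP0 : pairVec (K := K) N (2 * n + 1) μ lam s t ![y₀, γ • y₁] 0 =
      y₀ ⊗ₜ 𝕨 s t 0 0 + γ • (y₁ ⊗ₜ 𝕨 s t 0 1) := by
    simp [pairVec, Fin.sum_univ_two, TensorProduct.smul_tmul']
  have hP1 : pairVec (K := K) N (2 * n + 1) μ lam s t ![y₀, γ • y₁] 1 =
      γ • (y₁ ⊗ₜ 𝕨 s t 1 1 + γ' • (y₀ ⊗ₜ 𝕨 s t 1 0)) := by
    simp only [pairVec, Fin.sum_univ_two, Matrix.cons_val_zero, Matrix.cons_val_one, smul_add,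
      smul_smul, hγ, one_smul, ← TensorProduct.smul_tmul']
    abel
  have hfin := hM.isomorphicToSub hmodel hind
  rcases hq with rfl | rfl
  · refine Eq.subst (motive := fun W => M.IsomorphicToSub ρ W)
      (span_range_eq_of_smul (Equiv.refl _) ![1, γ] ?_ ?_) hfin
    · rw [Fin.forall_fin_two]
      exact ⟨one_ne_zero, hγ0⟩
    · rw [Fin.forall_fin_two]
      exact ⟨hP0.trans (one_smul K _).symm, hP1⟩
  · refine Eq.subst (motive := fun W => M.IsomorphicToSub ρ W)
      (span_range_eq_of_smul (Equiv.swap 0 1) ![γ, 1] ?_ ?_) hfin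
    · rw [Fin.forall_fin_two]
      exact ⟨hγ0, one_ne_zero⟩
    · rw [Fin.forall_fin_two, Equiv.swap_apply_left, Equiv.swap_apply_right]
      exact ⟨hP1, hP0.trans (one_smul K _).symm⟩

/-- The one-dimensional modules occur in `V ⊠ A` for `V` one-dimensional: for words of extreme
length the two vectors of a pair are proportional. -/
theorem line_realization {ν : K} (hν : ((μ : ℤ) : K) * ν ^ (2 * N) = 1) (hs : s ∈ Set.Icc 1 N)
    (ht : t = 0 ∨ t = 2 * n + 1) {c : Fin 2} (hc : par t = c)
    (hρ : ∀ i j, i + j ≠ c → ρ (𝕩 i j) = 0)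
    {y : V} {a : Fin 2 → K} (ha : ∀ i, ρ (𝕩 i (i + c)) y = a i • y)
    (ha' : a 1 = ((blockSign lam c : ℤ) : K) * a 0) {κ : K}
    (hκ : κ * κ = ((blockSign lam c : ℤ) : K)) (hy : y ≠ 0) :
    (∃ M : YDModule.{u, u, u} K 𝔸, M.HasModel (lineX c a) (lineC N (2 * n + 1) μ lam s t κ)) ∧
    ∀ M : YDModule.{u, u, u} K 𝔸, M.HasModel (lineX c a) (lineC N (2 * n + 1) μ lam s t κ) →
      M.IsomorphicToSub ρ (span K (Set.range
        fun _ : Fin 1 => (y ⊗ₜ[K] 𝕨 s t 0 0 + κ • (y ⊗ₜ[K] 𝕨 s t 0 1) : V ⊗[K] 𝔸))) := by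
  subst hc
  have hσ : ((blockSign lam (par t) : ℤ) : K) * ((blockSign lam (par t) : ℤ) : K) = 1 := by
    rw [← Int.cast_mul, IsSuzukiTuple.units_cast_mul_self, Int.cast_one]
  have hκ1 : κ * (κ * ((blockSign lam (par t) : ℤ) : K)) = 1 := by rw [← mul_assoc, hκ, hσ]
  have hκ0 : κ ≠ 0 := left_ne_zero_of_mul_eq_one hκ1
  have hs0 : s ≠ 0 := by have := hs.1; omega
  have ht' : t ≤ 2 * n + 1 := by omega
  have hB : ∀ j l, ρ (𝕩 (j + l) (j + l + par t)) (![y, κ • y] l) =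
      (a j * κ⁻¹) • ![y, κ • y] (l + 1) := by
    have e : (1 : Fin 2) + 1 = 0 := rfl
    have ha₀ := ha 0
    have ha₁ := ha 1
    rw [zero_add] at ha₀
    rw [Fin.forall_fin_two]
    constructor <;> rw [Fin.forall_fin_two] <;> constructor <;>
      simp only [zero_add, add_zero, e, Matrix.cons_val_zero, Matrix.cons_val_one, map_smul,
        ha₀, ha₁, smul_smul] <;> congr 1
    · field_simp
    · field_simp
      linear_combination (κ * κ) * ha' + a 0 * ((blockSign lam (par t) : ℤ) : K) * hκ + a 0 * hσ
    · field_simp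
    · field_simp
      linear_combination a 0 * hκ - ha'
  have hq : pairVec (K := K) N (2 * n + 1) μ lam s t ![y, κ • y] 0 =
      y ⊗ₜ[K] 𝕨 s t 0 0 + κ • (y ⊗ₜ[K] 𝕨 s t 0 1) := by
    simp [pairVec, Fin.sum_univ_two, TensorProduct.smul_tmul']
  have hq' : pairVec (K := K) N (2 * n + 1) μ lam s t ![y, κ • y] 1 =
      κ • pairVec (K := K) N (2 * n + 1) μ lam s t ![y, κ • y] 0 := by
    have h0 := word_extreme (K := K) (N := N) (μ := μ) (lam := lam) (s := s) ht 0 0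
    have h1 := word_extreme (K := K) (N := N) (μ := μ) (lam := lam) (s := s) ht 0 1
    rw [zero_add, if_pos rfl, Int.cast_one, one_smul] at h0
    rw [zero_add, if_neg (by decide), show (1 : Fin 2) + 1 = 0 from rfl] at h1
    rw [hq, pairVec, Fin.sum_univ_two, h0, h1, ← hκ]
    simp only [Matrix.cons_val_zero, Matrix.cons_val_one, TensorProduct.tmul_smul, smul_add,
      ← TensorProduct.smul_tmul', smul_smul]
    abel
  have hmodel := line_isModel (pairVec_isModel hs0 hρ hB) hq'
  have hX : (lineX (par t) fun i => a i * κ⁻¹ * κ) = lineX (par t) a := by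
    congr 1; funext i; field_simp
  rw [hX] at hmodel
  have hind : LinearIndependent K
      (fun _ : Fin 1 => pairVec (K := K) N (2 * n + 1) μ lam s t ![y, κ • y] 0) := by
    obtain ⟨φ, h1, h2⟩ := exists_coordinate (n := n) (lam := lam) hν hs ht' 0 0
    refine linearIndependent_of_separating (fun _ => y) (fun _ => hy) fun r =>
      ⟨(TensorProduct.rid K V).toLinearMap ∘ₗ φ.lTensor V, fun r' => ?_⟩
    rw [if_pos (Subsingleton.elim _ _), hq]
    simp [h1, h2 s hs t ht' 0 1 (Or.inr (Or.inr (Or.inl (by decide))))]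
  refine ⟨hmodel.exists_hasModel hind, fun M hM => ?_⟩
  have := hM.isomorphicToSub hmodel hind
  rwa [hq] at this

theorem path_realization {c : Fin 2} (hρ : ∀ i j, i + j ≠ c → ρ (𝕩 i j) = 0) (hs : s ≠ 0) {u : V}
    {A : K} (hu : ρ (𝕩 0 c) u = A • u) (hA : A ≠ 0) {b : K}
    (hb : b ^ 2 * pathSign lam c 1 * A ^ (4 * n) = 1) (hu0 : u ≠ 0) :
    (∃ M : YDModule.{u, u, u} K 𝔸, M.HasModel (pathX n c A ((blockSign lam c : ℤ) : K))
      (pathC N n μ lam c (A ^ 2) (𝕨 s (pathLen n c) c c)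
        ((b * pathSign lam c 1) • 𝕨 s (pathLen n c) c (c + 1)))) ∧
    ∀ M : YDModule.{u, u, u} K 𝔸, M.HasModel (pathX n c A ((blockSign lam c : ℤ) : K))
      (pathC N n μ lam c (A ^ 2) (𝕨 s (pathLen n c) c c)
        ((b * pathSign lam c 1) • 𝕨 s (pathLen n c) c (c + 1))) →
      M.IsomorphicToSub ρ (span K (Set.range fun r : Fin (2 * n + 1) => boxPath ρ s c b u r)) := by
  have h1 := (boxPath_isPath hρ hs hu hA hb).isModel
  have h2 := boxPath_linearIndependent hρ hs hu hA hb hu0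
  exact ⟨h1.exists_hasModel h2, fun M hM => hM.isomorphicToSub h1 h2⟩

end Pair

end Realizations

/-! ### The two-dimensional modules of the list -/

section ListedModules

open SuzukiAlgebra Submodule

namespace RootChoice

variable {K : Type u} [Field K] {N n : ℕ} [NeZero N] {μ lam : ℤˣ} (R : RootChoice K N n μ lam)

local notation "𝔸" => SuzukiAlgebra K N (2 * n + 1) μ lam
local notation "𝕩" => gen K N (2 * n + 1) μ lam
local notation "𝕨" => word (gen K N (2 * n + 1) μ lam)

section Scalars

theorem neg_one_pow_mul_self (p : ℕ) : ((-1 : K)) ^ p * (-1) ^ p = 1 := by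
  rw [← mul_pow]; simp

theorem lam_mul_self : ((lam : ℤ) : K) * ((lam : ℤ) : K) = 1 := by
  rw [← Int.cast_mul, IsSuzukiTuple.units_cast_mul_self, Int.cast_one]

theorem blockSign_cast_zero : ((blockSign lam 0 : ℤ) : K) = 1 := by simp [blockSign]

theorem blockSign_cast_one : ((blockSign lam 1 : ℤ) : K) = ((lam : ℤ) : K) := by simp [blockSign]

theorem sqrtLam_mul_self : R.sqrtLam * R.sqrtLam = ((lam : ℤ) : K) := by
  rw [← pow_two, R.sqrtLam_sq]

theorem sqrtLam_ne_zero : R.sqrtLam ≠ 0 := fun h =>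
  units_cast_ne_zero (K := K) lam (by rw [← R.sqrtLam_mul_self, h, mul_zero])

theorem muBar_ne_zero : R.muBar ≠ 0 := by
  unfold muBar
  split_ifs
  · exact one_ne_zero
  · exact pow_ne_zero _ R.ω_ne_zero

theorem muTilde_mul_self : R.muTilde * R.muTilde = R.muBar := by
  unfold muTilde muBar
  split_ifs
  · simp
  · ring

theorem muTilde_ne_zero : R.muTilde ≠ 0 := ne_zero_of_mul_pow_eq_one R.muTilde_pow

theorem sqrtMuBar_mul_self : R.sqrtMuBar * R.sqrtMuBar = R.muBar := by
  rw [← pow_two, R.sqrtMuBar_sq, muBar]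

theorem sqrtMuBar_ne_zero : R.sqrtMuBar ≠ 0 := fun h =>
  R.muBar_ne_zero (by rw [← R.sqrtMuBar_mul_self, h, mul_zero])

theorem sqrtLamMuBar_mul_self : R.sqrtLamMuBar * R.sqrtLamMuBar = ((lam : ℤ) : K) * R.muBar := by
  rw [← pow_two, R.sqrtLamMuBar_sq, muBar]

theorem sqrtLamMuBar_ne_zero : R.sqrtLamMuBar ≠ 0 := fun h =>
  mul_ne_zero (units_cast_ne_zero (K := K) lam) R.muBar_ne_zero
    (by rw [← R.sqrtLamMuBar_mul_self, h, mul_zero])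

theorem β_inv (i k : ℕ) : (R.β i k)⁻¹ = R.ω ^ (2 * k * (2 * n + 1) - (2 * i) * N : ℤ) := by
  rw [β, ← zpow_neg]; congr 1; ring

theorem zpow_mul_zpow {a b d : K} {x y z : ℤ} (h : a * b = d) (hz : x + y = z) :
    d * R.ω ^ z = a * R.ω ^ x * (b * R.ω ^ y) := by
  rw [mul_mul_mul_comm, h, ← zpow_add₀ R.ω_ne_zero, hz]

/-- The scalars by which the letters of the block `c` exchange the vectors of a pair. -/
def pairScalars (c : Fin 2) (D : K) (I : ℤ) (k : ℕ) : Fin 2 → K :=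
  ![D * R.ω ^ (2 * k * (2 * n + 1) + 2 * I * N : ℤ),
    ((blockSign lam c : ℤ) : K) * D * R.ω ^ (2 * k * (2 * n + 1) - 2 * I * N : ℤ)]

theorem zpow_half_turn (e : ℤ) : R.ω ^ (e + 2 * N * (2 * n + 1) : ℤ) = -R.ω ^ e := by
  rw [zpow_add₀ R.ω_ne_zero, show (2 * N * (2 * n + 1) : ℤ) = (2 * (2 * n + 1) * N : ℕ) by
    push_cast; ring, zpow_natCast, R.half_turn, mul_neg_one]

/-- The isomorphisms `ℱ_{k+N,p+1} ≅ ℱ_{k,p}` and `𝒢_{k+N,p+1} ≅ 𝒢_{k,p}`. -/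
theorem pairScalars_add (c : Fin 2) (D : K) (I : ℤ) (k : ℕ) :
    R.pairScalars c (-D) I (k + N) = R.pairScalars c D I k := by
  have h1 := R.zpow_half_turn (2 * k * (2 * n + 1) + 2 * I * N)
  have h2 := R.zpow_half_turn (2 * k * (2 * n + 1) - 2 * I * N)
  have e1 : (2 * ((k + N : ℕ) : ℤ) * (2 * n + 1) + 2 * I * N) =
      2 * k * (2 * n + 1) + 2 * I * N + 2 * N * (2 * n + 1) := by push_cast; ring
  have e2 : (2 * ((k + N : ℕ) : ℤ) * (2 * n + 1) - 2 * I * N) =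
      2 * k * (2 * n + 1) - 2 * I * N + 2 * N * (2 * n + 1) := by push_cast; ring
  rw [pairScalars, pairScalars, e1, e2, h1, h2]
  congr 1
  · ring
  · congr 1; ring

end Scalars

section Reps

theorem repV_gen (k : ℕ) (i j : Fin 2) : R.repV k (𝕩 i j) =
    if i = j then algebraMap K _ (R.ω ^ (2 * k * (2 * n + 1) : ℤ)) else 0 := by
  rw [repV, lift_gen]
  fin_cases i <;> fin_cases j <;> rfl

theorem repV'_gen (k : ℕ) (i j : Fin 2) : R.repV' k (𝕩 i j) =
    if i = j then 0 else algebraMap K _ (R.ω ^ (2 * k * (2 * n + 1) : ℤ) * R.muTilde *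
      if i = 0 then 1 else ((lam : ℤ) : K)) := by
  rw [repV', lift_gen]
  fin_cases i <;> fin_cases j <;> simp [offTuple]

theorem repVV_zero_zero (i k : ℕ) (y : Fin 2 → K) : R.repVV i k (𝕩 0 0) y =
    ![R.ω ^ (4 * k * (2 * n + 1) - 2 * (2 * i) * N : ℤ) * y 1,
      R.ω ^ (2 * (2 * i) * N : ℤ) * y 0] := by
  rw [repVV, AlgHom.comp_apply, lift_gen]
  ext a
  fin_cases a <;> simp [diagTuple, Matrix.toLinAlgEquiv'_apply, Matrix.vecHead, Matrix.vecTail]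

theorem repVV_one_one (i k : ℕ) (y : Fin 2 → K) : R.repVV i k (𝕩 1 1) y =
    ![R.ω ^ (4 * k * (2 * n + 1) : ℤ) * y 1, y 0] := by
  rw [repVV, AlgHom.comp_apply, lift_gen]
  ext a
  fin_cases a <;> simp [diagTuple, Matrix.toLinAlgEquiv'_apply, Matrix.vecHead, Matrix.vecTail]

theorem repVV_off (i k : ℕ) (a b : Fin 2) (h : a + b ≠ 0) : R.repVV i k (𝕩 a b) = 0 := by
  rw [repVV, AlgHom.comp_apply, lift_gen]
  fin_cases a <;> fin_cases b <;> first | exact absurd rfl h | simp [diagTuple]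

theorem repVV'_zero_one (i k : ℕ) (y : Fin 2 → K) : R.repVV' i k (𝕩 0 1) y =
    ![R.muBar * R.ω ^ (4 * k * (2 * n + 1) : ℤ) * y 1, y 0] := by
  rw [repVV', AlgHom.comp_apply, lift_gen]
  ext a
  fin_cases a <;> simp [offTuple, Matrix.toLinAlgEquiv'_apply, Matrix.vecHead, Matrix.vecTail]

theorem repVV'_one_zero (i k : ℕ) (y : Fin 2 → K) : R.repVV' i k (𝕩 1 0) y =
    ![((lam : ℤ) : K) * R.muBar * R.ω ^ (4 * k * (2 * n + 1) - 2 * (2 * i) * N : ℤ) * y 1,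
      ((lam : ℤ) : K) * R.ω ^ (2 * (2 * i) * N : ℤ) * y 0] := by
  rw [repVV', AlgHom.comp_apply, lift_gen]
  ext a
  fin_cases a <;> simp [offTuple, Matrix.toLinAlgEquiv'_apply, Matrix.vecHead, Matrix.vecTail]

theorem repVV'_diag (i k : ℕ) (a b : Fin 2) (h : a + b ≠ 1) : R.repVV' i k (𝕩 a b) = 0 := by
  rw [repVV', AlgHom.comp_apply, lift_gen]
  fin_cases a <;> fin_cases b <;> first | exact absurd rfl h | simp [offTuple]

theorem repVV_x₁₁_fst (i k : ℕ) : R.repVV i k (𝕩 0 0) ![1, 0] =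
    (1 * R.ω ^ (2 * (2 * i) * N : ℤ)) • ![0, 1] := by simp [repVV_zero_zero]

theorem repVV_x₁₁_snd (i k : ℕ) : R.repVV i k (𝕩 0 0) ![0, 1] =
    (1 * R.ω ^ (4 * k * (2 * n + 1) - 2 * (2 * i) * N : ℤ)) • ![1, 0] := by simp [repVV_zero_zero]

theorem repVV_x₂₂_fst (i k : ℕ) : R.repVV i k (𝕩 1 1) ![1, 0] =
    (1 * R.ω ^ (0 : ℤ)) • ![0, 1] := by simp [repVV_one_one]

theorem repVV_x₂₂_snd (i k : ℕ) : R.repVV i k (𝕩 1 1) ![0, 1] =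
    (1 * R.ω ^ (4 * k * (2 * n + 1) : ℤ)) • ![1, 0] := by simp [repVV_one_one]

theorem repVV'_x₁₂_fst (i k : ℕ) : R.repVV' i k (𝕩 0 1) ![1, 0] =
    (1 * R.ω ^ (0 : ℤ)) • ![0, 1] := by simp [repVV'_zero_one]

theorem repVV'_x₁₂_snd (i k : ℕ) : R.repVV' i k (𝕩 0 1) ![0, 1] =
    (R.muBar * R.ω ^ (4 * k * (2 * n + 1) : ℤ)) • ![1, 0] := by simp [repVV'_zero_one]

theorem repVV'_x₂₁_fst (i k : ℕ) : R.repVV' i k (𝕩 1 0) ![1, 0] =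
    (((lam : ℤ) : K) * R.ω ^ (2 * (2 * i) * N : ℤ)) • ![0, 1] := by simp [repVV'_one_zero]

theorem repVV'_x₂₁_snd (i k : ℕ) : R.repVV' i k (𝕩 1 0) ![0, 1] =
    (((lam : ℤ) : K) * R.muBar * R.ω ^ (4 * k * (2 * n + 1) - 2 * (2 * i) * N : ℤ)) • ![1, 0] := by
  simp [repVV'_one_zero]

theorem basis_ne_zero : (![1, 0] : Fin 2 → K) ≠ 0 ∧ (![0, 1] : Fin 2 → K) ≠ 0 :=
  ⟨fun h => by simpa using congrFun h 0, fun h => by simpa using congrFun h 1⟩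

theorem linearIndependent_basis : LinearIndependent K ![(![1, 0] : Fin 2 → K), ![0, 1]] := by
  rw [LinearIndependent.pair_iff]
  intro a b hab
  exact ⟨by simpa using congrFun hab 0, by simpa using congrFun hab 1⟩

theorem linearIndependent_basis_swap : LinearIndependent K ![(![0, 1] : Fin 2 → K), ![1, 0]] := by
  rw [LinearIndependent.pair_iff]
  intro a b hab
  exact ⟨by simpa using congrFun hab 1, by simpa using congrFun hab 0⟩

end Reps

/-- A class of Yetter-Drinfeld modules, given by structure constants, is inhabited and consists of
modules isomorphic to the submodule `W` of `V ⊠ A`. -/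
def Realizes (_ : RootChoice K N n μ lam)
    (P : YDModule.{u, u, u} K (SuzukiAlgebra K N (2 * n + 1) μ lam) → Prop) {V : Type u}
    [AddCommGroup V] [Module K V] (ρ : SuzukiAlgebra K N (2 * n + 1) μ lam →ₐ[K] Module.End K V)
    (W : Submodule K (V ⊗[K] SuzukiAlgebra K N (2 * n + 1) μ lam)) : Prop :=
  (∃ M, P M) ∧ ∀ M, P M → M.IsomorphicToSub ρ W

/-- `M` has a basis of two vectors as in `pairVec`, with the scalars `pairScalars`. -/
def IsPair (c : Fin 2) (s t : ℕ) (D : K) (I : ℤ) (k : ℕ)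
    (M : YDModule.{u, u, u} K (SuzukiAlgebra K N (2 * n + 1) μ lam)) : Prop :=
  M.HasModel (pairX c (R.pairScalars c D I k)) (pairC K N (2 * n + 1) μ lam s t)

/-- `M` is one-dimensional, with the structure constants of `v ⊠ (W_{00} + κ W_{01})`. -/
def IsLine (_ : RootChoice K N n μ lam) (c : Fin 2) (s t : ℕ) (a κ : K)
    (M : YDModule.{u, u, u} K (SuzukiAlgebra K N (2 * n + 1) μ lam)) : Prop :=
  M.HasModel (lineX c ![a, ((blockSign lam c : ℤ) : K) * a]) (lineC N (2 * n + 1) μ lam s t κ)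

/-- `M` has a basis of `2n+1` vectors as in `boxPath`. -/
def HasPath (_ : RootChoice K N n μ lam) (c : Fin 2) (s : ℕ) (A δ : K)
    (M : YDModule.{u, u, u} K (SuzukiAlgebra K N (2 * n + 1) μ lam)) : Prop :=
  M.HasModel (pathX n c A ((blockSign lam c : ℤ) : K))
    (pathC N n μ lam c (A ^ 2) (𝕨 s (pathLen n c) c c) (δ • 𝕨 s (pathLen n c) c (c + 1)))

section Pairs

variable {s t : ℕ}

/-- The listed vectors of `V_{jk} ⊠ A` whose `v₁` is paired with the word `W_{00}`. -/
theorem realizes_VV (hs : s ∈ Set.Icc 1 N) (i k p : ℕ) (ht : t ≤ 2 * n + 1) (hp : par t = 0)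
    {q : Fin 2 → (Fin 2 → K) ⊗[K] SuzukiAlgebra K N (2 * n + 1) μ lam}
    (hq : q = ![![1, 0] ⊗ₜ 𝕨 s t 0 0 + ((-1) ^ p * R.β i k) • (![0, 1] ⊗ₜ 𝕨 s t 0 1),
      ![0, 1] ⊗ₜ 𝕨 s t 1 1 + ((-1) ^ p * (R.β i k)⁻¹) • (![1, 0] ⊗ₜ 𝕨 s t 1 0)]) :
    R.Realizes (R.IsPair 0 s t ((-1) ^ p) i k) (R.repVV i k) (span K (Set.range q)) := by
  have hε := neg_one_pow_mul_self (K := K) p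
  have hε' : ((blockSign lam 0 : ℤ) : K) * (-1) ^ p * (-1) ^ p = 1 := by
    rw [blockSign_cast_zero, one_mul, hε]
  rw [β_inv, β] at hq
  have h := pair_realization (ρ := R.repVV i k) R.muTilde_pow hs ht hp (R.repVV_off i k)
    (γ := (-1) ^ p * R.ω ^ ((2 * i) * N - 2 * k * (2 * n + 1) : ℤ))
    (γ' := (-1) ^ p * R.ω ^ (2 * k * (2 * n + 1) - (2 * i) * N : ℤ))
    (B := R.pairScalars 0 ((-1) ^ p) i k)
    ((R.zpow_mul_zpow (z := 0) hε (by ring)).symm.trans (by rw [zpow_zero, mul_one]))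
    ((R.repVV_x₁₁_fst i k).trans (congrArg (· • _) (R.zpow_mul_zpow hε (by ring))))
    ((R.repVV_x₂₂_snd i k).trans (congrArg (· • _) (R.zpow_mul_zpow hε (by ring))))
    ((R.repVV_x₂₂_fst i k).trans (congrArg (· • _) (R.zpow_mul_zpow hε' (by ring))))
    ((R.repVV_x₁₁_snd i k).trans (congrArg (· • _) (R.zpow_mul_zpow hε' (by ring))))
    basis_ne_zero.1 basis_ne_zero.2 (fun _ => linearIndependent_basis)
  exact ⟨h.1, fun M hM => h.2 M hM q (Or.inl hq)⟩

/-- The listed vectors of `V_{jk} ⊠ A` whose `v₁` is paired with `W_{11}`; exchanging the two basis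
vectors changes the sign of the twist. -/
theorem realizes_VV_swap (hs : s ∈ Set.Icc 1 N) (i k p : ℕ) (ht : t ≤ 2 * n + 1) (hp : par t = 0)
    {q : Fin 2 → (Fin 2 → K) ⊗[K] SuzukiAlgebra K N (2 * n + 1) μ lam}
    (hq : q = ![![1, 0] ⊗ₜ 𝕨 s t 1 1 + ((-1) ^ p * R.β i k) • (![0, 1] ⊗ₜ 𝕨 s t 1 0),
      ![0, 1] ⊗ₜ 𝕨 s t 0 0 + ((-1) ^ p * (R.β i k)⁻¹) • (![1, 0] ⊗ₜ 𝕨 s t 0 1)]) :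
    R.Realizes (R.IsPair 0 s t ((-1) ^ p) (-i) k) (R.repVV i k) (span K (Set.range q)) := by
  have hε := neg_one_pow_mul_self (K := K) p
  have hε' : ((blockSign lam 0 : ℤ) : K) * (-1) ^ p * (-1) ^ p = 1 := by
    rw [blockSign_cast_zero, one_mul, hε]
  rw [β_inv, β] at hq
  have h := pair_realization (ρ := R.repVV i k) R.muTilde_pow hs ht hp (R.repVV_off i k)
    (γ := (-1) ^ p * R.ω ^ (2 * k * (2 * n + 1) - (2 * i) * N : ℤ))
    (γ' := (-1) ^ p * R.ω ^ ((2 * i) * N - 2 * k * (2 * n + 1) : ℤ))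
    (B := R.pairScalars 0 ((-1) ^ p) (-i) k)
    ((R.zpow_mul_zpow (z := 0) hε (by ring)).symm.trans (by rw [zpow_zero, mul_one]))
    ((R.repVV_x₁₁_snd i k).trans (congrArg (· • _) (R.zpow_mul_zpow hε (by ring))))
    ((R.repVV_x₂₂_fst i k).trans (congrArg (· • _) (R.zpow_mul_zpow hε (by ring))))
    ((R.repVV_x₂₂_snd i k).trans (congrArg (· • _) (R.zpow_mul_zpow hε' (by ring))))
    ((R.repVV_x₁₁_fst i k).trans (congrArg (· • _) (R.zpow_mul_zpow hε' (by ring))))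
    basis_ne_zero.2 basis_ne_zero.1 (fun _ => linearIndependent_basis_swap)
  exact ⟨h.1, fun M hM => h.2 M hM q (Or.inr hq)⟩

/-- The listed vectors of `V'_{jk} ⊠ A` whose `v₁'` is paired with `W_{00}`. -/
theorem realizes_VV' (hs : s ∈ Set.Icc 1 N) (i k p : ℕ) (ht : t ≤ 2 * n + 1) (hp : par t = 1)
    {q : Fin 2 → (Fin 2 → K) ⊗[K] SuzukiAlgebra K N (2 * n + 1) μ lam}
    (hq : q = ![![1, 0] ⊗ₜ 𝕨 s t 0 0 +
        ((-1) ^ p / R.sqrtLamMuBar * R.β i k) • (![0, 1] ⊗ₜ 𝕨 s t 0 1),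
      ![0, 1] ⊗ₜ 𝕨 s t 1 1 +
        ((-1) ^ p * R.sqrtLamMuBar * (R.β i k)⁻¹) • (![1, 0] ⊗ₜ 𝕨 s t 1 0)]) :
    R.Realizes (R.IsPair 1 s t ((-1) ^ p * R.sqrtLamMuBar) (-i) k) (R.repVV' i k)
      (span K (Set.range q)) := by
  have hε := neg_one_pow_mul_self (K := K) p
  have hη := R.sqrtLamMuBar_mul_self
  have hη0 := R.sqrtLamMuBar_ne_zero
  have hl := lam_mul_self (K := K) (lam := lam)
  have h1 : (-1) ^ p * R.sqrtLamMuBar * ((-1) ^ p / R.sqrtLamMuBar) = 1 := by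
    field_simp; linear_combination hε
  have h2 : (-1) ^ p * R.sqrtLamMuBar * ((-1) ^ p * R.sqrtLamMuBar) =
      ((lam : ℤ) : K) * R.muBar := by
    linear_combination R.sqrtLamMuBar * R.sqrtLamMuBar * hε + hη
  rw [β_inv, β] at hq
  have h := pair_realization (ρ := R.repVV' i k) R.muTilde_pow hs ht hp (R.repVV'_diag i k)
    (γ := (-1) ^ p / R.sqrtLamMuBar * R.ω ^ ((2 * i) * N - 2 * k * (2 * n + 1) : ℤ))
    (γ' := (-1) ^ p * R.sqrtLamMuBar * R.ω ^ (2 * k * (2 * n + 1) - (2 * i) * N : ℤ))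
    (B := R.pairScalars 1 ((-1) ^ p * R.sqrtLamMuBar) (-i) k)
    ((R.zpow_mul_zpow (z := 0) ((mul_comm _ _).trans h1) (by ring)).symm.trans (by rw [zpow_zero, mul_one]))
    ((R.repVV'_x₁₂_fst i k).trans (congrArg (· • _) (R.zpow_mul_zpow h1 (by ring))))
    ((R.repVV'_x₂₁_snd i k).trans (congrArg (· • _) (R.zpow_mul_zpow h2 (by ring))))
    ((R.repVV'_x₂₁_fst i k).trans (congrArg (· • _) (R.zpow_mul_zpow
      (by rw [blockSign_cast_one]; linear_combination ((lam : ℤ) : K) * h1) (by ring))))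
    ((R.repVV'_x₁₂_snd i k).trans (congrArg (· • _) (R.zpow_mul_zpow
      (by rw [blockSign_cast_one]; linear_combination ((lam : ℤ) : K) * h2 + R.muBar * hl)
      (by ring))))
    basis_ne_zero.1 basis_ne_zero.2 (fun _ => linearIndependent_basis)
  exact ⟨h.1, fun M hM => h.2 M hM q (Or.inl hq)⟩

/-- The listed vectors of `V'_{jk} ⊠ A` whose `v₁'` is paired with `W_{11}`. -/
theorem realizes_VV'_swap (hs : s ∈ Set.Icc 1 N) (i k p : ℕ) (ht : t ≤ 2 * n + 1)
    (hp : par t = 1) {q : Fin 2 → (Fin 2 → K) ⊗[K] SuzukiAlgebra K N (2 * n + 1) μ lam}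
    (hq : q = ![![1, 0] ⊗ₜ 𝕨 s t 1 1 +
        ((-1) ^ p / R.sqrtLamMuBar * R.β i k) • (![0, 1] ⊗ₜ 𝕨 s t 1 0),
      ![0, 1] ⊗ₜ 𝕨 s t 0 0 +
        ((-1) ^ p * R.sqrtLamMuBar * (R.β i k)⁻¹) • (![1, 0] ⊗ₜ 𝕨 s t 0 1)]) :
    R.Realizes (R.IsPair 1 s t (((lam : ℤ) : K) * ((-1) ^ p * R.sqrtLamMuBar)) i k) (R.repVV' i k)
      (span K (Set.range q)) := by
  have hε := neg_one_pow_mul_self (K := K) p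
  have hη := R.sqrtLamMuBar_mul_self
  have hη0 := R.sqrtLamMuBar_ne_zero
  have hl := lam_mul_self (K := K) (lam := lam)
  have h1 : (-1) ^ p * R.sqrtLamMuBar * ((-1) ^ p / R.sqrtLamMuBar) = 1 := by
    field_simp; linear_combination hε
  have h2 : (-1) ^ p * R.sqrtLamMuBar * ((-1) ^ p * R.sqrtLamMuBar) =
      ((lam : ℤ) : K) * R.muBar := by
    linear_combination R.sqrtLamMuBar * R.sqrtLamMuBar * hε + hη
  rw [β_inv, β] at hq
  have h := pair_realization (ρ := R.repVV' i k) R.muTilde_pow hs ht hp (R.repVV'_diag i k)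
    (γ := (-1) ^ p * R.sqrtLamMuBar * R.ω ^ (2 * k * (2 * n + 1) - (2 * i) * N : ℤ))
    (γ' := (-1) ^ p / R.sqrtLamMuBar * R.ω ^ ((2 * i) * N - 2 * k * (2 * n + 1) : ℤ))
    (B := R.pairScalars 1 (((lam : ℤ) : K) * ((-1) ^ p * R.sqrtLamMuBar)) i k)
    ((R.zpow_mul_zpow (z := 0) h1 (by ring)).symm.trans (by rw [zpow_zero, mul_one]))
    ((R.repVV'_x₁₂_snd i k).trans (congrArg (· • _) (R.zpow_mul_zpow
      (by linear_combination ((lam : ℤ) : K) * h2 + R.muBar * hl) (by ring))))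
    ((R.repVV'_x₂₁_fst i k).trans (congrArg (· • _) (R.zpow_mul_zpow
      (by linear_combination ((lam : ℤ) : K) * h1) (by ring))))
    ((R.repVV'_x₂₁_snd i k).trans (congrArg (· • _) (R.zpow_mul_zpow
      (by rw [blockSign_cast_one]; linear_combination ((lam : ℤ) : K) ^ 2 * h2 +
        ((lam : ℤ) : K) * R.muBar * hl) (by ring))))
    ((R.repVV'_x₁₂_fst i k).trans (congrArg (· • _) (R.zpow_mul_zpow
      (by rw [blockSign_cast_one]; linear_combination ((lam : ℤ) : K) ^ 2 * h1 + hl) (by ring))))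
    basis_ne_zero.2 basis_ne_zero.1 (fun _ => linearIndependent_basis_swap)
  exact ⟨h.1, fun M hM => h.2 M hM q (Or.inr hq)⟩

end Pairs

section Families

variable {s t : ℕ}

theorem realizes_C (hs : s ∈ Set.Icc 1 N) (ht : t < n) (i k p : ℕ) :
    R.Realizes (R.IsPair 0 s (2 * t + 2) ((-1) ^ p) (-i) k) (R.repVV i k)
      (span K (Set.range (R.vecC s t i k p))) :=
  R.realizes_VV_swap hs i k p (by omega) (by rw [par_add_two, par_even])
    (by rw [vecC, mono₁_even, mono₂_even, mono₁_odd, mono₂_odd])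

theorem realizes_D (hs : s ∈ Set.Icc 1 N) (ht : t < n) (i k p : ℕ) :
    R.Realizes (R.IsPair 0 s (2 * t + 2) ((-1) ^ p) i k) (R.repVV i k)
      (span K (Set.range (R.vecD s t i k p))) :=
  R.realizes_VV hs i k p (by omega) (by rw [par_add_two, par_even])
    (by rw [vecD, mono₁_even, mono₂_even, mono₁_odd, mono₂_odd])

theorem realizes_E (hs : s ∈ Set.Icc 1 N) (i k p : ℕ) :
    R.Realizes (R.IsPair 0 s 0 ((-1) ^ p) i k) (R.repVV i k)
      (span K (Set.range (R.vecE s i k p))) := by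
  have h0 := word_extreme (K := K) (N := N) (n := n) (μ := μ) (lam := lam) (s := s)
    (Or.inl rfl) 0 0
  have h1 := word_extreme (K := K) (N := N) (n := n) (μ := μ) (lam := lam) (s := s)
    (Or.inl rfl) 0 1
  rw [zero_add, if_pos rfl, Int.cast_one, one_smul] at h0
  rw [zero_add, if_neg (by decide), show (1 : Fin 2) + 1 = 0 from rfl, show par 0 = 0 from rfl,
    blockSign_cast_zero, one_smul] at h1
  refine R.realizes_VV hs i k p (by omega) rfl ?_
  rw [vecE, mono₁_even, mono₂_even, h0, h1]

theorem realizes_H (hs : s ∈ Set.Icc 1 N) (ht : t < n) (i k p : ℕ) :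
    R.Realizes (R.IsPair 1 s (2 * t + 1) (((lam : ℤ) : K) * ((-1) ^ p * R.sqrtLamMuBar)) i k)
      (R.repVV' i k) (span K (Set.range (R.vecH s t i k p))) :=
  R.realizes_VV'_swap hs i k p (by omega) (par_odd t)
    (by rw [vecH, mono₁_even, mono₂_even, mono₁_odd, mono₂_odd])

theorem realizes_I (hs : s ∈ Set.Icc 1 N) (ht : t ≤ n) (i k p : ℕ) :
    R.Realizes (R.IsPair 1 s (2 * t + 1) ((-1) ^ p * R.sqrtLamMuBar) (-i) k)
      (R.repVV' i k) (span K (Set.range (R.vecI s t i k p))) :=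
  R.realizes_VV' hs i k p (by omega) (par_odd t)
    (by rw [vecI, mono₁_even, mono₂_even, mono₁_odd, mono₂_odd])

end Families

end RootChoice

end ListedModules

/-! ### The remaining modules of the list -/

section ListedLinesAndPaths

open SuzukiAlgebra Submodule

namespace RootChoice

variable {K : Type u} [Field K] {N n : ℕ} [NeZero N] {μ lam : ℤˣ} (R : RootChoice K N n μ lam)

local notation "𝔸" => SuzukiAlgebra K N (2 * n + 1) μ lam
local notation "𝕩" => gen K N (2 * n + 1) μ lam
local notation "𝕨" => word (gen K N (2 * n + 1) μ lam)

theorem repV_off (k : ℕ) (a b : Fin 2) (h : a + b ≠ 0) : R.repV k (𝕩 a b) = 0 := by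
  have hF : ∀ a b : Fin 2, a + b ≠ 0 → a ≠ b := by decide
  rw [repV_gen, if_neg (hF a b h)]

theorem repV'_diag (k : ℕ) (a b : Fin 2) (h : a + b ≠ 1) : R.repV' k (𝕩 a b) = 0 := by
  have hF : ∀ a b : Fin 2, a + b ≠ 1 → a = b := by decide
  rw [repV'_gen, if_pos (hF a b h)]

theorem repV_diag_apply (k : ℕ) (a : Fin 2) (y : Fin 1 → K) : R.repV k (𝕩 a a) y =
    R.ω ^ (2 * k * (2 * n + 1) : ℤ) • y := by
  rw [repV_gen, if_pos rfl, Module.algebraMap_end_apply]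

theorem repV'_off_apply (k : ℕ) (a : Fin 2) (y : Fin 1 → K) : R.repV' k (𝕩 a (a + 1)) y =
    (((blockSign lam a : ℤ) : K) * (R.ω ^ (2 * k * (2 * n + 1) : ℤ) * R.muTilde)) • y := by
  have hF : ∀ a : Fin 2, a ≠ a + 1 := by decide
  rw [repV'_gen, if_neg (hF a), Module.algebraMap_end_apply]
  congr 1
  unfold blockSign
  split_ifs <;> simp [mul_comm]

theorem one_ne_zero_fin_one : (![1] : Fin 1 → K) ≠ 0 := fun h => by simpa using congrFun h 0

theorem realizes_A {s : ℕ} (hs : s ∈ Set.Icc 1 N) (k p : ℕ) :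
    R.Realizes (R.IsLine 0 s 0 (R.ω ^ (2 * k * (2 * n + 1) : ℤ)) ((-1) ^ p)) (R.repV k)
      (span K (Set.range (R.vecA s p))) := by
  have h := line_realization (ρ := R.repV k) R.muTilde_pow hs (c := 0) (Or.inl rfl) rfl (R.repV_off k)
    (y := ![1]) (a := ![R.ω ^ (2 * k * (2 * n + 1) : ℤ),
      ((blockSign lam 0 : ℤ) : K) * R.ω ^ (2 * k * (2 * n + 1) : ℤ)]) (κ := (-1) ^ p)
    (fun i => ?_) rfl ?_ one_ne_zero_fin_one
  · refine ⟨h.1, fun M hM => ?_⟩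
    convert h.2 M hM using 3
    funext r
    rw [Subsingleton.elim r 0, vecA]
    have h0 := word_extreme (K := K) (N := N) (n := n) (μ := μ) (lam := lam) (s := s)
      (Or.inl rfl) 0 0
    have h1 := word_extreme (K := K) (N := N) (n := n) (μ := μ) (lam := lam) (s := s)
      (Or.inl rfl) 0 1
    rw [zero_add, if_pos rfl, Int.cast_one, one_smul] at h0
    rw [zero_add, if_neg (by decide), show (1 : Fin 2) + 1 = 0 from rfl, show par 0 = 0 from rfl,
      blockSign_cast_zero, one_smul] at h1
    rw [mono₁_even, mono₂_even, h0, h1]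
    simp [TensorProduct.tmul_add]
  · have hF : ∀ i : Fin 2, i = 0 ∨ i = 1 := by decide
    rw [add_zero, repV_diag_apply]
    rcases hF i with rfl | rfl <;> simp [blockSign]
  · rw [neg_one_pow_mul_self, blockSign_cast_zero]

theorem realizes_B {s : ℕ} (hs : s ∈ Set.Icc 1 N) (k p : ℕ) :
    R.Realizes (R.IsLine 1 s (2 * n + 1) (R.ω ^ (2 * k * (2 * n + 1) : ℤ) * R.muTilde)
      ((-1) ^ p * R.sqrtLam)) (R.repV' k) (span K (Set.range (R.vecB s p))) := by
  have h := line_realization (ρ := R.repV' k) R.muTilde_pow hs (Or.inr rfl) (par_odd n)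
    (R.repV'_diag k) (y := ![1]) (a := ![R.ω ^ (2 * k * (2 * n + 1) : ℤ) * R.muTilde,
      ((blockSign lam 1 : ℤ) : K) * (R.ω ^ (2 * k * (2 * n + 1) : ℤ) * R.muTilde)])
    (κ := (-1) ^ p * R.sqrtLam) (fun i => ?_) rfl ?_ one_ne_zero_fin_one
  · refine ⟨h.1, fun M hM => ?_⟩
    convert h.2 M hM using 3
    funext r
    rw [Subsingleton.elim r 0, vecB, mono₁_odd, mono₂_odd]
    simp [TensorProduct.tmul_add]
  · have hF : ∀ i : Fin 2, i = 0 ∨ i = 1 := by decide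
    rw [repV'_off_apply]
    rcases hF i with rfl | rfl <;> simp [blockSign]
  · rw [mul_mul_mul_comm, neg_one_pow_mul_self, one_mul, R.sqrtLam_mul_self, blockSign_cast_one]

theorem realizes_F {s t : ℕ} (hs : s ∈ Set.Icc 1 N) (ht : t < n) (k p : ℕ) :
    R.Realizes (R.IsPair 0 s (2 * t + 2) ((-1) ^ p) 0 k) (R.repV k)
      (span K (Set.range (R.vecF s t p))) := by
  have hε := neg_one_pow_mul_self (K := K) p
  have hB : ∀ a : Fin 2, R.pairScalars 0 ((-1) ^ p) 0 k a * (-1) ^ p =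
      R.ω ^ (2 * k * (2 * n + 1) : ℤ) := by
    rw [Fin.forall_fin_two]
    constructor <;>
      simp only [pairScalars, Matrix.cons_val_zero, Matrix.cons_val_one, blockSign_cast_zero,
        one_mul, Matrix.cons_val_fin_one, mul_zero, zero_mul, add_zero, sub_zero]
    all_goals linear_combination R.ω ^ (2 * k * (2 * n + 1) : ℤ) * hε
  have hact : ∀ a b : Fin 2, R.repV k (𝕩 a a) ![1] =
      (R.pairScalars 0 ((-1) ^ p) 0 k b * (-1) ^ p) • ![1] := fun a b => by
    rw [hB, repV_diag_apply]
  have h := pair_realization (ρ := R.repV k) R.muTilde_pow hs (t := 2 * t + 2) (by omega)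
    (by rw [par_add_two, par_even]) (R.repV_off k) hε (hact 0 0) (hact 1 0) (hact 1 1) (hact 0 1)
    one_ne_zero_fin_one one_ne_zero_fin_one (fun h => by omega)
  refine ⟨h.1, fun M hM => h.2 M hM _ (Or.inl ?_)⟩
  rw [vecF, mono₁_even, mono₂_even, mono₁_odd, mono₂_odd]
  simp only [TensorProduct.tmul_add, TensorProduct.tmul_smul]

theorem realizes_G {s t : ℕ} (hs : s ∈ Set.Icc 1 N) (ht : t < n) (k p : ℕ) :
    R.Realizes (R.IsPair 1 s (2 * t + 1) ((-1) ^ p * (R.sqrtLam * R.muTilde)) 0 k) (R.repV' k)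
      (span K (Set.range (R.vecG s t p))) := by
  have hε := neg_one_pow_mul_self (K := K) p
  have hl := R.sqrtLam_mul_self
  have hll := lam_mul_self (K := K) (lam := lam)
  have hl0 := R.sqrtLam_ne_zero
  have hγ : (-1) ^ p / R.sqrtLam * ((-1) ^ p * R.sqrtLam) = 1 := by
    field_simp; linear_combination hε
  have h0 := R.repV'_off_apply k 0 ![1]
  have h1 := R.repV'_off_apply k 1 ![1]
  rw [blockSign_cast_zero, one_mul, zero_add] at h0
  rw [blockSign_cast_one] at h1
  have e0 : R.pairScalars 1 ((-1) ^ p * (R.sqrtLam * R.muTilde)) 0 k 0 =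
      (-1) ^ p * (R.sqrtLam * R.muTilde) * R.ω ^ (2 * k * (2 * n + 1) : ℤ) := by
    simp [pairScalars]
  have e1 : R.pairScalars 1 ((-1) ^ p * (R.sqrtLam * R.muTilde)) 0 k 1 = ((lam : ℤ) : K) *
      ((-1) ^ p * (R.sqrtLam * R.muTilde)) * R.ω ^ (2 * k * (2 * n + 1) : ℤ) := by
    simp [pairScalars, blockSign_cast_one]
  have h := pair_realization (ρ := R.repV' k) R.muTilde_pow hs (t := 2 * t + 1) (by omega)
    (par_odd t) (R.repV'_diag k) hγ (B := R.pairScalars 1 ((-1) ^ p * (R.sqrtLam * R.muTilde)) 0 k)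
    (h0.trans (congrArg (· • _) ?_)) (h1.trans (congrArg (· • _) ?_))
    (h1.trans (congrArg (· • _) ?_)) (h0.trans (congrArg (· • _) ?_))
    one_ne_zero_fin_one one_ne_zero_fin_one (fun h => by omega)
  · refine ⟨h.1, fun M hM => h.2 M hM _ (Or.inr ?_)⟩
    rw [vecG, mono₁_even, mono₂_even, mono₁_odd, mono₂_odd]
    simp only [TensorProduct.tmul_add, TensorProduct.tmul_smul]
  · rw [e0]
    linear_combination -(R.muTilde * R.ω ^ (2 * k * (2 * n + 1) : ℤ)) * hγ
  · rw [e0]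
    linear_combination -(R.muTilde * R.ω ^ (2 * k * (2 * n + 1) : ℤ)) *
      (R.sqrtLam * R.sqrtLam * hε + hl)
  · rw [e1]
    linear_combination -(((lam : ℤ) : K) * R.muTilde * R.ω ^ (2 * k * (2 * n + 1) : ℤ)) * hγ
  · rw [e1]
    linear_combination -(R.muTilde * R.ω ^ (2 * k * (2 * n + 1) : ℤ)) *
      (((lam : ℤ) : K) * R.sqrtLam * R.sqrtLam * hε + ((lam : ℤ) : K) * hl + hll)

/-- Odd powers of a generator have period `4N`. The exponent `2s + 1` covers the words of `ℒ`, which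
start with `x_{11}^{2s-1}`, when `s` is shifted by `2N`. -/
theorem gen_pow_period (i j : Fin 2) (s : ℕ) : 𝕩 i j ^ (2 * (s + 2 * N) + 1) =
    𝕩 i j ^ (2 * s + 1) := by
  have hX := isSuzukiTuple_gen (K := K) (N := N) (m := 2 * n + 1) (μ := μ) (lam := lam)
  have h1 : 𝕩 i j ^ (4 * N) * 𝕩 i j = 𝕩 i j := by
    have h2 := congrArg (· * 𝕩 i j) (hX.idempotent_add i)
    simp only [add_mul, one_mul] at h2
    have hF : ∀ j : Fin 2, j = 0 ∨ j = 1 := by decide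
    have hN := NeZero.pos N
    have hi : ∀ i : Fin 2, i + 1 ≠ i + 0 ∧ i + 0 ≠ i + 1 := by decide
    rcases hF j with rfl | rfl
    · rwa [hX.pow_mul_eq_zero (hi i).1 (by omega), add_zero] at h2
    · rwa [hX.pow_mul_eq_zero (hi i).2 (by omega), zero_add] at h2
  rw [show 2 * (s + 2 * N) + 1 = 2 * s + 4 * N + 1 by ring, pow_succ, pow_add, mul_assoc, h1,
    ← pow_succ]

theorem par_succ_eq (r : ℕ) : par (r + 1) = if Even r then 1 else 0 := by
  unfold par
  by_cases h : Even r <;> simp [h, Nat.even_add_one]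

theorem vecL_eq (s i k p q r : ℕ) : R.vecL (s + 1) i k p q r = boxPath (R.repVV i k) (s + 2 * N) 0
    ((-1) ^ q * R.sqrtLam * R.ω ^ (-4 * k * n * (2 * n + 1) : ℤ)) (R.baseL i k p) r := by
  induction r with
  | zero =>
    have hw : ∀ i j, 𝕩 i j ^ (2 * (s + 1) - 1) = 𝕨 (s + 2 * N) (pathLen n 0) i j := by
      intro i j
      rw [word, pathLen, if_pos rfl, altProd_succ, altProd, mul_one, ← pow_succ, gen_pow_period]
      congr 1
    rw [vecL, boxPath, hw, hw]
    rfl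
  | succ r ih =>
    rw [vecL, boxPath, ih, par_succ_eq]
    split_ifs <;> rfl

theorem vecN_eq (hn : 1 ≤ n) (s i k p q r : ℕ) : R.vecN s i k p q r = boxPath (R.repVV' i k) s 1
    ((-1) ^ q * ((R.muBar * R.ω ^ (4 * k * (2 * n + 1) : ℤ)) ^ n)⁻¹) (R.baseN k p) r := by
  induction r with
  | zero =>
    rw [vecN, boxPath, mono₁_even, mono₂_odd, show 2 * n - 1 + 1 = 2 * n by omega]
    rfl
  | succ r ih =>
    rw [vecN, boxPath, ih, par_succ_eq]
    split_ifs <;> rfl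

/-- The module `ℒ` is the path through the block of `x_{11}, x_{22}` that starts with words of length
`1`. The exponent is shifted by the period `2N` to make it positive. -/
theorem realizes_L (s i k p q : ℕ) :
    R.Realizes (R.HasPath 0 (s + 2 * N) ((-1) ^ p * R.ω ^ (2 * k * (2 * n + 1) : ℤ))
      ((-1) ^ q * R.sqrtLam * R.ω ^ (-4 * k * n * (2 * n + 1) : ℤ) * pathSign lam 0 1))
      (R.repVV i k)
      (span K (Set.range fun r : Fin (2 * n + 1) => R.vecL (s + 1) i k p q r)) := by
  have hN := NeZero.pos N
  have hε := neg_one_pow_mul_self (K := K) p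
  have hδ := neg_one_pow_mul_self (K := K) q
  have hl := R.sqrtLam_mul_self
  have hll := lam_mul_self (K := K) (lam := lam)
  have h := path_realization (ρ := R.repVV i k) (R.repVV_off i k) (s := s + 2 * N) (by omega)
    (u := R.baseL i k p) (A := (-1) ^ p * R.ω ^ (2 * k * (2 * n + 1) : ℤ)) ?_
    (mul_ne_zero (left_ne_zero_of_mul_eq_one hε) (zpow_ne_zero _ R.ω_ne_zero))
    (b := (-1) ^ q * R.sqrtLam * R.ω ^ (-4 * k * n * (2 * n + 1) : ℤ)) ?_ ?_
  · refine ⟨h.1, fun M hM => ?_⟩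
    simp only [vecL_eq]
    exact h.2 M hM
  · rw [repVV_zero_zero, baseL]
    have e1 := R.zpow_mul_zpow (z := (2 * (2 * i) * N : ℤ)) hε
      (show (2 * k * (2 * n + 1) + (2 * (2 * i) * N - 2 * k * (2 * n + 1)) : ℤ) = _ by ring)
    have e2 := R.zpow_mul_zpow (z := (2 * k * (2 * n + 1) : ℤ)) (mul_one ((-1 : K) ^ p))
      (show ((2 * (2 * i) * N - 2 * k * (2 * n + 1)) + (4 * k * (2 * n + 1) - 2 * (2 * i) * N) : ℤ)
        = _ by ring)
    ext a
    fin_cases a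
    · simp only [Fin.zero_eta, Matrix.cons_val_zero, Matrix.cons_val_one, Pi.smul_apply,
        smul_eq_mul, mul_one, Matrix.cons_val_fin_one]
      linear_combination -e2
    · simp only [Fin.mk_one, Matrix.cons_val_zero, Matrix.cons_val_one, Pi.smul_apply,
        smul_eq_mul, mul_one, Matrix.cons_val_fin_one]
      linear_combination e1
  · have hA : ((-1) ^ p * R.ω ^ (2 * k * (2 * n + 1) : ℤ)) ^ (4 * n) =
        R.ω ^ (2 * k * (2 * n + 1) * (4 * n) : ℤ) := by
      rw [mul_pow, ← pow_mul, Even.neg_one_pow ⟨p * (2 * n), by ring⟩, one_mul, ← zpow_natCast,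
        ← zpow_mul]
      push_cast
      rfl
    have hb : (R.ω ^ (-4 * k * n * (2 * n + 1) : ℤ)) ^ 2 *
        R.ω ^ (2 * k * (2 * n + 1) * (4 * n) : ℤ) = 1 := by
      rw [← zpow_natCast, ← zpow_mul, ← zpow_add₀ R.ω_ne_zero]
      convert zpow_zero R.ω using 2
      push_cast
      ring
    rw [hA, pathSign, if_pos rfl, blockSign_cast_one]
    calc _ = ((-1) ^ q * (-1) ^ q) * ((R.sqrtLam * R.sqrtLam) * ((lam : ℤ) : K)) *
          ((R.ω ^ (-4 * k * n * (2 * n + 1) : ℤ)) ^ 2 *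
            R.ω ^ (2 * k * (2 * n + 1) * (4 * n) : ℤ)) := by ring
      _ = 1 := by rw [hδ, hl, hll, hb]; ring
  · intro h0
    simpa [baseL] using congrFun h0 0

/-- The module `𝒩` is the path through the block of `x_{12}, x_{21}` that starts with words of length
`2n`. -/
theorem realizes_N (hn : 1 ≤ n) {s : ℕ} (hs : s ≠ 0) (i k p q : ℕ) :
    R.Realizes (R.HasPath 1 s ((-1) ^ p * R.sqrtMuBar * R.ω ^ (2 * k * (2 * n + 1) : ℤ))
      ((-1) ^ q * ((R.muBar * R.ω ^ (4 * k * (2 * n + 1) : ℤ)) ^ n)⁻¹ * pathSign lam 1 1))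
      (R.repVV' i k)
      (span K (Set.range fun r : Fin (2 * n + 1) => R.vecN s i k p q r)) := by
  have hε := neg_one_pow_mul_self (K := K) p
  have hδ := neg_one_pow_mul_self (K := K) q
  have hm := R.sqrtMuBar_mul_self
  have hm0 := R.sqrtMuBar_ne_zero
  have hsq : ((-1) ^ p * R.sqrtMuBar * R.ω ^ (2 * k * (2 * n + 1) : ℤ)) *
      ((-1) ^ p * R.sqrtMuBar * R.ω ^ (2 * k * (2 * n + 1) : ℤ)) =
      R.muBar * R.ω ^ (4 * k * (2 * n + 1) : ℤ) :=
    (R.zpow_mul_zpow (by linear_combination R.sqrtMuBar * R.sqrtMuBar * hε + hm) (by ring)).symm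
  have h := path_realization (ρ := R.repVV' i k) (R.repVV'_diag i k) hs
    (u := R.baseN k p) (A := (-1) ^ p * R.sqrtMuBar * R.ω ^ (2 * k * (2 * n + 1) : ℤ)) ?_
    (mul_ne_zero (mul_ne_zero (left_ne_zero_of_mul_eq_one hε) hm0) (zpow_ne_zero _ R.ω_ne_zero))
    (b := (-1) ^ q * ((R.muBar * R.ω ^ (4 * k * (2 * n + 1) : ℤ)) ^ n)⁻¹) ?_ ?_
  · refine ⟨h.1, fun M hM => ?_⟩
    simp only [R.vecN_eq hn]
    exact h.2 M hM
  · have e1 : (-1) ^ p * R.sqrtMuBar * R.ω ^ (2 * k * (2 * n + 1) : ℤ) *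
        ((-1) ^ p / R.sqrtMuBar * R.ω ^ (-2 * k * (2 * n + 1) : ℤ)) = 1 := by
      rw [← R.zpow_mul_zpow (d := 1) (z := 0) (by field_simp; linear_combination hε) (by ring),
        zpow_zero, one_mul]
    rw [repVV'_zero_one, baseN]
    ext a
    fin_cases a
    · simp only [Fin.zero_eta, Matrix.cons_val_zero, Matrix.cons_val_one, Pi.smul_apply,
        smul_eq_mul, mul_one, Matrix.cons_val_fin_one]
      rw [← hsq, mul_assoc, e1, mul_one]
    · simp only [Fin.mk_one, Matrix.cons_val_zero, Matrix.cons_val_one, Pi.smul_apply,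
        smul_eq_mul, Matrix.cons_val_fin_one]
      exact e1.symm
  · have hz : (R.muBar * R.ω ^ (4 * k * (2 * n + 1) : ℤ)) ^ n ≠ 0 :=
      pow_ne_zero _ (mul_ne_zero R.muBar_ne_zero (zpow_ne_zero _ R.ω_ne_zero))
    rw [show 4 * n = 2 * n * 2 by ring, mul_comm (2 * n), pow_mul _ 2, pow_two (_ * _ * _), hsq,
      show 2 * n = n * 2 by ring, pow_mul, pathSign, if_neg (by decide)]
    generalize (R.muBar * R.ω ^ (4 * k * (2 * n + 1) : ℤ)) ^ n = z at *
    field_simp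
    push_cast
    linear_combination hδ
  · intro h0
    simpa [baseN] using congrFun h0 0

end RootChoice

end ListedLinesAndPaths

/-! ### Parameters of the two-dimensional modules -/

section Classification

open SuzukiAlgebra Submodule

namespace YDIndex

variable {N n : ℕ}

/-- The block `c`, diagonal or off-diagonal, that contains the generators acting by nonzero maps on
a two-dimensional module of the list. -/
def block : YDIndex N n → Fin 2
  | scrG .. | scrH .. | scrI .. => 1
  | _ => 0

/-- The exponent `s` of the words in a two-dimensional module of the list. -/
def layer : YDIndex N n → ℕ
  | scrC s .. | scrD s .. | scrE s .. | scrF s .. | scrG s .. | scrH s .. | scrI s .. => s + 1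
  | _ => 0

/-- The length `t` of the words in a two-dimensional module of the list. -/
def len : YDIndex N n → ℕ
  | scrC _ t .. | scrD _ t .. | scrF _ t .. => 2 * t + 2
  | scrG _ t .. | scrH _ t .. | scrI _ t .. => 2 * t + 1
  | _ => 0

/-- The integer `I` such that the product of the two generators of the block has the eigenvalues
`ω^{±4IN}`, up to a common factor, on a two-dimensional module of the list. -/
def twist : YDIndex N n → ℤ
  | scrC _ _ i .. | scrI _ _ i .. => -((i + 1 : ℕ) : ℤ)
  | scrD _ _ i .. | scrE _ i .. | scrH _ _ i .. => ((i + 1 : ℕ) : ℤ)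
  | _ => 0

/-- The parameter `k` of a two-dimensional module of the list. -/
def level : YDIndex N n → ℕ
  | scrC _ _ _ k _ | scrD _ _ _ k _ | scrE _ _ k _ | scrF _ _ k _ | scrG _ _ k _ | scrH _ _ _ k _
  | scrI _ _ _ k _ => k
  | _ => 0

variable {x : YDIndex N n}

theorem par_len (x : YDIndex N n) : par x.len = x.block := by
  cases x <;> simp only [len, block, par_add_two, par_even, par_odd] <;> rfl

theorem layer_mem (hx : x.dim = 2) : x.layer ∈ Set.Icc 1 N := by
  cases x <;> simp only [dim] at hx <;> simp only [layer, Set.mem_Icc] <;> omega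

theorem len_le (x : YDIndex N n) : x.len ≤ 2 * n + 1 := by
  cases x <;> simp only [len] <;> omega

theorem abs_twist_le (x : YDIndex N n) : |x.twist| ≤ n := by
  rw [abs_le]
  cases x <;> simp only [twist] <;> omega

theorem level_lt (hx : x.dim = 2) : x.level < N := by
  cases x <;> simp only [dim] at hx <;> simp only [level] <;> omega

theorem twist_sign (hx : x.dim = 2) :
    (x.len = 0 → 0 < x.twist) ∧ (x.len = 2 * n + 1 → x.twist < 0) := by
  cases x <;> simp only [dim] at hx <;> simp only [len, twist] <;> omega

end YDIndex

namespace RootChoice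

variable {K : Type u} [Field K] {N n : ℕ} [NeZero N] {μ lam : ℤˣ} (R : RootChoice K N n μ lam)

local notation "𝔸" => SuzukiAlgebra K N (2 * n + 1) μ lam
local notation "𝕩" => gen K N (2 * n + 1) μ lam
local notation "𝕨" => word (gen K N (2 * n + 1) μ lam)

/-- The scalar factor, with the sign `(-1)^p`, of the action of `x_{0c}` on a two-dimensional
module of the list. -/
def root : YDIndex N n → K
  | .scrC _ _ _ _ p | .scrD _ _ _ _ p | .scrE _ _ _ p | .scrF _ _ _ p => (-1) ^ (p : ℕ)
  | .scrG _ _ _ p => (-1) ^ (p : ℕ) * (R.sqrtLam * R.muTilde)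
  | .scrH _ _ _ _ p => ((lam : ℤ) : K) * ((-1) ^ (p : ℕ) * R.sqrtLamMuBar)
  | .scrI _ _ _ _ p => (-1) ^ (p : ℕ) * R.sqrtLamMuBar
  | _ => 1

/-- The structure constants of the module of the list with a given parameter. -/
def HasData (M : YDModule.{u, u, u} K (SuzukiAlgebra K N (2 * n + 1) μ lam)) :
    YDIndex N n → Prop
  | .scrA s k p => R.IsLine 0 (s + 1) 0 (R.ω ^ (2 * (k : ℕ) * (2 * n + 1) : ℤ)) ((-1) ^ (p : ℕ)) M
  | .scrB s k p => R.IsLine 1 (s + 1) (2 * n + 1)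
      (R.ω ^ (2 * (k : ℕ) * (2 * n + 1) : ℤ) * R.muTilde) ((-1) ^ (p : ℕ) * R.sqrtLam) M
  | .scrL s k p q => R.HasPath 0 (s + 2 * N)
      ((-1) ^ (p : ℕ) * R.ω ^ (2 * (k : ℕ) * (2 * n + 1) : ℤ))
      ((-1) ^ (q : ℕ) * R.sqrtLam * R.ω ^ (-4 * (k : ℕ) * n * (2 * n + 1) : ℤ) *
        pathSign lam 0 1) M
  | .scrN s k p q => R.HasPath 1 (s + 1)
      ((-1) ^ (p : ℕ) * R.sqrtMuBar * R.ω ^ (2 * (k : ℕ) * (2 * n + 1) : ℤ))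
      ((-1) ^ (q : ℕ) * ((R.muBar * R.ω ^ (4 * (k : ℕ) * (2 * n + 1) : ℤ)) ^ n)⁻¹ *
        pathSign lam 1 1) M
  | x => R.IsPair x.block x.layer x.len (R.root x) x.twist x.level M

theorem succ_mem_Icc (s : Fin N) : (s : ℕ) + 1 ∈ Set.Icc 1 N := ⟨by omega, s.2⟩

theorem exists_hasData (hn : 1 ≤ n) (x : YDIndex N n) : ∃ M, R.HasData M x := by
  cases x with
  | scrA s k p => exact (R.realizes_A (succ_mem_Icc s) k p).1
  | scrB s k p => exact (R.realizes_B (succ_mem_Icc s) k p).1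
  | scrC s t i k p => exact (R.realizes_C (succ_mem_Icc s) t.2 (i + 1) k p).1
  | scrD s t i k p => exact (R.realizes_D (succ_mem_Icc s) t.2 (i + 1) k p).1
  | scrE s i k p => exact (R.realizes_E (succ_mem_Icc s) (i + 1) k p).1
  | scrF s t k p => exact (R.realizes_F (succ_mem_Icc s) t.2 k p).1
  | scrG s t k p => exact (R.realizes_G (succ_mem_Icc s) t.2 k p).1
  | scrH s t i k p => exact (R.realizes_H (succ_mem_Icc s) t.2 (i + 1) k p).1
  | scrI s t i k p => exact (R.realizes_I (succ_mem_Icc s) (by omega) (i + 1) k p).1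
  | scrL s k p q => exact (R.realizes_L s 0 k p q).1
  | scrN s k p q => exact (R.realizes_N hn (Nat.succ_ne_zero s) 0 k p q).1

variable {R}

theorem HasData.isListed (hn : 1 ≤ n) {M : YDModule.{u, u, u} K 𝔸} {x : YDIndex N n}
    (h : R.HasData M x) : R.IsListed M x := by
  cases x with
  | scrA s k p => exact (R.realizes_A (succ_mem_Icc s) k p).2 M h
  | scrB s k p => exact (R.realizes_B (succ_mem_Icc s) k p).2 M h
  | scrC s t i k p => exact (R.realizes_C (succ_mem_Icc s) t.2 (i + 1) k p).2 M h
  | scrD s t i k p => exact (R.realizes_D (succ_mem_Icc s) t.2 (i + 1) k p).2 M h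
  | scrE s i k p => exact (R.realizes_E (succ_mem_Icc s) (i + 1) k p).2 M h
  | scrF s t k p =>
    refine ⟨(R.realizes_F (succ_mem_Icc s) t.2 k p).2 M h,
      (R.realizes_F (succ_mem_Icc s) t.2 (k + N) (p + 1)).2 M ?_⟩
    rw [IsPair, pow_succ, mul_neg_one, R.pairScalars_add]
    exact h
  | scrG s t k p =>
    refine ⟨(R.realizes_G (succ_mem_Icc s) t.2 k p).2 M h,
      (R.realizes_G (succ_mem_Icc s) t.2 (k + N) (p + 1)).2 M ?_⟩
    rw [IsPair, pow_succ, mul_neg_one, neg_mul, R.pairScalars_add]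
    exact h
  | scrH s t i k p => exact (R.realizes_H (succ_mem_Icc s) t.2 (i + 1) k p).2 M h
  | scrI s t i k p => exact (R.realizes_I (succ_mem_Icc s) (by omega) (i + 1) k p).2 M h
  | scrL s k p q => exact fun i => (R.realizes_L s (i + 1) k p q).2 M h
  | scrN s k p q => exact fun i => (R.realizes_N hn (Nat.succ_ne_zero s) (i + 1) k p q).2 M h

theorem HasData.isPair {M : YDModule.{u, u, u} K 𝔸} {x : YDIndex N n} (h : R.HasData M x)
    (hx : x.dim = 2) : R.IsPair x.block x.layer x.len (R.root x) x.twist x.level M := by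
  cases x <;> simp only [YDIndex.dim] at hx <;> first | exact h | omega

theorem HasData.finrank_eq {M : YDModule.{u, u, u} K 𝔸} {x : YDIndex N n} (h : R.HasData M x) :
    Module.finrank K M.carrier = x.dim := by
  cases x <;> exact (YDModule.HasModel.finrank_eq h).trans (Fintype.card_fin _)

variable (R)

theorem dvd_of_zpow_eq_one {x : ℤ} (h : R.ω ^ (4 * x * N) = 1) : (2 * n + 1 : ℤ) ∣ x := by
  have hN : (N : ℤ) ≠ 0 := by exact_mod_cast NeZero.ne N
  rw [R.prim.zpow_eq_one_iff_dvd] at h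
  obtain ⟨d, hd⟩ := h
  refine ⟨d, ?_⟩
  push_cast at hd
  have h2 : (4 * (N : ℤ)) * x = (4 * N) * ((2 * n + 1) * d) := by linear_combination hd
  exact mul_left_cancel₀ (mul_ne_zero (by norm_num) hN) h2

theorem level_eq_of_zpow_eq {k k' : ℕ} (hk : k < 2 * N) (hk' : k' < 2 * N)
    (h : R.ω ^ (2 * k * (2 * n + 1) : ℤ) = R.ω ^ (2 * k' * (2 * n + 1) : ℤ)) : k = k' := by
  have h1 : R.ω ^ (2 * k * (2 * n + 1) - 2 * k' * (2 * n + 1) : ℤ) = 1 := by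
    rw [zpow_sub₀ R.ω_ne_zero, h, div_self (zpow_ne_zero _ R.ω_ne_zero)]
  rw [R.prim.zpow_eq_one_iff_dvd] at h1
  obtain ⟨d, hd⟩ := h1
  push_cast at hd
  have h2 : (2 * (2 * (n : ℤ) + 1)) * (k - k') = (2 * (2 * n + 1)) * (2 * N * d) := by
    linear_combination hd
  have h3 := mul_left_cancel₀ (by positivity) h2
  have h4 : (k : ℤ) - k' = 0 := by
    refine Int.eq_zero_of_abs_lt_dvd (m := 2 * N) ⟨d, h3⟩ ?_
    rw [abs_lt]
    constructor <;> omega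
  omega

theorem level_eq_of_zpow_eq' {k k' : ℕ} (hk : k < N) (hk' : k' < N)
    (h : R.ω ^ (4 * k * (2 * n + 1) : ℤ) = R.ω ^ (4 * k' * (2 * n + 1) : ℤ)) : k = k' := by
  have := R.level_eq_of_zpow_eq (k := 2 * k) (k' := 2 * k') (by omega) (by omega)
    (by convert h using 2 <;> (push_cast; ring))
  omega

theorem neg_one_pow_injective [CharZero K] {p p' : Fin 2} {d : K} (hd : d ≠ 0)
    (h : (-1) ^ (p : ℕ) * d = (-1) ^ (p' : ℕ) * d) : p = p' := by
  have h1 := mul_right_cancel₀ hd h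
  fin_cases p <;> fin_cases p' <;> first | rfl | (norm_num at h1)

theorem blockSign_cast_mul_self (c : Fin 2) :
    ((blockSign lam c : ℤ) : K) * ((blockSign lam c : ℤ) : K) = 1 := by
  rw [← Int.cast_mul, IsSuzukiTuple.units_cast_mul_self, Int.cast_one]

/-- The square of the scalar `root` does not depend on the sign `p`. -/
theorem root_sq {x : YDIndex N n} (hx : x.dim = 2) : ((blockSign lam x.block : ℤ) : K) *
    (R.root x * R.root x) = if x.block = 0 then 1 else R.muBar := by
  have hll := lam_mul_self (K := K) (lam := lam)
  have hp := fun p : Fin 2 => neg_one_pow_mul_self (K := K) p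
  cases x <;> simp only [YDIndex.dim] at hx <;> first | omega | skip
  all_goals
    simp only [YDIndex.block, root, blockSign_cast_zero, blockSign_cast_one, one_mul, hp, if_true]
  case scrG s t k p =>
    refine Eq.trans ?_ (if_neg (show ¬ (1 : Fin 2) = 0 by decide)).symm
    linear_combination (((lam : ℤ) : K) * (R.sqrtLam * R.muTilde) ^ 2) * hp p +
      ((lam : ℤ) : K) * R.muTilde ^ 2 * R.sqrtLam_mul_self + R.muTilde ^ 2 * hll +
      R.muTilde_mul_self
  case scrH s t i k p =>
    refine Eq.trans ?_ (if_neg (show ¬ (1 : Fin 2) = 0 by decide)).symm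
    linear_combination (((lam : ℤ) : K) ^ 3 * R.sqrtLamMuBar ^ 2) * hp p +
      ((lam : ℤ) : K) ^ 3 * R.sqrtLamMuBar_mul_self +
      (((lam : ℤ) : K) ^ 2 + 1) * R.muBar * hll
  case scrI s t i k p =>
    refine Eq.trans ?_ (if_neg (show ¬ (1 : Fin 2) = 0 by decide)).symm
    linear_combination (((lam : ℤ) : K) * R.sqrtLamMuBar ^ 2) * hp p +
      ((lam : ℤ) : K) * R.sqrtLamMuBar_mul_self + R.muBar * hll

theorem root_ne_zero {x : YDIndex N n} (hx : x.dim = 2) : R.root x ≠ 0 := by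
  intro h
  have h1 := R.root_sq hx
  rw [h, mul_zero, mul_zero] at h1
  split_ifs at h1
  · exact zero_ne_one h1
  · exact R.muBar_ne_zero h1.symm

theorem pairScalars_ne_zero (c : Fin 2) {D : K} (hD : D ≠ 0) (I : ℤ) (k : ℕ) (j : Fin 2) :
    R.pairScalars c D I k j ≠ 0 := by
  revert j
  rw [Fin.forall_fin_two]
  exact ⟨mul_ne_zero hD (zpow_ne_zero _ R.ω_ne_zero),
    mul_ne_zero (mul_ne_zero (units_cast_ne_zero _) hD) (zpow_ne_zero _ R.ω_ne_zero)⟩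

theorem pairScalars_sq_ne {c : Fin 2} {D : K} (hD : D ≠ 0) {I : ℤ} (hI : I ≠ 0) (hI' : |I| ≤ n)
    (k : ℕ) : R.pairScalars c D I k 0 ^ 2 ≠ R.pairScalars c D I k 1 ^ 2 := by
  intro h
  have hσ := blockSign_cast_mul_self (K := K) (lam := lam) c
  have h0 := R.ω_ne_zero
  have e0 : R.pairScalars c D I k 0 ^ 2 =
      D ^ 2 * R.ω ^ (4 * k * (2 * n + 1) - 4 * I * N : ℤ) * R.ω ^ (4 * (2 * I) * N : ℤ) := by
    rw [pow_two, mul_assoc, ← zpow_add₀ h0]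
    exact (R.zpow_mul_zpow (pow_two D).symm (by ring)).symm
  have e1 : R.pairScalars c D I k 1 ^ 2 =
      D ^ 2 * R.ω ^ (4 * k * (2 * n + 1) - 4 * I * N : ℤ) := by
    rw [pow_two]
    exact (R.zpow_mul_zpow (by linear_combination D ^ 2 * hσ) (by ring)).symm
  rw [e0, e1] at h
  have h1 := mul_eq_left₀ (mul_ne_zero (pow_ne_zero 2 hD) (zpow_ne_zero _ h0)) |>.mp h
  have h2 := R.dvd_of_zpow_eq_one h1
  have h3 : 2 * I = 0 := by
    refine Int.eq_zero_of_abs_lt_dvd h2 ?_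
    rw [abs_le] at hI'
    rw [abs_lt]
    constructor <;> omega
  omega

/-- The parameters of a two-dimensional module of the list are determined by its isomorphism
class. For words of extreme length the two basis vectors could be exchanged; that possibility is
excluded by the sign of the twist. -/
theorem pair_parameters [CharZero K] {x y : YDIndex N n} (hx : x.dim = 2) (hy : y.dim = 2)
    {M Y : YDModule.{u, u, u} K 𝔸} (hM : R.HasData M x) (hY : R.HasData Y y)
    (h : M.Isomorphic Y) : x.layer = y.layer ∧ x.len = y.len ∧ x.twist = y.twist ∧
      x.level = y.level ∧ R.root x = R.root y := by
  have h0 := R.ω_ne_zero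
  have hσ := blockSign_cast_mul_self (K := K) (lam := lam) x.block
  have hM' := hM.isPair hx
  have hY' := hY.isPair hy
  have hxb := x.par_len
  have hyb := y.par_len
  rw [IsPair, ← hxb] at hM'
  rw [IsPair, ← hyb] at hY'
  obtain ⟨h1, h2, h3⟩ := YDModule.pair_invariants R.muTilde_pow (YDIndex.layer_mem hx) x.len_le
    (YDIndex.layer_mem hy) y.len_le hM' hY' h
  have hb : x.block = y.block := by rw [← hxb, ← hyb, h2]
  rw [hyb, hxb, ← hb] at h3
  have hDx := R.root_sq hx
  have hDy := R.root_sq hy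
  rw [← hb] at hDy
  have hx0 := R.root_ne_zero hx
  have hy0 := R.root_ne_zero hy
  have hix := abs_le.mp x.abs_twist_le
  have hiy := abs_le.mp y.abs_twist_le
  have hsx := YDIndex.twist_sign hx
  have hsy := YDIndex.twist_sign hy
  have hkx := YDIndex.level_lt hx
  have hky := YDIndex.level_lt hy
  set c := x.block
  set σ := ((blockSign lam c : ℤ) : K)
  have hc0 : (if c = 0 then (1 : K) else R.muBar) ≠ 0 := by
    split_ifs
    · exact one_ne_zero
    · exact R.muBar_ne_zero
  set Q := (if c = 0 then (1 : K) else R.muBar)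
  -- the product of the two scalars determines the level
  have hprod : ∀ (D : K) (I : ℤ) (k : ℕ), σ * (D * D) = Q → R.pairScalars c D I k 0 *
      R.pairScalars c D I k 1 = Q * R.ω ^ (4 * k * (2 * n + 1) : ℤ) := fun D I k hD =>
    (R.zpow_mul_zpow (by linear_combination hD) (by ring)).symm
  have hlevel : x.level = y.level := by
    have h4 : R.pairScalars c (R.root x) x.twist x.level 0 *
        R.pairScalars c (R.root x) x.twist x.level 1 = R.pairScalars c (R.root y) y.twist y.level 0 *
        R.pairScalars c (R.root y) y.twist y.level 1 := by
      rcases h3 with ⟨h5, h6⟩ | ⟨-, h5, h6⟩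
      · rw [h5, h6]
      · rw [h5, h6]
        linear_combination (R.pairScalars c (R.root y) y.twist y.level 0 *
          R.pairScalars c (R.root y) y.twist y.level 1) * hσ
    rw [hprod _ _ _ hDx, hprod _ _ _ hDy] at h4
    exact R.level_eq_of_zpow_eq' hkx hky (mul_left_cancel₀ hc0 h4)
  have hratio : ∀ (I J : ℤ), |J| ≤ 2 * n → R.ω ^ (I + 4 * J * N : ℤ) = R.ω ^ I → J = 0 := by
    intro I J hJ h4
    rw [zpow_add₀ h0] at h4
    have h5 := R.dvd_of_zpow_eq_one ((mul_eq_left₀ (zpow_ne_zero _ h0)).mp h4)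
    exact Int.eq_zero_of_abs_lt_dvd h5 (by omega)
  have hd0 : σ * (R.root x * R.root y) ≠ 0 :=
    mul_ne_zero (units_cast_ne_zero _) (mul_ne_zero hx0 hy0)
  have hd0' : R.root x * R.root y ≠ 0 := mul_ne_zero hx0 hy0
  rcases h3 with ⟨h5, h6⟩ | ⟨ht, h5, h6⟩
  · have h7 : R.pairScalars c (R.root x) x.twist x.level 0 *
        R.pairScalars c (R.root y) y.twist y.level 1 = R.pairScalars c (R.root x) x.twist x.level 1 *
        R.pairScalars c (R.root y) y.twist y.level 0 := by rw [h5, h6]; ring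
    have e1 := R.zpow_mul_zpow (a := R.root x) (b := σ * R.root y) (d := σ * (R.root x * R.root y))
      (x := 2 * x.level * (2 * n + 1) + 2 * x.twist * N)
      (y := 2 * y.level * (2 * n + 1) - 2 * y.twist * N)
      (z := (2 * x.level * (2 * n + 1) - 2 * x.twist * N +
        (2 * y.level * (2 * n + 1) + 2 * y.twist * N)) + 4 * (x.twist - y.twist) * N)
      (by ring) (by ring)
    have e2 := R.zpow_mul_zpow (a := σ * R.root x) (b := R.root y) (d := σ * (R.root x * R.root y))
      (x := 2 * x.level * (2 * n + 1) - 2 * x.twist * N)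
      (y := 2 * y.level * (2 * n + 1) + 2 * y.twist * N) (by ring) rfl
    have h8 := hratio _ _ (by rw [abs_le]; constructor <;> omega)
      (mul_left_cancel₀ hd0 ((e1.trans h7).trans e2.symm))
    have h9 : x.twist = y.twist := by omega
    refine ⟨h1, h2, h9, hlevel, ?_⟩
    rw [h9, hlevel] at h5
    exact mul_right_cancel₀ (zpow_ne_zero _ h0) h5
  · exfalso
    have h7 : R.pairScalars c (R.root x) x.twist x.level 0 *
        R.pairScalars c (R.root y) y.twist y.level 0 = R.pairScalars c (R.root x) x.twist x.level 1 *
        R.pairScalars c (R.root y) y.twist y.level 1 := by rw [h5, h6]; ring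
    have e1 := R.zpow_mul_zpow (a := R.root x) (b := R.root y) (d := R.root x * R.root y)
      (x := 2 * x.level * (2 * n + 1) + 2 * x.twist * N)
      (y := 2 * y.level * (2 * n + 1) + 2 * y.twist * N)
      (z := (2 * x.level * (2 * n + 1) - 2 * x.twist * N +
        (2 * y.level * (2 * n + 1) - 2 * y.twist * N)) + 4 * (x.twist + y.twist) * N)
      rfl (by ring)
    have e2 := R.zpow_mul_zpow (a := σ * R.root x) (b := σ * R.root y) (d := R.root x * R.root y)
      (x := 2 * x.level * (2 * n + 1) - 2 * x.twist * N)
      (y := 2 * y.level * (2 * n + 1) - 2 * y.twist * N)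
      (by linear_combination (R.root x * R.root y) * hσ) rfl
    have h8 := hratio _ _ (by rw [abs_le]; constructor <;> omega)
      (mul_left_cancel₀ hd0' ((e1.trans h7).trans e2.symm))
    rcases ht with ht | ht
    · have := hsx.1 ht
      have := hsy.1 (h2 ▸ ht)
      omega
    · have := hsx.2 ht
      have := hsy.2 (h2 ▸ ht)
      omega

/-- The parameters of a two-dimensional module of the list determine its position in the list. -/
theorem pair_ext [CharZero K] {x y : YDIndex N n} (hx : x.dim = 2) (hy : y.dim = 2)
    (h1 : x.layer = y.layer) (h2 : x.len = y.len) (h3 : x.twist = y.twist)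
    (h4 : x.level = y.level) (h5 : R.root x = R.root y) : x = y := by
  have hl := units_cast_ne_zero (K := K) lam
  cases x <;> simp only [YDIndex.dim] at hx <;> first | omega | skip
  all_goals
    cases y <;> simp only [YDIndex.dim] at hy <;> first | omega | skip
  all_goals
    simp only [YDIndex.layer, YDIndex.len, YDIndex.twist, YDIndex.level] at h1 h2 h3 h4
    first | omega | skip
  case scrC.scrC s t i k p s' t' i' k' p' =>
    obtain rfl : s = s' := Fin.ext (by omega)
    obtain rfl : t = t' := Fin.ext (by omega)
    obtain rfl : i = i' := Fin.ext (by omega)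
    obtain rfl : k = k' := Fin.ext h4
    obtain rfl : p = p' := neg_one_pow_injective one_ne_zero (congrArg (· * 1) h5)
    rfl
  case scrD.scrD s t i k p s' t' i' k' p' =>
    obtain rfl : s = s' := Fin.ext (by omega)
    obtain rfl : t = t' := Fin.ext (by omega)
    obtain rfl : i = i' := Fin.ext (by omega)
    obtain rfl : k = k' := Fin.ext h4
    obtain rfl : p = p' := neg_one_pow_injective one_ne_zero (congrArg (· * 1) h5)
    rfl
  case scrE.scrE s i k p s' i' k' p' =>
    obtain rfl : s = s' := Fin.ext (by omega)
    obtain rfl : i = i' := Fin.ext (by omega)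
    obtain rfl : k = k' := Fin.ext h4
    obtain rfl : p = p' := neg_one_pow_injective one_ne_zero (congrArg (· * 1) h5)
    rfl
  case scrF.scrF s t k p s' t' k' p' =>
    obtain rfl : s = s' := Fin.ext (by omega)
    obtain rfl : t = t' := Fin.ext (by omega)
    obtain rfl : k = k' := Fin.ext h4
    obtain rfl : p = p' := neg_one_pow_injective one_ne_zero (congrArg (· * 1) h5)
    rfl
  case scrG.scrG s t k p s' t' k' p' =>
    obtain rfl : s = s' := Fin.ext (by omega)
    obtain rfl : t = t' := Fin.ext (by omega)
    obtain rfl : k = k' := Fin.ext h4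
    obtain rfl : p = p' :=
      neg_one_pow_injective (mul_ne_zero R.sqrtLam_ne_zero R.muTilde_ne_zero) h5
    rfl
  case scrH.scrH s t i k p s' t' i' k' p' =>
    obtain rfl : s = s' := Fin.ext (by omega)
    obtain rfl : t = t' := Fin.ext (by omega)
    obtain rfl : i = i' := Fin.ext (by omega)
    obtain rfl : k = k' := Fin.ext h4
    obtain rfl : p = p' := neg_one_pow_injective R.sqrtLamMuBar_ne_zero (mul_left_cancel₀ hl h5)
    rfl
  case scrI.scrI s t i k p s' t' i' k' p' =>
    obtain rfl : s = s' := Fin.ext (by omega)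
    obtain rfl : t = t' := Fin.ext (by omega)
    obtain rfl : i = i' := Fin.ext (by omega)
    obtain rfl : k = k' := Fin.ext h4
    obtain rfl : p = p' := neg_one_pow_injective R.sqrtLamMuBar_ne_zero h5
    rfl

end RootChoice

end Classification

/-! ### Distinctness, simplicity and counting -/

section Classification

open SuzukiAlgebra Submodule

namespace RootChoice

variable {K : Type u} [Field K] {N n : ℕ} [NeZero N] {μ lam : ℤˣ} (R : RootChoice K N n μ lam)

local notation "𝔸" => SuzukiAlgebra K N (2 * n + 1) μ lam
local notation "𝕨" => word (gen K N (2 * n + 1) μ lam)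

variable {R}

theorem IsLine.invariants {c c' : Fin 2} {s s' t t' : ℕ} (hc : par t = c) (hc' : par t' = c')
    (hs : s ∈ Set.Icc 1 N) (ht : t ≤ 2 * n + 1) (hs' : s' ∈ Set.Icc 1 N) (ht' : t' ≤ 2 * n + 1)
    {a a' κ κ' : K} {M Y : YDModule.{u, u, u} K 𝔸} (hM : R.IsLine c s t a κ M)
    (hY : R.IsLine c' s' t' a' κ' Y) (h : M.Isomorphic Y) : s = s' ∧ t = t' ∧ κ = κ' ∧ a = a' := by
  subst hc hc'
  exact YDModule.line_invariants R.muTilde_pow hs ht hs' ht' hM hY h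

/-- One-dimensional modules of the list with different parameters are not isomorphic. -/
theorem eq_of_isomorphic_of_dim_eq_one [CharZero K] (hn : 1 ≤ n) {x y : YDIndex N n}
    (hx : x.dim = 1) (hy : y.dim = 1) {M Y : YDModule.{u, u, u} K 𝔸} (hM : R.HasData M x)
    (hY : R.HasData Y y) (h : M.Isomorphic Y) : x = y := by
  have h0 : par 0 = 0 := par_even 0
  have h1 : par (2 * n + 1) = 1 := par_odd n
  cases x <;> simp only [YDIndex.dim] at hx <;> first | omega | skip
  all_goals
    cases y <;> simp only [YDIndex.dim] at hy <;> first | omega | skip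
  case scrA.scrA s k p s' k' p' =>
    obtain ⟨e1, -, e3, e4⟩ := IsLine.invariants (R := R) h0 h0 (succ_mem_Icc s) (Nat.zero_le _)
      (succ_mem_Icc s') (Nat.zero_le _) hM hY h
    obtain rfl : s = s' := Fin.ext (by omega)
    obtain rfl : k = k' := Fin.ext (R.level_eq_of_zpow_eq k.2 k'.2 e4)
    obtain rfl : p = p' := neg_one_pow_injective (one_ne_zero (α := K)) (by rw [e3])
    rfl
  case scrA.scrB s k p s' k' p' =>
    have := (IsLine.invariants (R := R) h0 h1 (succ_mem_Icc s) (Nat.zero_le _)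
      (succ_mem_Icc s') le_rfl hM hY h).2.1
    omega
  case scrB.scrA s k p s' k' p' =>
    have := (IsLine.invariants (R := R) h1 h0 (succ_mem_Icc s) le_rfl
      (succ_mem_Icc s') (Nat.zero_le _) hM hY h).2.1
    omega
  case scrB.scrB s k p s' k' p' =>
    obtain ⟨e1, -, e3, e4⟩ := IsLine.invariants (R := R) h1 h1 (succ_mem_Icc s) le_rfl
      (succ_mem_Icc s') le_rfl hM hY h
    obtain rfl : s = s' := Fin.ext (by omega)
    obtain rfl : k = k' :=
      Fin.ext (R.level_eq_of_zpow_eq k.2 k'.2 (mul_right_cancel₀ R.muTilde_ne_zero e4))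
    obtain rfl : p = p' := neg_one_pow_injective R.sqrtLam_ne_zero e3
    rfl

theorem pathSign_cast_ne_zero (c β : Fin 2) : ((pathSign lam c β : ℤ) : K) ≠ 0 :=
  left_ne_zero_of_mul_eq_one (pathSign_mul_self c β)

/-- The square of the eigenvalue of a path determines `k`. -/
theorem level_eq_of_path_scalar {k k' : ℕ} (hk : k < N) (hk' : k' < N) {p p' : Fin 2} {d : K}
    (hd : d ≠ 0) (h : (-1) ^ (p : ℕ) * d * R.ω ^ (2 * k * (2 * n + 1) : ℤ) =
      (-1) ^ (p' : ℕ) * d * R.ω ^ (2 * k' * (2 * n + 1) : ℤ)) : k = k' := by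
  have hp := fun p : Fin 2 => neg_one_pow_mul_self (K := K) p
  have hsq : ∀ (p : Fin 2) (k : ℕ), ((-1) ^ (p : ℕ) * d * R.ω ^ (2 * k * (2 * n + 1) : ℤ)) *
      ((-1) ^ (p : ℕ) * d * R.ω ^ (2 * k * (2 * n + 1) : ℤ)) =
      d * d * R.ω ^ (4 * k * (2 * n + 1) : ℤ) := fun p k =>
    (R.zpow_mul_zpow (by linear_combination (d * d) * hp p) (by ring)).symm
  have h1 := congrArg (fun z => z * z) h
  simp only [hsq] at h1
  exact R.level_eq_of_zpow_eq' hk hk' (mul_left_cancel₀ (mul_ne_zero hd hd) h1)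

/-- Modules of the list of dimension `2n+1` with different parameters are not isomorphic. -/
theorem eq_of_isomorphic_of_dim_eq [CharZero K] (hn : 1 ≤ n) {x y : YDIndex N n}
    (hx : x.dim = 2 * n + 1) (hy : y.dim = 2 * n + 1) {M Y : YDModule.{u, u, u} K 𝔸}
    (hM : R.HasData M x) (hY : R.HasData Y y) (h : M.Isomorphic Y) : x = y := by
  have h0 := R.ω_ne_zero
  have hp : ∀ p : Fin 2, ((-1 : K)) ^ (p : ℕ) ≠ 0 := fun p => pow_ne_zero _ (by norm_num)
  cases x <;> simp only [YDIndex.dim] at hx <;> first | omega | skip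
  all_goals
    cases y <;> simp only [YDIndex.dim] at hy <;> first | omega | skip
  case scrL.scrL s k p q s' k' p' q' =>
    obtain ⟨-, e1, e2, e3⟩ := YDModule.path_invariants R.muTilde_pow (s := s + 2 * N)
      (s' := s' + 2 * N) (by have := NeZero.ne N; omega) (by have := NeZero.ne N; omega)
      (mul_ne_zero (hp p) (zpow_ne_zero _ h0)) (fun _ e => by
        -- the exponent of the words of `ℒ` is `s + 2N` with `0 ≤ s < N`
        have e' : ((2 * (s + 1) + (4 * N + pathLen n 0) : ℕ) : ZMod (2 * N)) =
            (2 * (s' + 1) + (4 * N + pathLen n 0) : ℕ) := by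
          have e2 := congrArg (fun z => z + (2 : ZMod (2 * N))) e
          push_cast at e2 ⊢
          linear_combination e2
        have := eq_of_modEq_of_mem (succ_mem_Icc s) (succ_mem_Icc s') e'
        omega) hM hY h
    obtain rfl : s = s' := Fin.ext (by omega)
    obtain rfl : k = k' := Fin.ext (level_eq_of_path_scalar (R := R) k.2 k'.2 one_ne_zero
      (p := p) (p' := p') (by rw [mul_one, mul_one]; exact e1))
    obtain rfl : p = p' := neg_one_pow_injective (zpow_ne_zero _ h0) e1
    obtain rfl : q = q' := neg_one_pow_injective (mul_ne_zero R.sqrtLam_ne_zero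
      (mul_ne_zero (zpow_ne_zero _ h0) (pathSign_cast_ne_zero 0 1)))
      (by simpa only [mul_assoc] using e3)
    rfl
  case scrL.scrN s k p q s' k' p' q' =>
    have := (YDModule.path_invariants R.muTilde_pow (s := s + 2 * N)
      (s' := s' + 1) (by have := NeZero.ne N; omega) (by omega)
      (mul_ne_zero (hp p) (zpow_ne_zero _ h0)) (fun e => absurd e (by decide)) hM hY h).1
    exact absurd this (by decide)
  case scrN.scrL s k p q s' k' p' q' =>
    have := (YDModule.path_invariants R.muTilde_pow (s := s + 1)
      (s' := s' + 2 * N) (by omega) (by have := NeZero.ne N; omega)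
      (mul_ne_zero (mul_ne_zero (hp p) R.sqrtMuBar_ne_zero) (zpow_ne_zero _ h0))
      (fun e => absurd e (by decide)) hM hY h).1
    exact absurd this (by decide)
  case scrN.scrN s k p q s' k' p' q' =>
    obtain ⟨-, e1, e2, e3⟩ := YDModule.path_invariants R.muTilde_pow (s := s + 1)
      (s' := s' + 1) (by omega) (by omega)
      (mul_ne_zero (mul_ne_zero (hp p) R.sqrtMuBar_ne_zero) (zpow_ne_zero _ h0))
      (fun _ e => eq_of_modEq_of_mem (succ_mem_Icc s) (succ_mem_Icc s') e) hM hY h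
    obtain rfl : s = s' := Fin.ext (by omega)
    obtain rfl : k = k' := Fin.ext (level_eq_of_path_scalar (R := R) k.2 k'.2
      R.sqrtMuBar_ne_zero e1)
    obtain rfl : p = p' := neg_one_pow_injective
      (mul_ne_zero R.sqrtMuBar_ne_zero (zpow_ne_zero _ h0)) (by simpa only [mul_assoc] using e1)
    obtain rfl : q = q' := neg_one_pow_injective (mul_ne_zero (inv_ne_zero (pow_ne_zero _
      (mul_ne_zero R.muBar_ne_zero (zpow_ne_zero _ h0)))) (pathSign_cast_ne_zero 1 1))
      (by simpa only [mul_assoc] using e3)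
    rfl

theorem dim_cases (x : YDIndex N n) : x.dim = 1 ∨ x.dim = 2 ∨ x.dim = 2 * n + 1 := by
  cases x <;> simp [YDIndex.dim]

/-- Modules of the list with different parameters are not isomorphic. -/
theorem HasData.eq_of_isomorphic [CharZero K] (hn : 1 ≤ n) {x y : YDIndex N n}
    {M Y : YDModule.{u, u, u} K 𝔸} (hM : R.HasData M x) (hY : R.HasData Y y)
    (h : M.Isomorphic Y) : x = y := by
  have hd : x.dim = y.dim := by
    obtain ⟨f, -, -⟩ := id h
    rw [← hM.finrank_eq, ← hY.finrank_eq, f.finrank_eq]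
  rcases dim_cases x with hx | hx | hx
  · exact eq_of_isomorphic_of_dim_eq_one hn hx (hd ▸ hx) hM hY h
  · obtain ⟨h1, h2, h3, h4, h5⟩ := R.pair_parameters hx (hd ▸ hx) hM hY h
    exact R.pair_ext hx (hd ▸ hx) h1 h2 h3 h4 h5
  · exact eq_of_isomorphic_of_dim_eq hn hx (hd ▸ hx) hM hY h

theorem fin2_ne_add_one (c : Fin 2) : c ≠ c + 1 := by revert c; decide

theorem HasPath.isSimpleYD [CharZero K] {c : Fin 2} {s : ℕ} (hs : s ≠ 0) {A δ : K} (hA : A ≠ 0)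
    {M : YDModule.{u, u, u} K 𝔸} (hM : R.HasPath c s A δ M) : M.IsSimpleYD :=
  YDModule.isSimpleYD_of_path hA (diagHom_word_self s _ c)
    (by rw [map_smul, diagHom_word_of_ne hs _ (fin2_ne_add_one c), smul_zero]) hM

theorem HasData.isSimpleYD [CharZero K] {x : YDIndex N n} {M : YDModule.{u, u, u} K 𝔸}
    (h : R.HasData M x) : M.IsSimpleYD := by
  have h0 := R.ω_ne_zero
  have hp : ∀ p : Fin 2, ((-1 : K)) ^ (p : ℕ) ≠ 0 := fun p => pow_ne_zero _ (by norm_num)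
  have hpair : x.dim = 2 → M.IsSimpleYD := fun hx => by
    have hsign := YDIndex.twist_sign hx
    refine YDModule.isSimpleYD_of_pair R.muTilde_pow (YDIndex.layer_mem hx) x.len_le
      (R.pairScalars_ne_zero _ (R.root_ne_zero hx) _ _) (fun ht => ?_) (h.isPair hx)
    exact R.pairScalars_sq_ne (R.root_ne_zero hx) (by rcases ht with ht | ht <;> omega)
      x.abs_twist_le _
  cases x with
  | scrA => exact YDModule.isSimpleYD_of_finrank_eq_one h.finrank_eq
  | scrB => exact YDModule.isSimpleYD_of_finrank_eq_one h.finrank_eq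
  | scrL s k p q =>
    exact HasPath.isSimpleYD (R := R) (by have := NeZero.ne N; omega)
      (mul_ne_zero (hp p) (zpow_ne_zero _ h0)) h
  | scrN s k p q =>
    exact HasPath.isSimpleYD (R := R) (Nat.succ_ne_zero s)
      (mul_ne_zero (mul_ne_zero (hp p) R.sqrtMuBar_ne_zero) (zpow_ne_zero _ h0)) h
  | _ => exact hpair rfl

end RootChoice

namespace YDIndex

variable (N n : ℕ)

/-- The parameters, family by family. -/
def equivSum : YDIndex N n ≃
    ((Fin N × Fin (2 * N) × Fin 2) ⊕ (Fin N × Fin (2 * N) × Fin 2)) ⊕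
    (((Fin N × Fin n × Fin n × Fin N × Fin 2) ⊕ (Fin N × Fin n × Fin n × Fin N × Fin 2) ⊕
      (Fin N × Fin n × Fin n × Fin N × Fin 2)) ⊕ (Fin N × Fin n × Fin N × Fin 2) ⊕
      (Fin N × Fin n × Fin N × Fin 2) ⊕ (Fin N × Fin n × Fin N × Fin 2) ⊕
      (Fin N × Fin (n + 1) × Fin n × Fin N × Fin 2)) ⊕
    ((Fin N × Fin N × Fin 2 × Fin 2) ⊕ (Fin N × Fin N × Fin 2 × Fin 2)) where
  toFun
    | scrA s k p => .inl (.inl (s, k, p))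
    | scrB s k p => .inl (.inr (s, k, p))
    | scrC s t i k p => .inr (.inl (.inl (.inl (s, t, i, k, p))))
    | scrD s t i k p => .inr (.inl (.inl (.inr (.inl (s, t, i, k, p)))))
    | scrH s t i k p => .inr (.inl (.inl (.inr (.inr (s, t, i, k, p)))))
    | scrE s i k p => .inr (.inl (.inr (.inl (s, i, k, p))))
    | scrF s t k p => .inr (.inl (.inr (.inr (.inl (s, t, k, p)))))
    | scrG s t k p => .inr (.inl (.inr (.inr (.inr (.inl (s, t, k, p))))))
    | scrI s t i k p => .inr (.inl (.inr (.inr (.inr (.inr (s, t, i, k, p))))))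
    | scrL s k p q => .inr (.inr (.inl (s, k, p, q)))
    | scrN s k p q => .inr (.inr (.inr (s, k, p, q)))
  invFun
    | .inl (.inl (s, k, p)) => scrA s k p
    | .inl (.inr (s, k, p)) => scrB s k p
    | .inr (.inl (.inl (.inl (s, t, i, k, p)))) => scrC s t i k p
    | .inr (.inl (.inl (.inr (.inl (s, t, i, k, p))))) => scrD s t i k p
    | .inr (.inl (.inl (.inr (.inr (s, t, i, k, p))))) => scrH s t i k p
    | .inr (.inl (.inr (.inl (s, i, k, p)))) => scrE s i k p
    | .inr (.inl (.inr (.inr (.inl (s, t, k, p))))) => scrF s t k p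
    | .inr (.inl (.inr (.inr (.inr (.inl (s, t, k, p)))))) => scrG s t k p
    | .inr (.inl (.inr (.inr (.inr (.inr (s, t, i, k, p)))))) => scrI s t i k p
    | .inr (.inr (.inl (s, k, p, q))) => scrL s k p q
    | .inr (.inr (.inr (s, k, p, q))) => scrN s k p q
  left_inv x := by cases x <;> rfl
  right_inv x := by
    rcases x with (x | x) | ((x | x | x) | x | x | x | x) | x | x <;> rfl

instance : Fintype (YDIndex N n) := Fintype.ofEquiv _ (equivSum N n).symm

theorem sum_dim (f : ℕ → ℕ) : ∑ x : YDIndex N n, f x.dim = 8 * N ^ 2 * f 1 +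
    8 * N ^ 2 * n * (n + 1) * f 2 + 8 * N ^ 2 * f (2 * n + 1) := by
  rw [← (equivSum N n).symm.sum_comp]
  simp only [Fintype.sum_sum_type]
  simp only [equivSum, Equiv.coe_fn_symm_mk, dim, Finset.sum_const, Finset.card_univ,
    Fintype.card_prod, Fintype.card_fin, smul_eq_mul]
  ring

theorem card_dim_eq (d : ℕ) : Nat.card {x : YDIndex N n // x.dim = d} =
    8 * N ^ 2 * (if 1 = d then 1 else 0) + 8 * N ^ 2 * n * (n + 1) * (if 2 = d then 1 else 0) +
      8 * N ^ 2 * (if 2 * n + 1 = d then 1 else 0) := by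
  rw [← sum_dim N n fun e => if e = d then 1 else 0, Nat.card_eq_fintype_card, Fintype.card_subtype,
    Finset.card_filter]

theorem sum_dim_sq : ∑ x : YDIndex N n, x.dim ^ 2 = (4 * N * (2 * n + 1)) ^ 2 := by
  rw [sum_dim N n fun e => e ^ 2]
  ring

end YDIndex

end Classification

theorem theorem3p1 {K : Type u} [Field K] [IsAlgClosed K] [CharZero K] (N n : ℕ) [NeZero N]
    (hn : 1 ≤ n) (μ lam : ℤˣ) (R : RootChoice K N n μ lam) :
    ∃ M : YDIndex N n → YDModule.{u, u, u} K (SuzukiAlgebra K N (2 * n + 1) μ lam),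
      (∀ x, R.IsListed (M x) x) ∧
      (∀ x, (M x).IsSimpleYD) ∧
      (∀ x, Module.finrank K (M x).carrier = x.dim) ∧
      (∀ x y, (M x).Isomorphic (M y) → x = y) ∧
      (∀ X : YDModule.{u, u, v} K (SuzukiAlgebra K N (2 * n + 1) μ lam), X.IsSimpleYD →
        ∃ x, X.Isomorphic (M x)) ∧
      Nat.card {x : YDIndex N n // x.dim = 1} = 8 * N ^ 2 ∧
      Nat.card {x : YDIndex N n // x.dim = 2} = 8 * N ^ 2 * n * (n + 1) ∧
      Nat.card {x : YDIndex N n // x.dim = 2 * n + 1} = 8 * N ^ 2 := by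
  choose M hM using R.exists_hasData hn
  have hsimple : ∀ x, (M x).IsSimpleYD := fun x => (hM x).isSimpleYD
  have hinj : ∀ x y, (M x).Isomorphic (M y) → x = y := fun x y =>
    (hM x).eq_of_isomorphic hn (hM y)
  refine ⟨M, fun x => (hM x).isListed hn, hsimple, fun x => (hM x).finrank_eq, hinj,
    fun X hX => ?_, ?_, ?_, ?_⟩
  · by_contra! hne
    have hfin := YDModule.finite_of_isSimpleYD hX
    have hpos : 0 < Module.finrank K X.carrier := by
      have := hX.1
      exact Module.finrank_pos
    obtain ⟨X', hX'⟩ := X.exists_isomorphic (Module.finBasis K X.carrier).equivFun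
    have hr : Module.finrank K X'.carrier = Module.finrank K X.carrier := by
      obtain ⟨f, -, -⟩ := hX'
      exact f.finrank_eq.symm
    -- a simple module outside the list would make the sum of the squares of the dimensions
    -- exceed the square of the dimension of the algebra
    have h1 := YDModule.sum_finrank_sq_le (fun o : Option (YDIndex N n) => o.elim X' M)
      (by
        rintro (_ | x)
        · exact hX'.isSimpleYD hX
        · exact hsimple x)
      (by
        rintro (_ | x) (_ | y) h
        · rfl
        · exact absurd (hX'.trans h) (hne y)
        · exact absurd (hX'.trans h.symm) (hne x)
        · exact congrArg some (hinj x y h))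
    rw [Fintype.sum_option] at h1
    change Module.finrank K X'.carrier ^ 2 + ∑ x, Module.finrank K (M x).carrier ^ 2 ≤ _ at h1
    have h4 : ∑ x, Module.finrank K (M x).carrier ^ 2 = (4 * N * (2 * n + 1)) ^ 2 := by
      rw [← YDIndex.sum_dim_sq]
      exact Finset.sum_congr rfl fun x _ => by rw [(hM x).finrank_eq]
    rw [h4, hr] at h1
    have h2 := Nat.pow_le_pow_left (finrank_suzukiAlgebra_le (K := K) (N := N) (m := 2 * n + 1)
      (μ := μ) (lam := lam)) 2
    have h3 := Nat.pow_pos (n := 2) hpos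
    omega
  · rw [YDIndex.card_dim_eq, if_pos rfl, if_neg (by omega), if_neg (by omega)]
    ring
  · rw [YDIndex.card_dim_eq, if_neg (by omega), if_pos rfl, if_neg (by omega)]
    ring
  · rw [YDIndex.card_dim_eq, if_neg (by omega), if_neg (by omega), if_pos rfl]
    ring
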